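/- **Setting.** Let $V:\mathbb R^2\to\mathbb R$, $V=V(\Phi)$ with $\Phi=(\phi,\sigma)$, be $C^3$ with $V(\phi,\sigma)=V(|\phi|,|\sigma|)$; $V(\pm1,0)=0$ and $V>0$ elsewhere; $V(1,y)<V(x,y)$ for $x>1$ and $V(x,1)<V(x,y)$ for $y>1$; $V$ has a local maximum at $0$ and $\nabla V\ne0$ on $(-1,1)^2\setminus\{0\}$; $|\mathrm{Hess}\,V(\Phi)|\lesssim 1+|\Phi|^2$ and $\mathrm{Hess}\,V(\pm1,0)\ge\lambda_* I$ for some $\lambda_*>0$. Let $d\in\mathbb R$ and, for $r>0$, $W(\Phi,r)=V(\Phi)+\frac{d^2}{2r^2}\sigma^2$, $w=\nabla_\Phi W$. *Profiles.* Let $0\le r_0<r_1\le\infty$. For $r\in(r_0,r_1)$ let $F_0(\cdot;r)=(f_0,s_0)$ minimize $\int_{\mathbb R}\frac12|F'|^2+W(F,r)$ among $F=(f,s)\in H^1_{loc}(\mathbb R;\mathbb R^2)$ with finite energy, $f(0)=0$ and $f(\pm\infty)=\pm1$, normalized so that $f_0$ is odd, $s_0$ is even, $|f_0|\le1$, $0\le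 s_0\le1$, and $f_0(x)=0$ iff $x=0$. Put $L_1(r)=-\partial_x^2+\mathrm{Hess}_\Phi W(F_0(\cdot;r),r)$. Assume that $\ker_{L^2}L_1(r)=\mathrm{span}\{F_0'(\cdot;r)\}$ for all $r\in(r_0,r_1)$ and that $(r,x)\mapsto F_0(x;r)$ is continuous. For $(r,v)\in(r_0,r_1)\times(-1,1)$ let $F_1(\cdot;r,v)\in H^1(\mathbb R;\mathbb R^2)$ be the solution of $$L_1(r)F_1=\frac{1}{\sqrt{1-v^2}}\frac{d^2}{r^3}\frac{\|s_0(\cdot;r)\|_{L^2}^2}{\|F_0'(\cdot;r)\|_{L^2}^2}\,F_0'-\frac{x}{\sqrt{1-v^2}}\,\partial_r w(F_0,r),\qquad \int_{\mathbb R}F_1\cdot F_0'=0 .$$ *Interface.* Let $y_*^0,y_*^1>0$, let $R$ have values in $(r_0,r_1)$ and $|R'|<1$ on a neighbourhood of $[0,y_*^0]$, and let it solve there, with $m=(1-(R')^2)^{-1/2}$, $$m\Big(\frac{R''}{1-(R')^2}+\frac1R\Big)\int_{\mathbb R}|F_0'(\cdot;R)|^2-\frac{d^2}{R^3}\,m\int_{\mathbb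 R}s_0(\cdot;R)^2=0 .$$ Let $n=1+y^1m^3R''$ and assume $n>0$ and $R+y^1m>0$ on $[0,y_*^0]\times[-y_*^1,y_*^1]$. *Equation.* For $\epsilon>0$ and $0<b\le y_*^0$ let $\Phi\in C^2((0,b)\times\mathbb R;\mathbb R^2)$ solve $$\frac{m^2}{n^2}\partial_{y^0y^0}\Phi+B^0\partial_{y^0}\Phi+B^1\partial_{y^1}\Phi-\partial_{y^1y^1}\Phi+\frac1{\epsilon^2}w(\Phi,R+y^1m)=0\quad\text{on }(0,b)\times(-y_*^1,y_*^1),$$ $$B^0=\frac mn\partial_{y^0}\Big(\frac mn\Big)+\frac{1}{R+y^1m}\frac{m^2}{n}R',\qquad B^1=-\frac{m^3}{n}R''-\frac{m}{R+y^1m},$$ with $\Phi=(-1,0)$ for $y^1<-y_*^1$ and $\Phi=(1,0)$ for $y^1>y_*^1$. *Shift, error, energy.* Put $h_\epsilon(\Psi,r,a)=\|\Psi-F_0(\frac{\cdot-a}{\epsilon};r)\|_{L^2(\mathbb R)}^2$ and $G_\epsilon=\partial_a h_\epsilon$, i.e. $G_\epsilon(\Psi,r,a)=\frac2\epsilon\int_{\mathbb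 R}\big(\Psi-F_0(\tfrac{y^1-a}{\epsilon};r)\big)\cdot F_0'(\tfrac{y^1-a}{\epsilon};r)\,dy^1$. For $\delta>0$, the shift $a$ is said to be *well defined on $(0,b)$* if $G_\epsilon(\Phi(y^0),R(y^0),a(y^0))=0$ and $h_\epsilon(\Phi(y^0),R(y^0),a(y^0))<\delta\epsilon$ for all $y^0\in(0,b)$. Put $\tilde F_0=F_0(\frac{y^1-a(y^0)}{\epsilon};R(y^0))$, $\tilde F_1=F_1(\frac{y^1-a(y^0)}{\epsilon};R(y^0),R'(y^0))$, $\xi=\Phi-\tilde F_0-\epsilon\tilde F_1$, and $$\underline A=\Big(1+\frac{|a|}{\epsilon}+\frac{|a'|}{\epsilon}\Big)^3,\qquad E=\int_{|y^1|\le y_*^1}\Big(\frac{m^2}{2n^2}|\partial_{y^0}\xi|^2+\frac12|\partial_{y^1}\xi|^2+\frac1{2\epsilon^2}\,\xi\cdot\mathrm{Hess}_\Phi W(\tilde F_0,R)\,\xi\Big)dy^1,$$ with the convention $\sqrt E=\sqrt{\max(E,0)}$. **Theorem (Bounded Shift Theorem).** There are $\delta,\alpha,C,\epsilon_0>0$,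 depending only on $V,d,r_0,r_1,F_0,F_1,R,y_*^0,y_*^1$ (and not on $\epsilon,b,\Phi,a$), such that the following holds for all $0<\epsilon<\epsilon_0$, all $0<b\le y_*^0$ and all $\Phi$ as above. If $a$ is well defined on $(0,b)$, then $a\in C^2((0,b))$ and at every $y^0\in(0,b)$ $$\Big[1-\epsilon\underline A-\sqrt\epsilon\,\underline A\sqrt E-e^{-\alpha\frac{y_*^1-a}{\epsilon}}\Big]\frac{|a''|}{\epsilon}\;\le\;\frac{C}{\sqrt\epsilon^{\,5}}\Big(\epsilon\underline A+\sqrt{\epsilon\sqrt E+e^{-\alpha\frac{y_*^1-a}{\epsilon}}}\,\sqrt[4]{E}\Big)\Big(\sqrt\epsilon^{\,3}+\epsilon\sqrt E+e^{-\alpha\frac{y_*^1-a}{\epsilon}}\Big).$$ -/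

import Mathlib

open Set Filter Topology MeasureTheory

namespace InterfaceModel

noncomputable section

/-- The target plane of the pair `(φ, σ)`, with its Euclidean norm. -/
abbrev Plane : Type := EuclideanSpace ℝ (Fin 2)

/-! ### The potential -/

/-- Standing assumptions on the potential `V(φ, σ)`. -/
structure IsPotential (V : Plane → ℝ) : Prop where
  smooth : ContDiff ℝ 3 V
  symm : ∀ Ψ : Plane, V Ψ = V !₂[|Ψ 0|, |Ψ 1|]
  well_pos : V !₂[1, 0] = 0
  well_neg : V !₂[-1, 0] = 0
  pos : ∀ Ψ : Plane, Ψ ≠ !₂[1, 0] → Ψ ≠ !₂[-1, 0] → 0 < V Ψ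
  lt_of_one_lt_left : ∀ x y : ℝ, 1 < x → V !₂[1, y] < V !₂[x, y]
  lt_of_one_lt_right : ∀ x y : ℝ, 1 < y → V !₂[x, 1] < V !₂[x, y]
  localMax : IsLocalMax V 0
  gradient_ne : ∀ Ψ : Plane, |Ψ 0| < 1 → |Ψ 1| < 1 → Ψ ≠ 0 → gradient V Ψ ≠ 0
  hess_growth : ∃ K : ℝ, ∀ Ψ : Plane, ‖fderiv ℝ (gradient V) Ψ‖ ≤ K * (1 + ‖Ψ‖ ^ 2)
  hess_wells : ∃ l : ℝ, 0 < l ∧ ∀ Ψ : Plane, (Ψ = !₂[1, 0] ∨ Ψ = !₂[-1, 0]) →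
    ∀ ψ : Plane, l * ‖ψ‖ ^ 2 ≤ inner ℝ ψ (fderiv ℝ (gradient V) Ψ ψ)

/-- The shifted potential `W(Φ, r) = V(Φ) + (1/2) (d² / r²) σ²`. -/
def shiftedPotential (V : Plane → ℝ) (d : ℝ) (Ψ : Plane) (r : ℝ) : ℝ :=
  V Ψ + 1 / 2 * (d ^ 2 / r ^ 2) * (Ψ 1) ^ 2

/-- `w(Φ, r)`, the gradient of `W(·, r)` with respect to `Φ`. -/
def force (V : Plane → ℝ) (d : ℝ) (Ψ : Plane) (r : ℝ) : Plane :=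
  gradient (fun X : Plane => shiftedPotential V d X r) Ψ

/-- `Hess_Φ W(Φ, r)`. -/
def hessW (V : Plane → ℝ) (d : ℝ) (Ψ : Plane) (r : ℝ) : Plane →L[ℝ] Plane :=
  fderiv ℝ (fun X : Plane => force V d X r) Ψ

/-- `∂_R w(Φ, r)`. -/
def forceR (V : Plane → ℝ) (d : ℝ) (Ψ : Plane) (r : ℝ) : Plane :=
  deriv (fun ρ : ℝ => force V d Ψ ρ) r

/-! ### The profiles -/

/-- The energy `∫ (1/2) |F'|² + W(F, r)` of a profile. -/
def profileEnergy (V : Plane → ℝ) (d r : ℝ) (F : ℝ → Plane) : ENNReal :=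
  ∫⁻ x : ℝ, ENNReal.ofReal (1 / 2 * ‖deriv F x‖ ^ 2 + shiftedPotential V d (F x) r)

/-- The class `𝒜`: finite energy, `f(0) = 0`, `f(±∞) = ±1`. Local absolute continuity together
with finite energy is membership in `H¹_loc`. -/
structure Admissible (V : Plane → ℝ) (d r : ℝ) (F : ℝ → Plane) : Prop where
  ac : ∀ p q : ℝ, AbsolutelyContinuousOnInterval F p q
  finite : profileEnergy V d r F < ⊤
  zero : F 0 0 = 0
  right : Tendsto (fun x => F x 0) atTop (𝓝 1)
  left : Tendsto (fun x => F x 0) atBot (𝓝 (-1))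

/-- `F = (f, s)` solves the minimization problem and has the normalizing symmetries. -/
structure IsProfile (V : Plane → ℝ) (d r : ℝ) (F : ℝ → Plane) : Prop where
  admissible : Admissible V d r F
  minimal : ∀ G : ℝ → Plane, Admissible V d r G → profileEnergy V d r F ≤ profileEnergy V d r G
  zero_iff : ∀ x : ℝ, F x 0 = 0 ↔ x = 0
  abs_le : ∀ x : ℝ, |F x 0| ≤ 1
  nonneg : ∀ x : ℝ, 0 ≤ F x 1
  le_one : ∀ x : ℝ, F x 1 ≤ 1
  odd : ∀ x : ℝ, F (-x) 0 = -F x 0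
  even : ∀ x : ℝ, F (-x) 1 = F x 1

/-- The linearized operator `L₁(F, r) ψ = -ψ'' + Hess_Φ W(F, r) ψ`. -/
def linOp (V : Plane → ℝ) (d r : ℝ) (F ψ : ℝ → Plane) (x : ℝ) : Plane :=
  -deriv (deriv ψ) x + hessW V d (F x) r (ψ x)

/-- Non-degeneracy: the `L²` kernel of `L₁(F, r)` is spanned by `F'`. -/
def Nondegenerate (V : Plane → ℝ) (d r : ℝ) (F : ℝ → Plane) : Prop :=
  ∀ ψ : ℝ → Plane,
    (ContDiff ℝ 2 ψ ∧ MemLp ψ 2 volume ∧ ∀ x : ℝ, linOp V d r F ψ x = 0) ↔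
      ∃ c : ℝ, ψ = c • deriv F

/-- The factor `g(r, v)`. -/
def curvatureFactor (d r v : ℝ) (F : ℝ → Plane) : ℝ :=
  1 / √(1 - v ^ 2) * (d ^ 2 / r ^ 3) * ((∫ x : ℝ, (F x 1) ^ 2) / ∫ x : ℝ, ‖deriv F x‖ ^ 2)

/-- `F₁ = F₁(·; r, v)` is the `H¹` solution, orthogonal to `F'`, of
`L₁(F, r) F₁ = g(r, v) F' - (x / √(1 - v²)) ∂_R w(F, r)`. -/
structure IsCorrector (V : Plane → ℝ) (d r v : ℝ) (F F₁ : ℝ → Plane) : Prop where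
  smooth : ContDiff ℝ 2 F₁
  memLp : MemLp F₁ 2 volume
  memLp_deriv : MemLp (deriv F₁) 2 volume
  equation : ∀ x : ℝ, linOp V d r F F₁ x =
    curvatureFactor d r v F • deriv F x - (x / √(1 - v ^ 2)) • forceR V d (F x) r
  orthogonal : ∫ x : ℝ, inner ℝ (F₁ x) (deriv F x) = 0

/-! ### The interface and its Minkowski normal coordinates `(t, y) = (y⁰, y¹)` -/

/-- `m = (1 - (R')²)^{-1/2}`. -/
def mFactor (R : ℝ → ℝ) (t : ℝ) : ℝ := 1 / √(1 - deriv R t ^ 2)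

/-- `n = 1 + y m³ R''`. -/
def nFactor (R : ℝ → ℝ) (t y : ℝ) : ℝ := 1 + y * mFactor R t ^ 3 * deriv (deriv R) t

/-- The polar radius `R + y m` of the point with coordinates `(t, y)`. -/
def radius (R : ℝ → ℝ) (t y : ℝ) : ℝ := R t + y * mFactor R t

/-- The mean curvature `H(R)`. -/
def meanCurvature (R : ℝ → ℝ) (t : ℝ) : ℝ :=
  1 / √(1 - deriv R t ^ 2) * (deriv (deriv R) t / (1 - deriv R t ^ 2) + 1 / R t)

/-- The coefficient `B⁰` of the wave equation. -/
def coeffB0 (R : ℝ → ℝ) (t y : ℝ) : ℝ :=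
  mFactor R t / nFactor R t y * deriv (fun τ => mFactor R τ / nFactor R τ y) t
    + 1 / radius R t y * (mFactor R t ^ 2 / nFactor R t y) * deriv R t

/-- The coefficient `B¹` of the wave equation. -/
def coeffB1 (R : ℝ → ℝ) (t y : ℝ) : ℝ :=
  -(mFactor R t ^ 3 / nFactor R t y * deriv (deriv R) t) - 1 / radius R t y * mFactor R t

/-- On (a neighbourhood of) `[0, T]` the function `R` is a timelike solution, with values in `I`, of
`H(R) ∫ |F₀'|² - (d² / R³) m ∫ s₀² = 0`. -/
def IsInterface (d : ℝ) (I : Set ℝ) (F₀ : ℝ → ℝ → Plane) (R : ℝ → ℝ) (T : ℝ) : Prop :=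
  ∀ᶠ t in 𝓝ˢ (Icc 0 T),
    R t ∈ I ∧ |deriv R t| < 1 ∧ DifferentiableAt ℝ R t ∧ DifferentiableAt ℝ (deriv R) t ∧
      meanCurvature R t * (∫ x : ℝ, ‖deriv (F₀ (R t)) x‖ ^ 2)
        - d ^ 2 / R t ^ 3 * mFactor R t * (∫ x : ℝ, (F₀ (R t) x 1) ^ 2) = 0

/-- Minkowski normal coordinates are non-degenerate, and stay away from the axis `r = 0`, on
`[0, T] × [-Y, Y]`. -/
def CoordinatesDefined (R : ℝ → ℝ) (T Y : ℝ) : Prop :=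
  ∀ t ∈ Icc 0 T, ∀ y ∈ Icc (-Y) Y, 0 < nFactor R t y ∧ 0 < radius R t y

/-- `Φ` is a classical solution of the wave equation in Minkowski normal coordinates on
`(0, b) × (-Y, Y)`, equal to `(-1, 0)` for `y < -Y` and to `(1, 0)` for `y > Y`. -/
structure IsSolution (V : Plane → ℝ) (d : ℝ) (R : ℝ → ℝ) (Y ε b : ℝ) (Φ : ℝ → ℝ → Plane) :
    Prop where
  smooth : ContDiffOn ℝ 2 (fun p : ℝ × ℝ => Φ p.1 p.2) (Ioo 0 b ×ˢ univ)
  equation : ∀ t ∈ Ioo 0 b, ∀ y ∈ Ioo (-Y) Y,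
    (mFactor R t ^ 2 / nFactor R t y ^ 2) • deriv (fun τ => deriv (fun τ' => Φ τ' y) τ) t
      + coeffB0 R t y • deriv (fun τ => Φ τ y) t + coeffB1 R t y • deriv (Φ t) y
      - deriv (deriv (Φ t)) y + (1 / ε ^ 2) • force V d (Φ t y) (radius R t y) = 0
  left : ∀ t ∈ Ioo 0 b, ∀ y : ℝ, y < -Y → Φ t y = !₂[-1, 0]
  right : ∀ t ∈ Ioo 0 b, ∀ y : ℝ, Y < y → Φ t y = !₂[1, 0]

/-! ### The shift, the error and its energy -/

/-- `h_ε(Ψ, r, a)`, the squared `L²` distance from `Ψ` to `F((· - a) / ε)`, where `F = F₀(·; r)`. -/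
def shiftDist (ε : ℝ) (F Ψ : ℝ → Plane) (a : ℝ) : ℝ :=
  ∫ y : ℝ, ‖Ψ y - F ((y - a) / ε)‖ ^ 2

/-- `G_ε(Ψ, r, a) = ∂_a h_ε(Ψ, r, a)`, with `F = F₀(·; r)`. -/
def shiftGrad (ε : ℝ) (F Ψ : ℝ → Plane) (a : ℝ) : ℝ :=
  2 / ε * ∫ y : ℝ, inner ℝ (Ψ y - F ((y - a) / ε)) (deriv F ((y - a) / ε))

/-- The shift `a` is well defined on `(0, b)`, with closeness threshold `η`: at each time
`a(t)` solves `G_ε(Φ(t), R(t), a(t)) = 0` with `h_ε(Φ(t), R(t), a(t)) < η`. -/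
def IsShift (F₀ : ℝ → ℝ → Plane) (R : ℝ → ℝ) (η ε b : ℝ) (Φ : ℝ → ℝ → Plane) (a : ℝ → ℝ) :
    Prop :=
  ∀ t ∈ Ioo 0 b, shiftDist ε (F₀ (R t)) (Φ t) (a t) < η ∧ shiftGrad ε (F₀ (R t)) (Φ t) (a t) = 0

/-- `F̃₀(t, y) = F₀((y - a(t)) / ε; R(t))`. -/
def tildeF0 (F₀ : ℝ → ℝ → Plane) (R a : ℝ → ℝ) (ε t y : ℝ) : Plane :=
  F₀ (R t) ((y - a t) / ε)

/-- `F̃₁(t, y) = F₁((y - a(t)) / ε; R(t), R'(t))`. -/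
def tildeF1 (F₁ : ℝ → ℝ → ℝ → Plane) (R a : ℝ → ℝ) (ε t y : ℝ) : Plane :=
  F₁ (R t) (deriv R t) ((y - a t) / ε)

/-- The error `ξ = Φ - F̃₀ - ε F̃₁`. -/
def errorTerm (F₀ : ℝ → ℝ → Plane) (F₁ : ℝ → ℝ → ℝ → Plane) (R a : ℝ → ℝ) (ε : ℝ)
    (Φ : ℝ → ℝ → Plane) (t y : ℝ) : Plane :=
  Φ t y - tildeF0 F₀ R a ε t y - ε • tildeF1 F₁ R a ε t y

/-- The energy density `e(Q)`. -/
def energyDensity (V : Plane → ℝ) (d : ℝ) (F₀ : ℝ → ℝ → Plane) (R a : ℝ → ℝ) (ε : ℝ)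
    (Q : ℝ → ℝ → Plane) (t y : ℝ) : ℝ :=
  1 / 2 * (mFactor R t ^ 2 / nFactor R t y ^ 2) * ‖deriv (fun τ => Q τ y) t‖ ^ 2
    + 1 / 2 * ‖deriv (Q t) y‖ ^ 2
    + 1 / (2 * ε ^ 2) * inner ℝ (Q t y) (hessW V d (tildeF0 F₀ R a ε t y) (R t) (Q t y))

/-- The energy `E(t) = ∫_{|y| ≤ Y} e(ξ)(t, y) dy` of the error. -/
def errorEnergy (V : Plane → ℝ) (d : ℝ) (F₀ : ℝ → ℝ → Plane) (F₁ : ℝ → ℝ → ℝ → Plane)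
    (R a : ℝ → ℝ) (Y ε : ℝ) (Φ : ℝ → ℝ → Plane) (t : ℝ) : ℝ :=
  ∫ y in Icc (-Y) Y, energyDensity V d F₀ R a ε (errorTerm F₀ F₁ R a ε Φ) t y

/-- `A(t) = (1 + |a| / ε + |a'| / ε)³`. -/
def shiftSize (a : ℝ → ℝ) (ε t : ℝ) : ℝ := (1 + |a t| / ε + |deriv a t| / ε) ^ 3

end

end InterfaceModel

open InterfaceModel

namespace InterfaceModel

open scoped BoundedContinuousFunction
open Real (exp exp_pos exp_add norm_eq_abs exp_le_one_iff exp_le_exp sqrt_pos sq_sqrt exp_zero dist_eq tendsto_exp_neg_atTop_nhds_zero exp_nat_mul)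

noncomputable section

set_option linter.unusedSectionVars false

notation "e(" κ "," x ")" => Real.exp (-(κ * |x|))
notation "⟪" x "," y "⟫" => inner ℝ x y

variable {E : Type*} [NormedAddCommGroup E] [NormedSpace ℝ E] {κ r t : ℝ}

theorem mul_mono {a b c d : ℝ} (h : a ≤ b) (h' : c ≤ d) (hc : 0 ≤ c := by positivity)
    (hb : 0 ≤ b := by positivity) : a * c ≤ b * d := mul_le_mul h h' hc hb

theorem mul_mono_left {a b c : ℝ} (h : b ≤ c) (ha : 0 ≤ a := by positivity) : a * b ≤ a * c :=
  mul_le_mul_of_nonneg_left h ha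

theorem mul_mono_right {a b c : ℝ} (h : a ≤ b) (hc : 0 ≤ c := by positivity) : a * c ≤ b * c :=
  mul_le_mul_of_nonneg_right h hc

theorem mem_Icc_of_mem_Ioo {b T : ℝ} (hb : b ≤ T) (ht : t ∈ Ioo 0 b) : t ∈ Icc 0 T :=
  ⟨ht.1.le, ht.2.le.trans hb⟩

theorem weight_le_one (hκ : 0 ≤ κ) (x : ℝ) : e(κ,x) ≤ 1 :=
  exp_le_one_iff.2 (neg_nonpos.2 (mul_nonneg hκ (abs_nonneg x)))

/-! ### Exponential weights -/

section Weights

/-- Continuous functions that are `O(exp (-κ |x|))`. -/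
def Decays (κ : ℝ) (u : ℝ → E) : Prop :=
  Continuous u ∧ ∃ C : ℝ, ∀ x, ‖u x‖ ≤ C * e(κ,x)

/-- The function represented by an element of the weighted space. -/
def unweight (κ : ℝ) (u : ℝ →ᵇ E) (x : ℝ) : E :=
  e(κ,x) • u x

open Classical in
/-- The element of the weighted space that represents a decaying function. -/
def weight (κ : ℝ) (u : ℝ → E) : ℝ →ᵇ E :=
  if h : Continuous u ∧ ∃ C : ℝ, ∀ x, ‖u x‖ ≤ C * e(κ,x) then
    BoundedContinuousFunction.ofNormedAddCommGroup (fun x => exp (κ * |x|) • u x)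
      (by have := h.1; fun_prop) h.2.choose (fun x => by
        rw [norm_smul, norm_eq_abs, abs_of_pos (exp_pos _)]
        calc exp (κ * |x|) * ‖u x‖ ≤ exp (κ * |x|) * (h.2.choose * e(κ,x)) := by
              gcongr; exact h.2.choose_spec x
          _ = h.2.choose * (exp (κ * |x|) * e(κ,x)) := by ring
          _ = h.2.choose := by rw [← exp_add]; simp)
  else 0

theorem weight_apply {u : ℝ → E} (h : Decays κ u) (x : ℝ) : weight κ u x = exp (κ * |x|) • u x := by
  have h' : Continuous u ∧ ∃ C : ℝ, ∀ x, ‖u x‖ ≤ C * e(κ,x) := h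
  rw [weight, dif_pos h']; rfl

theorem unweight_weight {u : ℝ → E} (h : Decays κ u) : unweight κ (weight κ u) = u := by
  ext1 x
  rw [unweight, weight_apply h, smul_smul, ← exp_add]; simp

theorem norm_unweight_le (κ : ℝ) (u : ℝ →ᵇ E) (x : ℝ) : ‖unweight κ u x‖ ≤ ‖u‖ * e(κ,x) := by
  rw [unweight, norm_smul, norm_eq_abs, abs_of_pos (exp_pos _), mul_comm]
  gcongr; exact u.norm_coe_le_norm x

theorem continuous_unweight (κ : ℝ) (u : ℝ →ᵇ E) : Continuous (unweight κ u) := by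
  unfold unweight; have := u.continuous; fun_prop

theorem decays_unweight (κ : ℝ) (u : ℝ →ᵇ E) : Decays κ (unweight κ u) :=
  ⟨continuous_unweight κ u, ‖u‖, norm_unweight_le κ u⟩

theorem unweight_injective (κ : ℝ) : Function.Injective (unweight κ : (ℝ →ᵇ E) → ℝ → E) := by
  intro u v h
  ext1 x
  have := congrFun h x
  simp only [unweight] at this
  exact smul_right_injective E (exp_pos _).ne' this

theorem unweight_add (κ : ℝ) (u v : ℝ →ᵇ E) :
    unweight κ (u + v) = fun x => unweight κ u x + unweight κ v x := by
  ext1 x; simp [unweight]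

theorem unweight_sub (κ : ℝ) (u v : ℝ →ᵇ E) :
    unweight κ (u - v) = fun x => unweight κ u x - unweight κ v x := by
  ext1 x; simp [unweight, smul_sub]

theorem unweight_neg (κ : ℝ) (u : ℝ →ᵇ E) : unweight κ (-u) = fun x => -unweight κ u x := by
  ext1 x; simp [unweight]

theorem unweight_smul (κ c : ℝ) (u : ℝ →ᵇ E) :
    unweight κ (c • u) = fun x => c • unweight κ u x := by
  ext1 x
  simp only [unweight, BoundedContinuousFunction.coe_smul]
  rw [smul_comm]

theorem unweight_zero (κ : ℝ) : unweight κ (0 : ℝ →ᵇ E) = fun _ => 0 := by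
  ext1 x; simp [unweight]

theorem norm_weight_le {C : ℝ} {u : ℝ → E} (hC : 0 ≤ C)
    (hu : ∀ x, ‖u x‖ ≤ C * e(κ,x)) : ‖weight κ u‖ ≤ C := by
  by_cases h : Continuous u
  · have hd : Decays κ u := ⟨h, C, hu⟩
    refine (BoundedContinuousFunction.norm_le hC).2 fun x => ?_
    rw [weight_apply hd, norm_smul, norm_eq_abs, abs_of_pos (exp_pos _)]
    calc exp (κ * |x|) * ‖u x‖ ≤ exp (κ * |x|) * (C * e(κ,x)) := by gcongr; exact hu x
      _ = C * (exp (κ * |x|) * e(κ,x)) := by ring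
      _ = C := by rw [← exp_add]; simp
  · rw [weight, dif_neg (fun h' => h h'.1)]; simpa using hC

theorem Decays.mono {κ' : ℝ} {u : ℝ → E} (h : Decays κ u) (hκ : κ' ≤ κ) : Decays κ' u := by
  obtain ⟨hc, C, hC⟩ := h
  refine ⟨hc, C, fun x => (hC x).trans ?_⟩
  have hC0 : 0 ≤ C := by
    have := (norm_nonneg _).trans (hC 0); simpa using this
  gcongr

theorem Decays.add {u v : ℝ → E} (hu : Decays κ u) (hv : Decays κ v) :
    Decays κ (fun x => u x + v x) := by
  obtain ⟨hc, C, hC⟩ := hu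
  obtain ⟨hc', C', hC'⟩ := hv
  refine ⟨hc.add hc', C + C', fun x => (norm_add_le _ _).trans ?_⟩
  rw [add_mul]; exact add_le_add (hC x) (hC' x)

theorem Decays.neg {u : ℝ → E} (hu : Decays κ u) : Decays κ (fun x => -u x) := by
  obtain ⟨hc, C, hC⟩ := hu
  exact ⟨hc.neg, C, fun x => by simpa using hC x⟩

theorem Decays.sub {u v : ℝ → E} (hu : Decays κ u) (hv : Decays κ v) :
    Decays κ (fun x => u x - v x) := by
  simpa [sub_eq_add_neg] using hu.add hv.neg

theorem Decays.const_smul {u : ℝ → E} (c : ℝ) (hu : Decays κ u) : Decays κ (fun x => c • u x) := by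
  obtain ⟨hc, C, hC⟩ := hu
  refine ⟨hc.const_smul c, |c| * C, fun x => ?_⟩
  rw [norm_smul, norm_eq_abs, mul_assoc]
  gcongr; exact hC x

theorem Decays.clm_apply {F : Type*} [NormedAddCommGroup F] [NormedSpace ℝ F]
    {u : ℝ → E} {P : ℝ → E →L[ℝ] F} (hP : Continuous P) {c : ℝ} (hPb : ∀ x, ‖P x‖ ≤ c)
    (hu : Decays κ u) : Decays κ (fun x => P x (u x)) := by
  obtain ⟨hc, C, hC⟩ := hu
  refine ⟨hP.clm_apply hc, c * C, fun x => ?_⟩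
  calc ‖P x (u x)‖ ≤ ‖P x‖ * ‖u x‖ := (P x).le_opNorm _
    _ ≤ c * (C * e(κ,x)) := by
        have := (norm_nonneg (P x)).trans (hPb x)
        gcongr
        · exact hPb x
        · exact hC x
    _ = _ := by ring

theorem Decays.clm {F : Type*} [NormedAddCommGroup F] [NormedSpace ℝ F]
    {u : ℝ → E} (P : E →L[ℝ] F) (hu : Decays κ u) : Decays κ (fun x => P (u x)) :=
  hu.clm_apply (P := fun _ => P) continuous_const (fun _ => le_rfl)

theorem Decays.bounded (hκ : 0 ≤ κ) {u : ℝ → E} (hu : Decays κ u) : ∃ C, ∀ x, ‖u x‖ ≤ C := by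
  obtain ⟨C, hC⟩ := (hu.mono hκ).2
  exact ⟨C, fun x => by simpa using hC x⟩

theorem weight_add {u v : ℝ → E} (hu : Decays κ u) (hv : Decays κ v) :
    weight κ (fun x => u x + v x) = weight κ u + weight κ v := by
  apply unweight_injective κ
  rw [unweight_weight (hu.add hv), unweight_add, unweight_weight hu, unweight_weight hv]

theorem weight_sub {u v : ℝ → E} (hu : Decays κ u) (hv : Decays κ v) :
    weight κ (fun x => u x - v x) = weight κ u - weight κ v := by
  apply unweight_injective κ
  rw [unweight_weight (hu.sub hv), unweight_sub, unweight_weight hu, unweight_weight hv]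

theorem weight_smul {u : ℝ → E} (c : ℝ) (hu : Decays κ u) :
    weight κ (fun x => c • u x) = c • weight κ u := by
  apply unweight_injective κ
  rw [unweight_weight (hu.const_smul c), unweight_smul, unweight_weight hu]

/-! ### One-sided exponential convolutions -/

/-- `∫_{y ≤ x} exp (-k (x - y)) f y`. -/
def causal (k : ℝ) (f : ℝ → E) (x : ℝ) : E :=
  exp (-(k * x)) • ∫ y in Iic x, exp (k * y) • f y

theorem integrableOn_causal {k : ℝ} (hk : 0 < k) {f : ℝ → E} (hf : Continuous f) {C : ℝ}
    (hC : ∀ x, ‖f x‖ ≤ C) (x : ℝ) : IntegrableOn (fun y => exp (k * y) • f y) (Iic x) := by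
  refine Integrable.mono' (g := fun y => C * exp (k * y)) ?_ ?_ ?_
  · exact (integrableOn_exp_mul_Iic hk x).const_mul C
  · exact (by fun_prop : Continuous fun y => exp (k * y) • f y).aestronglyMeasurable
  · refine .of_forall fun y => ?_
    rw [norm_smul, norm_eq_abs, abs_of_pos (exp_pos _), mul_comm]
    gcongr; exact hC y

theorem hasDerivAt_causal [CompleteSpace E] {k : ℝ} (hk : 0 < k) {f : ℝ → E} (hf : Continuous f)
    {C : ℝ} (hC : ∀ x, ‖f x‖ ≤ C) (x : ℝ) :
    HasDerivAt (causal k f) (f x - k • causal k f x) x := by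
  have hint := integrableOn_causal hk hf hC
  have hc : Continuous fun y => exp (k * y) • f y := by fun_prop
  have h1 : HasDerivAt (fun x => ∫ y in Iic x, exp (k * y) • f y) (exp (k * x) • f x) x := by
    have : (fun x => ∫ y in Iic x, exp (k * y) • f y) = fun x =>
        (∫ y in Iic (0 : ℝ), exp (k * y) • f y) + ∫ y in (0 : ℝ)..x, exp (k * y) • f y := by
      ext1 x
      rw [← intervalIntegral.integral_Iic_sub_Iic (hint 0) (hint x)]; abel
    rw [this]
    exact (intervalIntegral.integral_hasDerivAt_right (hc.intervalIntegrable _ _)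
      hc.aestronglyMeasurable.stronglyMeasurableAtFilter hc.continuousAt).const_add _
  have h2 : HasDerivAt (fun x => exp (-(k * x))) (exp (-(k * x)) * (-(k * 1))) x :=
    (((hasDerivAt_id x).const_mul k).neg).exp
  refine (h2.smul h1).congr_deriv ?_
  rw [smul_smul, ← exp_add, causal, smul_smul]
  simp only [neg_add_cancel, exp_zero, one_smul, mul_one, mul_neg, neg_smul]
  rw [sub_eq_add_neg, mul_comm _ k]

theorem norm_causal_le {k κ : ℝ} (hκ : 0 ≤ κ) (hk : κ < k) {f : ℝ → E} {C : ℝ}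
    (hC : ∀ x, ‖f x‖ ≤ C * e(κ,x)) (x : ℝ) :
    ‖causal k f x‖ ≤ C / (k - κ) * e(κ,x) := by
  have hkκ : 0 < k - κ := sub_pos.2 hk
  have hC0 : 0 ≤ C := by
    have := (norm_nonneg _).trans (hC 0); simpa using this
  rw [causal, norm_smul, norm_eq_abs, abs_of_pos (exp_pos _)]
  have hb : ‖∫ y in Iic x, exp (k * y) • f y‖ ≤
      ∫ y in Iic x, (C * e(κ,x) * exp (κ * x)) * exp ((k - κ) * y) := by
    refine norm_integral_le_of_norm_le ((integrableOn_exp_mul_Iic hkκ x).const_mul _) ?_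
    refine (ae_restrict_iff' measurableSet_Iic).2 (.of_forall fun y hy => ?_)
    rw [norm_smul, norm_eq_abs, abs_of_pos (exp_pos _)]
    calc exp (k * y) * ‖f y‖ ≤ exp (k * y) * (C * e(κ,y)) := by gcongr; exact hC y
      _ = C * exp (k * y + -(κ * |y|)) := by rw [exp_add]; ring
      _ ≤ C * exp (-(κ * |x|) + κ * x + (k - κ) * y) := by
          refine mul_mono_left (Real.exp_le_exp.2 ?_) hC0
          have h1 : |x| ≤ |y| + (x - y) := by
            have := abs_add_le y (x - y)
            rw [abs_of_nonneg (sub_nonneg.2 (mem_Iic.1 hy))] at this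
            simpa using this
          nlinarith [mul_mono_left h1 hκ]
      _ = _ := by rw [exp_add, exp_add]; ring
  rw [integral_const_mul, integral_exp_mul_Iic hkκ] at hb
  calc _ ≤ exp (-(k * x)) * (C * e(κ,x) * exp (κ * x) * (exp ((k - κ) * x) / (k - κ))) := by gcongr
    _ = C / (k - κ) * e(κ,x) * (exp (-(k * x)) * exp (κ * x) * exp ((k - κ) * x)) := by ring
    _ = _ := by
        rw [← exp_add, ← exp_add]
        ring_nf; simp

theorem continuous_causal [CompleteSpace E] {k : ℝ} (hk : 0 < k) {f : ℝ → E} (hf : Continuous f)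
    {C : ℝ} (hC : ∀ x, ‖f x‖ ≤ C) : Continuous (causal k f) :=
  continuous_iff_continuousAt.2 fun x => (hasDerivAt_causal hk hf hC x).continuousAt

/-- `∫_{y ≥ x} exp (-k (y - x)) f y`. -/
def anticausal (k : ℝ) (f : ℝ → E) (x : ℝ) : E := causal k (fun y => f (-y)) (-x)

theorem hasDerivAt_anticausal [CompleteSpace E] {k : ℝ} (hk : 0 < k) {f : ℝ → E}
    (hf : Continuous f) {C : ℝ} (hC : ∀ x, ‖f x‖ ≤ C) (x : ℝ) :
    HasDerivAt (anticausal k f) (k • anticausal k f x - f x) x := by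
  have := (hasDerivAt_causal hk (hf.comp continuous_neg) (fun x => hC (-x)) (-x)).scomp x
    (hasDerivAt_neg x)
  refine HasDerivAt.congr_deriv (f := anticausal k f) this ?_
  simp only [Function.comp_def, neg_neg, neg_smul, one_smul, neg_sub]
  rfl

theorem decays_causal [CompleteSpace E] {k κ : ℝ} (hκ : 0 ≤ κ) (hk : κ < k) {f : ℝ → E}
    (hf : Decays κ f) : Decays κ (causal k f) := by
  obtain ⟨C0, hC0⟩ := hf.bounded hκ
  obtain ⟨hc, C, hC⟩ := hf
  exact ⟨continuous_causal (hκ.trans_lt hk) hc hC0, _, norm_causal_le hκ hk hC⟩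

/-- The one-sided convolution as a bounded operator of the weighted space. -/
def causalOp [CompleteSpace E] (κ k : ℝ) (hκ : 0 ≤ κ) (hk : κ < k) : (ℝ →ᵇ E) →L[ℝ] ℝ →ᵇ E :=
  LinearMap.mkContinuous
    { toFun := fun u => weight κ (causal k (unweight κ u))
      map_add' := fun u v => by
        rw [← weight_add (decays_causal hκ hk (decays_unweight κ u))
          (decays_causal hκ hk (decays_unweight κ v)), unweight_add]
        congr 1; ext1 x
        obtain ⟨C, hC⟩ := (decays_unweight κ u).bounded hκ
        obtain ⟨C', hC'⟩ := (decays_unweight κ v).bounded hκ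
        simp only [causal, smul_add]
        rw [integral_add (integrableOn_causal (hκ.trans_lt hk) (continuous_unweight κ u) hC x)
          (integrableOn_causal (hκ.trans_lt hk) (continuous_unweight κ v) hC' x), smul_add]
      map_smul' := fun c u => by
        simp only [RingHom.id_apply]
        rw [← weight_smul c (decays_causal hκ hk (decays_unweight κ u)), unweight_smul]
        congr 1; ext1 x
        simp only [causal, smul_comm _ c]
        rw [integral_smul, smul_comm] }
    (1 / (k - κ)) (fun u => by
      refine norm_weight_le (by positivity) fun x => ?_
      have := norm_causal_le hκ hk (norm_unweight_le κ u) x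
      convert this using 2; ring)

theorem unweight_causalOp [CompleteSpace E] {k : ℝ} (hκ : 0 ≤ κ) (hk : κ < k) (u : ℝ →ᵇ E) :
    unweight κ (causalOp κ k hκ hk u) = causal k (unweight κ u) :=
  unweight_weight (decays_causal hκ hk (decays_unweight κ u))

/-- Reflection `x ↦ -x` on bounded continuous functions. -/
def reflectOp : (ℝ →ᵇ E) →L[ℝ] ℝ →ᵇ E :=
  LinearMap.mkContinuous
    { toFun := fun u => u.compContinuous ⟨fun x => -x, continuous_neg⟩
      map_add' := fun _ _ => rfl
      map_smul' := fun _ _ => rfl }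
    1 (fun u => by
      refine (BoundedContinuousFunction.norm_le (by positivity)).2 fun x => ?_
      rw [one_mul]; exact u.norm_coe_le_norm (-x))

theorem unweight_reflectOp (κ : ℝ) (u : ℝ →ᵇ E) :
    unweight κ (reflectOp u) = fun x => unweight κ u (-x) := by
  ext1 x
  simp only [unweight, abs_neg]; rfl

/-- Pointwise application of a fixed linear map. -/
def postOp {F : Type*} [NormedAddCommGroup F] [NormedSpace ℝ F] (P : E →L[ℝ] F) :
    (ℝ →ᵇ E) →L[ℝ] ℝ →ᵇ F :=
  P.compLeftContinuousBounded ℝ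

theorem unweight_postOp {F : Type*} [NormedAddCommGroup F] [NormedSpace ℝ F] (P : E →L[ℝ] F)
    (κ : ℝ) (u : ℝ →ᵇ E) :
    unweight κ (postOp P u) = fun x => P (unweight κ u x) := by
  ext1 x; simp [unweight, postOp]

end Weights

/-! ### Green's operators -/

/-- The weighted space of plane-valued functions. -/
abbrev Weighted : Type := ℝ →ᵇ Plane

/-- Linear endomorphisms of the weighted space. -/
abbrev WeightedEnd : Type := Weighted →L[ℝ] Weighted

/-- Linear endomorphisms of the plane. -/
abbrev PlaneEnd : Type := Plane →L[ℝ] Plane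

/-- The orthogonal projection onto a coordinate axis. -/
def coordProj (i : Fin 2) : PlaneEnd :=
  (EuclideanSpace.proj i : Plane →L[ℝ] ℝ).smulRight (EuclideanSpace.single i (1 : ℝ))

@[simp] theorem coordProj_apply (i j : Fin 2) (Ψ : Plane) :
    coordProj i Ψ j = if j = i then Ψ i else 0 := by
  simp [coordProj]

/-- `G` inverts `-∂² + M` on the weighted space, and `G'` is the derivative of `G`. -/
structure IsGreen (κ : ℝ) (M : PlaneEnd) (G G' : WeightedEnd) : Prop where
  deriv : ∀ f x, HasDerivAt (unweight κ (G f)) (unweight κ (G' f) x) x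
  deriv2 : ∀ f x, HasDerivAt (unweight κ (G' f)) (M (unweight κ (G f) x) - unweight κ f x) x
  unique : ∀ (f : Weighted) (u u1 : ℝ → Plane), (∃ C, ∀ x, ‖u x‖ ≤ C) →
    (∀ x, HasDerivAt u (u1 x) x) → (∀ x, HasDerivAt u1 (M (u x) - unweight κ f x) x) →
    u = unweight κ (G f) ∧ u1 = unweight κ (G' f)

/-- A bounded nonnegative solution of `ρ'' ≥ k² ρ` on a half line decays exponentially. -/
theorem le_exp_of_bounded_of_deriv2 {k : ℝ} (hk : 0 < k) {ρ ρ1 ρ2 : ℝ → ℝ} {X B : ℝ}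
    (h1 : ∀ x, HasDerivAt ρ (ρ1 x) x) (h2 : ∀ x, HasDerivAt ρ1 (ρ2 x) x)
    (hB : ∀ x, X ≤ x → ρ x ≤ B) (h3 : ∀ x, X ≤ x → k ^ 2 * ρ x ≤ ρ2 x) {x : ℝ} (hx : X ≤ x) :
    ρ x ≤ ρ X * exp (-(k * (x - X))) := by
  have he : ∀ l x : ℝ, HasDerivAt (fun x => exp (l * x)) (exp (l * x) * l) x :=
    fun l x => by simpa using ((hasDerivAt_id x).const_mul l).exp
  set A := ρ X * exp (k * X) with hA
  set ψ := fun x => exp (k * x) * (ρ1 x - k * ρ x) + 2 * k * A with hψ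
  set φ := fun x => exp (-k * x) * (ρ x - A * exp (-k * x)) with hφ
  have ee : ∀ x, exp (k * x) * exp (-k * x) = 1 := fun x => by rw [← exp_add]; simp
  have dψ : ∀ x, HasDerivAt ψ (exp (k * x) * (ρ2 x - k ^ 2 * ρ x)) x := fun x =>
    (((he k x).mul ((h2 x).sub ((h1 x).const_mul k))).add_const (2 * k * A)).congr_deriv
      (by simp only [Pi.sub_apply]; ring)
  have dφ : ∀ x, HasDerivAt φ (exp (-k * x) ^ 2 * ψ x) x := fun x =>
    ((he (-k) x).mul ((h1 x).sub ((he (-k) x).const_mul A))).congr_deriv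
      (by simp only [hψ, Pi.sub_apply]
          linear_combination (- exp (-k * x) * (ρ1 x - k * ρ x)) * ee x)
  have mψ : MonotoneOn ψ (Ici X) := monotoneOn_of_hasDerivWithinAt_nonneg (convex_Ici X)
    (fun y _ => (dψ y).continuousAt.continuousWithinAt) (fun y _ => (dψ y).hasDerivWithinAt)
    fun y hy => mul_nonneg (exp_pos _).le (sub_nonneg.2 (h3 y (interior_subset hy)))
  have hφx : φ x ≤ 0 := by
    by_contra! hpos
    have hX : φ X = 0 := by simp only [hφ, hA]; linear_combination -exp (-k * X) * ρ X * ee X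
    have hXx : X < x := hx.lt_of_ne (by rintro rfl; linarith)
    obtain ⟨c, hc, hc'⟩ := exists_hasDerivAt_eq_slope φ _ hXx
      (fun y _ => (dφ y).continuousAt.continuousWithinAt) fun y _ => dφ y
    have hψc : 0 < ψ c := by
      have : 0 < exp (-k * c) ^ 2 * ψ c := by
        rw [hc', hX, sub_zero]; exact div_pos hpos (sub_pos.2 hXx)
      exact (pos_iff_pos_of_mul_pos this).1 (by positivity)
    have mφ : MonotoneOn φ (Ici c) := monotoneOn_of_hasDerivWithinAt_nonneg (convex_Ici c)
      (fun y _ => (dφ y).continuousAt.continuousWithinAt) (fun y _ => (dφ y).hasDerivWithinAt)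
      fun y hy => mul_nonneg (sq_nonneg _)
        (hψc.le.trans (mψ hc.1.le (hc.1.le.trans (interior_subset hy)) (interior_subset hy)))
    have t0 : Tendsto (fun y => exp (-k * y)) atTop (𝓝 0) :=
      (tendsto_exp_neg_atTop_nhds_zero.comp (tendsto_id.const_mul_atTop hk)).congr fun y => by simp
    exact hpos.not_ge (ge_of_tendsto (x := atTop)
      (by simpa using t0.mul ((t0.const_mul A).const_sub B))
      ((eventually_ge_atTop x).mono fun y hy => (mφ hc.2.le (hc.2.le.trans hy) hy).trans
        (mul_mono_left (sub_le_sub_right (hB y (hx.trans hy)) _) (exp_pos _).le)))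
  have h := mul_nonpos_of_nonneg_of_nonpos (exp_pos (k * x)).le hφx
  rw [← mul_assoc, ee, one_mul, hA, mul_assoc, ← exp_add] at h
  rw [show -(k * (x - X)) = k * X + -k * x by ring]; linarith

theorem eq_zero_of_bounded_of_deriv2 {k : ℝ} (hk : 0 < k) {z z1 : ℝ → ℝ} {C : ℝ}
    (hC : ∀ x, |z x| ≤ C) (h1 : ∀ x, HasDerivAt z (z1 x) x)
    (h2 : ∀ x, HasDerivAt z1 (k ^ 2 * z x) x) (x : ℝ) : z x = 0 := by
  have t0 : Tendsto (fun s => C * exp (-(k * s))) atTop (𝓝 0) := by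
    simpa using (tendsto_exp_neg_atTop_nhds_zero.comp (tendsto_id.const_mul_atTop hk)).const_mul C
  refine abs_nonpos_iff.1 (ge_of_tendsto t0 ((eventually_ge_atTop 0).mono fun s hs => ?_))
  have a := le_exp_of_bounded_of_deriv2 hk h1 h2 (X := x - s) (fun x _ => (abs_le.1 (hC x)).2)
    (fun _ _ => le_rfl) (sub_le_self x hs)
  have b := le_exp_of_bounded_of_deriv2 hk (fun x => (h1 x).neg) (fun x => (h2 x).neg) (X := x - s)
    (fun x _ => neg_le.1 (abs_le.1 (hC x)).1) (fun _ _ => by simp) (sub_le_self x hs)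
  simp only [sub_sub_cancel, Pi.neg_apply] at a b
  have e := exp_pos (-(k * s))
  have := abs_le.1 (hC (x - s))
  exact abs_le.2 ⟨by nlinarith, by nlinarith⟩

/-- The Green's operator of `-∂² + k²`. -/
def greenScalar (κ k : ℝ) (hκ : 0 ≤ κ) (hk : κ < k) : WeightedEnd :=
  (1 / (2 * k)) • (causalOp κ k hκ hk + reflectOp ∘L causalOp κ k hκ hk ∘L reflectOp)

/-- The derivative of the Green's operator of `-∂² + k²`. -/
def greenScalar' (κ k : ℝ) (hκ : 0 ≤ κ) (hk : κ < k) : WeightedEnd :=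
  (1 / 2 : ℝ) • (reflectOp ∘L causalOp κ k hκ hk ∘L reflectOp - causalOp κ k hκ hk)

theorem unweight_reflect_causal {k : ℝ} (hκ : 0 ≤ κ) (hk : κ < k) (f : Weighted) :
    unweight κ (reflectOp (causalOp κ k hκ hk (reflectOp f))) = anticausal k (unweight κ f) := by
  rw [unweight_reflectOp, unweight_causalOp, unweight_reflectOp]; rfl

theorem unweight_greenScalar {k : ℝ} (hκ : 0 ≤ κ) (hk : κ < k) (f : Weighted) :
    unweight κ (greenScalar κ k hκ hk f) = fun x =>
      (1 / (2 * k)) • (causal k (unweight κ f) x + anticausal k (unweight κ f) x) := by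
  rw [← unweight_reflect_causal hκ hk, ← unweight_causalOp hκ hk]
  simp only [greenScalar, FunLike.coe_smul, Pi.smul_apply, FunLike.coe_add, Pi.add_apply,
    ContinuousLinearMap.comp_apply, unweight_smul, unweight_add]

theorem unweight_greenScalar' {k : ℝ} (hκ : 0 ≤ κ) (hk : κ < k) (f : Weighted) :
    unweight κ (greenScalar' κ k hκ hk f) = fun x =>
      (1 / 2 : ℝ) • (anticausal k (unweight κ f) x - causal k (unweight κ f) x) := by
  rw [← unweight_reflect_causal hκ hk, ← unweight_causalOp hκ hk]
  simp only [greenScalar', FunLike.coe_smul, Pi.smul_apply, FunLike.coe_sub, Pi.sub_apply,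
    ContinuousLinearMap.comp_apply, unweight_smul, unweight_sub]

theorem hasDerivAt_greenScalar {k : ℝ} (hκ : 0 ≤ κ) (hk : κ < k) (f : Weighted) (x : ℝ) :
    HasDerivAt (unweight κ (greenScalar κ k hκ hk f)) (unweight κ (greenScalar' κ k hκ hk f) x) x
    := by
  have hk0 := hκ.trans_lt hk
  obtain ⟨C, hC⟩ := (decays_unweight κ f).bounded hκ
  have hA := hasDerivAt_causal hk0 (continuous_unweight κ f) hC x
  have hB := hasDerivAt_anticausal hk0 (continuous_unweight κ f) hC x
  rw [unweight_greenScalar, unweight_greenScalar']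
  refine ((hA.add hB).const_smul (1 / (2 * k))).congr_deriv ?_
  match_scalars <;> field_simp <;> ring

theorem hasDerivAt_greenScalar' {k : ℝ} (hκ : 0 ≤ κ) (hk : κ < k) (f : Weighted) (x : ℝ) :
    HasDerivAt (unweight κ (greenScalar' κ k hκ hk f))
      (k ^ 2 • unweight κ (greenScalar κ k hκ hk f) x - unweight κ f x) x := by
  have hk0 := hκ.trans_lt hk
  obtain ⟨C, hC⟩ := (decays_unweight κ f).bounded hκ
  have hA := hasDerivAt_causal hk0 (continuous_unweight κ f) hC x
  have hB := hasDerivAt_anticausal hk0 (continuous_unweight κ f) hC x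
  rw [unweight_greenScalar, unweight_greenScalar']
  refine ((hB.sub hA).const_smul (1 / 2 : ℝ)).congr_deriv ?_
  match_scalars <;> field_simp <;> ring

theorem exists_isGreen {κ k₀ k₁ : ℝ} (hκ : 0 ≤ κ) (h₀ : κ < k₀) (h₁ : κ < k₁) :
    ∃ G G', IsGreen κ (k₀ ^ 2 • coordProj 0 + k₁ ^ 2 • coordProj 1) G G' := by
  set M : PlaneEnd := k₀ ^ 2 • coordProj 0 + k₁ ^ 2 • coordProj 1 with hM
  set G : WeightedEnd := postOp (coordProj 0) ∘L greenScalar κ k₀ hκ h₀ +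
    postOp (coordProj 1) ∘L greenScalar κ k₁ hκ h₁ with hG
  set G' : WeightedEnd := postOp (coordProj 0) ∘L greenScalar' κ k₀ hκ h₀ +
    postOp (coordProj 1) ∘L greenScalar' κ k₁ hκ h₁ with hG'
  have eG : ∀ f, unweight κ (G f) = fun x => coordProj 0 (unweight κ (greenScalar κ k₀ hκ h₀ f) x)
      + coordProj 1 (unweight κ (greenScalar κ k₁ hκ h₁ f) x) := fun f => by
    simp only [hG, FunLike.coe_add, Pi.add_apply, ContinuousLinearMap.comp_apply, unweight_add,
      unweight_postOp]
  have eG' : ∀ f, unweight κ (G' f) = fun x =>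
      coordProj 0 (unweight κ (greenScalar' κ k₀ hκ h₀ f) x)
      + coordProj 1 (unweight κ (greenScalar' κ k₁ hκ h₁ f) x) := fun f => by
    simp only [hG', FunLike.coe_add, Pi.add_apply, ContinuousLinearMap.comp_apply, unweight_add,
      unweight_postOp]
  have d1 : ∀ f x, HasDerivAt (unweight κ (G f)) (unweight κ (G' f) x) x := fun f x => by
    rw [eG, eG']
    exact ((coordProj 0).hasFDerivAt.comp_hasDerivAt x (hasDerivAt_greenScalar hκ h₀ f x)).add
      ((coordProj 1).hasFDerivAt.comp_hasDerivAt x (hasDerivAt_greenScalar hκ h₁ f x))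
  have d2 : ∀ f x, HasDerivAt (unweight κ (G' f))
      (M (unweight κ (G f) x) - unweight κ f x) x := fun f x => by
    rw [eG, eG']
    refine (((coordProj 0).hasFDerivAt.comp_hasDerivAt x (hasDerivAt_greenScalar' hκ h₀ f x)).add
      ((coordProj 1).hasFDerivAt.comp_hasDerivAt x
        (hasDerivAt_greenScalar' hκ h₁ f x))).congr_deriv ?_
    ext i
    fin_cases i <;> simp [hM]
  refine ⟨G, G', d1, d2, fun f u u1 hb hu hu1 => ?_⟩
  have hGu : u = unweight κ (G f) := by
    obtain ⟨C, hC⟩ := hb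
    have key : ∀ i : Fin 2, ∀ k : ℝ, 0 < k → (∀ Ψ : Plane, M Ψ i = k ^ 2 * Ψ i) → ∀ x,
        (u x - unweight κ (G f) x) i = 0 := by
      intro i k hk hMi
      obtain ⟨C', hC'⟩ := (decays_unweight κ (G f)).bounded hκ
      have hp : ∀ {v : ℝ → Plane} {v' : Plane} {x : ℝ}, HasDerivAt v v' x →
          HasDerivAt (fun x => v x i) (v' i) x := fun h =>
        (EuclideanSpace.proj i : Plane →L[ℝ] ℝ).hasFDerivAt.comp_hasDerivAt _ h
      refine eq_zero_of_bounded_of_deriv2 (C := C + C')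
        (z1 := fun x => (u1 x - unweight κ (G' f) x) i) hk (fun x => ?_)
        (fun x => hp ((hu x).sub (d1 f x))) (fun x => ?_)
      · calc |(u x - unweight κ (G f) x) i| ≤ ‖u x - unweight κ (G f) x‖ := by
              simpa using PiLp.norm_apply_le (p := 2) (u x - unweight κ (G f) x) i
          _ ≤ C + C' := (norm_sub_le _ _).trans (add_le_add (hC x) (hC' x))
      · refine (hp ((hu1 x).sub (d2 f x))).congr_deriv ?_
        have e : M (u x) - unweight κ f x - (M (unweight κ (G f) x) - unweight κ f x) =
            M (u x - unweight κ (G f) x) := by rw [map_sub]; abel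
        rw [e, hMi]
    ext x i
    have : (u x - unweight κ (G f) x) i = 0 := by
      fin_cases i
      · exact key 0 k₀ (hκ.trans_lt h₀) (fun Ψ => by simp [hM]) x
      · exact key 1 k₁ (hκ.trans_lt h₁) (fun Ψ => by simp [hM]) x
    simpa [sub_eq_zero] using this
  refine ⟨hGu, ?_⟩
  ext1 x
  have := d1 f x
  rw [← hGu] at this
  exact (hu x).unique this

/-! ### A compactness criterion and a bound for symmetric operators -/

theorem isCompactOperator_of_lipschitz_of_decay {Z : Type*} [NormedAddCommGroup Z]
    [NormedSpace ℝ Z] (K : Z →L[ℝ] Weighted) {L : NNReal} {C : ℝ} {β : ℝ} (hβ : 0 < β)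
    (hL : ∀ u : Z, ‖u‖ ≤ 1 → LipschitzWith L (K u))
    (hd : ∀ u : Z, ‖u‖ ≤ 1 → ∀ x, ‖K u x‖ ≤ C * e(β,x)) :
    IsCompactOperator K := by
  have hC0 : 0 ≤ C := by
    have := (norm_nonneg _).trans (hd 0 (by simp) 0); simpa using this
  rw [← ContinuousLinearMap.coe_coe, isCompactOperator_iff_isCompact_closure_image_closedBall
    (K : Z →ₗ[ℝ] Weighted) one_pos]
  refine TotallyBounded.isCompact_of_isClosed (TotallyBounded.closure ?_) isClosed_closure
  rw [Metric.totallyBounded_iff]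
  intro η hη
  obtain ⟨N, hN⟩ : ∃ N : ℝ, C * exp (-(β * N)) < η / 4 := by
    have : Tendsto (fun x : ℝ => C * exp (-(β * x))) atTop (𝓝 (C * 0)) :=
      (Real.tendsto_exp_neg_atTop_nhds_zero.comp (tendsto_id.const_mul_atTop hβ)).const_mul C
    rw [mul_zero] at this
    exact (this.eventually_lt_const (by positivity : 0 < η / 4)).exists
  let J := Icc (-N) N
  let res : Weighted → BoundedContinuousFunction J Plane := fun f =>
    f.compContinuous ⟨Subtype.val, continuous_subtype_val⟩
  set A : Set (BoundedContinuousFunction J Plane) := (fun u => res (K u)) '' Metric.closedBall 0 1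
  have hAc : IsCompact (closure A) := by
    refine BoundedContinuousFunction.arzela_ascoli (Metric.closedBall 0 C)
      (isCompact_closedBall _ _) A ?_ ?_
    · rintro f x ⟨u, hu, rfl⟩
      rw [mem_closedBall_zero_iff] at hu ⊢
      refine (hd u hu x).trans ?_
      nlinarith [weight_le_one hβ.le x]
    · refine (LipschitzWith.uniformEquicontinuous _ L ?_).equicontinuous
      rintro ⟨f, u, hu, rfl⟩
      rw [mem_closedBall_zero_iff] at hu
      exact (hL u hu).comp (LipschitzWith.subtype_val J) |>.weaken (by simp)
  obtain ⟨t, htA, htf, hcov⟩ := Metric.finite_approx_of_totallyBounded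
    (hAc.totallyBounded.subset subset_closure) (η / 2) (by positivity)
  have hch : ∀ f ∈ t, ∃ u : Z, ‖u‖ ≤ 1 ∧ res (K u) = f := fun f hf => by
    obtain ⟨u, hu, h⟩ := htA hf
    exact ⟨u, by simpa using hu, h⟩
  choose! s hs1 hs2 using hch
  refine ⟨(fun f => K (s f)) '' t, htf.image _, ?_⟩
  rintro _ ⟨u, hu, rfl⟩
  rw [mem_closedBall_zero_iff] at hu
  have : res (K u) ∈ A := ⟨u, by simpa using hu, rfl⟩
  obtain ⟨f, hf, hfu⟩ := mem_iUnion₂.1 (hcov this)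
  refine mem_iUnion₂.2 ⟨K (s f), ⟨f, hf, rfl⟩, ?_⟩
  rw [Metric.mem_ball] at hfu ⊢
  refine lt_of_le_of_lt ((BoundedContinuousFunction.dist_le (C := η / 2) (by positivity)).2
    fun x => ?_) (by linarith)
  by_cases hx : x ∈ J
  · have h1 := (BoundedContinuousFunction.dist_coe_le_dist (f := res (K u)) (g := f)
      ⟨x, hx⟩).trans hfu.le
    rw [← hs2 f hf] at h1
    exact h1
  · have hx' : N < |x| := by
      by_contra h
      exact hx (abs_le.1 (not_lt.1 h))
    have hsm : ∀ v : Z, ‖v‖ ≤ 1 → ‖K v x‖ ≤ η / 4 := fun v hv => by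
      refine (hd v hv x).trans (le_trans ?_ hN.le)
      gcongr
    rw [dist_eq_norm]
    have h1 := hsm u hu
    have h2 := hsm (s f) (hs1 f hf)
    refine (norm_sub_le _ _).trans ?_
    simp only [ContinuousLinearMap.coe_coe]
    linarith

/-- A Lax-type bound: an operator `B` on a normed space that is symmetric and nonnegative for a
positive semidefinite bounded form `p` satisfies `p (B f) (B f) ≤ ‖B‖ p (B f) f`. -/
theorem symmetric_nonneg_bound {Z : Type*} [NormedAddCommGroup Z] [NormedSpace ℝ Z]
    (p : Z →L[ℝ] Z →L[ℝ] ℝ) (hp : ∀ f g, p f g = p g f) (hp0 : ∀ f, 0 ≤ p f f)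
    (B : Z →L[ℝ] Z) (hB : ∀ f g, p (B f) g = p f (B g)) (hB0 : ∀ f, 0 ≤ p (B f) f) (f : Z) :
    p (B f) (B f) ≤ ‖B‖ * p (B f) f := by
  have hcs : ∀ (b : Z → Z → ℝ), (∀ f g h, b (f + g) h = b f h + b g h) →
      (∀ (c : ℝ) f h, b (c • f) h = c * b f h) → (∀ f g, b f g = b g f) → (∀ f, 0 ≤ b f f) →
      ∀ f g, b f g ^ 2 ≤ b f f * b g g := by
    intro b hadd hsm hsymm h0 f g
    have h : ∀ x : ℝ, 0 ≤ b g g * (x * x) + 2 * b f g * x + b f f := fun x => by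
      have := h0 (x • g + f)
      rw [hadd, hsm, hsymm _ (x • g + f), hsymm _ (x • g + f), hadd, hsm, hadd, hsm,
        hsymm g f] at this
      nlinarith
    have := discrim_le_zero h
    rw [discrim] at this
    nlinarith
  set c : ℕ → ℝ := fun n => p ((B ^ n) f) f with hc
  have hsh : ∀ j n, p ((B ^ (j + n)) f) f = p ((B ^ n) f) ((B ^ j) f) := by
    intro j
    induction j with
    | zero => intro n; simp
    | succ j ih =>
      intro n
      have := ih (n + 1)
      rw [show j + 1 + n = j + (n + 1) by ring, this, pow_succ' B n, pow_succ' B j,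
        mul_apply_eq_comp, mul_apply_eq_comp, hB]
  have hpow : ∀ n, B ((B ^ n) f) = (B ^ (n + 1)) f := fun n => by
    rw [pow_succ', mul_apply_eq_comp]
  have hnn : ∀ n, 0 ≤ c n := by
    intro n
    obtain ⟨j, rfl | rfl⟩ := Nat.even_or_odd' n
    · rw [hc]; dsimp only; rw [two_mul, hsh]; exact hp0 _
    · rw [hc]; dsimp only
      rw [show 2 * j + 1 = j + (j + 1) by ring, hsh, ← hpow]; exact hB0 _
  have hlog : ∀ n, c (n + 1) ^ 2 ≤ c n * c (n + 2) := by
    intro n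
    obtain ⟨j, rfl | rfl⟩ := Nat.even_or_odd' n
    · have := hcs (fun f g => p f g) (by simp) (by simp) hp hp0 ((B ^ j) f) ((B ^ (j + 1)) f)
      simp only [hc]
      rw [show 2 * j + 2 = (j + 1) + (j + 1) by ring, show 2 * j + 1 = (j + 1) + j by ring,
        show 2 * j = j + j by ring, hsh, hsh, hsh]
      exact this
    · have := hcs (fun f g => p (B f) g) (by simp) (by simp) (fun f g => by rw [hB, hp]) hB0
        ((B ^ j) f) ((B ^ (j + 1)) f)
      simp only [hpow] at this
      simp only [hc]
      rw [show 2 * j + 1 + 2 = (j + 1) + (j + 2) by ring,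
        show 2 * j + 1 + 1 = (j + 1) + (j + 1) by ring,
        show 2 * j + 1 = j + (j + 1) by ring, hsh, hsh, hsh]
      exact this
  have h2 : p (B f) (B f) = c 2 := by
    simp only [hc]; rw [show 2 = 1 + 1 by rfl, hsh]; simp
  have h1 : p (B f) f = c 1 := by simp [hc]
  rw [h1, h2]
  rcases (hnn 1).eq_or_lt with h0 | hpos
  · have := hlog 1
    have h3 := hlog 1
    rw [← h0] at h3 ⊢
    have : c 2 = 0 := by
      have : c (1 + 1) ^ 2 ≤ 0 := by simpa using h3
      exact pow_eq_zero_iff (two_ne_zero) |>.1 (le_antisymm this (sq_nonneg _))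
    rw [this]; simp
  set ρ := c 2 / c 1 with hρ
  have hρ0 : 0 ≤ ρ := div_nonneg (hnn 2) hpos.le
  rcases hρ0.eq_or_lt with h0 | hρpos
  · have : c 2 = 0 := by
      rw [hρ, eq_comm, div_eq_zero_iff] at h0
      exact h0.resolve_right hpos.ne'
    rw [this]; exact mul_nonneg (norm_nonneg _) hpos.le
  have hstep : ∀ n, 0 < c (n + 1) ∧ ρ * c (n + 1) ≤ c (n + 2) := by
    intro n
    induction n with
    | zero => exact ⟨hpos, by rw [hρ]; field_simp; rfl⟩
    | succ n ih =>
      have hp2 : 0 < c (n + 1 + 1) := lt_of_lt_of_le (mul_pos hρpos ih.1) ih.2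
      refine ⟨hp2, ?_⟩
      have := hlog (n + 1)
      have h3 : ρ * c (n + 1) * c (n + 1 + 1) ≤ c (n + 1) * c (n + 1 + 2) :=
        (mul_mono_right ih.2 hp2.le).trans (by rw [← sq]; exact this)
      have h4 : c (n + 1) * (ρ * c (n + 1 + 1)) ≤ c (n + 1) * c (n + 1 + 2) := by linarith
      exact le_of_mul_le_mul_left h4 ih.1
  have hgrow : ∀ n, ρ ^ n * c 1 ≤ c (n + 1) := by
    intro n
    induction n with
    | zero => simp
    | succ n ih =>
      rw [pow_succ', mul_assoc]
      exact (mul_mono_left ih hρ0).trans (hstep n).2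
  have hup : ∀ n, c n ≤ ‖p‖ * ‖f‖ ^ 2 * ‖B‖ ^ n := by
    intro n
    calc c n ≤ ‖p ((B ^ n) f) f‖ := le_abs_self _
      _ ≤ ‖p‖ * ‖(B ^ n) f‖ * ‖f‖ := p.le_opNorm₂ _ _
      _ ≤ ‖p‖ * (‖B‖ ^ n * ‖f‖) * ‖f‖ := by
          gcongr
          have h5 : ‖(B ^ n) f‖ ≤ ‖B‖ ^ n * ‖f‖ := by
            induction n with
            | zero => simp
            | succ n ih =>
              rw [← hpow, pow_succ', mul_assoc]
              exact (B.le_opNorm _).trans (by gcongr)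
          exact h5
      _ = _ := by ring
  have hle : ρ ≤ ‖B‖ := by
    by_contra hlt
    rw [not_le] at hlt
    have hB1 : 0 < ‖B‖ := by
      rcases (norm_nonneg B).eq_or_lt with h | h
      · have := hup 1
        rw [← h] at this
        simp only [pow_one, mul_zero] at this
        linarith
      · exact h
    have ht := tendsto_pow_atTop_atTop_of_one_lt ((one_lt_div hB1).2 hlt)
    obtain ⟨n, hn⟩ := (ht.eventually_gt_atTop (‖p‖ * ‖f‖ ^ 2 * ‖B‖ / c 1)).exists
    have h6 := (hgrow n).trans (hup (n + 1))
    rw [div_pow, div_lt_div_iff₀ hpos (by positivity)] at hn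
    rw [pow_succ ‖B‖ n] at h6
    nlinarith
  calc c 2 = ρ * c 1 := by rw [hρ]; field_simp
    _ ≤ _ := by gcongr

variable {V : Plane → ℝ} {d : ℝ} {I : Set ℝ} {F : ℝ → ℝ → Plane} {l : ℝ} {Z : ℝ → ℝ → Plane}
  {R : ℝ → ℝ} {T Y C ε b r₀ : ℝ}

/-! ### The potential -/

notation:max "∇²" f:max => fderiv ℝ (gradient f)

/-- The vacuum `(1, 0)`. -/
def vacuum : Plane := !₂[1, 0]

@[simp] theorem vacuum_zero : vacuum 0 = 1 := rfl
@[simp] theorem vacuum_one : vacuum 1 = 0 := rfl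

theorem norm_sq_eq_coords (Ψ : Plane) : ‖Ψ‖ ^ 2 = Ψ 0 ^ 2 + Ψ 1 ^ 2 := by
  rw [EuclideanSpace.norm_sq_eq]; simp

theorem inner_eq_coords (Ψ X : Plane) : ⟪Ψ, X⟫ = Ψ 0 * X 0 + Ψ 1 * X 1 := by
  rw [PiLp.inner_apply]; simp [mul_comm]

@[simp] theorem norm_vacuum : ‖vacuum‖ = 1 := by
  have := norm_sq_eq_coords vacuum
  simp only [vacuum_zero, vacuum_one] at this
  nlinarith [norm_nonneg vacuum]

theorem norm_coordProj_apply_le (i : Fin 2) (Ψ : Plane) : ‖coordProj i Ψ‖ ≤ ‖Ψ‖ := by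
  have h1 := norm_sq_eq_coords Ψ
  have h2 := norm_sq_eq_coords (coordProj i Ψ)
  refine (sq_le_sq₀ (norm_nonneg _) (norm_nonneg _)).1 ?_
  rw [h1, h2]
  fin_cases i <;> simp <;> positivity

theorem norm_coordProj_le (i : Fin 2) : ‖coordProj i‖ ≤ 1 :=
  (coordProj i).opNorm_le_bound zero_le_one fun Ψ => by
    simpa using norm_coordProj_apply_le i Ψ

/-- The reflection `(φ, σ) ↦ (-φ, σ)`. -/
def flipφ : PlaneEnd := coordProj 1 - coordProj 0

/-- The reflection `(φ, σ) ↦ (φ, -σ)`. -/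
def flipσ : PlaneEnd := coordProj 0 - coordProj 1

@[simp] theorem flipφ_zero (Ψ : Plane) : flipφ Ψ 0 = -Ψ 0 := by simp [flipφ]
@[simp] theorem flipφ_one (Ψ : Plane) : flipφ Ψ 1 = Ψ 1 := by simp [flipφ]
@[simp] theorem flipσ_zero (Ψ : Plane) : flipσ Ψ 0 = Ψ 0 := by simp [flipσ]
@[simp] theorem flipσ_one (Ψ : Plane) : flipσ Ψ 1 = -Ψ 1 := by simp [flipσ]

theorem plane_ext {Ψ X : Plane} (h0 : Ψ 0 = X 0) (h1 : Ψ 1 = X 1) : Ψ = X := by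
  ext i; fin_cases i
  · exact h0
  · exact h1

/-- The two coordinate reflections. -/
structure IsFlip (L : PlaneEnd) : Prop where
  inner_left : ∀ Ψ X : Plane, ⟪L Ψ, X⟫ = ⟪Ψ, L X⟫
  involutive : ∀ Ψ : Plane, L (L Ψ) = Ψ
  comm : ∀ Ψ : Plane, coordProj 1 (L Ψ) = L (coordProj 1 Ψ)
  abs : ∀ (Ψ : Plane) (i : Fin 2), |L Ψ i| = |Ψ i|

theorem isFlip_flipφ : IsFlip flipφ where
  inner_left Ψ X := by simp [inner_eq_coords]
  involutive Ψ := plane_ext (by simp) (by simp)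
  comm Ψ := plane_ext (by simp) (by simp)
  abs Ψ i := by fin_cases i <;> simp

theorem isFlip_flipσ : IsFlip flipσ where
  inner_left Ψ X := by simp [inner_eq_coords]
  involutive Ψ := plane_ext (by simp) (by simp)
  comm Ψ := plane_ext (by simp) (by simp)
  abs Ψ i := by fin_cases i <;> simp

theorem IsFlip.norm_map {L : PlaneEnd} (hL : IsFlip L) (Ψ : Plane) : ‖L Ψ‖ = ‖Ψ‖ := by
  have : ‖L Ψ‖ ^ 2 = ‖Ψ‖ ^ 2 := by
    rw [← real_inner_self_eq_norm_sq, ← real_inner_self_eq_norm_sq, hL.inner_left, hL.involutive]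
  exact (pow_left_inj₀ (norm_nonneg _) (norm_nonneg _) two_ne_zero).1 this

theorem IsPotential.flip (hV : IsPotential V) {L : PlaneEnd} (hL : IsFlip L) (Ψ : Plane) :
    V (L Ψ) = V Ψ := by
  rw [hV.symm, hL.abs, hL.abs, ← hV.symm]

theorem IsPotential.nonneg (hV : IsPotential V) (Ψ : Plane) : 0 ≤ V Ψ := by
  by_cases h1 : Ψ = !₂[1, 0]
  · rw [h1, hV.well_pos]
  · by_cases h2 : Ψ = !₂[-1, 0]
    · rw [h2, hV.well_neg]
    · exact (hV.pos Ψ h1 h2).le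

theorem IsPotential.differentiable (hV : IsPotential V) : Differentiable ℝ V :=
  hV.smooth.differentiable (by norm_num)

theorem IsPotential.contDiff_gradient (hV : IsPotential V) : ContDiff ℝ 2 (gradient V) := by
  have h : ContDiff ℝ 2 (fderiv ℝ V) := hV.smooth.fderiv_right (by norm_num)
  exact (InnerProductSpace.toDual ℝ Plane).symm.toContinuousLinearEquiv.contDiff.comp h

theorem IsPotential.inner_gradient (_hV : IsPotential V) (Ψ X : Plane) :
    ⟪gradient V Ψ, X⟫ = fderiv ℝ V Ψ X := by
  rw [gradient, InnerProductSpace.toDual_symm_apply]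

theorem IsPotential.hasFDerivAt_gradient (hV : IsPotential V) (Ψ : Plane) :
    HasFDerivAt (gradient V) (∇²V Ψ) Ψ :=
  (hV.contDiff_gradient.differentiable (by norm_num) Ψ).hasFDerivAt

theorem IsPotential.contDiff_hess (hV : IsPotential V) : ContDiff ℝ 1 (∇²V) :=
  hV.contDiff_gradient.fderiv_right (by norm_num)

theorem IsPotential.inner_hess (hV : IsPotential V) (Ψ X Z : Plane) :
    ⟪∇²V Ψ X, Z⟫ = fderiv ℝ (fderiv ℝ V) Ψ X Z := by
  have h : HasFDerivAt (fderiv ℝ V) (fderiv ℝ (fderiv ℝ V) Ψ) Ψ :=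
    (((hV.smooth.fderiv_right (m := 2) (by norm_num)).differentiable (by norm_num)) Ψ).hasFDerivAt
  have h2 := (hV.hasFDerivAt_gradient Ψ).inner ℝ (hasFDerivAt_const Z Ψ)
  have h3 : HasFDerivAt (fun Ψ => fderiv ℝ V Ψ Z)
      ((ContinuousLinearMap.apply ℝ ℝ Z).comp (fderiv ℝ (fderiv ℝ V) Ψ)) Ψ :=
    (ContinuousLinearMap.apply ℝ ℝ Z).hasFDerivAt.comp Ψ h
  have h4 : (fun Ψ => fderiv ℝ V Ψ Z) = fun Ψ => ⟪gradient V Ψ, Z⟫ := by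
    ext1 Ψ; rw [hV.inner_gradient]
  rw [h4] at h3
  have := congrArg (fun T : Plane →L[ℝ] ℝ => T X) (h2.unique h3)
  simpa using this

theorem IsPotential.hess_symm (hV : IsPotential V) (Ψ X Z : Plane) :
    ⟪∇²V Ψ X, Z⟫ = ⟪X, ∇²V Ψ Z⟫ := by
  rw [real_inner_comm _ X, hV.inner_hess, hV.inner_hess]
  have : IsSymmSndFDerivAt ℝ V Ψ := hV.smooth.contDiffAt.isSymmSndFDerivAt (by simp; norm_num)
  exact this X Z

theorem IsPotential.gradient_flip (hV : IsPotential V) {L : PlaneEnd} (hL : IsFlip L) (Ψ : Plane) :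
    gradient V (L Ψ) = L (gradient V Ψ) := by
  have h1 : HasFDerivAt (fun Ψ => V (L Ψ)) ((fderiv ℝ V (L Ψ)).comp L) Ψ :=
    (hV.differentiable (L Ψ)).hasFDerivAt.comp Ψ L.hasFDerivAt
  simp only [hV.flip hL] at h1
  have h2 := h1.fderiv
  refine ext_inner_right ℝ fun X => ?_
  rw [hL.inner_left, hV.inner_gradient, hV.inner_gradient, h2, ContinuousLinearMap.comp_apply,
    hL.involutive]

theorem IsPotential.hess_flip (hV : IsPotential V) {L : PlaneEnd} (hL : IsFlip L) (Ψ X : Plane) :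
    ∇²V (L Ψ) (L X) = L (∇²V Ψ X) := by
  have h1 : HasFDerivAt (fun Ψ => gradient V (L Ψ)) ((∇²V (L Ψ)).comp L) Ψ :=
    (hV.hasFDerivAt_gradient (L Ψ)).comp Ψ L.hasFDerivAt
  simp only [hV.gradient_flip hL] at h1
  have h2 := L.hasFDerivAt.comp Ψ (hV.hasFDerivAt_gradient Ψ)
  have := congrArg (fun T : PlaneEnd => T X) (h1.unique h2)
  simpa using this

theorem force_eq (hV : IsPotential V) (Ψ : Plane) (r : ℝ) :
    force V d Ψ r = gradient V Ψ + (d ^ 2 / r ^ 2) • coordProj 1 Ψ := by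
  have hp : HasFDerivAt (fun X : Plane => X 1) (EuclideanSpace.proj 1 : Plane →L[ℝ] ℝ) Ψ :=
    (EuclideanSpace.proj 1 : Plane →L[ℝ] ℝ).hasFDerivAt
  have h := (hV.differentiable Ψ).hasFDerivAt.add ((hp.pow 2).const_mul (1 / 2 * (d ^ 2 / r ^ 2)))
  have h' : fderiv ℝ (fun X : Plane => shiftedPotential V d X r) Ψ = _ := h.fderiv
  refine ext_inner_right ℝ fun X => ?_
  rw [force, gradient, InnerProductSpace.toDual_symm_apply, h', inner_add_left, hV.inner_gradient]
  simp [inner_eq_coords]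
  ring

theorem hasFDerivAt_force (hV : IsPotential V) (Ψ : Plane) (r : ℝ) :
    HasFDerivAt (fun X => force V d X r) (∇²V Ψ + (d ^ 2 / r ^ 2) • coordProj 1) Ψ := by
  simp only [force_eq hV]
  exact (hV.hasFDerivAt_gradient Ψ).add ((coordProj 1).hasFDerivAt.const_smul (d ^ 2 / r ^ 2) :
      HasFDerivAt (fun X => (d ^ 2 / r ^ 2) • coordProj 1 X) _ Ψ)

theorem hessW_eq (hV : IsPotential V) (Ψ : Plane) (r : ℝ) :
    hessW V d Ψ r = ∇²V Ψ + (d ^ 2 / r ^ 2) • coordProj 1 :=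
  (hasFDerivAt_force hV Ψ r).fderiv

theorem hessW_symm (hV : IsPotential V) (Ψ X Z : Plane) (r : ℝ) :
    ⟪hessW V d Ψ r X, Z⟫ = ⟪X, hessW V d Ψ r Z⟫ := by
  simp only [hessW_eq hV, FunLike.coe_add, Pi.add_apply, FunLike.coe_smul,
    Pi.smul_apply, inner_add_left, inner_add_right, hV.hess_symm]
  simp [inner_eq_coords]; ring

theorem force_flip (hV : IsPotential V) {L : PlaneEnd} (hL : IsFlip L) (Ψ : Plane) (r : ℝ) :
    force V d (L Ψ) r = L (force V d Ψ r) := by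
  rw [force_eq hV, force_eq hV, hV.gradient_flip hL, hL.comm, map_add, map_smul]

theorem hessW_flip (hV : IsPotential V) {L : PlaneEnd} (hL : IsFlip L) (Ψ X : Plane) (r : ℝ) :
    hessW V d (L Ψ) r (L X) = L (hessW V d Ψ r X) := by
  simp [hessW_eq hV, hV.hess_flip hL, hL.comm]

theorem forceR_eq (hV : IsPotential V) (Ψ : Plane) (hr : r ≠ 0) :
    forceR V d Ψ r = -(2 * d ^ 2 / r ^ 3) • coordProj 1 Ψ := by
  have h : HasDerivAt (fun ρ : ℝ => d ^ 2 / ρ ^ 2) (-(2 * d ^ 2 / r ^ 3)) r := by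
    have := (hasDerivAt_const r (d ^ 2)).div (hasDerivAt_pow 2 r) (pow_ne_zero 2 hr)
    refine this.congr_deriv ?_
    field_simp; ring
  rw [forceR]
  simp only [force_eq hV]
  exact ((h.smul_const (coordProj 1 Ψ)).const_add _).deriv

theorem gradient_vacuum (hV : IsPotential V) : gradient V vacuum = 0 := by
  have h : IsLocalMin V vacuum := .of_forall fun Ψ => by
    rw [vacuum, hV.well_pos]; exact hV.nonneg Ψ
  rw [gradient, h.fderiv_eq_zero, map_zero]

theorem coordProj_one_vacuum : coordProj 1 vacuum = 0 := plane_ext (by simp) (by simp)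

theorem force_vacuum (hV : IsPotential V) (r : ℝ) : force V d vacuum r = 0 := by
  rw [force_eq hV, gradient_vacuum hV, coordProj_one_vacuum]; simp

theorem hess_flip_vacuum (hV : IsPotential V) (r : ℝ) :
    hessW V d (flipφ vacuum) r = hessW V d vacuum r := by
  have h1 : ∀ X, flipσ (hessW V d vacuum r X) = hessW V d vacuum r (flipσ X) := fun X => by
    rw [← hessW_flip hV isFlip_flipσ]; congr 2
    exact plane_ext (by simp) (by simp)
  ext1 X
  have h2 := hessW_flip (d := d) hV isFlip_flipφ vacuum (flipφ X) r
  rw [isFlip_flipφ.involutive] at h2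
  have h3 : ∀ Z : Plane, flipφ Z = -flipσ Z := fun Z => plane_ext (by simp) (by simp)
  rw [h2, h3, h3, map_neg, ← h1, map_neg, neg_neg, isFlip_flipσ.involutive]

/-- The Hessian at the vacua is diagonal, with eigenvalues bounded below. -/
theorem exists_hess_vacuum (hV : IsPotential V) (hl : 0 < l)
    (hwell : ∀ ψ : Plane, l * ‖ψ‖ ^ 2 ≤ ⟪ψ, ∇²V vacuum ψ⟫) (r : ℝ) :
    ∃ k₀ k₁ : ℝ, √l ≤ k₀ ∧ √l ≤ k₁ ∧
      hessW V d vacuum r = k₀ ^ 2 • coordProj 0 + k₁ ^ 2 • coordProj 1 := by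
  set H := hessW V d vacuum r with hH
  have h1 : ∀ X, flipσ (H X) = H (flipσ X) := fun X => by
    rw [hH, ← hessW_flip hV isFlip_flipσ]; congr 2
    exact plane_ext (by simp) (by simp)
  have hlow : ∀ ψ : Plane, l * ‖ψ‖ ^ 2 ≤ ⟪ψ, H ψ⟫ := fun ψ => by
    rw [hH, hessW_eq hV]
    simp only [FunLike.coe_add, Pi.add_apply, FunLike.coe_smul, Pi.smul_apply, inner_add_right]
    have : 0 ≤ ⟪ψ, (d ^ 2 / r ^ 2) • coordProj 1 ψ⟫ := by
      simp only [inner_eq_coords, PiLp.smul_apply, coordProj_apply, smul_eq_mul]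
      simp only [zero_ne_one, if_false, if_true, mul_zero, zero_add]
      have : ψ 1 * (d ^ 2 / r ^ 2 * ψ 1) = d ^ 2 / r ^ 2 * ψ 1 ^ 2 := by ring
      rw [this]; positivity
    linarith [hwell ψ]
  set E0 : Plane := EuclideanSpace.single 0 1 with hE0
  set E1 : Plane := EuclideanSpace.single 1 1 with hE1
  have f0 : flipσ E0 = E0 := plane_ext (by simp) (by simp [hE0])
  have f1 : flipσ E1 = -E1 := plane_ext (by simp [hE1]) (by simp)
  have h01 : H E0 1 = 0 := by
    have := congrArg (fun Z : Plane => Z 1) (h1 E0)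
    simp only [f0, flipσ_one] at this; linarith
  have h10 : H E1 0 = 0 := by
    have := congrArg (fun Z : Plane => Z 0) (h1 E1)
    simp only [f1, flipσ_zero, map_neg, PiLp.neg_apply] at this; linarith
  have hp0 : l ≤ H E0 0 := by
    have := hlow E0
    rw [inner_eq_coords, norm_sq_eq_coords] at this
    simpa [hE0] using this
  have hp1 : l ≤ H E1 1 := by
    have := hlow E1
    rw [inner_eq_coords, norm_sq_eq_coords] at this
    simpa [hE1] using this
  refine ⟨√(H E0 0), √(H E1 1), Real.sqrt_le_sqrt hp0, Real.sqrt_le_sqrt hp1, ?_⟩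
  rw [sq_sqrt (hl.le.trans hp0), sq_sqrt (hl.le.trans hp1)]
  ext1 ψ
  have hψ : ψ = ψ 0 • E0 + ψ 1 • E1 := plane_ext (by simp [hE0, hE1]) (by simp [hE0, hE1])
  have hHψ : H ψ = ψ 0 • H E0 + ψ 1 • H E1 := by
    conv_lhs => rw [hψ]
    rw [map_add, map_smul, map_smul]
  rw [hHψ]
  refine plane_ext ?_ ?_
  · simp [h10, mul_comm]
  · simp [h01, mul_comm]

/-- Uniform Taylor estimates on balls. -/
structure TaylorBound (V : Plane → ℝ) (ρ C : ℝ) : Prop where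
  nonneg : 0 ≤ C
  grad : ∀ Ψ : Plane, ‖Ψ‖ ≤ ρ → ‖gradient V Ψ‖ ≤ C
  hess : ∀ Ψ : Plane, ‖Ψ‖ ≤ ρ → ‖∇²V Ψ‖ ≤ C
  grad_lip : ∀ Ψ X : Plane, ‖Ψ‖ ≤ ρ → ‖X‖ ≤ ρ → ‖gradient V X - gradient V Ψ‖ ≤ C * ‖X - Ψ‖
  hess_lip : ∀ Ψ X : Plane, ‖Ψ‖ ≤ ρ → ‖X‖ ≤ ρ → ‖∇²V X - ∇²V Ψ‖ ≤ C * ‖X - Ψ‖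
  grad_taylor : ∀ Ψ X : Plane, ‖Ψ‖ ≤ ρ → ‖X‖ ≤ ρ →
    ‖gradient V X - gradient V Ψ - ∇²V Ψ (X - Ψ)‖ ≤ C * ‖X - Ψ‖ ^ 2
  taylor : ∀ Ψ X : Plane, ‖Ψ‖ ≤ ρ → ‖X‖ ≤ ρ → |V X - V Ψ - ⟪gradient V Ψ, X - Ψ⟫
      - 1 / 2 * ⟪X - Ψ, ∇²V Ψ (X - Ψ)⟫| ≤ C * ‖X - Ψ‖ ^ 3

theorem exists_taylorBound (hV : IsPotential V) (ρ : ℝ) : ∃ C, TaylorBound V ρ C := by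
  have hK : IsCompact (Metric.closedBall (0 : Plane) ρ) := isCompact_closedBall _ _
  have hconv : Convex ℝ (Metric.closedBall (0 : Plane) ρ) := convex_closedBall _ _
  obtain ⟨C1, h1⟩ := hK.exists_bound_of_continuousOn hV.contDiff_gradient.continuous.continuousOn
  obtain ⟨C2, h2⟩ := hK.exists_bound_of_continuousOn hV.contDiff_hess.continuous.continuousOn
  obtain ⟨C3, h3⟩ := hK.exists_bound_of_continuousOn
    (hV.contDiff_hess.continuous_fderiv (by norm_num)).continuousOn
  simp only [mem_closedBall_zero_iff] at h1 h2 h3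
  set C := max 0 (max C1 (max C2 C3)) with hC
  have hC0 : 0 ≤ C := le_max_left _ _
  have hCC1 : C1 ≤ C := by simp [hC]
  have hCC2 : C2 ≤ C := by simp [hC]
  have hCC3 : C3 ≤ C := by simp [hC]
  have hlip : ∀ Ψ X : Plane, ‖Ψ‖ ≤ ρ → ‖X‖ ≤ ρ → ‖∇²V X - ∇²V Ψ‖ ≤ C * ‖X - Ψ‖ := fun Ψ X hΨ hX =>
    hconv.norm_image_sub_le_of_norm_hasFDerivWithin_le (f' := fun Z => fderiv ℝ (∇²V) Z)
      (fun Z _ => ((hV.contDiff_hess.differentiable (by norm_num)) Z).hasFDerivAt.hasFDerivWithinAt)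
      (fun Z hZ => (h3 Z (by simpa using hZ)).trans hCC3) (by simpa using hΨ) (by simpa using hX)
  have hgt : ∀ Ψ X : Plane, ‖Ψ‖ ≤ ρ → ‖X‖ ≤ ρ →
      ‖gradient V X - gradient V Ψ - ∇²V Ψ (X - Ψ)‖ ≤ C * ‖X - Ψ‖ ^ 2 := by
    intro Ψ X hΨ hX
    have hseg : segment ℝ Ψ X ⊆ Metric.closedBall (0 : Plane) ρ :=
      hconv.segment_subset (by simpa using hΨ) (by simpa using hX)
    have := (convex_segment Ψ X).norm_image_sub_le_of_norm_hasFDerivWithin_le'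
      (φ := ∇²V Ψ) (C := C * ‖X - Ψ‖)
      (fun Z _ => (hV.hasFDerivAt_gradient Z).hasFDerivWithinAt)
      (fun Z hZ => (hlip Ψ Z hΨ (by simpa using hseg hZ)).trans (by
        have : ‖Z - Ψ‖ ≤ ‖X - Ψ‖ := by
          obtain ⟨θ, hθ, rfl⟩ := (segment_eq_image_lineMap ℝ Ψ X ▸ hZ)
          rw [AffineMap.lineMap_apply, vsub_eq_sub, vadd_eq_add, add_sub_cancel_right, norm_smul,
            norm_eq_abs, abs_of_nonneg hθ.1]
          exact mul_le_of_le_one_left (norm_nonneg _) hθ.2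
        gcongr)) (left_mem_segment ℝ Ψ X) (right_mem_segment ℝ Ψ X)
    rwa [mul_assoc, ← sq] at this
  refine ⟨C, hC0, fun Ψ h => (h1 Ψ h).trans hCC1, fun Ψ h => (h2 Ψ h).trans hCC2,
    fun Ψ X hΨ hX => ?_, hlip, hgt, fun Ψ X hΨ hX => ?_⟩
  · exact hconv.norm_image_sub_le_of_norm_hasFDerivWithin_le
      (fun Z _ => (hV.hasFDerivAt_gradient Z).hasFDerivWithinAt)
      (fun Z hZ => (h2 Z (by simpa using hZ)).trans hCC2) (by simpa using hΨ) (by simpa using hX)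
  · set h := X - Ψ with hh
    set H := ∇²V Ψ
    let g : ℝ → ℝ := fun t => V (Ψ + t • h) - t * ⟪gradient V Ψ, h⟫ - t ^ 2 * (1 / 2 * ⟪h, H h⟫)
    have hb : ∀ t ∈ Icc (0 : ℝ) 1, ‖Ψ + t • h‖ ≤ ρ := fun t ht => by
      have : Ψ + t • h ∈ Metric.closedBall (0 : Plane) ρ := by
        refine hconv.segment_subset (x := Ψ) (y := X) (by simpa using hΨ) (by simpa using hX) ?_
        rw [segment_eq_image']; exact ⟨t, ht, rfl⟩
      simpa using this
    have hd : ∀ t ∈ Icc (0 : ℝ) 1, HasDerivWithinAt g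
        ⟪gradient V (Ψ + t • h) - gradient V Ψ - t • H h, h⟫ (Icc 0 1) t := by
      intro t _
      have hl : HasDerivAt (fun t : ℝ => Ψ + t • h) h t := by
        simpa using ((hasDerivAt_id t).smul_const h).const_add Ψ
      have e1 := (hV.differentiable (Ψ + t • h)).hasFDerivAt.comp_hasDerivAt t hl
      have e2 := (hasDerivAt_id t).mul_const ⟪gradient V Ψ, h⟫
      have e3 := (hasDerivAt_pow 2 t).mul_const (1 / 2 * ⟪h, H h⟫)
      refine (((e1.sub e2).sub e3).congr_deriv ?_).hasDerivWithinAt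
      have e4 : ∀ A B Z : Plane, ⟪A - B - t • Z, h⟫ =
          ⟪A, h⟫ - ⟪B, h⟫ - t * ⟪Z, h⟫ := fun A B Z => by
        rw [inner_sub_left, inner_sub_left, real_inner_smul_left]
      rw [← hV.inner_gradient, e4, real_inner_comm h (H h), one_mul]
      push_cast
      ring
    have := (convex_Icc (0 : ℝ) 1).norm_image_sub_le_of_norm_hasDerivWithin_le hd
      (C := C * ‖h‖ ^ 3) (fun t ht => by
        have e := hgt Ψ (Ψ + t • h) hΨ (hb t ht)
        rw [add_sub_cancel_left, map_smul] at e
        calc _ ≤ _ := norm_inner_le_norm _ _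
          _ ≤ C * ‖t • h‖ ^ 2 * ‖h‖ := by gcongr
          _ ≤ C * ‖h‖ ^ 2 * ‖h‖ := by
            have : ‖t • h‖ ≤ ‖h‖ := by
              rw [norm_smul, norm_eq_abs, abs_of_nonneg ht.1]
              exact mul_le_of_le_one_left (norm_nonneg _) ht.2
            gcongr
          _ = _ := by ring) (left_mem_Icc.2 zero_le_one) (right_mem_Icc.2 zero_le_one)
    simp only [g, one_smul, zero_smul, add_zero, sub_zero, norm_one, mul_one, one_mul, one_pow,
      zero_mul, norm_eq_abs] at this
    rw [show Ψ + h = X by rw [hh]; abel] at this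
    convert this using 2
    ring

/-- The force is coercive near the vacuum, uniformly in the radius. -/
theorem exists_coercive_vacuum (hV : IsPotential V) (hl : 0 < l)
    (hwell : ∀ ψ : Plane, l * ‖ψ‖ ^ 2 ≤ ⟪ψ, ∇²V vacuum ψ⟫) :
    ∃ ρ : ℝ, 0 < ρ ∧ ρ ≤ 1 ∧ ∀ (Ψ : Plane) (r : ℝ), ‖Ψ - vacuum‖ ≤ ρ →
      l / 2 * ‖Ψ - vacuum‖ ^ 2 ≤ ⟪Ψ - vacuum, force V d Ψ r⟫ := by
  obtain ⟨C, hC⟩ := exists_taylorBound hV 2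
  have hC0 := hC.nonneg
  refine ⟨min 1 (l / (2 * (C + 1))), by positivity, min_le_left _ _, fun Ψ r hΨ => ?_⟩
  have h1 : ‖Ψ - vacuum‖ ≤ 1 := hΨ.trans (min_le_left _ _)
  have h2 : ‖Ψ - vacuum‖ ≤ l / (2 * (C + 1)) := hΨ.trans (min_le_right _ _)
  have hΨ2 : ‖Ψ‖ ≤ 2 := by
    have := norm_add_le (Ψ - vacuum) vacuum
    rw [sub_add_cancel, norm_vacuum] at this; linarith
  have ht := hC.grad_taylor vacuum Ψ (by simp) hΨ2
  rw [gradient_vacuum hV, sub_zero] at ht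
  set h := Ψ - vacuum with hh
  have hσ : 0 ≤ ⟪h, (d ^ 2 / r ^ 2) • coordProj 1 Ψ⟫ := by
    have : ⟪h, (d ^ 2 / r ^ 2) • coordProj 1 Ψ⟫ = d ^ 2 / r ^ 2 * Ψ 1 ^ 2 := by
      simp [inner_eq_coords, hh]; ring
    rw [this]; positivity
  have hg : ⟪h, ∇²V vacuum h⟫ - C * ‖h‖ ^ 3 ≤ ⟪h, gradient V Ψ⟫ := by
    have e : ⟪h, gradient V Ψ⟫ = ⟪h, ∇²V vacuum h⟫ + ⟪h, gradient V Ψ - ∇²V vacuum h⟫ := by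
      rw [inner_sub_right]; ring
    have e2 := (abs_le.1 (abs_real_inner_le_norm h (gradient V Ψ - ∇²V vacuum h))).1
    have e3 := mul_mono_left ht (norm_nonneg h)
    rw [e]; nlinarith
  have h4 : C * ‖h‖ ≤ l / 2 := by
    rw [le_div_iff₀ (by positivity)] at h2
    nlinarith [norm_nonneg h]
  have h5 : C * ‖h‖ ^ 3 ≤ l / 2 * ‖h‖ ^ 2 := by
    have := mul_mono_right h4 (sq_nonneg ‖h‖)
    nlinarith
  rw [force_eq hV, inner_add_right]
  linarith [hwell h]

/-- Away from the vacuum, in the half plane `φ ≥ 0`, the potential is bounded below. -/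
theorem exists_pos_le_potential (hV : IsPotential V) {ρ : ℝ} (hρ : 0 < ρ) :
    ∃ v : ℝ, 0 < v ∧ ∀ Ψ : Plane, ‖Ψ‖ ≤ 2 → 0 ≤ Ψ 0 → ρ ≤ ‖Ψ - vacuum‖ → v ≤ V Ψ := by
  set K : Set Plane := Metric.closedBall 0 2 ∩ ({Ψ | 0 ≤ Ψ 0} ∩ {Ψ | ρ ≤ ‖Ψ - vacuum‖})
  have hK : IsCompact K := by
    refine (isCompact_closedBall _ _).inter_right (IsClosed.inter ?_ ?_)
    · exact isClosed_le continuous_const (EuclideanSpace.proj 0 : Plane →L[ℝ] ℝ).continuous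
    · exact isClosed_le continuous_const (by fun_prop)
  rcases K.eq_empty_or_nonempty with h | h
  · refine ⟨1, one_pos, fun Ψ h1 h2 h3 => ?_⟩
    have : Ψ ∈ K := ⟨by simpa using h1, h2, h3⟩
    rw [h] at this; exact absurd this (notMem_empty _)
  · obtain ⟨Ψ₀, h0, hmin⟩ := hK.exists_isMinOn h hV.differentiable.continuous.continuousOn
    refine ⟨V Ψ₀, hV.pos Ψ₀ ?_ ?_, fun Ψ h1 h2 h3 => hmin ⟨by simpa using h1, h2, h3⟩⟩
    · rintro rfl
      have : ρ ≤ ‖(!₂[1, 0] : Plane) - vacuum‖ := h0.2.2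
      rw [vacuum, sub_self, norm_zero] at this; linarith
    · rintro rfl
      have : (0 : ℝ) ≤ (!₂[-1, 0] : Plane) 0 := h0.2.1
      simp at this; linarith

/-! ### Calculus lemmas -/

theorem norm_sub_sub_deriv_le {u u1 u2 : ℝ → E} (h1 : ∀ x, HasDerivAt u (u1 x) x) (h2 : ∀ x, HasDerivAt u1 (u2 x) x)
    {x B : ℝ} (hB : ∀ y ∈ Icc x (x + 1), ‖u2 y‖ ≤ B) : ‖u (x + 1) - u x - u1 x‖ ≤ B := by
  have hx : x ∈ Icc x (x + 1) := ⟨le_rfl, by linarith⟩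
  have hx1 : x + 1 ∈ Icc x (x + 1) := ⟨by linarith, le_rfl⟩
  have hB0 : 0 ≤ B := (norm_nonneg _).trans (hB x hx)
  have e1 : ∀ y ∈ Icc x (x + 1), ‖u1 y - u1 x‖ ≤ B := fun y hy => by
    have := (convex_Icc x (x + 1)).norm_image_sub_le_of_norm_hasDerivWithin_le
      (fun z _ => (h2 z).hasDerivWithinAt) hB hx hy
    refine this.trans (mul_le_of_le_one_right hB0 ?_)
    rw [norm_eq_abs, abs_of_nonneg (sub_nonneg.2 hy.1)]; linarith [hy.2]
  have := (convex_Icc x (x + 1)).norm_image_sub_le_of_norm_hasDerivWithin_le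
    (f := fun y => u y - y • u1 x) (f' := fun y => u1 y - u1 x)
    (fun z _ => by
      exact (((h1 z).sub ((hasDerivAt_id z).smul_const (u1 x))).congr_deriv
        (by simp)).hasDerivWithinAt) e1 hx hx1
  simp only [add_sub_cancel_left, norm_one, mul_one] at this
  convert this using 2
  module

/-- If `u → e` at infinity and `u'' → c` then `c = 0`. -/
theorem eq_zero_of_tendsto_deriv2 {u u1 u2 : ℝ → ℝ} {e c : ℝ} (h1 : ∀ x, HasDerivAt u (u1 x) x)
    (h2 : ∀ x, HasDerivAt u1 (u2 x) x) (hu : Tendsto u atTop (𝓝 e))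
    (hu2 : Tendsto u2 atTop (𝓝 c)) : c = 0 := by
  have key : ∀ x, ∃ z, x < z ∧ u (x + 2) - 2 * u (x + 1) + u x = u2 z := by
    intro x
    obtain ⟨y, hy, hy'⟩ := exists_hasDerivAt_eq_slope (fun x => u (x + 1) - u x)
      (fun x => u1 (x + 1) - u1 x) (show x < x + 1 by linarith)
      (fun y _ => (((h1 (y + 1)).comp_add_const y 1).sub (h1 y)).continuousAt.continuousWithinAt)
      (fun y _ => ((h1 (y + 1)).comp_add_const y 1).sub (h1 y))
    obtain ⟨z, hz, hz'⟩ := exists_hasDerivAt_eq_slope u1 u2 (show y < y + 1 by linarith)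
      (fun y _ => (h2 y).continuousAt.continuousWithinAt) (fun y _ => h2 y)
    refine ⟨z, hy.1.trans hz.1, ?_⟩
    rw [hz', add_sub_cancel_left, div_one, hy', add_sub_cancel_left, div_one,
      show x + 1 + 1 = x + 2 by ring]
    ring
  choose z hz hz' using key
  have hzt : Tendsto z atTop atTop := tendsto_atTop_mono (fun x => (hz x).le) tendsto_id
  have e1 : Tendsto (fun x => u (x + 2) - 2 * u (x + 1) + u x) atTop (𝓝 (e - 2 * e + e)) :=
    ((hu.comp (tendsto_atTop_add_const_right _ 2 tendsto_id)).sub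
      ((hu.comp (tendsto_atTop_add_const_right _ 1 tendsto_id)).const_mul 2)).add hu
  have e2 : Tendsto (fun x => u (x + 2) - 2 * u (x + 1) + u x) atTop (𝓝 c) :=
    (hu2.comp hzt).congr fun x => (hz' x).symm
  have := tendsto_nhds_unique e1 e2
  linarith

/-! ### Regularity of a single profile -/

theorem abs_coord_le_norm (i : Fin 2) (Ψ : Plane) : |Ψ i| ≤ ‖Ψ‖ := by
  simpa using PiLp.norm_apply_le (p := 2) Ψ i

theorem hasDerivAt_coord {u : ℝ → Plane} {u' : Plane} {x : ℝ} (h : HasDerivAt u u' x)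
    (i : Fin 2) : HasDerivAt (fun x => u x i) (u' i) x :=
  (EuclideanSpace.proj i : Plane →L[ℝ] ℝ).hasFDerivAt.comp_hasDerivAt x h

theorem hasDerivAt_of_absolutelyContinuous {F : ℝ → Plane}
    (hF : ∀ p q : ℝ, AbsolutelyContinuousOnInterval F p q) (hd : Continuous (deriv F)) (x : ℝ) :
    HasDerivAt F (deriv F x) x := by
  have hcoord : ∀ (i : Fin 2) (p q : ℝ), AbsolutelyContinuousOnInterval (fun x => F x i) p q := by
    intro i p q
    rw [absolutelyContinuousOnInterval_iff]
    intro ε hε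
    obtain ⟨δ, hδ, h⟩ := (absolutelyContinuousOnInterval_iff F p q).1 (hF p q) ε hε
    refine ⟨δ, hδ, fun E hE hE' => lt_of_le_of_lt (Finset.sum_le_sum fun j _ => ?_) (h E hE hE')⟩
    rw [dist_eq_norm, dist_eq_norm, norm_eq_abs]
    exact abs_coord_le_norm i (F (E.2 j).1 - F (E.2 j).2)
  have hdi : ∀ y, HasDerivAt (fun y => ∫ t in (0 : ℝ)..y, deriv F t) (deriv F y) y := fun y =>
    intervalIntegral.integral_hasDerivAt_right (hd.intervalIntegrable _ _)
      hd.aestronglyMeasurable.stronglyMeasurableAtFilter hd.continuousAt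
  have hdi' : ContDiff ℝ 1 (fun y => ∫ t in (0 : ℝ)..y, deriv F t) := by
    rw [contDiff_one_iff_deriv]
    refine ⟨fun y => (hdi y).differentiableAt, ?_⟩
    have : deriv (fun y => ∫ t in (0 : ℝ)..y, deriv F t) = deriv F := by
      ext1 y; exact (hdi y).deriv
    rwa [this]
  have hconst : ∀ n : ℝ, ∃ c, ∀ y ∈ uIcc (-n) n, F y - ∫ t in (0 : ℝ)..y, deriv F t = c := by
    intro n
    refine AbsolutelyContinuousOnInterval.const_of_ae_hasDerivAt_zero
      ((hF (-n) n).sub hdi'.contDiffOn.absolutelyContinuousOnInterval) ?_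
    filter_upwards [(hcoord 0 (-n) n).ae_differentiableAt, (hcoord 1 (-n) n).ae_differentiableAt]
      with y h0 h1 hy
    have hdF : DifferentiableAt ℝ F y := differentiableAt_euclidean.2 fun i => by
      fin_cases i
      · exact h0 hy
      · exact h1 hy
    have := hdF.hasDerivAt.sub (hdi y)
    rwa [sub_self] at this
  obtain ⟨c, hc⟩ := hconst (|x| + 1)
  have : F =ᶠ[𝓝 x] fun y => c + ∫ t in (0 : ℝ)..y, deriv F t := by
    have : Ioo (-(|x| + 1)) (|x| + 1) ∈ 𝓝 x :=
      Ioo_mem_nhds (by linarith [neg_abs_le x]) (by linarith [le_abs_self x])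
    filter_upwards [this] with y hy
    have := hc y (by
      rw [uIcc_of_le (by linarith [abs_nonneg x])]; exact Ioo_subset_Icc_self hy)
    rw [← this]; abel
  exact ((hdi x).const_add c).congr_of_eventuallyEq this

/-- If the tail of the potential energy is small then the profile stays near the vacuum. -/
theorem close_of_small_tail (hV : IsPotential V) {F S : ℝ → Plane} {L v ρ X : ℝ} (hL : 0 < L)
    (hv : ∀ Ψ : Plane, ‖Ψ‖ ≤ 2 → 0 ≤ Ψ 0 → ρ / 2 ≤ ‖Ψ - vacuum‖ → v ≤ V Ψ) (hρ : 0 < ρ)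
    (hF : ∀ x, HasDerivAt F (S x) x) (hS : ∀ x, ‖S x‖ ≤ L) (hF2 : ∀ x, ‖F x‖ ≤ 2)
    (hF0 : ∀ x, X ≤ x → 0 ≤ F x 0) (hint : IntegrableOn (fun x => V (F x)) (Ioi X))
    (htail : ∫ x in Ioi X, V (F x) < v * (ρ / (2 * L))) {x : ℝ} (hx : X ≤ x) :
    ‖F x - vacuum‖ < ρ := by
  by_contra hcon
  rw [not_lt] at hcon
  set τ := ρ / (2 * L) with hτ
  have hτ0 : 0 < τ := by positivity
  have hlow : ∀ s ∈ Ioc x (x + τ), v ≤ V (F s) := by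
    intro s hs
    refine hv _ (hF2 s) (hF0 s (hx.trans hs.1.le)) ?_
    have h1 : ‖F s - F x‖ ≤ L * ‖s - x‖ := convex_univ.norm_image_sub_le_of_norm_hasDerivWithin_le
        (fun z _ => (hF z).hasDerivWithinAt) (fun z _ => hS z) (mem_univ _) (mem_univ _)
    have h2 : ‖s - x‖ ≤ τ := by
      rw [norm_eq_abs, abs_of_pos (sub_pos.2 hs.1)]; linarith [hs.2]
    have h3 : L * τ = ρ / 2 := by rw [hτ]; field_simp
    have h4 : ‖F x - vacuum‖ ≤ ‖F s - F x‖ + ‖F s - vacuum‖ := by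
      have := norm_sub_le (F s - vacuum) (F s - F x)
      rw [show F s - vacuum - (F s - F x) = F x - vacuum by abel] at this; linarith
    nlinarith
  have h5 : ∫ _ in Ioc x (x + τ), v ≤ ∫ s in Ioc x (x + τ), V (F s) :=
    setIntegral_mono_on (by simp) (hint.mono_set fun s hs => lt_of_le_of_lt hx hs.1)
      measurableSet_Ioc hlow
  have h6 : ∫ s in Ioc x (x + τ), V (F s) ≤ ∫ s in Ioi X, V (F s) :=
    setIntegral_mono_set hint (.of_forall fun s => hV.nonneg _)
      (.of_forall fun s (hs : s ∈ Ioc x (x + τ)) => lt_of_le_of_lt hx hs.1)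
  rw [setIntegral_const] at h5
  simp only [Measure.real, Real.volume_Ioc, add_sub_cancel_left, ENNReal.toReal_ofReal hτ0.le,
    smul_eq_mul] at h5
  linarith

/-- The standing assumptions on a family of profiles. -/
structure ProfileFamily (V : Plane → ℝ) (d : ℝ) (I : Set ℝ) (F : ℝ → ℝ → Plane) (l : ℝ) : Prop where
  potential : IsPotential V
  isOpen : IsOpen I
  pos : ∀ r ∈ I, 0 < r
  profile : ∀ r ∈ I, IsProfile V d r (F r)
  nondeg : ∀ r ∈ I, Nondegenerate V d r (F r)
  cont : ContinuousOn (fun p : ℝ × ℝ => F p.1 p.2) (I ×ˢ univ)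
  l_pos : 0 < l
  well : ∀ ψ : Plane, l * ‖ψ‖ ^ 2 ≤ ⟪ψ, ∇²V vacuum ψ⟫

/-- The energy density of a profile. -/
def density (V : Plane → ℝ) (d r : ℝ) (F : ℝ → Plane) (x : ℝ) : ℝ :=
  1 / 2 * ‖deriv F x‖ ^ 2 + shiftedPotential V d (F x) r

namespace ProfileFamily

variable (h : ProfileFamily V d I F l)
include h

theorem norm_le (hr : r ∈ I) (x : ℝ) : ‖F r x‖ ≤ 2 := by
  have h0 := (h.profile r hr).abs_le x
  have h1 := abs_le_abs ((h.profile r hr).le_one x) (by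
    have := (h.profile r hr).nonneg x; linarith)
  have h2 := norm_sq_eq_coords (F r x)
  have h3 : F r x 0 ^ 2 ≤ 1 := by rw [← sq_abs]; nlinarith [abs_nonneg (F r x 0)]
  have h4 : F r x 1 ^ 2 ≤ 1 := by
    rw [abs_one] at h1; rw [← sq_abs]; nlinarith [abs_nonneg (F r x 1)]
  nlinarith [norm_nonneg (F r x)]

theorem flip (hr : r ∈ I) (x : ℝ) : F r (-x) = flipφ (F r x) :=
  plane_ext (by simp [(h.profile r hr).odd]) (by simp [(h.profile r hr).even])

theorem contDiff_deriv (hr : r ∈ I) : ContDiff ℝ 2 (deriv (F r)) ∧ MemLp (deriv (F r)) 2 volume ∧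
      ∀ x, linOp V d r (F r) (deriv (F r)) x = 0 :=
  (h.nondeg r hr (deriv (F r))).2 ⟨1, by simp⟩

theorem hasDerivAt (hr : r ∈ I) (x : ℝ) : HasDerivAt (F r) (deriv (F r) x) x :=
  hasDerivAt_of_absolutelyContinuous (h.profile r hr).admissible.ac
    (h.contDiff_deriv hr).1.continuous x

theorem continuous (hr : r ∈ I) : Continuous (F r) :=
  continuous_iff_continuousAt.2 fun x => (h.hasDerivAt hr x).continuousAt

theorem continuous_deriv (hr : r ∈ I) : Continuous (deriv (F r)) :=
  (h.contDiff_deriv hr).1.continuous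

theorem integrable_density (hr : r ∈ I) : Integrable (density V d r (F r)) := by
  have hV := h.potential
  have hc : Continuous (density V d r (F r)) := by
    unfold density shiftedPotential
    have := h.continuous hr
    have := h.continuous_deriv hr
    have := hV.differentiable.continuous
    fun_prop
  refine (lintegral_ofReal_ne_top_iff_integrable hc.aestronglyMeasurable
    (.of_forall fun x => ?_)).1 (h.profile r hr).admissible.finite.ne
  have := hV.nonneg (F r x)
  unfold density shiftedPotential
  simp only [Pi.zero_apply]
  positivity

theorem potential_le_density (x : ℝ) : V (F r x) ≤ density V d r (F r) x := by
  unfold density shiftedPotential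
  have : 0 ≤ 1 / 2 * ‖deriv (F r) x‖ ^ 2 + 1 / 2 * (d ^ 2 / r ^ 2) * F r x 1 ^ 2 := by positivity
  linarith

theorem density_nonneg (x : ℝ) : 0 ≤ density V d r (F r) x :=
  (h.potential.nonneg _).trans (h.potential_le_density x)

theorem integrable_potential (hr : r ∈ I) : Integrable (fun x => V (F r x)) := by
  refine (h.integrable_density hr).mono'
    (h.potential.differentiable.continuous.comp (h.continuous hr)).aestronglyMeasurable
    (.of_forall fun x => ?_)
  rw [norm_eq_abs, abs_of_nonneg (h.potential.nonneg _)]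
  exact h.potential_le_density x

theorem nonneg_of_nonneg (hr : r ∈ I) {x : ℝ} (hx : 0 ≤ x) : 0 ≤ F r x 0 := by
  by_contra hneg
  rw [not_le] at hneg
  have hP := h.profile r hr
  have hc : Continuous fun x => F r x 0 :=
    (EuclideanSpace.proj 0 : Plane →L[ℝ] ℝ).continuous.comp (h.continuous hr)
  obtain ⟨z, hz, hz'⟩ := ((hP.admissible.right.eventually (lt_mem_nhds zero_lt_one)).and
    (eventually_ge_atTop x)).exists
  obtain ⟨y, hy, hy'⟩ := intermediate_value_Icc hz' hc.continuousOn ⟨hneg.le, hz.le⟩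
  have h0 := (hP.zero_iff y).1 hy'
  have hx0 : x = 0 := le_antisymm (h0 ▸ hy.1) hx
  rw [hx0, hP.admissible.zero] at hneg
  exact lt_irrefl _ hneg

theorem hasDerivAt_force_comp (hr : r ∈ I) (x : ℝ) :
    HasDerivAt (fun x => force V d (F r x) r) (hessW V d (F r x) r (deriv (F r) x)) x := by
  rw [hessW_eq h.potential]
  exact (hasFDerivAt_force h.potential (F r x) r).comp_hasDerivAt x (h.hasDerivAt hr x)

omit h in
theorem norm_force_le {ρ : ℝ} (hV : IsPotential V) (hC : TaylorBound V 2 C) (hρ : 0 < ρ)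
    (hr : ρ ≤ r) {Ψ : Plane} (hΨ : ‖Ψ‖ ≤ 2) : ‖force V d Ψ r‖ ≤ C + d ^ 2 / ρ ^ 2 * 2 := by
  rw [force_eq hV]
  refine (norm_add_le _ _).trans (add_le_add (hC.grad Ψ hΨ) ?_)
  rw [norm_smul, norm_eq_abs, abs_of_nonneg (by positivity)]
  gcongr
  exact (norm_coordProj_apply_le 1 Ψ).trans hΨ

theorem norm_deriv_le_of_bound {B : ℝ} (hr : r ∈ I) {D : ℝ → Plane}
    (hD : ∀ x, HasDerivAt (deriv (F r)) (D x) x) (hB : ∀ x, ‖D x‖ ≤ B) (x : ℝ) :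
    ‖deriv (F r) x‖ ≤ 4 + B := by
  have h1 := norm_sub_sub_deriv_le (h.hasDerivAt hr) hD (x := x) fun y _ => hB y
  have h2 : deriv (F r) x = (F r (x + 1) - F r x) - (F r (x + 1) - F r x - deriv (F r) x) := by abel
  rw [h2]
  refine (norm_sub_le _ _).trans ?_
  have h3 := norm_sub_le (F r (x + 1)) (F r x)
  linarith [h.norm_le hr x, h.norm_le hr (x + 1)]

theorem tendsto_vacuum {B : ℝ} (hr : r ∈ I) (hB : ∀ x, ‖deriv (F r) x‖ ≤ B) :
    Tendsto (F r) atTop (𝓝 vacuum) := by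
  have hB0 : 0 ≤ B := (norm_nonneg _).trans (hB 0)
  rw [Metric.tendsto_nhds]
  intro ρ hρ
  obtain ⟨v, hv0, hv⟩ := exists_pos_le_potential h.potential (half_pos hρ)
  have ht : Tendsto (fun X : ℝ => ∫ x in Ioi X, V (F r x)) atTop (𝓝 0) :=
    tendsto_integral_Ioi_zero tendsto_id
  obtain ⟨X, hX, hX0⟩ := ((ht.eventually (gt_mem_nhds
    (show 0 < v * (ρ / (2 * (B + 1))) by positivity))).and (eventually_ge_atTop 0)).exists
  filter_upwards [eventually_ge_atTop X] with x hx
  rw [dist_eq_norm]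
  exact close_of_small_tail h.potential (by positivity : 0 < B + 1) hv hρ (h.hasDerivAt hr)
    (fun x => (hB x).trans (by linarith)) (h.norm_le hr)
    (fun x hx => h.nonneg_of_nonneg hr (hX0.trans hx)) (h.integrable_potential hr).integrableOn
    hX hx

/-- The Euler–Lagrange equation. -/
theorem hasDerivAt_deriv (hr : r ∈ I) (x : ℝ) :
    HasDerivAt (deriv (F r)) (force V d (F r x) r) x := by
  obtain ⟨hc2, -, heq⟩ := h.contDiff_deriv hr
  set D := deriv (deriv (F r))
  have hc1 : ContDiff ℝ 1 D := by
    have : ContDiff ℝ (1 + 1) (deriv (F r)) := by simpa [one_add_one_eq_two] using hc2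
    exact (contDiff_succ_iff_deriv.1 this).2.2
  have d1 : ∀ x, HasDerivAt (deriv (F r)) (D x) x := fun x =>
    (hc2.differentiable (by norm_num) x).hasDerivAt
  have d2 : ∀ x, HasDerivAt D (hessW V d (F r x) r (deriv (F r) x)) x := fun x => by
    have := (hc1.differentiable (by norm_num) x).hasDerivAt
    refine this.congr_deriv ?_
    have e := heq x
    rw [linOp, neg_add_eq_zero] at e
    exact e
  have hconst : ∀ x, D x - force V d (F r x) r = D 0 - force V d (F r 0) r := by
    have hd : ∀ x, HasDerivAt (fun x => D x - force V d (F r x) r) 0 x := fun x =>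
      ((d2 x).sub (h.hasDerivAt_force_comp hr x)).congr_deriv (sub_self _)
    exact fun x => is_const_of_deriv_eq_zero (fun x => (hd x).differentiableAt)
      (fun x => (hd x).deriv) x 0
  set c := D 0 - force V d (F r 0) r
  have hDeq : ∀ x, D x = c + force V d (F r x) r := fun x => by rw [← hconst x]; abel
  obtain ⟨C, hC⟩ := exists_taylorBound h.potential 2
  have hvac := h.tendsto_vacuum hr (h.norm_deriv_le_of_bound hr d1 fun x => by
    rw [hDeq]
    exact (norm_add_le _ _).trans (add_le_add le_rfl
      (norm_force_le h.potential hC (h.pos r hr) le_rfl (h.norm_le hr x))))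
  have hforce : Tendsto D atTop (𝓝 c) := by
    have hcf : Continuous fun Ψ => force V d Ψ r := continuous_iff_continuousAt.2 fun Ψ =>
      (hasFDerivAt_force h.potential Ψ r).continuousAt
    have := ((hcf.tendsto vacuum).comp hvac).const_add c
    rw [force_vacuum h.potential, add_zero] at this
    exact this.congr fun x => (hDeq x).symm
  have hc0 : c = 0 := by
    ext i
    have hp : Continuous fun Ψ : Plane => Ψ i := (EuclideanSpace.proj i : Plane →L[ℝ] ℝ).continuous
    exact eq_zero_of_tendsto_deriv2 (fun x => hasDerivAt_coord (h.hasDerivAt hr x) i)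
      (fun x => hasDerivAt_coord (d1 x) i) ((hp.tendsto _).comp hvac) ((hp.tendsto _).comp hforce)
  have := d1 x
  rwa [hDeq, hc0, zero_add] at this

theorem norm_deriv_le {ρ : ℝ} (hC : TaylorBound V 2 C) (hρ : 0 < ρ) (hρr : ρ ≤ r) (hr : r ∈ I)
    (x : ℝ) : ‖deriv (F r) x‖ ≤ 4 + (C + d ^ 2 / ρ ^ 2 * 2) :=
  h.norm_deriv_le_of_bound hr (h.hasDerivAt_deriv hr)
    (fun x => norm_force_le h.potential hC hρ hρr (h.norm_le hr x)) x

theorem deriv_flip (hr : r ∈ I) (x : ℝ) : deriv (F r) (-x) = -flipφ (deriv (F r) x) := by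
  have h1 : HasDerivAt (fun x => F r (-x)) (-deriv (F r) (-x)) x := by
    exact ((h.hasDerivAt hr (-x)).scomp x (hasDerivAt_neg x)).congr_deriv (by simp)
  have h2 : HasDerivAt (fun x => F r (-x)) (flipφ (deriv (F r) x)) x := by
    simp only [h.flip hr]
    exact flipφ.hasFDerivAt.comp_hasDerivAt x (h.hasDerivAt hr x)
  rw [← h1.unique h2, neg_neg]

/-! ### Uniform decay -/

omit h in
theorem continuous_force_comp {X : Type*} [TopologicalSpace X] (hV : IsPotential V)
    {f : X → Plane} {ρ : X → ℝ} (hf : Continuous f) (hρ : Continuous ρ) (h0 : ∀ x, ρ x ≠ 0) :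
    Continuous fun x => force V d (f x) (ρ x) := by
  simp only [force_eq hV]
  have := hV.contDiff_gradient.continuous
  have : Continuous fun x => d ^ 2 / ρ x ^ 2 :=
    continuous_const.div (hρ.pow 2) fun x => pow_ne_zero 2 (h0 x)
  fun_prop

theorem deriv_eq_integral (hr : r ∈ I) (x : ℝ) : deriv (F r) x =
    F r (x + 1) - F r x - ∫ s in (0 : ℝ)..1, (1 - s) • force V d (F r (x + s)) r := by
  have hd : ∀ s, HasDerivAt (fun s => F r (x + s) + (1 - s) • deriv (F r) (x + s))
      ((1 - s) • force V d (F r (x + s)) r) s := fun s => by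
    have e1 := (h.hasDerivAt hr (x + s)).comp_const_add x s
    have e2 := (h.hasDerivAt_deriv hr (x + s)).comp_const_add x s
    have e3 : HasDerivAt (fun s : ℝ => 1 - s) (-1) s := by
      simpa using (hasDerivAt_id s).const_sub 1
    refine (e1.add (e3.smul e2)).congr_deriv ?_
    module
  have hc : Continuous fun s => (1 - s) • force V d (F r (x + s)) r := by
    have := continuous_force_comp (d := d) h.potential
      (f := fun s => F r (x + s)) (ρ := fun _ : ℝ => r)
      ((h.continuous hr).comp (by fun_prop)) continuous_const (fun _ => (h.pos r hr).ne')
    fun_prop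
  rw [intervalIntegral.integral_eq_sub_of_hasDerivAt (fun s _ => hd s) (hc.intervalIntegrable _ _)]
  simp

theorem continuousOn_deriv : ContinuousOn (fun p : ℝ × ℝ => deriv (F p.1) p.2) (I ×ˢ univ) := by
  rw [continuousOn_iff_continuous_domRestrict]
  have hFc : ∀ {X : Type} [TopologicalSpace X] (f g : X → ℝ), Continuous f → Continuous g →
      (∀ x, f x ∈ I) → Continuous fun x => F (f x) (g x) := fun f g hf hg hI =>
    h.cont.comp_continuous (hf.prodMk hg) fun x => ⟨hI x, mem_univ _⟩
  have e : (I ×ˢ (univ : Set ℝ)).domRestrict (fun p : ℝ × ℝ => deriv (F p.1) p.2) =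
      fun p : ↥(I ×ˢ (univ : Set ℝ)) => F p.1.1 (p.1.2 + 1) - F p.1.1 p.1.2 -
        ∫ s in (0 : ℝ)..1, (1 - s) • force V d (F p.1.1 (p.1.2 + s)) p.1.1 := by
    ext1 p; exact h.deriv_eq_integral p.2.1 _
  rw [e]
  refine Continuous.sub (Continuous.sub ?_ ?_) ?_
  · exact hFc _ _ (by fun_prop) (by fun_prop) fun p => p.2.1
  · exact hFc _ _ (by fun_prop) (by fun_prop) fun p => p.2.1
  · refine intervalIntegral.continuous_parametric_intervalIntegral_of_continuous' ?_ 0 1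
    have c1 : Continuous fun q : ↥(I ×ˢ (univ : Set ℝ)) × ℝ => 1 - q.2 := by fun_prop
    refine c1.smul ?_
    exact continuous_force_comp h.potential
      (hFc (fun p : ↥(I ×ˢ (univ : Set ℝ)) × ℝ => p.1.1.1) (fun p => p.1.1.2 + p.2)
        (by fun_prop) (by fun_prop) fun p => p.1.2.1) (by fun_prop)
      (fun p => (h.pos _ p.1.2.1).ne')

theorem energy_le {r' : ℝ} (hr : r ∈ I) (hr' : r' ∈ I) :
    ∫ x, density V d r' (F r') x ≤ max 1 (r ^ 2 / r' ^ 2) * ∫ x, density V d r (F r) x := by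
  set c := max 1 (r ^ 2 / r' ^ 2)
  have hr0 := h.pos r hr
  have hr0' := h.pos r' hr'
  have hc1 : 1 ≤ c := le_max_left _ _
  have hE : ∀ r ∈ I, profileEnergy V d r (F r) = ENNReal.ofReal
      (∫ x, density V d r (F r) x) := fun r hr =>
    (ofReal_integral_eq_lintegral_ofReal (h.integrable_density hr)
      (.of_forall fun x => h.density_nonneg x)).symm
  have hle : profileEnergy V d r' (F r) ≤ ENNReal.ofReal c * profileEnergy V d r (F r) := by
    rw [profileEnergy, profileEnergy, ← lintegral_const_mul' _ _ ENNReal.ofReal_ne_top]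
    refine lintegral_mono fun x => ?_
    rw [← ENNReal.ofReal_mul (by positivity)]
    refine ENNReal.ofReal_le_ofReal ?_
    have h1 : d ^ 2 / r' ^ 2 ≤ c * (d ^ 2 / r ^ 2) := by
      have : r ^ 2 / r' ^ 2 ≤ c := le_max_right _ _
      calc d ^ 2 / r' ^ 2 = r ^ 2 / r' ^ 2 * (d ^ 2 / r ^ 2) := by field_simp
        _ ≤ _ := by gcongr
    have h2 := h.potential.nonneg (F r x)
    unfold shiftedPotential
    have h3 := mul_mono_right h1 (sq_nonneg (F r x 1))
    have h4 : 0 ≤ (c - 1) * (1 / 2 * ‖deriv (F r) x‖ ^ 2 + V (F r x)) :=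
      mul_nonneg (by linarith) (by positivity)
    nlinarith
  have hadm : Admissible V d r' (F r) := by
    have ha := (h.profile r hr).admissible
    exact ⟨ha.ac, hle.trans_lt (ENNReal.mul_lt_top ENNReal.ofReal_lt_top ha.finite), ha.zero,
      ha.right, ha.left⟩
  have := ((h.profile r' hr').minimal (F r) hadm).trans hle
  rw [hE r hr, hE r' hr', ← ENNReal.ofReal_mul (by positivity)] at this
  exact (ENNReal.ofReal_le_ofReal_iff (mul_nonneg (by positivity)
    (integral_nonneg fun x => h.density_nonneg x))).1 this

theorem eventually_tail_lt (hr₀ : r₀ ∈ I) {η : ℝ} (hη : 0 < η) :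
    ∃ N : ℝ, 0 ≤ N ∧ ∀ᶠ r in 𝓝 r₀, ∫ x in Ioi N, V (F r x) < η := by
  set D := fun r => density V d r (F r) with hD
  set e : ℝ → ℝ := fun r => ∫ x, D r x
  have ht : Tendsto (fun N : ℝ => ∫ x in (-N)..N, D r₀ x) atTop (𝓝 (e r₀)) :=
    intervalIntegral_tendsto_integral (h.integrable_density hr₀) tendsto_neg_atTop_atBot tendsto_id
  obtain ⟨N, hN, hN0⟩ := ((ht.eventually (lt_mem_nhds (show e r₀ - η / 3 < e r₀ by linarith))).and
    (eventually_ge_atTop 0)).exists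
  refine ⟨N, hN0, ?_⟩
  have hr0 := h.pos r₀ hr₀
  have hI : ∀ᶠ r in 𝓝 r₀, r ∈ I := h.isOpen.mem_nhds hr₀
  have hmax : ContinuousAt (fun r => max 1 (r₀ ^ 2 / r ^ 2) * e r₀) r₀ := by
    have : ContinuousAt (fun r : ℝ => r₀ ^ 2 / r ^ 2) r₀ :=
      continuousAt_const.div (continuousAt_id.pow 2) (by simpa using hr0.ne')
    exact (continuousAt_const.max this).mul continuousAt_const
  have hev1 : ∀ᶠ r in 𝓝 r₀, max 1 (r₀ ^ 2 / r ^ 2) * e r₀ < e r₀ + η / 3 := by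
    refine hmax.eventually (gt_mem_nhds ?_)
    show max 1 (r₀ ^ 2 / r₀ ^ 2) * e r₀ < e r₀ + η / 3
    rw [div_self (by positivity), max_self, one_mul]; linarith
  have hcore : ContinuousAt (fun r => ∫ x in (-N)..N, D r x) r₀ := by
    have hc : ContinuousOn (fun r => ∫ x in (-N)..N, D r x) I := by
      rw [continuousOn_iff_continuous_domRestrict]
      refine intervalIntegral.continuous_parametric_intervalIntegral_of_continuous'
        (f := fun (r : I) x => D r x) ?_ _ _
      have c1 : Continuous fun p : I × ℝ => deriv (F p.1) p.2 :=
        h.continuousOn_deriv.comp_continuous (f := fun p : I × ℝ => ((p.1 : ℝ), p.2))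
          (by fun_prop) fun p => ⟨p.1.2, mem_univ _⟩
      have c2 : Continuous fun p : I × ℝ => F p.1 p.2 :=
        h.cont.comp_continuous (f := fun p : I × ℝ => ((p.1 : ℝ), p.2))
          (by fun_prop) fun p => ⟨p.1.2, mem_univ _⟩
      have c3 : Continuous fun p : I × ℝ => d ^ 2 / (p.1 : ℝ) ^ 2 :=
        continuous_const.div (by fun_prop) fun p => pow_ne_zero 2 (h.pos _ p.1.2).ne'
      have c4 : Continuous fun p : I × ℝ => V (F p.1 p.2) :=
        h.potential.differentiable.continuous.comp c2
      have c5 : Continuous fun p : I × ℝ => F p.1 p.2 1 :=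
        (EuclideanSpace.proj 1 : Plane →L[ℝ] ℝ).continuous.comp c2
      change Continuous fun p : I × ℝ => D p.1 p.2
      simp only [hD, density, shiftedPotential]
      exact (continuous_const.mul (c1.norm.pow 2)).add
        (c4.add ((continuous_const.mul c3).mul (c5.pow 2)))
    exact hc.continuousAt (h.isOpen.mem_nhds hr₀)
  have hev2 : ∀ᶠ r in 𝓝 r₀, e r₀ - η / 3 - η / 3 < ∫ x in (-N)..N, D r x :=
    hcore.eventually (lt_mem_nhds (by linarith))
  filter_upwards [hI, hev1, hev2] with r hr h1 h2
  have h3 : e r ≤ max 1 (r₀ ^ 2 / r ^ 2) * e r₀ := h.energy_le hr₀ hr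
  have hint := h.integrable_density hr
  have h4 : (∫ x in (-N)..N, D r x) + ∫ x in Ioi N, D r x = ∫ x in Ioi (-N), D r x :=
    intervalIntegral.integral_interval_add_Ioi hint.integrableOn hint.integrableOn
  have h5 : ∫ x in Ioi (-N), D r x ≤ e r :=
    setIntegral_le_integral hint (.of_forall fun x => h.density_nonneg x)
  have h6 : ∫ x in Ioi N, V (F r x) ≤ ∫ x in Ioi N, D r x :=
    setIntegral_mono (h.integrable_potential hr).integrableOn hint.integrableOn
      fun x => h.potential_le_density x
  linarith

theorem eventually_half_lt (hr₀ : r₀ ∈ I) : ∀ᶠ r in 𝓝 r₀, r ∈ I ∧ r₀ / 2 ≤ r := by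
  have := h.pos r₀ hr₀
  filter_upwards [h.isOpen.mem_nhds hr₀, le_mem_nhds (show r₀ / 2 < r₀ by linarith)] with r h1 h2
  exact ⟨h1, h2⟩

theorem eventually_close (hr₀ : r₀ ∈ I) {ρ : ℝ} (hρ : 0 < ρ) :
    ∃ X : ℝ, 0 ≤ X ∧ ∀ᶠ r in 𝓝 r₀, ∀ x, X ≤ x → ‖F r x - vacuum‖ < ρ := by
  have hr0 := h.pos r₀ hr₀
  obtain ⟨C, hC⟩ := exists_taylorBound h.potential 2
  have hC0 := hC.nonneg
  set L := 4 + (C + d ^ 2 / (r₀ / 2) ^ 2 * 2)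
  have hL0 : 0 < L := by positivity
  obtain ⟨v, hv0, hv⟩ := exists_pos_le_potential h.potential (half_pos hρ)
  obtain ⟨X, hX0, hX⟩ := h.eventually_tail_lt hr₀ (show 0 < v * (ρ / (2 * L)) by positivity)
  refine ⟨X, hX0, ?_⟩
  filter_upwards [hX, h.eventually_half_lt hr₀] with r hrX hr x hx
  exact close_of_small_tail h.potential hL0 hv hρ (h.hasDerivAt hr.1)
    (h.norm_deriv_le hC (by positivity) hr.2 hr.1) (h.norm_le hr.1)
    (fun x hx => h.nonneg_of_nonneg hr.1 (hX0.trans hx)) (h.integrable_potential hr.1).integrableOn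
    hrX hx

/-- The profiles decay exponentially, locally uniformly in the parameter. -/
theorem eventually_decay (hr₀ : r₀ ∈ I) : ∃ C : ℝ, 0 ≤ C ∧
    ∀ᶠ r in 𝓝 r₀, ∀ x, 0 ≤ x → ‖F r x - vacuum‖ ≤ C * exp (-(√l / 2 * x)) := by
  obtain ⟨ρ, hρ, hρ1, hco⟩ := exists_coercive_vacuum (d := d) h.potential h.l_pos h.well
  obtain ⟨X, hX0, hX⟩ := h.eventually_close hr₀ hρ
  have hl := Real.sqrt_pos.2 h.l_pos
  refine ⟨3 * exp (√l / 2 * X), by positivity, ?_⟩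
  filter_upwards [hX, h.eventually_half_lt hr₀] with r hrX hr x hx
  have h3 : ∀ x, ‖F r x - vacuum‖ ≤ 3 := fun x => by
    have := norm_sub_le (F r x) vacuum
    rw [norm_vacuum] at this; linarith [h.norm_le hr.1 x]
  rcases le_total x X with hxX | hxX
  · refine (h3 x).trans ?_
    rw [mul_assoc, ← exp_add]
    have : 1 ≤ exp (√l / 2 * X + -(√l / 2 * x)) := Real.one_le_exp (by nlinarith)
    linarith
  · have d1 : ∀ x, HasDerivAt (fun x => ‖F r x - vacuum‖ ^ 2)
        (2 * ⟪F r x - vacuum, deriv (F r) x⟫) x := fun x =>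
      ((h.hasDerivAt hr.1 x).sub_const vacuum).norm_sq
    have d2 : ∀ x, HasDerivAt (fun x => 2 * ⟪F r x - vacuum, deriv (F r) x⟫)
        (2 * (⟪F r x - vacuum, force V d (F r x) r⟫ + ⟪deriv (F r) x, deriv (F r) x⟫)) x := fun x =>
      (((h.hasDerivAt hr.1 x).sub_const vacuum).inner ℝ (h.hasDerivAt_deriv hr.1 x)).const_mul 2
    have hb := le_exp_of_bounded_of_deriv2 hl d1 d2 (X := X) (B := 9)
      (fun x _ => by have := h3 x; nlinarith [norm_nonneg (F r x - vacuum)])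
      (fun x hx => by
        rw [sq_sqrt h.l_pos.le]
        have e1 := hco (F r x) r (hrX x hx).le
        have e2 : 0 ≤ ⟪deriv (F r) x, deriv (F r) x⟫ := real_inner_self_nonneg
        linarith) hxX
    have hX9 : ‖F r X - vacuum‖ ^ 2 ≤ 9 := by
      have := h3 X; nlinarith [norm_nonneg (F r X - vacuum)]
    refine (sq_le_sq₀ (norm_nonneg _) (by positivity)).1 (hb.trans ?_)
    rw [mul_assoc, ← exp_add, mul_pow, sq (exp _), ← exp_add,
      show √l / 2 * X + -(√l / 2 * x) + (√l / 2 * X + -(√l / 2 * x)) = -(√l * (x - X)) by ring]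
    have := exp_pos (-(√l * (x - X)))
    nlinarith

omit h in
/-- Pointwise bounds transfer from the half line by reflection. -/
theorem forall_abs_of_nonneg (g : ℝ → ℝ) (C : ℝ) {k D : ℝ} (hg : ∀ x, g x ≤ g (-x)) (hD : C ≤ D)
    (hC : ∀ x, 0 ≤ x → g x ≤ C * exp (-(k * x))) (x : ℝ) : g x ≤ D * e(k,x) := by
  refine le_trans ?_ (mul_mono_right hD)
  rcases abs_cases x with ⟨h1, h2⟩ | ⟨h1, h2⟩
  · rw [h1]; exact hC x h2
  · rw [h1]; exact (hg x).trans (hC (-x) (by linarith))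

/-- Locally uniform exponential bounds for all quantities derived from the profiles. -/
theorem eventually_bounds (hr₀ : r₀ ∈ I) : ∃ C : ℝ, 0 ≤ C ∧ ∀ᶠ r in 𝓝 r₀, r ∈ I ∧ ∀ x,
    ‖deriv (F r) x‖ ≤ C * e(√l / 2,x) ∧
    ‖force V d (F r x) r‖ ≤ C * e(√l / 2,x) ∧
    ‖coordProj 1 (F r x)‖ ≤ C * e(√l / 2,x) ∧
    ‖F r x - F r₀ x‖ ≤ C * e(√l / 2,x) ∧
    ‖hessW V d (F r x) r - hessW V d vacuum r‖ ≤ C * e(√l / 2,x) := by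
  have hr0 := h.pos r₀ hr₀
  obtain ⟨C, hC0, hC⟩ := h.eventually_decay hr₀
  have hCr₀ := hC.self_of_nhds
  obtain ⟨Ct, hCt⟩ := exists_taylorBound h.potential 2
  have hCt0 := hCt.nonneg
  set q := Ct + d ^ 2 / (r₀ / 2) ^ 2 with hq
  have hq0 : 0 ≤ q := by positivity
  refine ⟨max (2 * C + q * C) (max (q * C) (max C (max (2 * C) (Ct * C)))), by positivity, ?_⟩
  filter_upwards [hC, h.eventually_half_lt hr₀] with r hCr hr
  refine ⟨hr.1, fun x => ?_⟩
  have hV := h.potential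
  have hvac2 : ‖vacuum‖ ≤ 2 := by simp
  have hfb : ∀ x, ‖force V d (F r x) r‖ ≤ q * ‖F r x - vacuum‖ := fun x => by
    have e1 := hCt.grad_lip vacuum (F r x) hvac2 (h.norm_le hr.1 x)
    rw [gradient_vacuum hV, sub_zero] at e1
    have e2 : coordProj 1 (F r x) = coordProj 1 (F r x - vacuum) := by
      rw [map_sub, coordProj_one_vacuum, sub_zero]
    rw [force_eq hV, hq, add_mul]
    refine (norm_add_le _ _).trans (add_le_add e1 ?_)
    rw [norm_smul, norm_eq_abs, abs_of_nonneg (by positivity), e2]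
    have := hr.2
    gcongr
    exact norm_coordProj_apply_le 1 _
  have hflipV : ∀ X : Plane, ‖hessW V d (flipφ X) r - hessW V d vacuum r‖ ≤
      ‖hessW V d X r - hessW V d vacuum r‖ := fun X => by
    refine ContinuousLinearMap.opNorm_le_bound _ (norm_nonneg _) fun Z => ?_
    have e : (hessW V d (flipφ X) r - hessW V d vacuum r) Z =
        flipφ ((hessW V d X r - hessW V d vacuum r) (flipφ Z)) := by
      have e1 := hessW_flip (d := d) hV isFlip_flipφ X (flipφ Z) r
      have e2 := hessW_flip (d := d) hV isFlip_flipφ vacuum (flipφ Z) r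
      rw [isFlip_flipφ.involutive] at e1 e2
      rw [hess_flip_vacuum hV] at e2
      simp only [FunLike.coe_sub, Pi.sub_apply, map_sub, e1, e2]
    rw [e, isFlip_flipφ.norm_map]
    refine (ContinuousLinearMap.le_opNorm _ _).trans ?_
    rw [isFlip_flipφ.norm_map]
  have hstep : ∀ x, 0 ≤ x → ∀ y ∈ Icc x (x + 1), ‖F r y - vacuum‖ ≤
      C * exp (-(√l / 2 * x)) := fun x hx y hy => by
    refine (hCr y (hx.trans hy.1)).trans ?_
    have := hy.1
    gcongr
  refine ⟨?_, ?_, ?_, ?_, ?_⟩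
  · refine forall_abs_of_nonneg (fun x => ‖deriv (F r) x‖) (2 * C + q * C)
      (fun x => by rw [h.deriv_flip hr.1, norm_neg, isFlip_flipφ.norm_map]) (le_max_left _ _)
      (fun x hx => ?_) x
    have h1 := norm_sub_sub_deriv_le (h.hasDerivAt hr.1) (h.hasDerivAt_deriv hr.1) (x := x)
      (B := q * (C * exp (-(√l / 2 * x)))) fun y hy =>
        (hfb y).trans (mul_mono_left (hstep x hx y hy) hq0)
    have h2 := hstep x hx x ⟨le_rfl, by linarith⟩
    have h3 := hstep x hx (x + 1) ⟨by linarith, le_rfl⟩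
    have h4 : deriv (F r) x = (F r (x + 1) - vacuum) - (F r x - vacuum)
        - (F r (x + 1) - F r x - deriv (F r) x) := by abel
    show ‖deriv (F r) x‖ ≤ _
    rw [h4]
    refine (norm_sub_le _ _).trans ?_
    have := norm_sub_le (F r (x + 1) - vacuum) (F r x - vacuum)
    linarith
  · refine forall_abs_of_nonneg (fun x => ‖force V d (F r x) r‖) (q * C)
      (fun x => by rw [h.flip hr.1, force_flip hV isFlip_flipφ, isFlip_flipφ.norm_map])
      (by simp) (fun x hx => ?_) x
    rw [mul_assoc]
    exact (hfb x).trans (mul_mono_left (hCr x hx) hq0)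
  · refine forall_abs_of_nonneg (fun x => ‖coordProj 1 (F r x)‖) C
      (fun x => by rw [h.flip hr.1, isFlip_flipφ.comm, isFlip_flipφ.norm_map])
      (by simp) (fun x hx => ?_) x
    have e2 : coordProj 1 (F r x) = coordProj 1 (F r x - vacuum) := by
      rw [map_sub, coordProj_one_vacuum, sub_zero]
    show ‖coordProj 1 (F r x)‖ ≤ _
    rw [e2]
    exact (norm_coordProj_apply_le 1 _).trans (hCr x hx)
  · refine forall_abs_of_nonneg (fun x => ‖F r x - F r₀ x‖) (2 * C)
      (fun x => by rw [h.flip hr.1, h.flip hr₀, ← map_sub, isFlip_flipφ.norm_map])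
      (by simp) (fun x hx => ?_) x
    have := norm_sub_le (F r x - vacuum) (F r₀ x - vacuum)
    rw [show F r x - vacuum - (F r₀ x - vacuum) = F r x - F r₀ x by abel] at this
    linarith [hCr x hx, hCr₀ x hx]
  · refine forall_abs_of_nonneg (fun x => ‖hessW V d (F r x) r - hessW V d vacuum r‖)
      (Ct * C) (fun x => by
        simpa only [h.flip hr.1, isFlip_flipφ.involutive _] using hflipV (F r (-x)))
      (by simp) (fun x hx => ?_) x
    have e1 := hCt.hess_lip vacuum (F r x) hvac2 (h.norm_le hr.1 x)
    show ‖hessW V d (F r x) r - hessW V d vacuum r‖ ≤ _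
    rw [hessW_eq hV, hessW_eq hV, add_sub_add_right_eq_sub, mul_assoc]
    exact e1.trans (mul_mono_left (hCr x hx) hCt0)

end ProfileFamily

/-! ### Integrals of decaying functions -/

theorem integrable_exp_neg_abs {c : ℝ} (hc : 0 < c) : Integrable (fun x : ℝ => e(c,x)) := by
  have h1 : IntegrableOn (fun x : ℝ => e(c,x)) (Ioi 0) :=
    (integrableOn_exp_mul_Ioi (a := -c) (by linarith) 0).congr_fun
      (fun x hx => by simp [abs_of_pos (mem_Ioi.1 hx)]) measurableSet_Ioi
  have h2 : IntegrableOn (fun x : ℝ => e(c,x)) (Iic 0) :=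
    (integrableOn_exp_mul_Iic (a := c) hc 0).congr_fun
      (fun x hx => by simp [abs_of_nonpos (mem_Iic.1 hx)]) measurableSet_Iic
  rw [← integrableOn_univ, ← Iic_union_Ioi (a := (0 : ℝ))]
  exact h2.union h1

section

theorem Decays.integrable (hκ : 0 < κ) {u : ℝ → E} (hu : Decays κ u) : Integrable u := by
  obtain ⟨hc, C, hC⟩ := hu
  exact ((integrable_exp_neg_abs hκ).const_mul C).mono' hc.aestronglyMeasurable
    (Eventually.of_forall hC)

theorem Decays.continuous {u : ℝ → E} (hu : Decays κ u) : Continuous u := hu.1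

theorem Decays.of_bound {u : ℝ → E} (hc : Continuous u)
    (hC : ∀ x, ‖u x‖ ≤ C * e(κ,x)) : Decays κ u := ⟨hc, C, hC⟩

theorem Decays.of_bounded {u : ℝ → E} (hc : Continuous u) (hC : ∀ x, ‖u x‖ ≤ C) :
    Decays 0 u := ⟨hc, C, fun x => by simpa using hC x⟩

theorem Decays.exists_bound {u : ℝ → E} (hu : Decays κ u) :
    ∃ C, 0 ≤ C ∧ ∀ x, ‖u x‖ ≤ C * e(κ,x) := by
  obtain ⟨-, C, hC⟩ := hu
  refine ⟨C, ?_, hC⟩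
  have := (norm_nonneg _).trans (hC 0)
  simpa using this
end

section
variable {E : Type*} [NormedAddCommGroup E] [InnerProductSpace ℝ E]

theorem Decays.inner {κ' : ℝ} {u v : ℝ → E} (hu : Decays κ u) (hv : Decays κ' v) :
    Decays (κ + κ') fun x => ⟪u x, v x⟫ := by
  obtain ⟨Cu, hCu0, hCu⟩ := hu.exists_bound
  obtain ⟨Cv, hCv0, hCv⟩ := hv.exists_bound
  refine ⟨hu.1.inner hv.1, Cu * Cv, fun x => (norm_inner_le_norm _ _).trans ?_⟩
  calc ‖u x‖ * ‖v x‖ ≤ (Cu * e(κ,x)) * (Cv * e(κ',x)) :=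
        mul_mono (hCu x) (hCv x)
    _ = Cu * Cv * (e(κ,x) * e(κ',x)) := by ring
    _ = _ := by rw [← exp_add]; ring_nf

theorem Decays.integrable_inner {κ' : ℝ} {u v : ℝ → E} (hu : Decays κ u)
    (hv : Decays κ' v) (hκ : 0 < κ + κ' := by linarith) : Integrable fun x => Inner.inner ℝ (u x) (v x) :=
  (hu.inner hv).integrable hκ

/-- Integration by parts for decaying functions. -/
theorem integral_inner_deriv {κ' : ℝ} (hκ : 0 < κ + κ') {u u1 v v1 : ℝ → E}
    (hu : Decays κ u) (hu1 : Decays κ u1) (hv : Decays κ' v) (hv1 : Decays κ' v1)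
    (hdu : ∀ x, HasDerivAt u (u1 x) x) (hdv : ∀ x, HasDerivAt v (v1 x) x) :
    ∫ x, Inner.inner ℝ (u x) (v1 x) = -∫ x, Inner.inner ℝ (u1 x) (v x) :=
  integral_bilinear_hasDerivAt_right_eq_neg_left_of_integrable (L := innerSL ℝ)
    (fun x _ => hdu x) (fun x _ => hdv x) (hu.integrable_inner hv1)
    (hu1.integrable_inner hv) (hu.integrable_inner hv)

theorem integral_inner_self_pos {u : ℝ → E} (hκ : 0 < κ) (hu : Decays κ u) {x₀ : ℝ}
    (h0 : u x₀ ≠ 0) : 0 < ∫ x, Inner.inner ℝ (u x) (u x) :=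
  integral_pos_of_integrable_nonneg_nonzero (x := x₀) (hu.1.inner hu.1)
    (hu.integrable_inner hu) (fun _ => real_inner_self_nonneg)
    (inner_self_ne_zero.2 h0)
end

/-! ### Multiplication operators and the weighted pairing -/

section
variable {E E' : Type*} [NormedAddCommGroup E] [NormedSpace ℝ E] [NormedAddCommGroup E']
  [NormedSpace ℝ E']

/-- Pointwise application of a bounded field of operators. -/
def mulOp : (ℝ →ᵇ (E →L[ℝ] E')) →L[ℝ] (ℝ →ᵇ E) →L[ℝ] ℝ →ᵇ E' :=
  LinearMap.mkContinuous₂ (LinearMap.mk₂ ℝ (fun (A : ℝ →ᵇ (E →L[ℝ] E')) (u : ℝ →ᵇ E) =>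
        (BoundedContinuousFunction.ofNormedAddCommGroup (fun x => A x (u x))
          (A.continuous.clm_apply u.continuous) (‖A‖ * ‖u‖) (fun x => by
            refine ((A x).le_opNorm _).trans ?_
            gcongr
            · exact A.norm_coe_le_norm x
            · exact u.norm_coe_le_norm x) : ℝ →ᵇ E'))
      (fun A B u => by ext1 x; simp)
      (fun c A u => by ext1 x; simp)
      (fun A u v => by ext1 x; simp)
      (fun c A u => by ext1 x; simp)) 1
    (fun A u => by
      rw [one_mul]
      refine (BoundedContinuousFunction.norm_le (by positivity)).2 fun x => ?_
      refine ((A x).le_opNorm _).trans ?_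
      gcongr
      · exact A.norm_coe_le_norm x
      · exact u.norm_coe_le_norm x)

theorem mulOp_apply (A : ℝ →ᵇ (E →L[ℝ] E')) (u : ℝ →ᵇ E) (x : ℝ) : mulOp A u x = A x (u x) := rfl

theorem unweight_mulOp (κ : ℝ) (A : ℝ →ᵇ (E →L[ℝ] E')) (u : ℝ →ᵇ E) (x : ℝ) :
    unweight κ (mulOp A u) x = A x (unweight κ u x) := by
  simp [unweight, mulOp_apply]

end

/-- The `L²` pairing of the functions represented by elements of the weighted space. -/
def pairing (κ : ℝ) (hκ : 0 < κ) : Weighted →L[ℝ] Weighted →L[ℝ] ℝ :=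
  LinearMap.mkContinuous₂
    (LinearMap.mk₂ ℝ (fun u v : Weighted => ∫ x, ⟪unweight κ u x, unweight κ v x⟫) (fun u v w => by
        rw [← integral_add ((decays_unweight κ u).integrable_inner
          (decays_unweight κ w)) ((decays_unweight κ v).integrable_inner
          (decays_unweight κ w))]
        simp only [unweight_add, inner_add_left])
      (fun c u v => by
        rw [smul_eq_mul, ← integral_const_mul]
        simp only [unweight_smul, real_inner_smul_left])
      (fun u v w => by
        rw [← integral_add ((decays_unweight κ u).integrable_inner
          (decays_unweight κ v)) ((decays_unweight κ u).integrable_inner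
          (decays_unweight κ w))]
        simp only [unweight_add, inner_add_right])
      (fun c u v => by
        rw [smul_eq_mul, ← integral_const_mul]
        simp only [unweight_smul, real_inner_smul_right]))
    (∫ x : ℝ, e(2 * κ,x))
    (fun u v => by
      rw [mul_assoc, ← integral_mul_const]
      refine norm_integral_le_of_norm_le ((integrable_exp_neg_abs (by positivity)).mul_const _)
        (.of_forall fun x => (norm_inner_le_norm _ _).trans ?_)
      calc ‖unweight κ u x‖ * ‖unweight κ v x‖ ≤ (‖u‖ * e(κ,x)) * (‖v‖ * e(κ,x)) :=
            mul_mono (norm_unweight_le κ u x) (norm_unweight_le κ v x)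
        _ = e(κ,x) * e(κ,x) * (‖u‖ * ‖v‖) := by ring
        _ = _ := by rw [← exp_add]; ring_nf)

theorem pairing_apply (hκ : 0 < κ) (u v : Weighted) :
    pairing κ hκ u v = ∫ x, ⟪unweight κ u x, unweight κ v x⟫ := rfl

theorem pairing_comm (hκ : 0 < κ) (u v : Weighted) : pairing κ hκ u v = pairing κ hκ v u := by
  simp only [pairing_apply, real_inner_comm]

theorem pairing_self_nonneg (hκ : 0 < κ) (u : Weighted) : 0 ≤ pairing κ hκ u u :=
  integral_nonneg fun _ => real_inner_self_nonneg

/-! ### The linearization at a profile -/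

namespace ProfileFamily

variable (h : ProfileFamily V d I F l)
include h

theorem sqrt_pos : 0 < √l := Real.sqrt_pos.2 h.l_pos

theorem decays_deriv (hr : r ∈ I) : Decays (√l / 2) (deriv (F r)) := by
  obtain ⟨C, -, hC⟩ := h.eventually_bounds hr
  exact .of_bound (h.continuous_deriv hr) fun x => (hC.self_of_nhds.2 x).1

theorem continuous_force (hr : r ∈ I) : Continuous fun x => force V d (F r x) r :=
  continuous_force_comp h.potential (h.continuous hr) continuous_const fun _ => (h.pos r hr).ne'

theorem decays_force (hr : r ∈ I) : Decays (√l / 2) fun x => force V d (F r x) r := by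
  obtain ⟨C, -, hC⟩ := h.eventually_bounds hr
  exact .of_bound (h.continuous_force hr) fun x => (hC.self_of_nhds.2 x).2.1

theorem decays_coordProj (hr : r ∈ I) : Decays (√l / 2) fun x => coordProj 1 (F r x) := by
  obtain ⟨C, -, hC⟩ := h.eventually_bounds hr
  exact .of_bound ((coordProj 1).continuous.comp (h.continuous hr))
    fun x => (hC.self_of_nhds.2 x).2.2.1

theorem continuous_hess (hr : r ∈ I) : Continuous fun x => hessW V d (F r x) r := by
  simp only [hessW_eq h.potential]
  exact (h.potential.contDiff_hess.continuous.comp (h.continuous hr)).add continuous_const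

theorem decays_hess_sub (hr : r ∈ I) :
    Decays (√l / 2) fun x => hessW V d (F r x) r - hessW V d vacuum r := by
  obtain ⟨C, -, hC⟩ := h.eventually_bounds hr
  exact .of_bound ((h.continuous_hess hr).sub continuous_const)
    fun x => (hC.self_of_nhds.2 x).2.2.2.2

theorem exists_norm_hess_le (hr : r ∈ I) : ∃ c, ∀ x, ‖hessW V d (F r x) r‖ ≤ c := by
  obtain ⟨c, hc⟩ := (h.decays_hess_sub hr).bounded (by have := h.sqrt_pos; positivity)
  refine ⟨c + ‖hessW V d vacuum r‖, fun x => ?_⟩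
  have := norm_add_le (hessW V d (F r x) r - hessW V d vacuum r) (hessW V d vacuum r)
  rw [sub_add_cancel] at this
  linarith [hc x]

theorem decays_hess_apply (hr : r ∈ I) {u : ℝ → Plane} (hu : Decays κ u) :
    Decays κ fun x => hessW V d (F r x) r (u x) := by
  obtain ⟨c, hc⟩ := h.exists_norm_hess_le hr
  exact hu.clm_apply (h.continuous_hess hr) hc

theorem exists_deriv_ne_zero (hr : r ∈ I) : ∃ x, deriv (F r) x ≠ 0 := by
  by_contra! hne
  have hc := is_const_of_deriv_eq_zero (fun x => (h.hasDerivAt hr x).differentiableAt) hne 1 0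
  have h0 := ((h.profile r hr).zero_iff 1).1 (by rw [hc, (h.profile r hr).admissible.zero])
  norm_num at h0

theorem integral_deriv_sq_pos (hr : r ∈ I) : 0 < ∫ x, ⟪deriv (F r) x, deriv (F r) x⟫ := by
  obtain ⟨x, hx⟩ := h.exists_deriv_ne_zero hr
  exact integral_inner_self_pos (by have := h.sqrt_pos; positivity) (h.decays_deriv hr) hx

/-- The second variation of the energy at a minimizer is non-negative. -/
theorem second_variation_nonneg (hr : r ∈ I) (hκ : 0 < κ) {u u1 : ℝ → Plane}
    (hu : Decays κ u) (hu1 : Decays κ u1) (hd : ∀ x, HasDerivAt u (u1 x) x) :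
    0 ≤ ∫ x, (⟪u1 x, u1 x⟫ + ⟪u x, hessW V d (F r x) r (u x)⟫) := by
  have hV := h.potential
  have hb : 0 < √l / 2 := by have := h.sqrt_pos; positivity
  obtain ⟨cu, hcu⟩ := hu.bounded hκ.le
  have hcu0 : 0 ≤ cu := (norm_nonneg _).trans (hcu 0)
  obtain ⟨C, hC⟩ := exists_taylorBound hV (2 + cu)
  have hC0 := hC.nonneg
  set D := density V d r (F r)
  set Q : ℝ → ℝ := fun x => ⟪u1 x, u1 x⟫ + ⟪u x, hessW V d (F r x) r (u x)⟫
  set P : ℝ → ℝ := fun x => ⟪deriv (F r) x, u1 x⟫ + ⟪force V d (F r x) r, u x⟫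
  have hQi : Integrable Q := (hu1.integrable_inner hu1).add
    (hu.integrable_inner (h.decays_hess_apply hr hu))
  have hPi1 := (h.decays_deriv hr).integrable_inner hu1
  have hPi2 := (h.decays_force hr).integrable_inner hu
  have hPi : Integrable P := hPi1.add hPi2
  have hP0 : ∫ x, P x = 0 := by
    have := integral_inner_deriv (κ := √l / 2) (by linarith) (h.decays_deriv hr)
      (h.decays_force hr) hu hu1 (h.hasDerivAt_deriv hr) hd
    rw [integral_add hPi1 hPi2, this]; ring
  have hUi : Integrable fun x => ⟪u x, u x⟫ := hu.integrable_inner hu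
  -- the energy of a competitor
  have hcomp : ∀ τ : ℝ, 0 < τ → τ ≤ 1 → 0 ≤ τ ^ 2 / 2 * (∫ x, Q x) +
      τ ^ 3 * (C * cu * ∫ x, ⟪u x, u x⟫) := by
    intro τ hτ0 hτ1
    set G : ℝ → Plane := fun x => F r x + τ • u x with hG
    have hGd : ∀ x, HasDerivAt G (deriv (F r) x + τ • u1 x) x := fun x =>
      (h.hasDerivAt hr x).add ((hd x).const_smul τ)
    have hGc : Continuous G := continuous_iff_continuousAt.2 fun x => (hGd x).continuousAt
    set DG : ℝ → ℝ := fun x =>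
      1 / 2 * ‖deriv (F r) x + τ • u1 x‖ ^ 2 + shiftedPotential V d (G x) r
    have hDG0 : ∀ x, 0 ≤ DG x := fun x => by
      have := hV.nonneg (G x)
      simp only [DG, shiftedPotential]; positivity
    set UB : ℝ → ℝ := fun x => D x + τ * P x + τ ^ 2 / 2 * Q x +
      τ ^ 3 * (C * cu * ⟪u x, u x⟫) with hUB
    have hDGle : ∀ x, DG x ≤ UB x := fun x => by
      have hF2 := h.norm_le hr x
      have hGx : G x - F r x = τ • u x := by simp [hG]
      have e := hC.taylor (F r x) (G x) (by linarith) (by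
        refine (norm_add_le _ _).trans (add_le_add hF2 ?_)
        rw [norm_smul, norm_eq_abs, abs_of_pos hτ0]
        nlinarith [hcu x, norm_nonneg (u x)])
      rw [hGx, norm_smul, norm_eq_abs, abs_of_pos hτ0, map_smul, real_inner_smul_right,
        real_inner_smul_left, real_inner_smul_right] at e
      have e1 := (abs_le.1 e).2
      have e2 : C * (τ * ‖u x‖) ^ 3 ≤ τ ^ 3 * (C * cu * ⟪u x, u x⟫) := by
        rw [real_inner_self_eq_norm_sq]
        have : C * (τ * ‖u x‖) ^ 3 = τ ^ 3 * (C * ‖u x‖ * ‖u x‖ ^ 2) := by ring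
        rw [this]; gcongr; exact hcu x
      have e3 : ‖deriv (F r) x + τ • u1 x‖ ^ 2 = ‖deriv (F r) x‖ ^ 2 +
          2 * τ * ⟪deriv (F r) x, u1 x⟫ + τ ^ 2 * ⟪u1 x, u1 x⟫ := by
        rw [norm_add_sq_real, real_inner_smul_right, norm_smul, mul_pow, norm_eq_abs, sq_abs,
          real_inner_self_eq_norm_sq]; ring
      have e4 : G x 1 = F r x 1 + τ * u x 1 := by simp [hG]
      simp only [DG, UB, D, P, Q, density, shiftedPotential, e3, e4]
      have e5 : ⟪force V d (F r x) r, u x⟫ =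
          ⟪gradient V (F r x), u x⟫ + d ^ 2 / r ^ 2 * (F r x 1 * u x 1) := by
        rw [force_eq hV, inner_add_left, real_inner_smul_left, inner_eq_coords (coordProj 1 _)]
        simp
      have e6 : ⟪u x, hessW V d (F r x) r (u x)⟫ =
          ⟪u x, ∇²V (F r x) (u x)⟫ + d ^ 2 / r ^ 2 * (u x 1) ^ 2 := by
        rw [hessW_eq hV]
        simp only [FunLike.coe_add, Pi.add_apply, FunLike.coe_smul, Pi.smul_apply]
        rw [inner_add_right, real_inner_smul_right, inner_eq_coords _ (coordProj 1 _)]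
        simp [sq]
      rw [e5, e6]
      nlinarith
    have hUBi : Integrable UB := (((h.integrable_density hr).add (hPi.const_mul τ)).add
      (hQi.const_mul _)).add ((hUi.const_mul _).const_mul _)
    have hDGc : Continuous DG := by
      have c1 := h.continuous_deriv hr
      have c2 := hu1.continuous
      have c3 := hV.differentiable.continuous
      simp only [DG, shiftedPotential]
      fun_prop
    have hDGi : Integrable DG := hUBi.mono' hDGc.aestronglyMeasurable (.of_forall fun x => by
        rw [norm_eq_abs, abs_of_nonneg (hDG0 x)]; exact hDGle x)
    -- translate to normalize the zero
    have hlim : ∀ {L : Filter ℝ}, Tendsto (fun x => e(κ,x)) L (𝓝 0) →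
        ∀ {c}, Tendsto (fun x => F r x 0) L (𝓝 c) → Tendsto (fun x => G x 0) L (𝓝 c) := by
      intro L hL c hc
      obtain ⟨K, hK0, hK⟩ := hu.exists_bound
      have : Tendsto (fun x => τ * u x 0) L (𝓝 (τ * 0)) := by
        refine (squeeze_zero_norm (fun x => ?_) (by simpa using hL.const_mul K)).const_mul τ
        exact (abs_coord_le_norm 0 _).trans (hK x)
      have := hc.add this
      rw [mul_zero, add_zero] at this
      exact this.congr fun x => by simp [hG]
    have hexp : Tendsto (fun x : ℝ => exp (-(κ * x))) atTop (𝓝 0) :=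
      Real.tendsto_exp_neg_atTop_nhds_zero.comp (tendsto_id.const_mul_atTop hκ)
    have hGr := hlim (hexp.comp tendsto_abs_atTop_atTop) (h.profile r hr).admissible.right
    have hGl := hlim (hexp.comp tendsto_abs_atBot_atTop) (h.profile r hr).admissible.left
    have hGc0 : Continuous fun x => G x 0 :=
      (EuclideanSpace.proj 0 : Plane →L[ℝ] ℝ).continuous.comp hGc
    obtain ⟨z, hz⟩ : ∃ z, G z 0 = 0 := mem_range_of_exists_le_of_exists_ge hGc0
        ((hGl.eventually (gt_mem_nhds (show (-1 : ℝ) < 0 by norm_num))).exists.imp fun _ => le_of_lt)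
        ((hGr.eventually (lt_mem_nhds (show (0 : ℝ) < 1 by norm_num))).exists.imp fun _ => le_of_lt)
    have hsd : ∀ x, HasDerivAt (fun x => G (x + z)) (deriv (F r) (x + z) + τ • u1 (x + z)) x :=
      fun x => (hGd (x + z)).comp_add_const x z
    have hen : profileEnergy V d r (fun x => G (x + z)) = ENNReal.ofReal (∫ x, DG x) := by
      rw [profileEnergy]
      simp only [(hsd _).deriv]
      rw [lintegral_add_right_eq_self (fun x => ENNReal.ofReal (1 / 2 *
        ‖deriv (F r) x + τ • u1 x‖ ^ 2 + shiftedPotential V d (G x) r)) z]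
      exact (ofReal_integral_eq_lintegral_ofReal hDGi (Eventually.of_forall hDG0)).symm
    have hadm : Admissible V d r (fun x => G (x + z)) := by
      refine ⟨fun p q => ContDiffOn.absolutelyContinuousOnInterval (ContDiff.contDiffOn ?_),
        by rw [hen]; exact ENNReal.ofReal_lt_top, by simpa using hz,
        hGr.comp (tendsto_atTop_add_const_right _ z tendsto_id),
        hGl.comp (tendsto_atBot_add_const_right _ z tendsto_id)⟩
      refine contDiff_one_iff_deriv.2 ⟨fun x => (hsd x).differentiableAt, ?_⟩
      rw [funext fun x => (hsd x).deriv]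
      have c1 := h.continuous_deriv hr
      have c2 := hu1.continuous
      fun_prop
    have hmin : ∫⁻ x, ENNReal.ofReal (D x) ≤ _ := (h.profile r hr).minimal _ hadm
    rw [hen, ← ofReal_integral_eq_lintegral_ofReal (h.integrable_density hr)
      (.of_forall fun x => h.density_nonneg x),
      ENNReal.ofReal_le_ofReal_iff (integral_nonneg hDG0)] at hmin
    have hle := hmin.trans (integral_mono hDGi hUBi hDGle)
    have hI : ∫ x, UB x = (∫ x, D x) + τ * (∫ x, P x) + τ ^ 2 / 2 * (∫ x, Q x) +
        τ ^ 3 * (C * cu * ∫ x, ⟪u x, u x⟫) := by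
      have i1 : Integrable fun x => τ * P x := hPi.const_mul τ
      have i2 : Integrable fun x => τ ^ 2 / 2 * Q x := hQi.const_mul _
      have i3 : Integrable fun x => τ ^ 3 * (C * cu * ⟪u x, u x⟫) := (hUi.const_mul _).const_mul _
      have i4 : Integrable fun x => D x + τ * P x := (h.integrable_density hr).add i1
      have i5 : Integrable fun x => D x + τ * P x + τ ^ 2 / 2 * Q x := i4.add i2
      rw [hUB, integral_add i5 i3, integral_add i4 i2, integral_add (h.integrable_density hr) i1,
        integral_const_mul, integral_const_mul, integral_const_mul, integral_const_mul]
    rw [hI, hP0] at hle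
    linarith
  by_contra! hneg
  set q := ∫ x, Q x
  set k := C * cu * ∫ x, ⟪u x, u x⟫
  have hk0 : 0 ≤ k := mul_nonneg (by positivity) (integral_nonneg fun _ => real_inner_self_nonneg)
  set τ := min 1 (-q / (4 * (k + 1)))
  have hτ0 : 0 < τ := lt_min one_pos (div_pos (by linarith) (by positivity))
  have hτ1 : τ ≤ -q / (4 * (k + 1)) := min_le_right _ _
  rw [le_div_iff₀ (by positivity)] at hτ1
  have := hcomp τ hτ0 (min_le_left _ _)
  have h2 : 0 < τ ^ 2 := by positivity
  nlinarith

end ProfileFamily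

/-! ### Perturbations of the Green operator -/

/-- `1 + G (A + S ⊗ S)`, where `G` is a Green operator. -/
def perturbedOp {κ : ℝ} (hκ : 0 < κ) (G : WeightedEnd)
    (A : ℝ →ᵇ PlaneEnd) (S : Weighted) : WeightedEnd :=
  1 + G.comp (mulOp A + (pairing κ hκ S).smulRight S)

theorem perturbedOp_apply (hκ : 0 < κ) (G : WeightedEnd) (A : ℝ →ᵇ PlaneEnd) (S u : Weighted) :
    perturbedOp hκ G A S u = u + G (mulOp A u + pairing κ hκ S u • S) := by
  simp [perturbedOp]

theorem weight_zero_apply {A : ℝ → E} (hA : Decays 0 A) (x : ℝ) : weight 0 A x = A x := by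
  simp [weight_apply hA]

theorem pairing_weight (hκ : 0 < κ) {u v : ℝ → Plane} (hu : Decays κ u) (hv : Decays κ v) :
    pairing κ hκ (weight κ u) (weight κ v) = ∫ x, ⟪u x, v x⟫ := by
  rw [pairing_apply, unweight_weight hu, unweight_weight hv]

section
variable {M : PlaneEnd} {G G' : WeightedEnd}

theorem IsGreen.hasDerivAt_of_perturbedOp (hG : IsGreen κ M G G') (hκ : 0 < κ)
    {A : ℝ →ᵇ PlaneEnd} {S u f : Weighted}
    (hu : perturbedOp hκ G A S u = G f) : ∃ u1 : ℝ → Plane, Decays κ u1 ∧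
      (∀ x, HasDerivAt (unweight κ u) (u1 x) x) ∧
      ∀ x, HasDerivAt u1 (M (unweight κ u x) + A x (unweight κ u x)
        + pairing κ hκ S u • unweight κ S x - unweight κ f x) x := by
  rw [perturbedOp_apply, ← eq_sub_iff_add_eq, ← map_sub] at hu
  set g := f - (mulOp A u + pairing κ hκ S u • S) with hg
  refine ⟨unweight κ (G' g), decays_unweight _ _, fun x => ?_, fun x => ?_⟩
  · have := hG.deriv g x
    rwa [← hu] at this
  · have := hG.deriv2 g x
    rw [← hu] at this
    refine this.congr_deriv ?_
    simp only [hg, unweight_sub, unweight_add, unweight_smul, unweight_mulOp]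
    abel

theorem IsGreen.perturbedOp_weight (hG : IsGreen κ M G G') (hκ : 0 < κ)
    {A : ℝ →ᵇ PlaneEnd} {S f : Weighted} {u u1 : ℝ → Plane}
    (hu : Decays κ u) (hd : ∀ x, HasDerivAt u (u1 x) x)
    (hd1 : ∀ x, HasDerivAt u1 (M (u x) + A x (u x)
      + pairing κ hκ S (weight κ u) • unweight κ S x - unweight κ f x) x) :
    perturbedOp hκ G A S (weight κ u) = G f := by
  set g := f - (mulOp A (weight κ u) + pairing κ hκ S (weight κ u) • S) with hg
  have := (hG.unique g u u1 (hu.bounded hκ.le) hd fun x => by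
    refine (hd1 x).congr_deriv ?_
    simp only [hg, unweight_sub, unweight_add, unweight_smul, unweight_mulOp, unweight_weight hu]
    abel).1
  have h2 : weight κ u = G g := by
    apply unweight_injective κ
    rw [unweight_weight hu, this]
  rw [perturbedOp_apply, ← eq_sub_iff_add_eq, ← map_sub]
  exact h2

/-- A bounded solution with decaying source decays, together with its derivative. -/
theorem IsGreen.decays (hG : IsGreen κ M G G') {u u1 u2 : ℝ → Plane}
    (hC : ∀ x, ‖u x‖ ≤ C) (hd : ∀ x, HasDerivAt u (u1 x) x) (hd1 : ∀ x, HasDerivAt u1 (u2 x) x)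
    (hf : Decays κ fun x => M (u x) - u2 x) :
    u = unweight κ (G (weight κ fun x => M (u x) - u2 x)) ∧
      u1 = unweight κ (G' (weight κ fun x => M (u x) - u2 x)) :=
  hG.unique _ u u1 ⟨C, hC⟩ hd fun x => (hd1 x).congr_deriv (by rw [unweight_weight hf, sub_sub_cancel])

/-- Weighted Lipschitz bound for the Green operator. -/
theorem IsGreen.lipschitz (hG : IsGreen κ M G G') (hκ : 0 < κ) (f : Weighted) :
    LipschitzWith (2 * (Real.toNNReal (κ * ‖G f‖ + ‖G' f‖))) (G f) := by
  set c := κ * ‖G f‖ + ‖G' f‖ with hc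
  have hc0 : 0 ≤ c := by positivity
  have hE : ∀ (s : ℝ) (x : ℝ), HasDerivAt (fun x => exp (s * x)) (s * exp (s * x)) x :=
    fun s x => by simpa [mul_comm] using ((hasDerivAt_id x).const_mul s).exp
  have hun : ∀ x, G f x = exp (κ * |x|) • unweight κ (G f) x := fun x => by
    rw [unweight, smul_smul, ← exp_add]; simp
  have key : ∀ s : ℝ, |s| = κ → ∀ D : Set ℝ, Convex ℝ D → (∀ x ∈ D, s * x = κ * |x|) →
      LipschitzOnWith (Real.toNNReal c) (G f) D := by
    intro s hs D hD hsD
    have hl : LipschitzOnWith (Real.toNNReal c) (fun x => exp (s * x) • unweight κ (G f) x) D := by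
      refine Convex.lipschitzOnWith_of_nnnorm_hasDerivWithin_le hD
        (fun x _ => ((hE s x).smul (hG.deriv f x)).hasDerivWithinAt) fun x hx => ?_
      rw [← NNReal.coe_le_coe, coe_nnnorm, Real.coe_toNNReal _ hc0]
      refine (norm_add_le _ _).trans ?_
      rw [hc, add_comm]
      have e : ∀ w : Weighted, exp (s * x) * ‖unweight κ w x‖ ≤ ‖w‖ := fun w => by
        have := norm_unweight_le κ w x
        calc exp (s * x) * ‖unweight κ w x‖ ≤ exp (s * x) * (‖w‖ * e(κ,x)) := by gcongr
          _ = ‖w‖ * (exp (s * x) * e(κ,x)) := by ring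
          _ = ‖w‖ := by rw [← exp_add, hsD x hx]; simp
      refine add_le_add ?_ ?_
      · rw [norm_smul, norm_mul, norm_eq_abs, hs, norm_eq_abs, abs_of_pos (exp_pos _), mul_assoc]
        exact mul_mono_left (e _) hκ.le
      · rw [norm_smul, norm_eq_abs, abs_of_pos (exp_pos _)]
        exact e _
    intro x hx y hy
    have := hl hx hy
    simpa only [hun, hsD x hx, hsD y hy] using this
  have hp := key κ (abs_of_pos hκ) (Ici 0) (convex_Ici 0) fun x hx => by rw [abs_of_nonneg hx]
  have hm := key (-κ) (by rw [abs_neg, abs_of_pos hκ]) (Iic 0) (convex_Iic 0)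
    fun x hx => by rw [abs_of_nonpos hx]; ring
  refine LipschitzWith.of_dist_le_mul fun x y => ?_
  simp only [NNReal.coe_mul, NNReal.coe_ofNat, Real.coe_toNNReal _ hc0]
  have hp' : ∀ x y, 0 ≤ x → 0 ≤ y → dist (G f x) (G f y) ≤ c * |x - y| := fun x y hx hy => by
    have := hp.dist_le_mul x hx y hy
    rwa [Real.coe_toNNReal _ hc0, dist_eq] at this
  have hm' : ∀ x y, x ≤ 0 → y ≤ 0 → dist (G f x) (G f y) ≤ c * |x - y| := fun x y hx hy => by
    have := hm.dist_le_mul x hx y hy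
    rwa [Real.coe_toNNReal _ hc0, dist_eq] at this
  have hcross : ∀ x y, x ≤ 0 → 0 ≤ y → dist (G f x) (G f y) ≤ 2 * c * |x - y| := fun x y hx hy => by
      have e1 := hm' x 0 hx le_rfl
      have e2 := hp' 0 y le_rfl hy
      have e3 := dist_triangle (G f x) (G f 0) (G f y)
      rw [sub_zero, abs_of_nonpos hx] at e1
      rw [zero_sub, abs_neg, abs_of_nonneg hy] at e2
      rw [abs_of_nonpos (by linarith : x - y ≤ 0)]
      nlinarith
  rw [dist_eq]
  have hd : 0 ≤ c * |x - y| := by positivity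
  rcases le_total x 0 with hx | hx <;> rcases le_total y 0 with hy | hy
  · linarith [hm' x y hx hy]
  · exact hcross x y hx hy
  · have := hcross y x hy hx
    rwa [dist_comm, abs_sub_comm] at this
  · linarith [hp' x y hx hy]

/-- Perturbations with a faster decay are compact. -/
theorem IsGreen.isCompactOperator (hG : IsGreen κ M G G') (hκ : 0 < κ) {κ' : ℝ} (hκ' : κ < κ')
    {H H' : WeightedEnd} (hH : IsGreen κ' M H H') {A : ℝ → PlaneEnd}
    (hA : Decays κ' A) {S : ℝ → Plane} (hS : Decays κ' S) :
    IsCompactOperator (G.comp (mulOp (weight 0 A) +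
      (pairing κ hκ (weight κ S)).smulRight (weight κ S))) := by
  set N := mulOp (weight 0 A) + (pairing κ hκ (weight κ S)).smulRight (weight κ S) with hN
  have hA0 : Decays 0 A := hA.mono (by linarith)
  have hSκ : Decays κ S := hS.mono hκ'.le
  have hNapp : ∀ u x, unweight κ (N u) x = A x (unweight κ u x) +
      pairing κ hκ (weight κ S) u • S x := fun u x => by
    rw [hN]
    simp only [FunLike.coe_add, Pi.add_apply, ContinuousLinearMap.smulRight_apply]
    simp only [unweight_add, unweight_smul, unweight_mulOp, weight_zero_apply hA0,
      unweight_weight hSκ]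
  obtain ⟨cA, hcA0, hcA⟩ := hA.exists_bound
  obtain ⟨cS, hcS0, hcS⟩ := hS.exists_bound
  set c := cA + ‖pairing κ hκ (weight κ S)‖ * cS with hcdef
  have hc0 : 0 ≤ c := by positivity
  have hNb : ∀ u : Weighted, ‖u‖ ≤ 1 → ∀ x, ‖unweight κ (N u) x‖ ≤ c * e(κ',x) := fun u hu x => by
    rw [hNapp, hcdef, add_mul]
    refine (norm_add_le _ _).trans (add_le_add ?_ ?_)
    · refine ((A x).le_opNorm _).trans ?_
      have h1 : ‖unweight κ u x‖ ≤ 1 := by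
        refine (norm_unweight_le κ u x).trans ?_
        nlinarith [norm_nonneg u, weight_le_one hκ.le x]
      calc ‖A x‖ * ‖unweight κ u x‖ ≤ ‖A x‖ * 1 := by gcongr
        _ ≤ _ := by rw [mul_one]; exact hcA x
    · rw [norm_smul, mul_assoc]
      refine mul_mono ?_ (hcS x)
      refine ((pairing κ hκ (weight κ S)).le_opNorm u).trans ?_
      exact mul_le_of_le_one_right (norm_nonneg _) hu
  refine isCompactOperator_of_lipschitz_of_decay (β := κ' - κ) (C := ‖H‖ * c)
    (L := 2 * Real.toNNReal (κ * (‖G‖ * ‖N‖) + ‖G'‖ * ‖N‖)) _ (by linarith)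
    (fun u hu => ?_) (fun u hu x => ?_)
  · refine (hG.lipschitz hκ (N u)).weaken ?_
    have e0 : ‖N u‖ ≤ ‖N‖ := (N.le_opNorm u).trans (mul_le_of_le_one_right (norm_nonneg _) hu)
    have e1 : ‖G (N u)‖ ≤ ‖G‖ * ‖N‖ := (G.le_opNorm _).trans (by gcongr)
    have e2 : ‖G' (N u)‖ ≤ ‖G'‖ * ‖N‖ := (G'.le_opNorm _).trans (by gcongr)
    gcongr
  · have hd : Decays κ' (unweight κ (N u)) := ⟨continuous_unweight _ _, c, hNb u hu⟩
    have hun := (hH.unique (weight κ' (unweight κ (N u))) (unweight κ (G (N u)))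
      (unweight κ (G' (N u))) ((decays_unweight κ _).bounded hκ.le) (hG.deriv _) (fun x => by
        rw [unweight_weight hd]; exact hG.deriv2 _ x)).1
    have e1 : ‖weight κ' (unweight κ (N u))‖ ≤ c := norm_weight_le hc0 (hNb u hu)
    have e2 := norm_unweight_le κ' (H (weight κ' (unweight κ (N u)))) x
    have e3 : ‖H (weight κ' (unweight κ (N u)))‖ ≤ ‖H‖ * c := (H.le_opNorm _).trans (by gcongr)
    have e4 : G (N u) x = exp (κ * |x|) • unweight κ (G (N u)) x := by
      rw [unweight, smul_smul, ← exp_add]; simp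
    show ‖G (N u) x‖ ≤ _
    rw [e4, norm_smul, norm_eq_abs, abs_of_pos (exp_pos _), hun]
    calc exp (κ * |x|) * ‖unweight κ' (H (weight κ' (unweight κ (N u)))) x‖
        ≤ exp (κ * |x|) * (‖H‖ * c * e(κ',x)) := by
          gcongr; exact e2.trans (by gcongr)
      _ = ‖H‖ * c * (exp (κ * |x|) * e(κ',x)) := by ring
      _ = _ := by rw [← exp_add]; ring_nf
end

theorem isUnit_one_add_of_isCompactOperator {Z : Type*} [NormedAddCommGroup Z] [NormedSpace ℝ Z]
    [CompleteSpace Z] {K : Z →L[ℝ] Z} (hK : IsCompactOperator K)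
    (hinj : ∀ u, u + K u = 0 → u = 0) : IsUnit (1 + K) := by
  rcases hK.hasEigenvalue_or_mem_resolventSet (μ := (-1 : ℝ)) (by norm_num) with he | he
  · exfalso
    obtain ⟨v, hv, hv0⟩ := he.exists_hasEigenvector
    have hv1 : K v = -v := by simpa using Module.End.mem_eigenspace_iff.1 hv
    exact hv0 (hinj v (by rw [hv1]; abel))
  · rw [spectrum.mem_resolventSet_iff] at he
    have := he.neg
    simpa [neg_sub, add_comm] using this

namespace ProfileFamily

variable (h : ProfileFamily V d I F l)
include h

theorem exists_green (hκ : 0 ≤ κ) (hκl : κ < √l) (r : ℝ) :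
    ∃ G G', IsGreen κ (hessW V d vacuum r) G G' := by
  obtain ⟨k₀, k₁, h0, h1, hM⟩ := exists_hess_vacuum (d := d) h.potential h.l_pos h.well r
  rw [hM]
  exact exists_isGreen hκ (hκl.trans_le h0) (hκl.trans_le h1)

/-- Symmetry of the linearized operator. -/
theorem integral_hess_form {κ' : ℝ} (hr : r ∈ I) (hκ : 0 < κ + κ') {u u1 u2 v v1 : ℝ → Plane}
    (hu : Decays κ u) (hu1 : Decays κ u1) (hu2 : Decays κ u2) (hv : Decays κ' v)
    (hv1 : Decays κ' v1) (hdu1 : ∀ x, HasDerivAt u1 (u2 x) x) (hdv : ∀ x, HasDerivAt v (v1 x) x) :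
    ∫ x, ⟪hessW V d (F r x) r (u x) - u2 x, v x⟫ =
      (∫ x, ⟪u1 x, v1 x⟫) + ∫ x, ⟪u x, hessW V d (F r x) r (v x)⟫ := by
  have e1 := integral_inner_deriv hκ hu1 hu2 hv hv1 hdu1 hdv
  simp only [inner_sub_left]
  rw [integral_sub ((h.decays_hess_apply hr hu).integrable_inner hv) (hu2.integrable_inner hv), e1]
  simp only [hessW_symm h.potential]
  ring

/-- The linearization at `F r`, made invertible by a rank-one term. -/
def linearization (_ : ProfileFamily V d I F l) {κ : ℝ} (hκ : 0 < κ)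
    (G : WeightedEnd) (r : ℝ) : WeightedEnd :=
  perturbedOp hκ G (weight 0 fun x => hessW V d (F r x) r - hessW V d vacuum r)
    (weight κ (deriv (F r)))

theorem decays_zero_hess_sub (hr : r ∈ I) :
    Decays 0 fun x => hessW V d (F r x) r - hessW V d vacuum r :=
  (h.decays_hess_sub hr).mono (by have := h.sqrt_pos; positivity)

theorem exists_of_linearization_eq (hr : r ∈ I) (hκ : 0 < κ) (hκl : κ < √l / 2)
    {G G' : WeightedEnd} (hG : IsGreen κ (hessW V d vacuum r) G G') {u f : Weighted}
    (hu : h.linearization hκ G r u = G f) :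
    ∃ u1 u2 : ℝ → Plane, Decays κ u1 ∧ Decays κ u2 ∧
      (∀ x, HasDerivAt (unweight κ u) (u1 x) x) ∧ (∀ x, HasDerivAt u1 (u2 x) x) ∧
      ∀ x, unweight κ f x = hessW V d (F r x) r (unweight κ u x) - u2 x
        + pairing κ hκ (weight κ (deriv (F r))) u • deriv (F r) x := by
  have hS := (h.decays_deriv hr).mono hκl.le
  obtain ⟨u1, hu1, d1, d2⟩ := hG.hasDerivAt_of_perturbedOp hκ hu
  refine ⟨u1, fun x => hessW V d (F r x) r (unweight κ u x) +
    pairing κ hκ (weight κ (deriv (F r))) u • deriv (F r) x - unweight κ f x, hu1,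
    ((h.decays_hess_apply hr (decays_unweight κ u)).add (hS.const_smul _)).sub
      (decays_unweight κ f), d1, fun x => (d2 x).congr_deriv ?_, fun x => by module⟩
  rw [weight_zero_apply (h.decays_zero_hess_sub hr), unweight_weight hS, FunLike.coe_sub,
    Pi.sub_apply]
  abel

theorem pairing_of_linearization_eq (hr : r ∈ I) (hκ : 0 < κ) (hκl : κ < √l / 2)
    {f : Weighted} {u u1 u2 v v1 : ℝ → Plane} (hu : Decays κ u) (hu1 : Decays κ u1)
    (hu2 : Decays κ u2) (hv : Decays κ v) (hv1 : Decays κ v1)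
    (hdu1 : ∀ x, HasDerivAt u1 (u2 x) x) (hdv : ∀ x, HasDerivAt v (v1 x) x) {c : ℝ}
    (hf : ∀ x, unweight κ f x = hessW V d (F r x) r (u x) - u2 x + c • deriv (F r) x) :
    ∫ x, ⟪unweight κ f x, v x⟫ = (∫ x, ⟪u1 x, v1 x⟫) + (∫ x, ⟪u x, hessW V d (F r x) r (v x)⟫)
      + c * ∫ x, ⟪deriv (F r) x, v x⟫ := by
  have hS := (h.decays_deriv hr).mono hκl.le
  have e := h.integral_hess_form hr (by linarith) hu hu1 hu2 hv hv1 hdu1 hdv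
  rw [← e]
  simp only [hf, inner_add_left _ (_ • _), real_inner_smul_left]
  rw [integral_add (((h.decays_hess_apply hr hu).sub hu2).integrable_inner hv)
    ((hS.integrable_inner hv).const_mul _), integral_const_mul]

theorem isUnit_linearization (hr : r ∈ I) (hκ : 0 < κ) (hκl : κ < √l / 2)
    {G G' : WeightedEnd} (hG : IsGreen κ (hessW V d vacuum r) G G') :
    IsUnit (h.linearization hκ G r) := by
  have hS := (h.decays_deriv hr).mono hκl.le
  have hl := h.sqrt_pos
  obtain ⟨H, H', hH⟩ := h.exists_green (d := d) (κ := √l / 2) (by positivity) (by linarith) r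
  refine isUnit_one_add_of_isCompactOperator
    (hG.isCompactOperator hκ hκl hH (h.decays_hess_sub hr) (h.decays_deriv hr)) fun u hu => ?_
  have hu' : h.linearization hκ G r u = G 0 := by
    rw [map_zero]; exact hu
  obtain ⟨u1, u2, hu1, hu2, d1, d2, hf⟩ := h.exists_of_linearization_eq hr hκ hκl hG hu'
  set c := pairing κ hκ (weight κ (deriv (F r))) u with hc
  have hpos := h.integral_deriv_sq_pos hr
  have hT := (h.decays_force hr).mono hκl.le
  have e1 := h.pairing_of_linearization_eq hr hκ hκl (decays_unweight κ u) hu1 hu2 hS hT d2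
    (h.hasDerivAt_deriv hr) hf
  have e2 : ∫ x, ⟪u1 x, force V d (F r x) r⟫ =
      -∫ x, ⟪unweight κ u x, hessW V d (F r x) r (deriv (F r) x)⟫ := by
    have := integral_inner_deriv (κ := κ) (κ' := κ) (by linarith) (decays_unweight κ u) hu1 hT
      (h.decays_hess_apply hr hS) d1 (h.hasDerivAt_force_comp hr)
    rw [this, neg_neg]
  rw [e2, unweight_zero] at e1
  simp only [inner_zero_left, integral_zero] at e1
  have hc0 : c = 0 := (mul_eq_zero.1 (by linarith)).resolve_right hpos.ne'
  have hker : unweight κ u ∈ {ψ | ∃ c : ℝ, ψ = c • deriv (F r)} := by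
    refine (h.nondeg r hr _).1 ⟨?_, ?_, fun x => ?_⟩
    · have hu1c : ContDiff ℝ 1 u1 := by
        rw [contDiff_one_iff_deriv]
        exact ⟨fun x => (d2 x).differentiableAt,
          by rw [funext fun x => (d2 x).deriv]; exact hu2.continuous⟩
      have : ContDiff ℝ (1 + 1) (unweight κ u) := by
        rw [contDiff_succ_iff_deriv]
        exact ⟨fun x => (d1 x).differentiableAt, by simp,
          by rw [funext fun x => (d1 x).deriv]; exact hu1c⟩
      simpa [one_add_one_eq_two] using this
    · rw [memLp_two_iff_integrable_sq_norm (continuous_unweight κ u).aestronglyMeasurable]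
      simpa [real_inner_self_eq_norm_sq] using
        (decays_unweight κ u).integrable_inner (decays_unweight κ u)
    · rw [linOp, funext fun x => (d1 x).deriv, (d2 x).deriv]
      have := hf x
      rw [hc0, zero_smul, add_zero, unweight_zero] at this
      rw [neg_add_eq_sub, ← this]
  obtain ⟨k, hk⟩ := hker
  have hk0 : k = 0 := by
    have : c = k * ∫ x, ⟪deriv (F r) x, deriv (F r) x⟫ := by
      rw [hc, pairing_apply, unweight_weight hS, hk, ← integral_const_mul]
      simp [real_inner_smul_right]
    rw [hc0] at this
    exact (mul_eq_zero.1 this.symm).resolve_right hpos.ne'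
  apply unweight_injective κ
  rw [hk, hk0, zero_smul, unweight_zero]; rfl

/-- Coercivity of the second variation orthogonally to the translation mode, at one radius. -/
theorem exists_coercive (hr : r ∈ I) (hκ : 0 < κ) (hκl : κ < √l / 2) :
    ∃ K : ℝ, 0 ≤ K ∧ ∀ u u1 u2 : ℝ → Plane, Decays κ u → Decays κ u1 → Decays κ u2 →
      (∀ x, HasDerivAt u (u1 x) x) → (∀ x, HasDerivAt u1 (u2 x) x) →
      ∫ x, ⟪u x, u x⟫ ≤ K * ((∫ x, ⟪u1 x, u1 x⟫) + (∫ x, ⟪u x, hessW V d (F r x) r (u x)⟫) +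
        (∫ x, ⟪deriv (F r) x, u x⟫) ^ 2) := by
  have hS := (h.decays_deriv hr).mono hκl.le
  obtain ⟨G, G', hG⟩ := h.exists_green (d := d) (κ := κ) hκ.le (by linarith) r
  obtain ⟨T, hT⟩ := h.isUnit_linearization hr hκ hκl hG
  set B : WeightedEnd := (↑T⁻¹ : WeightedEnd).comp G with hB
  have hTB : ∀ f, h.linearization hκ G r (B f) = G f := fun f => by
    rw [← hT]
    exact DFunLike.congr_fun T.mul_inv (G f)
  have hBT : ∀ u f, h.linearization hκ G r u = G f → B f = u := fun u f hu => by
    rw [hB, ContinuousLinearMap.comp_apply, ← hu, ← hT]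
    exact DFunLike.congr_fun T.inv_mul u
  have hex := fun f => h.exists_of_linearization_eq hr hκ hκl hG (hTB f)
  have hd := fun f => decays_unweight κ (B f)
  have hpS : ∀ w, pairing κ hκ (weight κ (deriv (F r))) w =
      ∫ x, ⟪deriv (F r) x, unweight κ w x⟫ := fun w => by
    rw [pairing_apply, unweight_weight hS]
  have hsym : ∀ f g, pairing κ hκ (B f) g = pairing κ hκ f (B g) := fun f g => by
    obtain ⟨u1, u2, hu1, hu2, d1, d2, hf⟩ := hex f
    obtain ⟨v1, v2, hv1, hv2, e1, e2, hg⟩ := hex g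
    have s1 : ∫ x, ⟪v1 x, u1 x⟫ = ∫ x, ⟪u1 x, v1 x⟫ := by
      simp only [real_inner_comm]
    have s2 : ∫ x, ⟪unweight κ (B g) x, hessW V d (F r x) r (unweight κ (B f) x)⟫ =
        ∫ x, ⟪unweight κ (B f) x, hessW V d (F r x) r (unweight κ (B g) x)⟫ := by
      congr 1; ext x
      rw [← hessW_symm h.potential, real_inner_comm]
    rw [pairing_comm, pairing_apply, pairing_apply,
      h.pairing_of_linearization_eq hr hκ hκl (hd f) hu1 hu2 (hd g) hv1 d2 e1 hf,
      h.pairing_of_linearization_eq hr hκ hκl (hd g) hv1 hv2 (hd f) hu1 e2 d1 hg, s1, s2,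
      ← hpS, ← hpS]
    ring
  have hBf : ∀ f u1, Decays κ u1 → (∀ x, HasDerivAt (unweight κ (B f)) (u1 x) x) →
      pairing κ hκ (B f) f = (∫ x, ⟪u1 x, u1 x⟫)
      + (∫ x, ⟪unweight κ (B f) x, hessW V d (F r x) r (unweight κ (B f) x)⟫)
      + pairing κ hκ (weight κ (deriv (F r))) (B f) ^ 2 := fun f u1 hu1 d1 => by
    obtain ⟨w1, w2, hw1, hw2, c1, c2, hf⟩ := hex f
    obtain rfl : w1 = u1 := funext fun x => (c1 x).unique (d1 x)
    rw [pairing_comm, pairing_apply,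
      h.pairing_of_linearization_eq hr hκ hκl (hd f) hw1 hw2 (hd f) hw1 c2 c1 hf, ← hpS, sq]
  have hnn : ∀ f, 0 ≤ pairing κ hκ (B f) f := fun f => by
    obtain ⟨u1, -, hu1, -, d1, -⟩ := hex f
    rw [hBf f u1 hu1 d1]
    have := h.second_variation_nonneg hr hκ (hd f) hu1 d1
    rw [integral_add (hu1.integrable_inner hu1)
      ((hd f).integrable_inner (h.decays_hess_apply hr (hd f)))] at this
    positivity
  refine ⟨‖B‖, norm_nonneg B, fun u u1 u2 hu hu1 hu2 d1 d2 => ?_⟩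
  set c := pairing κ hκ (weight κ (deriv (F r))) (weight κ u) with hc
  have hcS : c = ∫ x, ⟪deriv (F r) x, u x⟫ := pairing_weight hκ hS hu
  have hfd : Decays κ fun x => hessW V d (F r x) r (u x) - u2 x + c • deriv (F r) x :=
    ((h.decays_hess_apply hr hu).sub hu2).add (hS.const_smul c)
  set f := weight κ fun x => hessW V d (F r x) r (u x) - u2 x + c • deriv (F r) x
  have hBu : B f = weight κ u := by
    refine hBT _ _ (hG.perturbedOp_weight hκ hu d1 fun x => (d2 x).congr_deriv ?_)
    rw [weight_zero_apply (h.decays_zero_hess_sub hr), unweight_weight hS, unweight_weight hfd,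
      FunLike.coe_sub, Pi.sub_apply]
    module
  have key := symmetric_nonneg_bound (pairing κ hκ) (pairing_comm hκ) (pairing_self_nonneg hκ) B
    hsym hnn f
  rw [hBf f u1 hu1 (by rw [hBu, unweight_weight hu]; exact d1), hBu, unweight_weight hu, ← hc, hcS,
    pairing_weight hκ hu hu] at key
  exact key

end ProfileFamily

theorem eventually_small_of_decay {E : Type*} [NormedAddCommGroup E] {f : ℝ → ℝ → E}
    (hκ : κ < b) (hf : ∀ x, ContinuousAt (fun p : ℝ × ℝ => f p.1 p.2) (r₀, x))
    (h0 : ∀ x, f r₀ x = 0) (hκ0 : 0 ≤ κ)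
    (hC : ∀ᶠ r in 𝓝 r₀, ∀ x, ‖f r x‖ ≤ C * e(b,x)) {η : ℝ} (hη : 0 < η) :
    ∀ᶠ r in 𝓝 r₀, ∀ x, ‖f r x‖ ≤ η * e(κ,x) := by
  have hC0 : 0 ≤ C := by
    have := (norm_nonneg _).trans (hC.self_of_nhds 0); simpa using this
  obtain ⟨N, hN⟩ : ∃ N : ℝ, C * exp (-((b - κ) * N)) < η := by
    have : Tendsto (fun x : ℝ => C * exp (-((b - κ) * x))) atTop (𝓝 (C * 0)) :=
      (Real.tendsto_exp_neg_atTop_nhds_zero.comp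
        (tendsto_id.const_mul_atTop (by linarith))).const_mul C
    rw [mul_zero] at this
    exact (this.eventually (gt_mem_nhds hη)).exists
  have hcore : ∀ᶠ r in 𝓝 r₀, ∀ x ∈ Icc (-N) N, ‖f r x‖ < η * exp (-(κ * N)) := by
    refine isCompact_Icc.eventually_forall_of_forall_eventually fun x _ => ?_
    have := (hf x).norm.eventually (gt_mem_nhds (show ‖f r₀ x‖ < η * exp (-(κ * N)) by
      rw [h0, norm_zero]; positivity))
    exact this
  filter_upwards [hC, hcore] with r h1 h2 x
  rcases le_total |x| N with hx | hx
  · refine (h2 x (abs_le.1 hx)).le.trans (mul_mono_left (Real.exp_le_exp.2 ?_) hη.le)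
    have := mul_mono_left hx hκ0
    linarith
  · refine (h1 x).trans ?_
    have e : C * e(b,x) = C * e(b - κ,x) * e(κ,x) := by
      rw [mul_assoc, ← exp_add]; ring_nf
    rw [e]
    refine mul_mono_right (le_trans ?_ hN.le) (exp_pos _).le
    refine mul_mono_left (Real.exp_le_exp.2 ?_) hC0
    have := mul_mono_left hx (by linarith : 0 ≤ b - κ)
    linarith

theorem integral_inner_sq_le {E : Type*} [NormedAddCommGroup E] [InnerProductSpace ℝ E]
    {μ : Measure ℝ} {u v : ℝ → E}
    (huu : Integrable (fun x => ⟪u x, u x⟫) μ)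
    (huv : Integrable (fun x => ⟪u x, v x⟫) μ)
    (hvv : Integrable (fun x => ⟪v x, v x⟫) μ) :
    (∫ x, ⟪u x, v x⟫ ∂μ) ^ 2 ≤ (∫ x, ⟪u x, u x⟫ ∂μ) * ∫ x, ⟪v x, v x⟫ ∂μ := by
  have h : ∀ s : ℝ, 0 ≤ (∫ x, ⟪v x, v x⟫ ∂μ) * (s * s) +
      2 * (∫ x, ⟪u x, v x⟫ ∂μ) * s + ∫ x, ⟪u x, u x⟫ ∂μ := fun s => by
    have h0 : 0 ≤ ∫ x, ⟪s • v x + u x, s • v x + u x⟫ ∂μ :=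
      integral_nonneg fun x => real_inner_self_nonneg
    have e : ∀ x, ⟪s • v x + u x, s • v x + u x⟫ =
        s * s * ⟪v x, v x⟫ + 2 * s * ⟪u x, v x⟫ + ⟪u x, u x⟫ :=
      fun x => by
        simp only [inner_add_left, inner_add_right, real_inner_smul_left, real_inner_smul_right,
          real_inner_comm (u x) (v x)]
        ring
    simp only [e] at h0
    have i1 : Integrable (fun x => s * s * ⟪v x, v x⟫) μ := hvv.const_mul _
    have i2 : Integrable (fun x => 2 * s * ⟪u x, v x⟫) μ := huv.const_mul _
    have i3 : Integrable (fun x => s * s * ⟪v x, v x⟫ + 2 * s * ⟪u x, v x⟫) μ := i1.add i2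
    rw [integral_add i3 huu, integral_add i1 i2, integral_const_mul, integral_const_mul] at h0
    linarith
  have := discrim_le_zero h
  rw [discrim] at this
  nlinarith

namespace ProfileFamily

variable (h : ProfileFamily V d I F l)
include h

theorem continuousAt (hr : r ∈ I) (x : ℝ) : ContinuousAt (fun p : ℝ × ℝ => F p.1 p.2) (r, x) :=
  h.cont.continuousAt ((h.isOpen.prod isOpen_univ).mem_nhds ⟨hr, mem_univ x⟩)

theorem continuousAt_deriv (hr : r ∈ I) (x : ℝ) :
    ContinuousAt (fun p : ℝ × ℝ => deriv (F p.1) p.2) (r, x) :=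
  h.continuousOn_deriv.continuousAt ((h.isOpen.prod isOpen_univ).mem_nhds ⟨hr, mem_univ x⟩)

theorem eventually_sub_small {η : ℝ} (hr₀ : r₀ ∈ I) (hκ : 0 < κ) (hκl : κ < √l / 2)
    (hη : 0 < η) : ∀ᶠ r in 𝓝 r₀, ∀ x, ‖F r x - F r₀ x‖ ≤ η * e(κ,x) := by
  obtain ⟨C, -, hC⟩ := h.eventually_bounds hr₀
  refine eventually_small_of_decay hκl (fun x => ?_) (fun x => sub_self _) hκ.le
    (hC.mono fun r hr x => (hr.2 x).2.2.2.1) hη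
  exact (h.continuousAt hr₀ x).sub (((h.continuous hr₀).comp continuous_snd).continuousAt)

theorem eventually_deriv_sub_small {η : ℝ} (hr₀ : r₀ ∈ I) (hκ : 0 < κ) (hκl : κ < √l / 2)
    (hη : 0 < η) :
    ∀ᶠ r in 𝓝 r₀, ∀ x, ‖deriv (F r) x - deriv (F r₀) x‖ ≤ η * e(κ,x) := by
  obtain ⟨C, -, hC⟩ := h.eventually_bounds hr₀
  refine eventually_small_of_decay (C := C + C) hκl (fun x => ?_) (fun x => sub_self _) hκ.le
    (hC.mono fun r hr x => ?_) hη
  · exact (h.continuousAt_deriv hr₀ x).sub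
      (((h.continuous_deriv hr₀).comp continuous_snd).continuousAt)
  · rw [add_mul]
    exact (norm_sub_le _ _).trans (add_le_add (hr.2 x).1 (hC.self_of_nhds.2 x).1)

theorem eventually_hess_sub_small {η : ℝ} (hr₀ : r₀ ∈ I) (hη : 0 < η) :
    ∀ᶠ r in 𝓝 r₀, ∀ x, ‖hessW V d (F r x) r - hessW V d (F r₀ x) r₀‖ ≤ η := by
  obtain ⟨C, hC⟩ := exists_taylorBound h.potential 2
  have hC0 := hC.nonneg
  have hl := h.sqrt_pos
  have h1 := h.eventually_sub_small (κ := √l / 4) hr₀ (by positivity) (by linarith)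
    (show 0 < η / 2 / (C + 1) by positivity)
  have hc : ContinuousAt (fun r : ℝ => d ^ 2 / r ^ 2) r₀ :=
    continuousAt_const.div (continuousAt_id.pow 2) (by simpa using (h.pos r₀ hr₀).ne')
  have h2 := hc.eventually (Metric.ball_mem_nhds _ (half_pos hη))
  filter_upwards [h1, h2, h.isOpen.mem_nhds hr₀] with r e1 e2 hr x
  have e0 : (d ^ 2 / r ^ 2) • coordProj 1 - (d ^ 2 / r₀ ^ 2) • coordProj 1 =
      (d ^ 2 / r ^ 2 - d ^ 2 / r₀ ^ 2) • coordProj 1 := by module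
  rw [hessW_eq h.potential, hessW_eq h.potential, add_sub_add_comm, e0]
  refine (norm_add_le _ _).trans ?_
  have e3 := hC.hess_lip (F r₀ x) (F r x) (h.norm_le hr₀ x) (h.norm_le hr x)
  have e4 : ‖F r x - F r₀ x‖ ≤ η / 2 / (C + 1) := (e1 x).trans
    (mul_le_of_le_one_right (by positivity) (weight_le_one (by positivity) x))
  have e5 : C * ‖F r x - F r₀ x‖ ≤ η / 2 := by
    calc C * ‖F r x - F r₀ x‖ ≤ (C + 1) * (η / 2 / (C + 1)) := by gcongr; linarith
      _ = η / 2 := by field_simp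
  have e6 : ‖(d ^ 2 / r ^ 2 - d ^ 2 / r₀ ^ 2) • coordProj 1‖ ≤ η / 2 := by
    rw [norm_smul]
    rw [dist_eq_norm] at e2
    exact (mul_le_of_le_one_right (norm_nonneg _) (norm_coordProj_le 1)).trans e2.le
  linarith

set_option maxHeartbeats 400000 in
/-- Coercivity of the second variation, locally uniformly in the radius. -/
theorem eventually_coercive (hr₀ : r₀ ∈ I) (hκ : 0 < κ) (hκl : κ < √l / 2) :
    ∃ K : ℝ, 0 ≤ K ∧ ∀ᶠ r in 𝓝 r₀, ∀ u u1 u2 : ℝ → Plane, Decays κ u → Decays κ u1 →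
      Decays κ u2 → (∀ x, HasDerivAt u (u1 x) x) → (∀ x, HasDerivAt u1 (u2 x) x) →
      (∫ x, ⟪u x, u x⟫) + ∫ x, ⟪u1 x, u1 x⟫ ≤ K * ((∫ x, ⟪u1 x, u1 x⟫) +
        (∫ x, ⟪u x, hessW V d (F r x) r (u x)⟫) +
        (∫ x, ⟪deriv (F r) x, u x⟫) ^ 2) := by
  obtain ⟨K, hK0, hK⟩ := h.exists_coercive hr₀ hκ hκl
  obtain ⟨c, hc⟩ := h.exists_norm_hess_le hr₀
  have hc0 : 0 ≤ c := (norm_nonneg _).trans (hc 0)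
  have hl := h.sqrt_pos
  set J := ∫ x : ℝ, e(√l / 4 + √l / 4,x)
  have hJ0 : 0 ≤ J := integral_nonneg fun x => (exp_pos _).le
  set θ := 1 / (4 * (K + 1)) with hθ
  have hθ0 : 0 < θ := by positivity
  set θ' := min 1 (θ / (2 * (J + 1)))
  have hθ'0 : 0 < θ' := by positivity
  refine ⟨(2 * K + 1) * 4 * (c + 2), by positivity, ?_⟩
  filter_upwards [h.eventually_hess_sub_small hr₀ (η := min θ 1) (by positivity),
    h.eventually_deriv_sub_small (κ := √l / 4) hr₀ (by positivity) (by linarith) hθ'0,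
    h.isOpen.mem_nhds hr₀] with r e1 e2 hr u u1 u2 hu hu1 hu2 d1 d2
  have key := hK u u1 u2 hu hu1 hu2 d1 d2
  have hS := (h.decays_deriv hr).mono hκl.le
  have hS₀ := (h.decays_deriv hr₀).mono hκl.le
  set N := ∫ x, ⟪u x, u x⟫ with hN
  set D := ∫ x, ⟪u1 x, u1 x⟫
  set P := ∫ x, ⟪u x, hessW V d (F r x) r (u x)⟫ with hP
  set P₀ := ∫ x, ⟪u x, hessW V d (F r₀ x) r₀ (u x)⟫ with hP₀
  set s := ∫ x, ⟪deriv (F r) x, u x⟫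
  set s₀ := ∫ x, ⟪deriv (F r₀) x, u x⟫
  have hN0 : 0 ≤ N := integral_nonneg fun x => real_inner_self_nonneg
  have hD0 : 0 ≤ D := integral_nonneg fun x => real_inner_self_nonneg
  have iN : Integrable fun x => ⟪u x, u x⟫ := hu.integrable_inner hu
  have iP : Integrable fun x => ⟪u x, hessW V d (F r x) r (u x)⟫ :=
    hu.integrable_inner (h.decays_hess_apply hr hu)
  have iP₀ : Integrable fun x => ⟪u x, hessW V d (F r₀ x) r₀ (u x)⟫ :=
    hu.integrable_inner (h.decays_hess_apply hr₀ hu)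
  have hPP : |P₀ - P| ≤ min θ 1 * N := by
    rw [hP, hP₀, ← integral_sub iP₀ iP, hN, ← integral_const_mul, ← norm_eq_abs]
    refine norm_integral_le_of_norm_le (iN.const_mul _) (.of_forall fun x => ?_)
    rw [← inner_sub_right, real_inner_self_eq_norm_sq]
    refine (norm_inner_le_norm _ _).trans ?_
    have : ‖hessW V d (F r₀ x) r₀ (u x) - hessW V d (F r x) r (u x)‖ ≤ min θ 1 * ‖u x‖ := by
      rw [← sub_apply, ← norm_neg, ← neg_apply, neg_sub]
      exact ContinuousLinearMap.le_of_opNorm_le _ (e1 x) _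
    nlinarith [norm_nonneg (u x)]
  have hss : (s₀ - s) ^ 2 ≤ θ / 2 * N := by
    have hdS : Decays κ fun x => deriv (F r₀) x - deriv (F r) x := hS₀.sub hS
    have i1 := hdS.integrable_inner hdS
    have := integral_inner_sq_le i1 (hdS.integrable_inner hu) iN
    simp only [inner_sub_left _ _ (u _)] at this
    rw [integral_sub (hS₀.integrable_inner hu) (hS.integrable_inner hu)] at this
    refine this.trans (mul_mono_right ?_ hN0)
    have hle : ∫ x, ⟪deriv (F r₀) x - deriv (F r) x, deriv (F r₀) x - deriv (F r) x⟫ ≤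
        ∫ x, θ' * e(√l / 4 + √l / 4,x) := by
      refine integral_mono i1 ((integrable_exp_neg_abs (by positivity)).const_mul _) fun x => ?_
      show ⟪_, _⟫ ≤ _
      rw [real_inner_self_eq_norm_sq, norm_sub_rev]
      have e3 := e2 x
      calc ‖deriv (F r) x - deriv (F r₀) x‖ ^ 2 ≤ (θ' * e(√l / 4,x)) ^ 2 := by
            gcongr
        _ = θ' * θ' * (e(√l / 4,x) * e(√l / 4,x)) := by ring
        _ = θ' * θ' * e(√l / 4 + √l / 4,x) := by
            rw [← exp_add]; ring_nf
        _ ≤ θ' * 1 * e(√l / 4 + √l / 4,x) := by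
            gcongr; exact min_le_left _ _
        _ = _ := by rw [mul_one]
    refine hle.trans ?_
    rw [integral_const_mul]
    have h3 : θ' ≤ θ / (2 * (J + 1)) := min_le_right _ _
    calc θ' * J ≤ θ / (2 * (J + 1)) * (J + 1) := by gcongr; linarith
      _ = θ / 2 := by field_simp
  have hPP1 : P₀ - P ≤ θ * N := (le_abs_self _).trans (hPP.trans (by gcongr; exact min_le_left _ _))
  have hPP2 : P₀ - P ≤ N := by
    have := le_abs_self (P₀ - P)
    have h3 : min θ 1 * N ≤ 1 * N := by gcongr; exact min_le_right _ _
    linarith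
  have hs2 : s₀ ^ 2 ≤ 2 * s ^ 2 + θ * N := by nlinarith [sq_nonneg (s₀ - 2 * s)]
  have hPc : |P₀| ≤ c * N := by
    rw [hP₀, hN, ← integral_const_mul, ← norm_eq_abs]
    refine norm_integral_le_of_norm_le (iN.const_mul _) (.of_forall fun x => ?_)
    rw [real_inner_self_eq_norm_sq]
    refine (norm_inner_le_norm _ _).trans ?_
    have := ContinuousLinearMap.le_of_opNorm_le _ (hc x) (u x)
    nlinarith [norm_nonneg (u x)]
  have hpos : 0 ≤ D + P := by
    have := h.second_variation_nonneg hr hκ hu hu1 d1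
    rwa [integral_add (hu1.integrable_inner hu1) iP] at this
  set q := D + P + s ^ 2
  have hq0 : 0 ≤ q := by positivity
  have hKθ : K * θ ≤ 1 / 4 := by
    rw [hθ, mul_one_div, div_le_div_iff₀ (by positivity) (by norm_num)]; linarith
  have hN1 : N ≤ 4 * K * q := by
    have h1 : D + P₀ + s₀ ^ 2 ≤ 2 * q + 2 * (θ * N) := by nlinarith [sq_nonneg s]
    have h2 := key.trans (mul_mono_left h1 hK0)
    nlinarith
  have hD1 : D ≤ q + (c + 1) * N := by
    have := neg_abs_le P₀
    linarith [sq_nonneg s]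
  have h5 := mul_mono_left hN1 (by linarith : 0 ≤ c + 2)
  have h6 := mul_nonneg hK0 hq0
  have h7 := mul_nonneg hc0 hq0
  linarith

end ProfileFamily

/-! ### Superposition operators -/

section
variable {E E' : Type*} [NormedAddCommGroup E] [NormedSpace ℝ E] [ProperSpace E]
  [NormedAddCommGroup E'] [NormedSpace ℝ E']

/-- The superposition operator `q ↦ φ ∘ q`. -/
def superpose (φ : E → E') (q : ℝ →ᵇ E) : ℝ →ᵇ E' :=
  weight 0 fun x => φ (q x)

theorem decays_superpose {φ : E → E'} (hφ : Continuous φ) (q : ℝ →ᵇ E) :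
    Decays 0 fun x => φ (q x) := by
  obtain ⟨C, hC⟩ := (isCompact_closedBall (0 : E) ‖q‖).exists_bound_of_continuousOn hφ.continuousOn
  exact .of_bounded (hφ.comp q.continuous) fun x => hC _ (by simpa using q.norm_coe_le_norm x)

theorem superpose_apply {φ : E → E'} (hφ : Continuous φ) (q : ℝ →ᵇ E)
    (x : ℝ) : superpose φ q x = φ (q x) := by
  simp [superpose, weight_apply (decays_superpose hφ q)]

theorem continuous_superpose {φ : E → E'} (hφ : Continuous φ) :
    Continuous (superpose φ : (ℝ →ᵇ E) → _) := by
  rw [continuous_iff_continuousAt]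
  intro q
  rw [Metric.continuousAt_iff]
  intro η hη
  have huc := (isCompact_closedBall (0 : E) (‖q‖ + 1)).uniformContinuousOn_of_continuous
    hφ.continuousOn
  obtain ⟨δ, hδ, hu⟩ := Metric.uniformContinuousOn_iff.1 huc (η / 2) (half_pos hη)
  refine ⟨min δ 1, by positivity, fun {p} hp => ?_⟩
  refine lt_of_le_of_lt ((BoundedContinuousFunction.dist_le (half_pos hη).le).2 fun x => ?_)
    (half_lt_self hη)
  rw [superpose_apply hφ, superpose_apply hφ]
  have hx := (BoundedContinuousFunction.dist_coe_le_dist x).trans_lt hp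
  refine (hu _ ?_ _ ?_ (hx.trans_le (min_le_left _ _))).le
  · have h1 := hx.trans_le (min_le_right _ _)
    rw [dist_eq_norm] at h1
    have h2 := norm_le_norm_add_norm_sub (q x) (p x)
    rw [norm_sub_rev] at h1
    have h3 := q.norm_coe_le_norm x
    rw [mem_closedBall_zero_iff]; linarith
  · have h3 := q.norm_coe_le_norm x
    rw [mem_closedBall_zero_iff]; linarith

theorem hasFDerivAt_superpose {φ : E → E'} (hφ : ContDiff ℝ 1 φ) (q : ℝ →ᵇ E) :
    HasFDerivAt (superpose φ) (mulOp (superpose (fderiv ℝ φ) q)) q := by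
  have hc := hφ.continuous
  have hc' := hφ.continuous_fderiv (by norm_num)
  rw [hasFDerivAt_iff_isLittleO, Asymptotics.isLittleO_iff]
  intro η hη
  have huc := (isCompact_closedBall (0 : E) (‖q‖ + 1)).uniformContinuousOn_of_continuous
    hc'.continuousOn
  obtain ⟨δ, hδ, hu⟩ := Metric.uniformContinuousOn_iff.1 huc η hη
  filter_upwards [Metric.ball_mem_nhds q (show 0 < min δ 1 by positivity)] with p hp
  refine (BoundedContinuousFunction.norm_le (by positivity)).2 fun x => ?_
  have hx := (BoundedContinuousFunction.dist_coe_le_dist (f := p) (g := q) x).trans_lt hp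
  rw [dist_eq_norm] at hx
  have hq := q.norm_coe_le_norm x
  have e : (superpose φ p - superpose φ q - mulOp (superpose (fderiv ℝ φ) q) (p - q)) x =
      φ (p x) - φ (q x) - fderiv ℝ φ (q x) (p x - q x) := by
    simp only [BoundedContinuousFunction.coe_sub, Pi.sub_apply, mulOp_apply, superpose_apply hc,
      superpose_apply hc']
  rw [e]
  have hb : ∀ z ∈ Metric.closedBall (q x) ‖p x - q x‖, ‖fderiv ℝ φ z - fderiv ℝ φ (q x)‖ ≤ η := by
    intro z hz
    rw [mem_closedBall_iff_norm] at hz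
    rw [← dist_eq_norm]
    refine (hu _ ?_ _ ?_ ?_).le
    · have h1 := norm_le_norm_add_norm_sub (q x) z
      have h2 := hx.trans_le (min_le_right _ _)
      rw [norm_sub_rev] at h1
      rw [norm_sub_rev] at hz
      rw [mem_closedBall_zero_iff]
      rw [norm_sub_rev] at hz
      linarith [norm_sub_rev z (q x)]
    · rw [mem_closedBall_zero_iff]; linarith
    · rw [dist_eq_norm]; exact hz.trans_lt (hx.trans_le (min_le_left _ _))
  refine (Convex.norm_image_sub_le_of_norm_fderiv_le' (𝕜 := ℝ)
    (s := Metric.closedBall (q x) ‖p x - q x‖)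
    (fun z _ => hφ.differentiable (by norm_num) z) hb (convex_closedBall _ _)
    (Metric.mem_closedBall_self (norm_nonneg _)) (by rw [mem_closedBall_iff_norm])).trans ?_
  gcongr
  exact (p - q).norm_coe_le_norm x

theorem contDiff_superpose {φ : E → E'} (hφ : ContDiff ℝ 1 φ) :
    ContDiff ℝ 1 (superpose φ : (ℝ →ᵇ E) → _) :=
  contDiff_one_iff_hasFDerivAt.2 ⟨_, mulOp.continuous.comp
    (continuous_superpose (hφ.continuous_fderiv (by norm_num))), hasFDerivAt_superpose hφ⟩

end

/-- Multiplication by a scalar function. -/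
def scaleOp (m : ℝ → ℝ) : WeightedEnd :=
  mulOp (weight 0 fun x => m x • ContinuousLinearMap.id ℝ Plane)

theorem scaleOp_apply {m : ℝ → ℝ} (hm : Decays 0 m) (u : Weighted) (x : ℝ) :
    scaleOp m u x = m x • u x := by
  obtain ⟨C, hC0, hC⟩ := hm.exists_bound
  have hd : Decays 0 fun x => m x • ContinuousLinearMap.id ℝ Plane :=
    .of_bound (C := C) (hm.continuous.smul continuous_const) fun x => by
      rw [norm_smul]
      exact (mul_le_of_le_one_right (norm_nonneg _) ContinuousLinearMap.norm_id_le).trans (hC x)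
  rw [scaleOp, mulOp_apply, weight_zero_apply hd]
  rfl

theorem contDiffAt_one_of_hasDerivAt {f f' : ℝ → E} (hf : ∀ᶠ s in 𝓝 r, HasDerivAt f (f' s) s)
    (hc : ∀ᶠ s in 𝓝 r, ContinuousAt f' s) : ContDiffAt ℝ 1 f r := by
  refine contDiffAt_one_iff.2 ⟨fun s => ContinuousLinearMap.toSpanSingleton ℝ (f' s),
    {s | HasDerivAt f (f' s) s ∧ ContinuousAt f' s}, hf.and hc, fun s hs => ?_,
    fun s hs => hs.1.hasFDerivAt⟩
  exact ((ContinuousLinearMap.toSpanSingletonCLE (𝕜 := ℝ) (E := E)).continuous.continuousAt.comp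
    hs.2).continuousWithinAt

/-! ### Dependence of the profiles on the radius -/

/-- `F r - F r₀` in the weighted space. -/
def profileDiff (F : ℝ → ℝ → Plane) (κ r₀ r : ℝ) : Weighted := weight κ fun x => F r x - F r₀ x

/-- `∂ₓ F` in the weighted space. -/
def profileSlope (F : ℝ → ℝ → Plane) (κ r : ℝ) : Weighted := weight κ (deriv (F r))

/-- `∂ₓ² F = w(F, r)` in the weighted space. -/
def profileForce (V : Plane → ℝ) (d : ℝ) (F : ℝ → ℝ → Plane) (κ r : ℝ) : Weighted :=
  weight κ fun x => force V d (F r x) r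

/-- The second component of `F` in the weighted space. -/
def profileTail (F : ℝ → ℝ → Plane) (κ r : ℝ) : Weighted := weight κ fun x => coordProj 1 (F r x)

/-- `Hess W` along the profile, relative to the vacuum at `r₀`. -/
def profileHess (V : Plane → ℝ) (d : ℝ) (F : ℝ → ℝ → Plane) (r₀ r : ℝ) : ℝ →ᵇ PlaneEnd :=
  weight 0 fun x => hessW V d (F r x) r - hessW V d vacuum r₀

theorem hasDerivAt_inv_sq (d : ℝ) (hr : r ≠ 0) :
    HasDerivAt (fun r : ℝ => d ^ 2 / r ^ 2) (-(2 * d ^ 2 / r ^ 3)) r := by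
  have h1 := ((hasDerivAt_pow 2 r).fun_inv (pow_ne_zero 2 hr)).const_mul (d ^ 2)
  refine (h1.congr_of_eventuallyEq (.of_forall fun s => ?_)).congr_deriv ?_
  · simp [div_eq_mul_inv]
  · field_simp; ring

section
variable {Z : Type*} [NormedAddCommGroup Z] [NormedSpace ℝ Z]

theorem continuousAt_one_add_comp {f : ℝ → Z →L[ℝ] Z} (G K : Z →L[ℝ] Z)
    (hf : ContinuousAt f r) : ContinuousAt (fun r => 1 + G.comp (f r + K)) r :=
  continuousAt_const.add (continuousAt_const.clm_comp (hf.add continuousAt_const))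

theorem eventually_isUnit [CompleteSpace Z] {f : ℝ → Z →L[ℝ] Z} (hf : ContinuousAt f r)
    (hu : IsUnit (f r)) : ∀ᶠ s in 𝓝 r, IsUnit (f s) := by
  obtain ⟨T, hT⟩ := hu
  have := Units.nhds T
  rw [hT] at this
  exact hf.eventually this

end

namespace ProfileFamily

variable (h : ProfileFamily V d I F l)
include h

theorem decays_sub {r' : ℝ} (hr : r ∈ I) (hr' : r' ∈ I) :
    Decays (√l / 2) fun x => F r' x - F r x := by
  obtain ⟨C, -, hC⟩ := h.eventually_decay hr
  obtain ⟨C', -, hC'⟩ := h.eventually_decay hr'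
  refine .of_bound (C := C' + C) ((h.continuous hr').sub (h.continuous hr)) fun x => ?_
  refine forall_abs_of_nonneg (fun x => ‖F r' x - F r x‖) _ (fun x => by
    rw [h.flip hr, h.flip hr', ← map_sub, isFlip_flipφ.norm_map]) le_rfl (fun x hx => ?_) x
  have := norm_sub_le (F r' x - vacuum) (F r x - vacuum)
  rw [sub_sub_sub_cancel_right] at this
  rw [add_mul]
  exact this.trans (add_le_add (hC'.self_of_nhds x hx) (hC.self_of_nhds x hx))

theorem decays_zero_hess_sub' (hr : r ∈ I) (r₀ : ℝ) :
    Decays 0 fun x => hessW V d (F r x) r - hessW V d vacuum r₀ := by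
  obtain ⟨c, hc⟩ := h.exists_norm_hess_le hr
  refine .of_bounded (C := c + ‖hessW V d vacuum r₀‖) ((h.continuous_hess hr).sub continuous_const)
    fun x => (norm_sub_le _ _).trans ?_
  linarith [hc x]

theorem integral_inner_deriv_sub {r' r'' : ℝ} (hr : r ∈ I) (hr' : r' ∈ I) (hr'' : r'' ∈ I) :
    ∫ x, ⟪deriv (F r) x, F r' x - F r'' x⟫ = 0 := by
  have e : ∀ x, ⟪deriv (F r) (-x), F r' (-x) - F r'' (-x)⟫ =
      -⟪deriv (F r) x, F r' x - F r'' x⟫ := fun x => by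
    rw [h.deriv_flip hr, h.flip hr', h.flip hr'', ← map_sub, inner_neg_left,
      isFlip_flipφ.inner_left, isFlip_flipφ.involutive]
  have := integral_neg_eq_self (fun x => ⟪deriv (F r) x, F r' x - F r'' x⟫) volume
  simp only [e] at this
  rw [integral_neg] at this
  linarith

theorem profileDiff_sub {r' : ℝ} (hκl : κ < √l / 2) (hr₀ : r₀ ∈ I) (hr : r ∈ I)
    (hr' : r' ∈ I) : profileDiff F κ r₀ r' - profileDiff F κ r₀ r = profileDiff F κ r r' := by
  rw [profileDiff, profileDiff, profileDiff, ← weight_sub ((h.decays_sub hr₀ hr').mono hκl.le)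
    ((h.decays_sub hr₀ hr).mono hκl.le)]
  simp only [sub_sub_sub_cancel_right]

theorem profileTail_sub {r' : ℝ} (hκl : κ < √l / 2) (hr : r ∈ I) (hr' : r' ∈ I) :
    profileTail F κ r' - profileTail F κ r = postOp (coordProj 1) (profileDiff F κ r r') := by
  apply unweight_injective κ
  rw [unweight_postOp, unweight_sub, profileTail, profileTail, profileDiff,
    unweight_weight ((h.decays_coordProj hr').mono hκl.le),
    unweight_weight ((h.decays_coordProj hr).mono hκl.le),
    unweight_weight ((h.decays_sub hr hr').mono hκl.le)]
  simp only [map_sub]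

theorem tendsto_profileDiff (hκ : 0 < κ) (hκl : κ < √l / 2) (hr : r ∈ I) :
    Tendsto (profileDiff F κ r) (𝓝 r) (𝓝 0) := by
  rw [Metric.tendsto_nhds]
  intro η hη
  filter_upwards [h.eventually_sub_small hr hκ hκl (half_pos hη)] with r' hr'
  rw [dist_zero_right]
  exact (norm_weight_le (half_pos hη).le hr').trans_lt (half_lt_self hη)

theorem continuousAt_profileTail (hκ : 0 < κ) (hκl : κ < √l / 2) (hr : r ∈ I) :
    ContinuousAt (profileTail F κ) r := by
  have h1 := ((postOp (coordProj 1)).continuous.tendsto _).comp (h.tendsto_profileDiff hκ hκl hr)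
  rw [map_zero] at h1
  have h2 := h1.add_const (profileTail F κ r)
  rw [zero_add] at h2
  refine h2.congr' ?_
  filter_upwards [h.isOpen.mem_nhds hr] with r' hr'
  rw [Function.comp_apply, ← h.profileTail_sub hκl hr hr', sub_add_cancel]

theorem continuousAt_profileHess (r₀ : ℝ) (hr : r ∈ I) : ContinuousAt (profileHess V d F r₀) r := by
  rw [Metric.continuousAt_iff']
  intro η hη
  filter_upwards [h.eventually_hess_sub_small hr (half_pos hη), h.isOpen.mem_nhds hr] with r' e hr'
  refine lt_of_le_of_lt ((BoundedContinuousFunction.dist_le (half_pos hη).le).2 fun x => ?_)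
    (half_lt_self hη)
  rw [profileHess, profileHess, weight_zero_apply (h.decays_zero_hess_sub' hr' r₀),
    weight_zero_apply (h.decays_zero_hess_sub' hr r₀), dist_eq_norm, sub_sub_sub_cancel_right]
  exact e x

/-- The Taylor remainder of the force along the family. -/
def remainder (_ : ProfileFamily V d I F l) (κ r r' : ℝ) : Weighted :=
  weight κ fun x => gradient V (F r' x) - gradient V (F r x) - ∇²V (F r x) (F r' x - F r x)

theorem exists_remainder (hκ : 0 < κ) (hκl : κ < √l / 2) : ∃ C, 0 ≤ C ∧
    ∀ r ∈ I, ∀ r' ∈ I, Decays κ (fun x => gradient V (F r' x) - gradient V (F r x)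
      - ∇²V (F r x) (F r' x - F r x)) ∧
      ‖h.remainder κ r r'‖ ≤ C * ‖profileDiff F κ r r'‖ ^ 2 := by
  obtain ⟨C, hC⟩ := exists_taylorBound h.potential 2
  have hC0 := hC.nonneg
  refine ⟨C, hC0, fun r hr r' hr' => ?_⟩
  have hb : ∀ x, ‖gradient V (F r' x) - gradient V (F r x) - ∇²V (F r x) (F r' x - F r x)‖ ≤
      C * ‖profileDiff F κ r r'‖ ^ 2 * e(κ,x) := fun x => by
    refine (hC.grad_taylor _ _ (h.norm_le hr x) (h.norm_le hr' x)).trans ?_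
    have e := norm_unweight_le κ (profileDiff F κ r r') x
    rw [profileDiff, unweight_weight ((h.decays_sub hr hr').mono hκl.le)] at e
    rw [mul_assoc]
    refine mul_mono_left ?_ hC0
    calc ‖F r' x - F r x‖ ^ 2 ≤ (‖profileDiff F κ r r'‖ * e(κ,x)) ^ 2 := by
          gcongr; exact e
      _ = ‖profileDiff F κ r r'‖ ^ 2 * (e(κ,x) * e(κ,x)) := by ring
      _ ≤ ‖profileDiff F κ r r'‖ ^ 2 * (1 * e(κ,x)) := by
          gcongr
          exact weight_le_one hκ.le x
      _ = _ := by rw [one_mul]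
  refine ⟨.of_bound ?_ hb, norm_weight_le (by positivity) hb⟩
  have hg := h.potential.contDiff_gradient.continuous
  exact ((hg.comp (h.continuous hr')).sub (hg.comp (h.continuous hr))).sub
    ((h.potential.contDiff_hess.continuous.comp (h.continuous hr)).clm_apply
      ((h.continuous hr').sub (h.continuous hr)))

theorem force_sub {r' : ℝ} (x : ℝ) :
    force V d (F r' x) r' - force V d (F r x) r = hessW V d (F r x) r (F r' x - F r x)
      + (gradient V (F r' x) - gradient V (F r x) - ∇²V (F r x) (F r' x - F r x))
      + (d ^ 2 / r' ^ 2 - d ^ 2 / r ^ 2) • coordProj 1 (F r' x) := by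
  rw [force_eq h.potential, force_eq h.potential, hessW_eq h.potential]
  simp only [FunLike.coe_add, Pi.add_apply, FunLike.coe_smul, Pi.smul_apply, map_sub]
  module

theorem profileForce_sub {r' : ℝ} (hκ : 0 < κ) (hκl : κ < √l / 2)
    (hr : r ∈ I) (hr' : r' ∈ I) : profileForce V d F κ r' - profileForce V d F κ r =
      mulOp (profileHess V d F r₀ r) (profileDiff F κ r r')
      + postOp (hessW V d vacuum r₀) (profileDiff F κ r r')
      + (h.remainder κ r r' + (d ^ 2 / r' ^ 2 - d ^ 2 / r ^ 2) • profileTail F κ r') := by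
  obtain ⟨C, -, hC⟩ := h.exists_remainder hκ hκl
  apply unweight_injective κ
  have e1 := (h.decays_sub hr hr').mono hκl.le
  simp only [unweight_sub, unweight_add, unweight_smul, unweight_postOp, unweight_mulOp]
  rw [profileForce, profileForce, profileDiff, remainder, profileTail, profileHess,
    unweight_weight ((h.decays_force hr).mono hκl.le),
    unweight_weight ((h.decays_force hr').mono hκl.le), unweight_weight e1,
    unweight_weight (hC r hr r' hr').1, unweight_weight ((h.decays_coordProj hr').mono hκl.le)]
  ext1 x
  rw [h.force_sub, weight_zero_apply (h.decays_zero_hess_sub' hr r₀), FunLike.coe_sub, Pi.sub_apply]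
  module

/-- The linearization based at `r₀`, along the family. -/
def linearizationAt (_ : ProfileFamily V d I F l) {κ : ℝ} (hκ : 0 < κ)
    (G : WeightedEnd) (r₀ r : ℝ) : WeightedEnd :=
  perturbedOp hκ G (profileHess V d F r₀ r) (profileSlope F κ r₀)

theorem linearizationAt_profileDiff {r' : ℝ} (hκ : 0 < κ) (hκl : κ < √l / 2)
    (hr₀ : r₀ ∈ I) (hr : r ∈ I) (hr' : r' ∈ I) {G G' : WeightedEnd}
    (hG : IsGreen κ (hessW V d vacuum r₀) G G') :
    h.linearizationAt hκ G r₀ r (profileDiff F κ r r') =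
      G (-(h.remainder κ r r' + (d ^ 2 / r' ^ 2 - d ^ 2 / r ^ 2) • profileTail F κ r')) := by
  obtain ⟨C, -, hC⟩ := h.exists_remainder hκ hκl
  have hS := (h.decays_deriv hr₀).mono hκl.le
  have e1 := (h.decays_sub hr hr').mono hκl.le
  refine hG.perturbedOp_weight hκ e1
    (fun x => (h.hasDerivAt hr' x).sub (h.hasDerivAt hr x)) fun x =>
      ((h.hasDerivAt_deriv hr' x).sub (h.hasDerivAt_deriv hr x)).congr_deriv ?_
  have hp : pairing κ hκ (profileSlope F κ r₀) (weight κ fun x => F r' x - F r x) = 0 := by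
    rw [profileSlope, pairing_weight hκ hS e1, h.integral_inner_deriv_sub hr₀ hr' hr]
  simp only [hp, unweight_neg, unweight_add, unweight_smul]
  rw [remainder, profileTail, profileHess, unweight_weight (hC r hr r' hr').1,
    unweight_weight ((h.decays_coordProj hr').mono hκl.le), h.force_sub,
    weight_zero_apply (h.decays_zero_hess_sub' hr r₀), FunLike.coe_sub, Pi.sub_apply]
  module

theorem continuousAt_linearizationAt (hκ : 0 < κ) (hr : r ∈ I)
    (G : WeightedEnd) : ContinuousAt (h.linearizationAt hκ G r₀) r := by
  have h1 : ContinuousAt (fun r => mulOp (profileHess V d F r₀ r) : ℝ → WeightedEnd) r :=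
    mulOp.continuous.continuousAt.comp (h.continuousAt_profileHess r₀ hr)
  exact continuousAt_one_add_comp G _ h1

theorem eventually_isUnit_linearizationAt (hκ : 0 < κ) (hκl : κ < √l / 2)
    (hr₀ : r₀ ∈ I) {G G' : WeightedEnd}
    (hG : IsGreen κ (hessW V d vacuum r₀) G G') :
    ∀ᶠ r in 𝓝 r₀, r ∈ I ∧ IsUnit (h.linearizationAt hκ G r₀ r) := by
  have hI : ∀ᶠ r in 𝓝 r₀, r ∈ I := h.isOpen.mem_nhds hr₀
  exact hI.and (eventually_isUnit (h.continuousAt_linearizationAt hκ hr₀ G)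
    (h.isUnit_linearization hr₀ hκ hκl hG))

/-- First order expansion of the family at `r`, given that the linearization is invertible. -/
theorem isLittleO_remainder (hκ : 0 < κ) (hκl : κ < √l / 2)
    (hr₀ : r₀ ∈ I) (hr : r ∈ I) {G G' : WeightedEnd}
    (hG : IsGreen κ (hessW V d vacuum r₀) G G') (hu : IsUnit (h.linearizationAt hκ G r₀ r)) :
    (fun r' => h.remainder κ r r' + (d ^ 2 / r' ^ 2 - d ^ 2 / r ^ 2) •
      (profileTail F κ r' - profileTail F κ r)) =o[𝓝 r] fun r' => r' - r := by
  obtain ⟨C, hC0, hC⟩ := h.exists_remainder hκ hκl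
  set W := (Ring.inverse (h.linearizationAt hκ G r₀ r)).comp G with hW
  have hWeq : ∀ r' ∈ I, profileDiff F κ r r' =
      W (-(h.remainder κ r r' + (d ^ 2 / r' ^ 2 - d ^ 2 / r ^ 2) • profileTail F κ r')) :=
    fun r' hr' => by
      rw [hW, ContinuousLinearMap.comp_apply, ← h.linearizationAt_profileDiff hκ hκl hr₀ hr hr' hG]
      have := DFunLike.congr_fun (Ring.inverse_mul_cancel _ hu) (profileDiff F κ r r')
      exact this.symm
  have hI : ∀ᶠ r' in 𝓝 r, r' ∈ I := h.isOpen.mem_nhds hr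
  have ht := h.tendsto_profileDiff hκ hκl hr
  have hc := (hasDerivAt_inv_sq d (h.pos r hr).ne').isBigO_sub
  have hO : profileDiff F κ r =O[𝓝 r] fun r' => d ^ 2 / r' ^ 2 - d ^ 2 / r ^ 2 := by
    refine Asymptotics.IsBigO.of_bound (2 * (‖W‖ * (‖profileTail F κ r‖ + 1))) ?_
    have e1 := ht.norm.eventually (gt_mem_nhds (show ‖(0 : Weighted)‖ <
      1 / (2 * (‖W‖ * C + 1)) by rw [norm_zero]; positivity))
    have e2 := (h.continuousAt_profileTail hκ hκl hr).norm.eventually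
      (gt_mem_nhds (lt_add_one ‖profileTail F κ r‖))
    filter_upwards [hI, e1, e2] with r' hr' h1 h2
    have h3 : ‖profileDiff F κ r r'‖ ≤ ‖W‖ * (C * ‖profileDiff F κ r r'‖ ^ 2 +
        ‖d ^ 2 / r' ^ 2 - d ^ 2 / r ^ 2‖ * (‖profileTail F κ r‖ + 1)) := by
      conv_lhs => rw [hWeq r' hr']
      refine (W.le_opNorm _).trans (mul_mono_left ?_ (norm_nonneg W))
      rw [norm_neg]
      refine (norm_add_le _ _).trans (add_le_add (hC r hr r' hr').2 ?_)
      rw [norm_smul]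
      exact mul_mono_left h2.le (norm_nonneg _)
    set D := ‖profileDiff F κ r r'‖
    have h4 : ‖W‖ * C * D ≤ 1 / 2 := by
      have h5 : (‖W‖ * C + 1) * D ≤ (‖W‖ * C + 1) * (1 / (2 * (‖W‖ * C + 1))) := by gcongr
      have h6 : (‖W‖ * C + 1) * (1 / (2 * (‖W‖ * C + 1))) = 1 / 2 := by field_simp
      have h7 : 0 ≤ D := norm_nonneg _
      linarith
    have h8 : 0 ≤ D := norm_nonneg _
    nlinarith
  have hO2 := hO.trans hc
  have ho1 : profileDiff F κ r =o[𝓝 r] fun _ => (1 : ℝ) := (Asymptotics.isLittleO_one_iff ℝ).2 ht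
  refine Asymptotics.IsLittleO.add ?_ ?_
  · have e1 : h.remainder κ r =O[𝓝 r] fun r' => ‖profileDiff F κ r r'‖ * ‖profileDiff F κ r r'‖ := by
      refine Asymptotics.IsBigO.of_bound C ?_
      filter_upwards [hI] with r' hr'
      rw [norm_mul, norm_norm, ← sq]
      exact (hC r hr r' hr').2
    refine e1.trans_isLittleO ?_
    simpa using hO2.norm_left.mul_isLittleO ho1.norm_left
  · have e2 : (fun r' => profileTail F κ r' - profileTail F κ r) =o[𝓝 r] fun _ => (1 : ℝ) := by
      rw [Asymptotics.isLittleO_one_iff]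
      have := (h.continuousAt_profileTail hκ hκl hr).tendsto.sub_const (profileTail F κ r)
      rwa [sub_self] at this
    simpa using hc.smul_isLittleO e2

end ProfileFamily

theorem contDiffAt_one_add_comp {Z : Type*} [NormedAddCommGroup Z] [NormedSpace ℝ Z]
    {f g : ℝ → Z →L[ℝ] Z} (G : Z →L[ℝ] Z) (hf : ContDiffAt ℝ 1 f r)
    (hg : ContDiffAt ℝ 1 g r) : ContDiffAt ℝ 1 (fun r => 1 + G.comp (f r + g r)) r :=
  contDiffAt_const.add (contDiffAt_const.clm_comp (hf.add hg))

theorem contDiffAt_inverse_apply {Z : Type*} [NormedAddCommGroup Z] [NormedSpace ℝ Z]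
    [CompleteSpace Z] {f : ℝ → Z →L[ℝ] Z} {g : ℝ → Z} (hf : ContDiffAt ℝ 1 f r)
    (hu : IsUnit (f r)) (hg : ContDiffAt ℝ 1 g r) :
    ContDiffAt ℝ 1 (fun r => Ring.inverse (f r) (g r)) r := by
  obtain ⟨T, hT⟩ := hu
  have h1 : ContDiffAt ℝ 1 (Ring.inverse : (Z →L[ℝ] Z) → _) (f r) := by
    rw [← hT]; exact contDiffAt_ringInverse ℝ T
  exact (h1.comp r hf).clm_apply hg

theorem continuousAt_inverse_apply {Z : Type*} [NormedAddCommGroup Z] [NormedSpace ℝ Z]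
    [CompleteSpace Z] {f : ℝ → Z →L[ℝ] Z} {g : ℝ → Z} (hf : ContinuousAt f r)
    (hu : IsUnit (f r)) (hg : ContinuousAt g r) :
    ContinuousAt (fun r => Ring.inverse (f r) (g r)) r := by
  obtain ⟨T, hT⟩ := hu
  have h1 : ContinuousAt (Ring.inverse : (Z →L[ℝ] Z) → _) (f r) := by
    rw [← hT]; exact NormedRing.inverse_continuousAt T
  exact (ContinuousAt.comp (f := f) h1 hf).clm_apply hg

theorem contDiffAt_mulOp {A : ℝ → ℝ →ᵇ PlaneEnd} (hA : ContDiffAt ℝ 1 A r) :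
    ContDiffAt ℝ 1 (fun r => mulOp (A r) : ℝ → WeightedEnd) r := by
  fun_prop

theorem decays_exp_neg_abs : Decays κ fun x : ℝ => e(κ,x) :=
  .of_bound (C := 1) (by fun_prop) fun x => by
    rw [one_mul, norm_eq_abs, abs_of_pos (exp_pos _)]

theorem scaleOp_exp (hκ : 0 ≤ κ) (u : Weighted) (x : ℝ) :
    scaleOp (fun x => e(κ,x)) u x = unweight κ u x :=
  scaleOp_apply (decays_exp_neg_abs.mono hκ) u x

namespace ProfileFamily

variable (h : ProfileFamily V d I F l)
include h

theorem hasDerivAt_remainder (hκ : 0 < κ) (hκl : κ < √l / 2)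
    (hr₀ : r₀ ∈ I) (hr : r ∈ I) {G G' : WeightedEnd}
    (hG : IsGreen κ (hessW V d vacuum r₀) G G') (hu : IsUnit (h.linearizationAt hκ G r₀ r)) :
    HasDerivAt (fun r' => h.remainder κ r r' + (d ^ 2 / r' ^ 2 - d ^ 2 / r ^ 2) •
      profileTail F κ r') (-(2 * d ^ 2 / r ^ 3) • profileTail F κ r) r := by
  obtain ⟨C, -, hC⟩ := h.exists_remainder hκ hκl
  have h1 := h.isLittleO_remainder hκ hκl hr₀ hr hG hu
  have h0 : h.remainder κ r r = 0 := by
    have := (hC r hr r hr).2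
    rw [← h.profileDiff_sub hκl hr hr hr, sub_self, norm_zero] at this
    simpa using this
  have h2 : HasDerivAt (fun r' => h.remainder κ r r' + (d ^ 2 / r' ^ 2 - d ^ 2 / r ^ 2) •
      (profileTail F κ r' - profileTail F κ r)) 0 r := by
    rw [hasDerivAt_iff_isLittleO]
    simpa [h0] using h1
  have h3 := (((hasDerivAt_inv_sq d (h.pos r hr).ne').sub_const (d ^ 2 / r ^ 2)).smul_const
    (profileTail F κ r))
  refine ((h2.add h3).congr_of_eventuallyEq (.of_forall fun r' => ?_)).congr_deriv (zero_add _)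
  simp only [Pi.add_apply]
  module

/-- The radial derivative of the profiles, in terms of the linearization. -/
def slopeAt {κ : ℝ} (hκ : 0 < κ) (G : WeightedEnd) (r₀ r : ℝ) : Weighted :=
  Ring.inverse (h.linearizationAt hκ G r₀ r) (G ((2 * d ^ 2 / r ^ 3) • profileTail F κ r))

theorem hasDerivAt_profileDiff_of_isUnit (hκ : 0 < κ) (hκl : κ < √l / 2)
    (hr₀ : r₀ ∈ I) (hr : r ∈ I) {G G' : WeightedEnd}
    (hG : IsGreen κ (hessW V d vacuum r₀) G G') (hu : IsUnit (h.linearizationAt hκ G r₀ r)) :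
    HasDerivAt (profileDiff F κ r₀) (h.slopeAt hκ G r₀ r) r := by
  set W := (Ring.inverse (h.linearizationAt hκ G r₀ r)).comp G
  have h1 := (W.hasFDerivAt.comp_hasDerivAt r
    (h.hasDerivAt_remainder hκ hκl hr₀ hr hG hu).neg).const_add (profileDiff F κ r₀ r)
  refine (h1.congr_of_eventuallyEq ?_).congr_deriv ?_
  · filter_upwards [h.isOpen.mem_nhds hr] with r' hr'
    rw [← sub_eq_iff_eq_add', h.profileDiff_sub hκl hr₀ hr hr']
    have := DFunLike.congr_fun (Ring.inverse_mul_cancel _ hu) (profileDiff F κ r r')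
    rw [mul_apply_eq_comp, h.linearizationAt_profileDiff hκ hκl hr₀ hr hr' hG] at this
    exact this.symm
  · have e : -(-(2 * d ^ 2 / r ^ 3) • profileTail F κ r) =
        (2 * d ^ 2 / r ^ 3) • profileTail F κ r := by module
    rw [e]; rfl

theorem hasDerivAt_profileForce_of_isUnit (hκ : 0 < κ) (hκl : κ < √l / 2)
    (hr₀ : r₀ ∈ I) (hr : r ∈ I) {G G' : WeightedEnd}
    (hG : IsGreen κ (hessW V d vacuum r₀) G G') (hu : IsUnit (h.linearizationAt hκ G r₀ r)) :
    HasDerivAt (profileForce V d F κ) (mulOp (profileHess V d F r₀ r) (h.slopeAt hκ G r₀ r)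
      + postOp (hessW V d vacuum r₀) (h.slopeAt hκ G r₀ r)
      + -(2 * d ^ 2 / r ^ 3) • profileTail F κ r) r := by
  have h0 := (h.hasDerivAt_profileDiff_of_isUnit hκ hκl hr₀ hr hG hu).sub_const
    (profileDiff F κ r₀ r)
  have h1 := (((mulOp (profileHess V d F r₀ r)).hasFDerivAt.comp_hasDerivAt r h0).add
    ((postOp (hessW V d vacuum r₀)).hasFDerivAt.comp_hasDerivAt r h0)).add
    (h.hasDerivAt_remainder hκ hκl hr₀ hr hG hu)
  refine (h1.const_add (profileForce V d F κ r)).congr_of_eventuallyEq ?_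
  filter_upwards [h.isOpen.mem_nhds hr] with r' hr'
  rw [← sub_eq_iff_eq_add', h.profileForce_sub (r₀ := r₀) hκ hκl hr hr']
  simp only [Pi.add_apply, Function.comp_apply, h.profileDiff_sub hκl hr₀ hr hr']

theorem profileDiff_eq_green (hκ : 0 < κ) (hκl : κ < √l / 2)
    (hr₀ : r₀ ∈ I) (hr : r ∈ I) {G G' : WeightedEnd}
    (hG : IsGreen κ (hessW V d vacuum r₀) G G') :
    profileDiff F κ r₀ r = G (postOp (hessW V d vacuum r₀) (profileDiff F κ r₀ r) -
      (profileForce V d F κ r - profileForce V d F κ r₀)) ∧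
    profileSlope F κ r = profileSlope F κ r₀ +
      G' (postOp (hessW V d vacuum r₀) (profileDiff F κ r₀ r) -
      (profileForce V d F κ r - profileForce V d F κ r₀)) := by
  have e0 := (h.decays_sub hr₀ hr).mono hκl.le
  have eT := (h.decays_force hr).mono hκl.le
  have eT₀ := (h.decays_force hr₀).mono hκl.le
  obtain ⟨c, hc⟩ := e0.bounded hκ.le
  have e1 : Decays κ fun x => hessW V d vacuum r₀ (F r x - F r₀ x) -
      (force V d (F r x) r - force V d (F r₀ x) r₀) := (e0.clm _).sub (eT.sub eT₀)
  have e2 : weight κ (fun x => hessW V d vacuum r₀ (F r x - F r₀ x) -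
      (force V d (F r x) r - force V d (F r₀ x) r₀)) =
      postOp (hessW V d vacuum r₀) (profileDiff F κ r₀ r) -
      (profileForce V d F κ r - profileForce V d F κ r₀) := by
    apply unweight_injective κ
    simp only [unweight_sub, unweight_postOp]
    rw [unweight_weight e1, profileDiff, profileForce, profileForce, unweight_weight e0,
      unweight_weight eT, unweight_weight eT₀]
  obtain ⟨k1, k2⟩ := hG.decays hc (fun x => (h.hasDerivAt hr x).sub (h.hasDerivAt hr₀ x))
    (fun x => (h.hasDerivAt_deriv hr x).sub (h.hasDerivAt_deriv hr₀ x)) e1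
  rw [e2] at k1 k2
  constructor
  · apply unweight_injective κ
    rw [← k1, profileDiff, unweight_weight e0]
  · apply unweight_injective κ
    rw [unweight_add, ← k2, profileSlope, profileSlope,
      unweight_weight ((h.decays_deriv hr).mono hκl.le),
      unweight_weight ((h.decays_deriv hr₀).mono hκl.le)]
    ext1 x
    exact (add_sub_cancel _ _).symm

theorem contDiffAt_profileTail_of (hκl : κ < √l / 2) (hr₀ : r₀ ∈ I)
    (hU : ContDiffAt ℝ 1 (profileDiff F κ r₀) r₀) : ContDiffAt ℝ 1 (profileTail F κ) r₀ := by
  have h1 : ContDiffAt ℝ 1 (fun r => profileTail F κ r₀ +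
      postOp (coordProj 1) (profileDiff F κ r₀ r)) r₀ :=
    contDiffAt_const.add ((postOp (coordProj 1)).contDiff.contDiffAt.comp r₀ hU)
  refine h1.congr_of_eventuallyEq ?_
  filter_upwards [h.isOpen.mem_nhds hr₀] with r hr
  rw [← h.profileTail_sub hκl hr₀ hr, add_sub_cancel]

theorem contDiffAt_profileHess_of (hκ : 0 < κ) (hκl : κ < √l / 2) (hr₀ : r₀ ∈ I)
    (hU : ContDiffAt ℝ 1 (profileDiff F κ r₀) r₀) :
    ContDiffAt ℝ 1 (profileHess V d F r₀) r₀ := by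
  have hV := h.potential
  have hF0 : Decays 0 (F r₀) := .of_bounded (h.continuous hr₀) (h.norm_le hr₀)
  have h1 : ContDiffAt ℝ 1 (fun r => weight 0 (F r₀) +
      scaleOp (fun x => e(κ,x)) (profileDiff F κ r₀ r)) r₀ :=
    contDiffAt_const.add ((scaleOp _).contDiff.contDiffAt.comp r₀ hU)
  have h2 : ContDiffAt ℝ 1 (fun r : ℝ => d ^ 2 / r ^ 2) r₀ :=
    contDiffAt_const.div (contDiffAt_id.pow 2) (pow_ne_zero 2 (h.pos r₀ hr₀).ne')
  have h3 : ContDiffAt ℝ 1 (fun r => superpose (∇²V) (weight 0 (F r₀) +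
      scaleOp (fun x => e(κ,x)) (profileDiff F κ r₀ r)) +
      (d ^ 2 / r ^ 2) • BoundedContinuousFunction.const ℝ (coordProj 1) -
      BoundedContinuousFunction.const ℝ (hessW V d vacuum r₀)) r₀ :=
    (((contDiff_superpose hV.contDiff_hess).contDiffAt.comp r₀ h1).add
      (h2.smul contDiffAt_const)).sub contDiffAt_const
  refine h3.congr_of_eventuallyEq ?_
  filter_upwards [h.isOpen.mem_nhds hr₀] with r hr
  ext1 x
  rw [profileHess, weight_zero_apply (h.decays_zero_hess_sub' hr r₀), hessW_eq hV]
  simp only [BoundedContinuousFunction.coe_sub, BoundedContinuousFunction.coe_add, Pi.sub_apply,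
    Pi.add_apply, superpose_apply hV.contDiff_hess.continuous, weight_zero_apply hF0,
    scaleOp_exp hκ.le, BoundedContinuousFunction.coe_smul, BoundedContinuousFunction.const_apply]
  rw [profileDiff, unweight_weight ((h.decays_sub hr₀ hr).mono hκl.le), add_sub_cancel]

/-- Regularity in the radius, in the weighted space. -/
theorem regularity (hκ : 0 < κ) (hκl : κ < √l / 2) (hr₀ : r₀ ∈ I) :
    ContDiffAt ℝ 1 (profileDiff F κ r₀) r₀ ∧ ContDiffAt ℝ 1 (profileSlope F κ) r₀ ∧
    ContDiffAt ℝ 1 (deriv (profileSlope F κ)) r₀ ∧ ContDiffAt ℝ 1 (profileForce V d F κ) r₀ ∧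
    (∀ x, HasDerivAt (unweight κ (deriv (profileDiff F κ r₀) r₀))
      (unweight κ (deriv (profileSlope F κ) r₀) x) x) ∧
    ∀ x, HasDerivAt (unweight κ (deriv (profileSlope F κ) r₀))
      (unweight κ (deriv (profileForce V d F κ) r₀) x) x := by
  obtain ⟨G, G', hG⟩ := h.exists_green (d := d) (κ := κ) hκ.le (by linarith) r₀
  have hev := h.eventually_isUnit_linearizationAt hκ hκl hr₀ hG
  have hu₀ := hev.self_of_nhds.2
  have hUd : ∀ᶠ r in 𝓝 r₀, HasDerivAt (profileDiff F κ r₀) (h.slopeAt hκ G r₀ r) r :=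
    hev.mono fun r hr => h.hasDerivAt_profileDiff_of_isUnit hκ hκl hr₀ hr.1 hG hr.2
  have hcoef : ∀ r ∈ I, ContDiffAt ℝ 1 (fun r : ℝ => 2 * d ^ 2 / r ^ 3) r := fun r hr =>
    contDiffAt_const.div (contDiffAt_id.pow 3) (pow_ne_zero 3 (h.pos r hr).ne')
  have hVc : ∀ᶠ r in 𝓝 r₀, ContinuousAt (h.slopeAt hκ G r₀) r := hev.mono fun r hr =>
    continuousAt_inverse_apply (h.continuousAt_linearizationAt hκ hr.1 G) hr.2
      (G.continuous.continuousAt.comp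
        ((hcoef r hr.1).continuousAt.smul (h.continuousAt_profileTail hκ hκl hr.1)))
  have hU := contDiffAt_one_of_hasDerivAt hUd hVc
  have hA := h.contDiffAt_profileHess_of hκ hκl hr₀ hU
  have hP := h.contDiffAt_profileTail_of hκl hr₀ hU
  have hL : ContDiffAt ℝ 1 (h.linearizationAt hκ G r₀) r₀ := by
    have h1 : ContDiffAt ℝ 1 (fun r => mulOp (profileHess V d F r₀ r) :
        ℝ → WeightedEnd) r₀ := contDiffAt_mulOp hA
    exact contDiffAt_one_add_comp G h1 contDiffAt_const
  have hVs : ContDiffAt ℝ 1 (h.slopeAt hκ G r₀) r₀ := contDiffAt_inverse_apply hL hu₀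
      (G.contDiff.contDiffAt.comp r₀ ((hcoef r₀ hr₀).smul hP))
  set k : ℝ → Weighted := fun r => mulOp (profileHess V d F r₀ r) (h.slopeAt hκ G r₀ r) +
    -(2 * d ^ 2 / r ^ 3) • profileTail F κ r with hk
  have hkC : ContDiffAt ℝ 1 k r₀ := by
    have h1 : ContDiffAt ℝ 1 (fun r => mulOp (profileHess V d F r₀ r) :
        ℝ → WeightedEnd) r₀ := contDiffAt_mulOp hA
    exact (h1.clm_apply hVs).add ((hcoef r₀ hr₀).neg.smul hP)
  set M := postOp (hessW V d vacuum r₀) with hM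
  have hTd : ∀ᶠ r in 𝓝 r₀, HasDerivAt (profileForce V d F κ)
      (M (h.slopeAt hκ G r₀ r) + k r) r := hev.mono fun r hr =>
    (h.hasDerivAt_profileForce_of_isUnit hκ hκl hr₀ hr.1 hG hr.2).congr_deriv (by
      simp only [hk]; abel)
  have hSd : ∀ᶠ r in 𝓝 r₀, HasDerivAt (profileSlope F κ) (-G' (k r)) r := by
    have hI : ∀ᶠ r in 𝓝 r₀, r ∈ I := h.isOpen.mem_nhds hr₀
    filter_upwards [hUd, hTd, hI.eventually_nhds] with r h1 h2 h3
    have h4 := (G'.hasFDerivAt.comp_hasDerivAt r ((M.hasFDerivAt.comp_hasDerivAt r h1).sub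
      (h2.sub_const (profileForce V d F κ r₀)))).const_add (profileSlope F κ r₀)
    refine (h4.congr_of_eventuallyEq (h3.mono fun r' hr' =>
      (h.profileDiff_eq_green hκ hκl hr₀ hr' hG).2)).congr_deriv ?_
    rw [sub_add_cancel_left, map_neg]
  have hVk : h.slopeAt hκ G r₀ r₀ = -G (k r₀) := by
    have h4 := G.hasFDerivAt.comp_hasDerivAt r₀
      ((M.hasFDerivAt.comp_hasDerivAt r₀ hUd.self_of_nhds).sub
      (hTd.self_of_nhds.sub_const (profileForce V d F κ r₀)))
    have h5 := h4.congr_of_eventuallyEq (f₁ := profileDiff F κ r₀) (by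
      filter_upwards [h.isOpen.mem_nhds hr₀] with r' hr'
      exact (h.profileDiff_eq_green hκ hκl hr₀ hr' hG).1)
    rw [hUd.self_of_nhds.unique h5, sub_add_cancel_left, map_neg]
  have hSeq : deriv (profileSlope F κ) =ᶠ[𝓝 r₀] fun r => -G' (k r) := hSd.mono fun r hr => hr.deriv
  have hGk : ContDiffAt ℝ 1 (fun r => -G' (k r)) r₀ := (G'.contDiff.contDiffAt.comp r₀ hkC).neg
  have hMk : ContDiffAt ℝ 1 (fun r => M (h.slopeAt hκ G r₀ r) + k r) r₀ :=
    (M.contDiff.contDiffAt.comp r₀ hVs).add hkC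
  have hCe : ∀ {f : ℝ → Weighted}, ContDiffAt ℝ 1 f r₀ → ∀ᶠ r in 𝓝 r₀, ContinuousAt f r :=
    fun hf => (hf.eventually (by simp)).mono fun r hr => hr.continuousAt
  refine ⟨hU, contDiffAt_one_of_hasDerivAt hSd (hCe hGk), hGk.congr_of_eventuallyEq hSeq,
    contDiffAt_one_of_hasDerivAt hTd (hCe hMk), fun x => ?_, fun x => ?_⟩
  · rw [hUd.self_of_nhds.deriv, hSd.self_of_nhds.deriv, hVk, ← map_neg, ← map_neg]
    exact hG.deriv _ x
  · rw [hSd.self_of_nhds.deriv, hTd.self_of_nhds.deriv, hVk, ← map_neg]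
    refine (hG.deriv2 _ x).congr_deriv ?_
    simp only [unweight_add, hM, unweight_postOp, map_neg, unweight_neg, sub_neg_eq_add]

end ProfileFamily

theorem bounded_of_memLp {E : Type*} [NormedAddCommGroup E] [InnerProductSpace ℝ E]
    {u u1 : ℝ → E} (hd : ∀ x, HasDerivAt u (u1 x) x) (hc : Continuous u1)
    (hu : MemLp u 2 volume) (hu1 : MemLp u1 2 volume) : ∃ C, ∀ x, ‖u x‖ ≤ C := by
  have huc : Continuous u := continuous_iff_continuousAt.2 fun x => (hd x).continuousAt
  have i1 := (memLp_two_iff_integrable_sq_norm huc.aestronglyMeasurable).1 hu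
  have i2 := (memLp_two_iff_integrable_sq_norm hc.aestronglyMeasurable).1 hu1
  have i3 : Integrable fun x => ‖u x‖ ^ 2 + ‖u1 x‖ ^ 2 := i1.add i2
  have i4 : Integrable fun x => 2 * ⟪u x, u1 x⟫ :=
    i3.mono' (continuous_const.mul (huc.inner hc)).aestronglyMeasurable (.of_forall fun x => by
        rw [norm_eq_abs, abs_mul, abs_two]
        have := abs_real_inner_le_norm (u x) (u1 x)
        nlinarith [sq_nonneg (‖u x‖ - ‖u1 x‖)])
  set B := ‖u 0‖ ^ 2 + ∫ x, ‖2 * ⟪u x, u1 x⟫‖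
  have hB : ∀ x, ‖u x‖ ^ 2 ≤ B := fun x => by
    have e : ∫ y in (0 : ℝ)..x, 2 * ⟪u y, u1 y⟫ = ‖u x‖ ^ 2 - ‖u 0‖ ^ 2 :=
      intervalIntegral.integral_eq_sub_of_hasDerivAt (fun y _ => (hd y).norm_sq)
        i4.intervalIntegrable
    have h1 := intervalIntegral.norm_integral_le_integral_norm_uIoc (a := 0) (b := x) (μ := volume)
      (f := fun y => 2 * ⟪u y, u1 y⟫)
    have h2 := setIntegral_le_integral (s := Set.uIoc 0 x) i4.norm
      (.of_forall fun y => norm_nonneg _)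
    rw [e] at h1
    have h3 := (le_abs_self _).trans (h1.trans h2)
    linarith
  exact ⟨√B, fun x => Real.le_sqrt_of_sq_le (hB x)⟩

theorem memLp_inner {E : Type*} [NormedAddCommGroup E] [InnerProductSpace ℝ E] {u v : ℝ → E}
    (hu : MemLp u 2 volume) (hv : MemLp v 2 volume) : Integrable fun x => ⟪u x, v x⟫ := by
  have h1 := hu.integrable_norm_pow (p := 2) (by norm_num)
  have h2 := hv.integrable_norm_pow (p := 2) (by norm_num)
  refine (h1.add h2).mono' (hu.1.inner hv.1) (.of_forall fun x => ?_)
  have := norm_inner_le_norm (𝕜 := ℝ) (u x) (v x)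
  simp only [Pi.add_apply]
  nlinarith [sq_nonneg (‖u x‖ - ‖v x‖)]

section
variable {X : Type*} [NormedAddCommGroup X] [NormedSpace ℝ X] {f : ℝ → X}

theorem contDiffAt_rankOne (p : X →L[ℝ] X →L[ℝ] ℝ) (hf : ContDiffAt ℝ 1 f r) :
    ContDiffAt ℝ 1 (fun r => (p (f r)).smulRight (f r)) r :=
  (hf.continuousLinearMap_comp p).smulRight hf

theorem contDiffAt_form (p : X →L[ℝ] X →L[ℝ] ℝ) (hf : ContDiffAt ℝ 1 f r) :
    ContDiffAt ℝ 1 (fun r => p (f r) (f r)) r :=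
  (hf.continuousLinearMap_comp p).clm_apply hf

end

theorem abs_mul_exp_le {c : ℝ} (hc : 0 < c) (x : ℝ) : |x| * e(c,x) ≤ 1 / c := by
  rw [le_div_iff₀ hc, Real.exp_neg, ← div_eq_mul_inv, div_mul_eq_mul_div, div_le_one (exp_pos _)]
  have := Real.add_one_le_exp (c * |x|)
  linarith

theorem Decays.id_smul {κ' : ℝ}
    (hκ : κ < κ') {u : ℝ → E} (hu : Decays κ' u) : Decays κ fun x => x • u x := by
  obtain ⟨C, hC0, hC⟩ := hu.exists_bound
  have hc : 0 < κ' - κ := by linarith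
  refine .of_bound (C := C * (1 / (κ' - κ))) (continuous_id.smul hu.continuous) fun x => ?_
  rw [norm_smul, norm_eq_abs]
  calc |x| * ‖u x‖ ≤ |x| * (C * e(κ',x)) := by gcongr; exact hC x
    _ = C * (|x| * e(κ' - κ,x)) * e(κ,x) := by
        have : e(κ',x) = e(κ' - κ,x) * e(κ,x) := by
          rw [← exp_add]; ring_nf
        rw [this]; ring
    _ ≤ _ := by gcongr; exact abs_mul_exp_le hc x

theorem decays_id_mul_exp {c : ℝ} (hc : 0 < c) : Decays 0 fun x : ℝ => x * e(c,x) :=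
  (decays_exp_neg_abs (κ := c)).id_smul hc

theorem weight_id_smul {κ' : ℝ} (hκ : κ < κ') {u : ℝ → Plane} (hu : Decays κ' u) :
    weight κ (fun x => x • u x) = scaleOp (fun x => x * e(κ' - κ,x)) (weight κ' u) := by
  ext1 x
  rw [scaleOp_apply (decays_id_mul_exp (by linarith)), weight_apply hu,
    weight_apply (hu.id_smul hκ), smul_smul, smul_smul]
  congr 1
  rw [mul_assoc, ← exp_add, mul_comm]
  ring_nf

namespace ProfileFamily

variable (h : ProfileFamily V d I F l)
include h

theorem forceR_eq' (hr : r ∈ I) (x : ℝ) :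
    forceR V d (F r x) r = -(2 * d ^ 2 / r ^ 3) • coordProj 1 (F r x) :=
  forceR_eq h.potential _ (h.pos r hr).ne'

/-- The source of the corrector equation at zero velocity. -/
def source (_ : ProfileFamily V d I F l) (r x : ℝ) : Plane :=
  curvatureFactor d r 0 (F r) • deriv (F r) x - x • forceR V d (F r x) r

theorem decays_source (hκl : κ < √l / 2) (hr : r ∈ I) : Decays κ (h.source r) := by
  unfold source
  simp only [h.forceR_eq' hr]
  exact (((h.decays_deriv hr).mono hκl.le).const_smul _).sub
    (((h.decays_coordProj hr).const_smul _).id_smul hκl)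

section corrector
variable {Z : ℝ → Plane}

theorem hasDerivAt_corrector {v : ℝ} (hZ : IsCorrector V d r v (F r) Z) (x : ℝ) :
    HasDerivAt Z (deriv Z x) x := (hZ.smooth.differentiable (by norm_num) x).hasDerivAt

theorem hasDerivAt_deriv_corrector (hZ : IsCorrector V d r 0 (F r) Z) (x : ℝ) :
    HasDerivAt (deriv Z) (hessW V d (F r x) r (Z x) - h.source r x) x := by
  have h1 : ContDiff ℝ (1 + 1) Z := by simpa [one_add_one_eq_two] using hZ.smooth
  have h2 := ((contDiff_succ_iff_deriv.1 h1).2.2.differentiable (by norm_num) x).hasDerivAt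
  refine h2.congr_deriv ?_
  have e := hZ.equation x
  rw [linOp] at e
  simp only [ne_eq, OfNat.ofNat_ne_zero, not_false_eq_true, zero_pow, sub_zero, Real.sqrt_one,
    div_one] at e
  rw [source, ← e]
  abel

theorem decays_corrector (hr : r ∈ I) (hZ : IsCorrector V d r 0 (F r) Z)
    (hκ : 0 < κ) (hκl : κ < √l / 2) : Decays κ Z ∧ Decays κ (deriv Z) := by
  obtain ⟨C, hC⟩ := bounded_of_memLp (h.hasDerivAt_corrector hZ)
    (hZ.smooth.continuous_deriv (by norm_num)) hZ.memLp hZ.memLp_deriv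
  obtain ⟨G, G', hG⟩ := h.exists_green (d := d) (κ := κ) hκ.le (by linarith) r
  have hf : Decays κ fun x => hessW V d vacuum r (Z x) -
      (hessW V d (F r x) r (Z x) - h.source r x) := by
    obtain ⟨c, hc0, hc⟩ := (h.decays_hess_sub hr).exists_bound
    have h1 : Decays κ fun x => (hessW V d (F r x) r - hessW V d vacuum r) (Z x) := by
      refine Decays.mono (κ := √l / 2) (.of_bound (C := c * C)
        (((h.continuous_hess hr).sub continuous_const).clm_apply hZ.smooth.continuous)
        fun x => ?_) hκl.le
      refine (ContinuousLinearMap.le_opNorm _ _).trans ?_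
      calc _ ≤ c * e(√l / 2,x) * C :=
            mul_mono (hc x) (hC x)
        _ = _ := by ring
    have h2 := (h.decays_source hκl hr).sub h1
    have e : (fun x => hessW V d vacuum r (Z x) - (hessW V d (F r x) r (Z x) - h.source r x)) =
        fun x => h.source r x - (hessW V d (F r x) r - hessW V d vacuum r) (Z x) := by
      funext x
      rw [FunLike.coe_sub, Pi.sub_apply]; abel
    rw [e]; exact h2
  obtain ⟨e1, e2⟩ := hG.decays hC (h.hasDerivAt_corrector hZ) (h.hasDerivAt_deriv_corrector hZ) hf
  exact ⟨by rw [e1]; exact decays_unweight _ _, by rw [e2]; exact decays_unweight _ _⟩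

/-- Correctors at different velocities are proportional. -/
theorem corrector_eq (hr : r ∈ I) (hZ : IsCorrector V d r 0 (F r) Z) {v : ℝ} {Z' : ℝ → Plane}
    (hZ' : IsCorrector V d r v (F r) Z') : Z' = fun x => (1 / √(1 - v ^ 2)) • Z x := by
  set m := 1 / √(1 - v ^ 2) with hm
  set D : ℝ → Plane := fun x => Z' x - m • Z x with hD
  have hd1 : deriv D = fun x => deriv Z' x - m • deriv Z x := funext fun x =>
    ((h.hasDerivAt_corrector hZ' x).sub ((h.hasDerivAt_corrector hZ x).const_smul m)).deriv
  have h1 : ContDiff ℝ (1 + 1) Z' := by simpa [one_add_one_eq_two] using hZ'.smooth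
  have hd2 : ∀ x, deriv (deriv D) x = deriv (deriv Z') x - m • deriv (deriv Z) x := fun x => by
    have h2 := ((contDiff_succ_iff_deriv.1 h1).2.2.differentiable (by norm_num) x).hasDerivAt
    have h3 := h.hasDerivAt_deriv_corrector hZ x
    rw [hd1, h3.deriv]
    exact (h2.sub (h3.const_smul m)).deriv
  have hlin : ∀ x, linOp V d r (F r) D x = 0 := fun x => by
    have e1 := hZ.equation x
    have e2 := hZ'.equation x
    rw [linOp] at e1 e2 ⊢
    have hcf : curvatureFactor d r v (F r) = m * curvatureFactor d r 0 (F r) := by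
      simp only [curvatureFactor, hm]; simp; ring
    have e3 : -deriv (deriv Z') x + hessW V d (F r x) r (Z' x) =
        m • (-deriv (deriv Z) x + hessW V d (F r x) r (Z x)) := by
      rw [e1, e2, hcf]
      simp only [ne_eq, OfNat.ofNat_ne_zero, not_false_eq_true, zero_pow, sub_zero, Real.sqrt_one,
        div_one]
      rw [show x / √(1 - v ^ 2) = m * x by rw [hm]; ring]
      module
    rw [hd2, hD]
    simp only [map_sub, map_smul]
    calc _ = -deriv (deriv Z') x + hessW V d (F r x) r (Z' x) -
        m • (-deriv (deriv Z) x + hessW V d (F r x) r (Z x)) := by module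
      _ = 0 := by rw [e3, sub_self]
  obtain ⟨c, hc⟩ := (h.nondeg r hr D).1 ⟨hZ'.smooth.sub (hZ.smooth.const_smul m),
    hZ'.memLp.sub (hZ.memLp.const_smul m), hlin⟩
  have hSL : MemLp (deriv (F r)) 2 volume := (h.contDiff_deriv hr).2.1
  have horth : ∫ x, ⟪D x, deriv (F r) x⟫ = 0 := by
    have i1 : Integrable fun x => ⟪Z' x, deriv (F r) x⟫ := memLp_inner hZ'.memLp hSL
    have i2 : Integrable fun x => ⟪Z x, deriv (F r) x⟫ := memLp_inner hZ.memLp hSL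
    simp only [hD, inner_sub_left, real_inner_smul_left]
    rw [integral_sub i1 (i2.const_mul m), integral_const_mul, hZ.orthogonal, hZ'.orthogonal]
    ring
  have hc0 : c = 0 := by
    rw [hc] at horth
    simp only [Pi.smul_apply, real_inner_smul_left] at horth
    rw [integral_const_mul] at horth
    exact (mul_eq_zero.1 horth).resolve_right (h.integral_deriv_sq_pos hr).ne'
  rw [hc0, zero_smul] at hc
  funext x
  exact sub_eq_zero.1 (congrFun hc x)

end corrector

/-- The source of the corrector equation in the weighted space. -/
theorem weight_source {κ' : ℝ} (hκ : 0 < κ) (hκκ' : κ < κ') (hκl : κ' < √l / 2) (hr : r ∈ I) :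
    weight κ (h.source r) = (d ^ 2 / r ^ 3 * (pairing κ hκ (profileTail F κ r) (profileTail F κ r) /
      pairing κ hκ (profileSlope F κ r) (profileSlope F κ r))) • profileSlope F κ r +
      (2 * d ^ 2 / r ^ 3) • scaleOp (fun x => x * e(κ' - κ,x)) (profileTail F κ' r) := by
  have hS := (h.decays_deriv hr).mono (hκκ'.trans hκl).le
  have hP := (h.decays_coordProj hr).mono (hκκ'.trans hκl).le
  have hP' := (h.decays_coordProj hr).mono hκl.le
  rw [profileTail, profileTail, profileSlope, pairing_weight hκ hP hP, pairing_weight hκ hS hS,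
    ← weight_id_smul hκκ' hP']
  apply unweight_injective κ
  simp only [unweight_add, unweight_smul]
  rw [unweight_weight (h.decays_source (hκκ'.trans hκl) hr), unweight_weight hS,
    unweight_weight (hP'.id_smul hκκ')]
  ext1 x
  rw [source, h.forceR_eq' hr, curvatureFactor]
  have e1 : ∀ x, ⟪coordProj 1 (F r x), coordProj 1 (F r x)⟫ = F r x 1 ^ 2 := fun x => by
    rw [inner_eq_coords]; simp [sq]
  simp only [e1, real_inner_self_eq_norm_sq]
  simp only [ne_eq, OfNat.ofNat_ne_zero, not_false_eq_true, zero_pow, sub_zero, Real.sqrt_one,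
    div_one, one_mul]
  module

theorem contDiffAt_source (hκ : 0 < κ) (hκl : κ < √l / 2) (hr₀ : r₀ ∈ I) :
    ContDiffAt ℝ 1 (fun r => weight κ (h.source r)) r₀ := by
  obtain ⟨κ', hκκ', hκ'l⟩ := exists_between hκl
  obtain ⟨hU, hS, -⟩ := h.regularity hκ hκl hr₀
  have hP := h.contDiffAt_profileTail_of hκl hr₀ hU
  have hP' := h.contDiffAt_profileTail_of hκ'l hr₀ (h.regularity (hκ.trans hκκ') hκ'l hr₀).1
  have hpos : pairing κ hκ (profileSlope F κ r₀) (profileSlope F κ r₀) ≠ 0 := by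
    have hS := (h.decays_deriv hr₀).mono hκl.le
    rw [profileSlope, pairing_weight hκ hS hS]
    exact (h.integral_deriv_sq_pos hr₀).ne'
  have hcoef : ∀ c : ℝ, ContDiffAt ℝ 1 (fun r : ℝ => c / r ^ 3) r₀ := fun c =>
    contDiffAt_const.div (contDiffAt_id.pow 3) (pow_ne_zero 3 (h.pos r₀ hr₀).ne')
  have hsrc : ContDiffAt ℝ 1 (fun r => (d ^ 2 / r ^ 3 *
      (pairing κ hκ (profileTail F κ r) (profileTail F κ r) /
      pairing κ hκ (profileSlope F κ r) (profileSlope F κ r))) • profileSlope F κ r +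
      (2 * d ^ 2 / r ^ 3) • scaleOp (fun x => x * e(κ' - κ,x)) (profileTail F κ' r)) r₀ :=
    (((hcoef _).mul
      ((contDiffAt_form (pairing κ hκ) hP).div (contDiffAt_form (pairing κ hκ) hS) hpos)).smul hS).add
      ((hcoef _).smul (hP'.continuousLinearMap_comp (scaleOp _)))
  refine hsrc.congr_of_eventuallyEq ?_
  filter_upwards [h.isOpen.mem_nhds hr₀] with r hr
  exact h.weight_source hκ hκκ' hκ'l hr

/-- The correctors at zero velocity depend differentiably on the radius. -/
theorem contDiffAt_corrector (hZ : ∀ r ∈ I, IsCorrector V d r 0 (F r) (Z r))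
    (hκ : 0 < κ) (hκl : κ < √l / 2) (hr₀ : r₀ ∈ I) :
    ContDiffAt ℝ 1 (fun r => weight κ (Z r)) r₀ := by
  obtain ⟨G, G', hG⟩ := h.exists_green (d := d) (κ := κ) hκ.le (by linarith) r₀
  obtain ⟨hU, hS, -⟩ := h.regularity hκ hκl hr₀
  have hA := h.contDiffAt_profileHess_of hκ hκl hr₀ hU
  set T : ℝ → WeightedEnd := fun r =>
    perturbedOp hκ G (profileHess V d F r₀ r) (profileSlope F κ r)
  have hrank := contDiffAt_rankOne (pairing κ hκ) hS
  have hTc : ContDiffAt ℝ 1 T r₀ := contDiffAt_one_add_comp G (contDiffAt_mulOp hA) hrank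
  have hTu : IsUnit (T r₀) := h.isUnit_linearization hr₀ hκ hκl hG
  have hsrc := h.contDiffAt_source hκ hκl hr₀
  refine (contDiffAt_inverse_apply hTc hTu
    (hsrc.continuousLinearMap_comp G)).congr_of_eventuallyEq ?_
  have hI : ∀ᶠ r in 𝓝 r₀, r ∈ I := h.isOpen.mem_nhds hr₀
  filter_upwards [hI, eventually_isUnit hTc.continuousAt hTu] with r hr hu
  obtain ⟨hZd, -⟩ := h.decays_corrector hr (hZ r hr) hκ hκl
  have hSr := (h.decays_deriv hr).mono hκl.le
  have key : T r (weight κ (Z r)) = G (weight κ (h.source r)) := by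
    refine hG.perturbedOp_weight hκ hZd (h.hasDerivAt_corrector (hZ r hr)) fun x =>
      (h.hasDerivAt_deriv_corrector (hZ r hr) x).congr_deriv ?_
    have hp : pairing κ hκ (profileSlope F κ r) (weight κ (Z r)) = 0 := by
      rw [pairing_comm, profileSlope, pairing_weight hκ hZd hSr, (hZ r hr).orthogonal]
    rw [hp, zero_smul, profileHess, weight_zero_apply (h.decays_zero_hess_sub' hr r₀),
      unweight_weight (h.decays_source hκl hr), FunLike.coe_sub, Pi.sub_apply]
    abel
  rw [Function.comp_apply, ← key]
  exact (DFunLike.congr_fun (Ring.inverse_mul_cancel _ hu) _).symm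

end ProfileFamily

/-! ### Pointwise derivatives and uniform bounds -/

theorem hasDerivAt_unweight_comp (hκ : 0 ≤ κ) {u : ℝ → Weighted} {ρ ζ : ℝ → ℝ}
    {ρ' ζ' : ℝ} {u' : Weighted} {ux : Plane} (hρ : HasDerivAt ρ ρ' t) (hζ : HasDerivAt ζ ζ' t)
    (hu : HasDerivAt u u' (ρ t)) (hx : HasDerivAt (unweight κ (u (ρ t))) ux (ζ t)) :
    HasDerivAt (fun τ => unweight κ (u (ρ τ)) (ζ τ)) (ρ' • unweight κ u' (ζ t) + ζ' • ux) t := by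
  have h1 : HasDerivAt (fun τ => unweight κ (u (ρ t)) (ζ τ)) (ζ' • ux) t := hx.scomp t hζ
  have h2 : HasDerivAt (fun τ => u (ρ τ)) (ρ' • u') t := hu.scomp t hρ
  have hev : ∀ (w : Weighted) z, ‖unweight κ w z‖ ≤ ‖w‖ := fun w z =>
    (norm_unweight_le κ w z).trans (mul_le_of_le_one_right (norm_nonneg _) (weight_le_one hκ z))
  have h3 : HasDerivAt (fun τ => unweight κ (u (ρ τ) - u (ρ t)) (ζ τ))
      (ρ' • unweight κ u' (ζ t)) t := by
    rw [hasDerivAt_iff_isLittleO] at h2 ⊢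
    have e1 : (fun τ => unweight κ (u (ρ τ) - u (ρ t) - (τ - t) • ρ' • u') (ζ τ)) =o[𝓝 t]
        fun τ => τ - t :=
      (Asymptotics.IsBigO.of_bound 1 (.of_forall fun τ => by
        rw [one_mul]; exact hev _ _)).trans_isLittleO h2
    have e2 : (fun τ => (τ - t) • (ρ' • unweight κ u' (ζ τ) - ρ' • unweight κ u' (ζ t))) =o[𝓝 t]
        fun τ => τ - t := by
      have e3 : (fun τ => ρ' • unweight κ u' (ζ τ) - ρ' • unweight κ u' (ζ t)) =o[𝓝 t]
          fun _ => (1 : ℝ) := by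
        rw [Asymptotics.isLittleO_one_iff]
        have := (((continuous_unweight κ u').continuousAt.comp hζ.continuousAt).const_smul ρ').tendsto
        have := this.sub_const (ρ' • unweight κ u' (ζ t))
        simpa using this
      simpa using (Asymptotics.isBigO_refl (fun τ => τ - t) (𝓝 t)).smul_isLittleO e3
    refine (e1.add e2).congr_left fun τ => ?_
    simp only [unweight_sub, unweight_smul, smul_sub]
    abel
  refine ((h1.add h3).congr_of_eventuallyEq (.of_forall fun τ => ?_)).congr_deriv (add_comm _ _)
  simp only [Pi.add_apply, unweight_sub, add_sub_cancel]

theorem exp_neg_le_of_mem_Icc {x y : ℝ} (hκ : 0 ≤ κ) (hy : y ∈ Icc x (x + 1)) :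
    e(κ,y) ≤ exp κ * e(κ,x) := by
  rw [← exp_add, exp_le_exp]
  have h1 : |x| ≤ |y| + 1 := by
    have := abs_sub_abs_le_abs_sub x y
    have h2 : |x - y| ≤ 1 := abs_le.2 ⟨by linarith [hy.2], by linarith [hy.1]⟩
    linarith
  nlinarith

/-- The quantities derived from the profile at radius `r` are controlled by `C`. -/
structure ProfileBound (V : Plane → ℝ) (d : ℝ) (F : ℝ → ℝ → Plane) (Z : ℝ → ℝ → Plane)
    (κ C r : ℝ) : Prop where
  one_le : 1 ≤ C
  inv_le : r⁻¹ ≤ C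
  slope : ∀ x, ‖deriv (F r) x‖ ≤ C * e(κ,x)
  force : ∀ x, ‖force V d (F r x) r‖ ≤ C * e(κ,x)
  tail : ∀ x, ‖coordProj 1 (F r x)‖ ≤ C * e(κ,x)
  vacuum : ∀ x, 0 ≤ x → ‖F r x - vacuum‖ ≤ C * e(κ,x)
  hess : ∀ x, ‖hessW V d (F r x) r‖ ≤ C
  rate : ∀ x, ‖unweight κ (deriv (profileDiff F κ r) r) x‖ ≤ C * e(κ,x)
  slope_r : ∀ x, ‖unweight κ (deriv (profileSlope F κ) r) x‖ ≤ C * e(κ,x)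
  slope_rr : ∀ x, ‖unweight κ (deriv (deriv (profileSlope F κ)) r) x‖ ≤ C * e(κ,x)
  force_r : ∀ x, ‖unweight κ (deriv (profileForce V d F κ) r) x‖ ≤ C * e(κ,x)
  corrector : ∀ x, ‖Z r x‖ ≤ C * e(κ,x)
  corrector_x : ∀ x, ‖deriv (Z r) x‖ ≤ C * e(κ,x)
  corrector_r : ∀ x, ‖unweight κ (deriv (fun r => weight κ (Z r)) r) x‖ ≤ C * e(κ,x)
  coercive : ∀ u u1 u2 : ℝ → Plane, Decays κ u → Decays κ u1 →
    Decays κ u2 → (∀ x, HasDerivAt u (u1 x) x) → (∀ x, HasDerivAt u1 (u2 x) x) →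
    (∫ x, ⟪u x, u x⟫) + ∫ x, ⟪u1 x, u1 x⟫ ≤
      C * ((∫ x, ⟪u1 x, u1 x⟫) + (∫ x, ⟪u x, hessW V d (F r x) r (u x)⟫) +
      (∫ x, ⟪deriv (F r) x, u x⟫) ^ 2)
  mass : C⁻¹ ≤ ∫ x, ⟪deriv (F r) x, deriv (F r) x⟫

namespace ProfileFamily

variable (h : ProfileFamily V d I F l)
include h

/-- The radial derivative does not depend on the base point. -/
theorem eventually_deriv_profileDiff (hκl : κ < √l / 2) (hr₀ : r₀ ∈ I) :
    ∀ᶠ r in 𝓝 r₀, deriv (profileDiff F κ r) r = deriv (profileDiff F κ r₀) r := by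
  have hI : ∀ᶠ r in 𝓝 r₀, r ∈ I := h.isOpen.mem_nhds hr₀
  filter_upwards [hI] with r hr
  have e : profileDiff F κ r =ᶠ[𝓝 r] fun r' => profileDiff F κ r₀ r' - profileDiff F κ r₀ r := by
    filter_upwards [h.isOpen.mem_nhds hr] with r' hr'
    rw [h.profileDiff_sub hκl hr₀ hr hr']
  rw [e.deriv_eq, deriv_sub_const]

theorem continuousAt_rate (hκ : 0 < κ) (hκl : κ < √l / 2) (hr₀ : r₀ ∈ I) :
    ContinuousAt (fun r => deriv (profileDiff F κ r) r) r₀ :=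
  (((h.regularity hκ hκl hr₀).1.derivWithin (m := 0) le_rfl).continuousAt).congr
    ((h.eventually_deriv_profileDiff hκl hr₀).mono fun _ hr => hr.symm)

theorem eventually_profileBound (hZ : ∀ r ∈ I, IsCorrector V d r 0 (F r) (Z r)) (hκ : 0 < κ) (hκl : κ < √l / 2)
    (hr₀ : r₀ ∈ I) : ∃ C, ∀ᶠ r in 𝓝 r₀, ProfileBound V d F Z κ C r := by
  have hb : ∀ (f : ℝ → Weighted), ContinuousAt f r₀ → ∃ C, 0 ≤ C ∧ ∀ᶠ r in 𝓝 r₀,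
      ∀ x, ‖unweight κ (f r) x‖ ≤ C * e(κ,x) := fun f hf => by
    refine ⟨‖f r₀‖ + 1, by positivity, ?_⟩
    filter_upwards [hf.norm.eventually (gt_mem_nhds (lt_add_one ‖f r₀‖))] with r hr x
    exact (norm_unweight_le κ (f r) x).trans (by gcongr)
  have hexp : ∀ x : ℝ, e(√l / 2,x) ≤ e(κ,x) := fun x => by
    rw [exp_le_exp]; nlinarith [abs_nonneg x]
  obtain ⟨hU, hS, hSr, hT, -, -⟩ := h.regularity hκ hκl hr₀
  have hZc := h.contDiffAt_corrector hZ hκ hκl hr₀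
  have d0 : ∀ {f : ℝ → Weighted}, ContDiffAt ℝ 1 f r₀ → ContinuousAt (deriv f) r₀ := fun hf =>
    (hf.derivWithin (m := 0) le_rfl).continuousAt
  obtain ⟨C1, hC1, b1⟩ := h.eventually_bounds hr₀
  obtain ⟨C2, hC2, b2⟩ := h.eventually_decay hr₀
  obtain ⟨C3, hC3, b3⟩ := hb _ (h.continuousAt_rate hκ hκl hr₀)
  obtain ⟨C4, hC4, b4⟩ := hb _ (d0 hS)
  obtain ⟨C5, hC5, b5⟩ := hb _ (d0 hSr)
  obtain ⟨C6, hC6, b6⟩ := hb _ (d0 hT)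
  obtain ⟨C7, hC7, b7⟩ := hb _ hZc.continuousAt
  obtain ⟨C8, hC8, b8⟩ := hb _ (d0 hZc)
  obtain ⟨C9, hC9, b9⟩ := hb _ (h.contDiffAt_source hκ hκl hr₀).continuousAt
  obtain ⟨C10, hC10, b10⟩ := h.eventually_coercive hr₀ hκ hκl
  obtain ⟨Ct, hCt⟩ := exists_taylorBound h.potential 2
  have hCt0 := hCt.nonneg
  have hr0 := h.pos r₀ hr₀
  set C11 := Ct + d ^ 2 / (r₀ / 2) ^ 2
  have hC110 : 0 ≤ C11 := by positivity
  have hSS := h.integral_deriv_sq_pos hr₀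
  set M₀ := ∫ x, ⟪deriv (F r₀) x, deriv (F r₀) x⟫
  have hSd : ∀ r ∈ I, Decays κ (deriv (F r)) := fun r hr => (h.decays_deriv hr).mono hκl.le
  have hmass : ContinuousAt (fun r => pairing κ hκ (profileSlope F κ r) (profileSlope F κ r)) r₀ :=
    (contDiffAt_form _ hS).continuousAt
  have hmass₀ : M₀ / 2 < pairing κ hκ (profileSlope F κ r₀) (profileSlope F κ r₀) := by
    rw [profileSlope, pairing_weight hκ (hSd r₀ hr₀) (hSd r₀ hr₀)]; linarith
  set C12 := C7 + exp κ * C7 + (C11 * (exp κ * C7) + exp κ * C9) with hC12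
  have hC120 : 0 ≤ C12 := by positivity
  refine ⟨1 + (r₀ / 2)⁻¹ + C1 + C2 + C3 + C4 + C5 + C6 + C7 + C8 + C10 + C11 + C12 + (M₀ / 2)⁻¹, ?_⟩
  filter_upwards [b1, b2, b3, b4, b5, b6, b7, b8, b9, b10, h.eventually_half_lt hr₀,
    hmass.eventually (lt_mem_nhds hmass₀)] with r b1 b2 b3 b4 b5 b6 b7 b8 b9 b10 hr b11
  have hr0' := hr.2
  set C := 1 + (r₀ / 2)⁻¹ + C1 + C2 + C3 + C4 + C5 + C6 + C7 + C8 + C10 + C11 + C12 + (M₀ / 2)⁻¹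
  have hinv : 0 < (r₀ / 2)⁻¹ := by positivity
  have hMinv : 0 < (M₀ / 2)⁻¹ := by positivity
  have mono : ∀ {a c x : ℝ}, c ≤ C → a ≤ c * e(κ,x) →
      a ≤ C * e(κ,x) := fun hc ha => ha.trans (by gcongr)
  have mono' : ∀ {a x : ℝ}, a ≤ C1 * e(√l / 2,x) → a ≤ C * e(κ,x) := fun {a x} ha =>
    mono (c := C1) (by linarith) (ha.trans (mul_mono_left (hexp x) hC1))
  have hhess : ∀ x, ‖hessW V d (F r x) r‖ ≤ C11 := fun x => by
    rw [hessW_eq h.potential]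
    refine (norm_add_le _ _).trans (add_le_add (hCt.hess _ (h.norm_le hr.1 x)) ?_)
    rw [norm_smul, norm_eq_abs, abs_of_nonneg (by positivity)]
    refine (mul_le_of_le_one_right (by positivity) (norm_coordProj_le 1)).trans ?_
    gcongr
  have hZr := hZ r hr.1
  have hZd := (h.decays_corrector hr.1 hZr hκ hκl).1
  have hZb : ∀ x, ‖Z r x‖ ≤ C7 * e(κ,x) := fun x => by
    have := b7 x; rwa [unweight_weight hZd] at this
  have hsb : ∀ x, ‖h.source r x‖ ≤ C9 * e(κ,x) := fun x => by
    have := b9 x; rwa [unweight_weight (h.decays_source hκl hr.1)] at this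
  refine ⟨by linarith, (inv_anti₀ (by positivity) hr0').trans (by linarith),
    fun x => mono' (b1.2 x).1, fun x => mono' (b1.2 x).2.1, fun x => mono' (b1.2 x).2.2.1,
    fun x hx => ?_, fun x => (hhess x).trans (by linarith), fun x => mono (by linarith) (b3 x),
    fun x => mono (by linarith) (b4 x), fun x => mono (by linarith) (b5 x),
    fun x => mono (by linarith) (b6 x), fun x => mono (by linarith) (hZb x), fun x => ?_,
    fun x => mono (by linarith) (b8 x), fun u u1 u2 k1 k2 k3 k4 k5 => ?_, ?_⟩
  · refine mono (c := C2) (by linarith) ((b2 x hx).trans ?_)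
    have := hexp x
    rw [abs_of_nonneg hx] at this ⊢
    gcongr
  · refine mono (c := C12) (by linarith) ?_
    have hx1 : ∀ y ∈ Icc x (x + 1), ‖Z r y‖ ≤ exp κ * C7 * e(κ,x) := fun y hy => (hZb y).trans (by
        have := mul_mono_left (exp_neg_le_of_mem_Icc hκ.le hy) hC7
        linarith)
    have h1 := norm_sub_sub_deriv_le (h.hasDerivAt_corrector hZr)
      (h.hasDerivAt_deriv_corrector hZr) (x := x)
      (B := (C11 * (exp κ * C7) + exp κ * C9) * e(κ,x)) fun y hy => by
        refine (norm_sub_le _ _).trans ?_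
        have e1 := (ContinuousLinearMap.le_of_opNorm_le _ (hhess y) (Z r y)).trans
          (mul_mono_left (hx1 y hy) hC110)
        have e2 := (hsb y).trans (mul_mono_left (exp_neg_le_of_mem_Icc hκ.le hy) hC9)
        linarith
    have h2 := hZb x
    have h3 := hx1 (x + 1) ⟨by linarith, le_rfl⟩
    have h4 : deriv (Z r) x = Z r (x + 1) - Z r x - (Z r (x + 1) - Z r x - deriv (Z r) x) := by abel
    rw [h4, hC12]
    refine (norm_sub_le _ _).trans ?_
    have := norm_sub_le (Z r (x + 1)) (Z r x)
    linarith
  · refine (b10 u u1 u2 k1 k2 k3 k4 k5).trans (mul_mono_right (by linarith) ?_)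
    have := h.second_variation_nonneg hr.1 hκ k1 k2 k4
    rw [integral_add (k2.integrable_inner k2)
      (k1.integrable_inner (h.decays_hess_apply hr.1 k1))] at this
    positivity
  · rw [profileSlope, pairing_weight hκ (hSd r hr.1) (hSd r hr.1)] at b11
    refine le_trans ?_ b11.le
    refine inv_le_of_inv_le₀ (by positivity) ?_
    linarith

omit h in
theorem _root_.InterfaceModel.ProfileBound.mono {C' : ℝ}
    (hb : ProfileBound V d F Z κ C r) (h : ProfileFamily V d I F l) (hr : r ∈ I) (hκ : 0 < κ)
    (hC : C ≤ C') : ProfileBound V d F Z κ C' r := by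
  have hC0 : 0 < C := zero_lt_one.trans_le hb.one_le
  have m : ∀ {a x : ℝ}, a ≤ C * e(κ,x) → a ≤ C' * e(κ,x) := fun ha => ha.trans (by gcongr)
  exact ⟨hb.one_le.trans hC, hb.inv_le.trans hC, fun x => m (hb.slope x), fun x => m (hb.force x),
    fun x => m (hb.tail x), fun x hx => m (hb.vacuum x hx), fun x => (hb.hess x).trans hC,
    fun x => m (hb.rate x), fun x => m (hb.slope_r x), fun x => m (hb.slope_rr x),
    fun x => m (hb.force_r x), fun x => m (hb.corrector x), fun x => m (hb.corrector_x x),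
    fun x => m (hb.corrector_r x), fun u u1 u2 k1 k2 k3 k4 k5 => by
      refine (hb.coercive u u1 u2 k1 k2 k3 k4 k5).trans (mul_mono_right hC ?_)
      have := h.second_variation_nonneg hr hκ k1 k2 k4
      rw [integral_add (k2.integrable_inner k2)
        (k1.integrable_inner (h.decays_hess_apply hr k1))] at this
      positivity, (inv_anti₀ hC0 hC).trans hb.mass⟩

/-- Uniform bounds over a compact set of radii. -/
theorem exists_profileBound (hZ : ∀ r ∈ I, IsCorrector V d r 0 (F r) (Z r)) (hκ : 0 < κ) (hκl : κ < √l / 2)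
    {K : Set ℝ} (hK : IsCompact K) (hKI : K ⊆ I) : ∃ C, ∀ r ∈ K, ProfileBound V d F Z κ C r := by
  refine hK.induction_on (p := fun s => ∃ C, ∀ r ∈ s, r ∈ I → ProfileBound V d F Z κ C r)
    ⟨0, by simp⟩ (fun s t hst ⟨C, hC⟩ => ⟨C, fun r hr => hC r (hst hr)⟩)
    (fun s t ⟨C, hC⟩ ⟨C', hC'⟩ => ⟨max C C', ?_⟩) (fun r hr => ?_) |> fun ⟨C, hC⟩ =>
      ⟨C, fun r hr => hC r hr (hKI hr)⟩
  · rintro r (hr | hr) hI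
    · exact (hC r hr hI).mono h hI hκ (le_max_left _ _)
    · exact (hC' r hr hI).mono h hI hκ (le_max_right _ _)
  · obtain ⟨C, hC⟩ := h.eventually_profileBound hZ hκ hκl (hKI hr)
    exact ⟨_, mem_nhdsWithin_of_mem_nhds hC, C, fun r hr _ => hr⟩

end ProfileFamily

/-! ### Regularity of the interface -/

theorem one_sub_sq_pos {v : ℝ} (hv : |v| < 1) : 0 < 1 - v ^ 2 :=
  sub_pos.2 ((sq_lt_one_iff_abs_lt_one _).2 hv)

/-- The ratio `∫ s² / ∫ |F'|²`. -/
def massRatio (F : ℝ → Plane) : ℝ := (∫ x, (F x 1) ^ 2) / ∫ x, ‖deriv F x‖ ^ 2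

theorem norm_coordProj_sq (Ψ : Plane) : ‖coordProj 1 Ψ‖ ^ 2 = (Ψ 1) ^ 2 := by
  rw [norm_sq_eq_coords]; simp

namespace ProfileFamily

variable (h : ProfileFamily V d I F l)
include h

theorem contDiffAt_massRatio (hr₀ : r₀ ∈ I) : ContDiffAt ℝ 1 (fun r => massRatio (F r)) r₀ := by
  have hl := h.sqrt_pos
  have hκ : 0 < √l / 4 := by positivity
  have hκl : √l / 4 < √l / 2 := by linarith
  obtain ⟨hU, hS, -⟩ := h.regularity hκ hκl hr₀
  have hP := contDiffAt_form (pairing _ hκ) (h.contDiffAt_profileTail_of hκl hr₀ hU)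
  have hQ := contDiffAt_form (pairing _ hκ) hS
  have hd : ∀ r ∈ I, Decays (√l / 4) (deriv (F r)) := fun r hr => (h.decays_deriv hr).mono hκl.le
  have ht : ∀ r ∈ I, Decays (√l / 4) fun x => coordProj 1 (F r x) := fun r hr =>
    (h.decays_coordProj hr).mono hκl.le
  have hpos : pairing _ hκ (profileSlope F (√l / 4) r₀) (profileSlope F (√l / 4) r₀) ≠ 0 := by
    rw [profileSlope, pairing_weight hκ (hd r₀ hr₀) (hd r₀ hr₀)]
    exact (h.integral_deriv_sq_pos hr₀).ne'
  refine (hP.div hQ hpos).congr_of_eventuallyEq ?_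
  filter_upwards [h.isOpen.mem_nhds hr₀] with r hr
  simp only [massRatio, profileSlope, profileTail, Pi.div_apply]
  rw [pairing_weight hκ (hd r hr) (hd r hr), pairing_weight hκ (ht r hr) (ht r hr)]
  simp only [real_inner_self_eq_norm_sq, norm_coordProj_sq]

end ProfileFamily

/-- Smoothness and the interface equation at a single time. -/
structure InterfaceRegular (d : ℝ) (I : Set ℝ) (F : ℝ → ℝ → Plane) (R : ℝ → ℝ) (t : ℝ) : Prop where
  mem : R t ∈ I
  lt_one : |deriv R t| < 1
  smooth : ContDiffAt ℝ 1 R t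
  smooth_deriv : ContDiffAt ℝ 1 (deriv R) t
  smooth_deriv2 : ContDiffAt ℝ 1 (deriv (deriv R)) t
  equation : meanCurvature R t * (∫ x : ℝ, ‖deriv (F (R t)) x‖ ^ 2)
    - d ^ 2 / R t ^ 3 * mFactor R t * (∫ x : ℝ, (F (R t) x 1) ^ 2) = 0

theorem InterfaceRegular.smooth_mFactor (h : InterfaceRegular d I F R t) : ContDiffAt ℝ 1 (mFactor R) t := by
  have h1 := one_sub_sq_pos h.lt_one
  have := h.smooth_deriv
  unfold mFactor
  exact contDiffAt_const.div ((contDiffAt_const.sub (this.pow 2)).sqrt h1.ne')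
    (Real.sqrt_pos.2 h1).ne'

theorem InterfaceRegular.mFactor_pos (h : InterfaceRegular d I F R t) : 1 ≤ mFactor R t := by
  have h1 := one_sub_sq_pos h.lt_one
  rw [mFactor, le_div_iff₀ (Real.sqrt_pos.2 h1), one_mul, Real.sqrt_le_one]
  nlinarith [sq_nonneg (deriv R t)]

theorem ProfileFamily.interfaceRegular (h : ProfileFamily V d I F l) (hR : IsInterface d I F R T)
    (ht : t ∈ Icc 0 T) : InterfaceRegular d I F R t := by
  have hev := eventually_nhdsSet_iff_forall.1 hR t ht
  have hself := hev.self_of_nhds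
  have hG : deriv (deriv R) =ᶠ[𝓝 t] fun s => (1 - deriv R s ^ 2) *
      (d ^ 2 / R s ^ 3 * massRatio (F (R s)) - 1 / R s) := by
    filter_upwards [hev] with s hs
    obtain ⟨hI, hlt, -, -, heq⟩ := hs
    have hm := h.integral_deriv_sq_pos hI
    simp only [real_inner_self_eq_norm_sq] at hm
    have h1 := one_sub_sq_pos hlt
    have h3 := h.pos _ hI
    rw [meanCurvature, mFactor] at heq
    rw [massRatio]
    field_simp at heq ⊢
    linarith
  have hΓ : ∀ s, R s ∈ I → ContDiffAt ℝ 1 R s → ContDiffAt ℝ 1 (deriv R) s →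
      ContDiffAt ℝ 1 (fun s => (1 - deriv R s ^ 2) *
      (d ^ 2 / R s ^ 3 * massRatio (F (R s)) - 1 / R s)) s := fun s hI h1 h2 => by
    have h3 := (h.pos _ hI).ne'
    exact (contDiffAt_const.sub (h2.pow 2)).mul (((contDiffAt_const.div (h1.pow 3)
      (pow_ne_zero 3 h3)).mul ((h.contDiffAt_massRatio hI).comp s h1)).sub
      (contDiffAt_const.div h1 h3))
  have hev' := hev.eventually_nhds
  have hG' := hG.eventually_nhds
  have c0 : ∀ᶠ s in 𝓝 t, ContDiffAt ℝ 1 R s := hev'.mono fun s hs =>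
    contDiffAt_one_of_hasDerivAt (hs.mono fun _ h => h.2.2.1.hasDerivAt)
      (hs.mono fun _ h => h.2.2.2.1.continuousAt)
  have c1 : ContDiffAt ℝ 1 (deriv R) t :=
    contDiffAt_one_of_hasDerivAt (hev.mono fun _ h => h.2.2.2.1.hasDerivAt) (by
      filter_upwards [hev, hG', c0] with s hs hs' hs0
      refine ContinuousAt.congr ?_ (EventuallyEq.symm hs')
      have h3 := (h.pos _ hs.1).ne'
      exact (continuousAt_const.sub (hs.2.2.2.1.continuousAt.pow 2)).mul
        (((continuousAt_const.div (hs0.continuousAt.pow 3) (pow_ne_zero 3 h3)).mul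
        (ContinuousAt.comp (f := R) (h.contDiffAt_massRatio hs.1).continuousAt
          hs0.continuousAt)).sub (continuousAt_const.div hs0.continuousAt h3)))
  exact ⟨hself.1, hself.2.1, c0.self_of_nhds, c1,
    (hΓ t hself.1 c0.self_of_nhds c1).congr_of_eventuallyEq hG, hself.2.2.2.2⟩

/-- Bounds for the coefficients of the wave equation at time `t`. -/
structure GeomBound (R : ℝ → ℝ) (Y C t : ℝ) : Prop where
  one_le : 1 ≤ C
  m_le : mFactor R t ≤ C
  m_deriv : |deriv (mFactor R) t| ≤ C
  deriv2 : |deriv (deriv R) t| ≤ C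
  slope : |mFactor R t ^ 3 * deriv (deriv R) t| ≤ C
  radius_zero : (R t)⁻¹ ≤ C
  n_inv : ∀ y ∈ Icc (-Y) Y, (nFactor R t y)⁻¹ ≤ C
  radius_inv : ∀ y ∈ Icc (-Y) Y, (radius R t y)⁻¹ ≤ C
  B0_le : ∀ y ∈ Icc (-Y) Y, |coeffB0 R t y| ≤ C
  B1_le : ∀ y ∈ Icc (-Y) Y, |coeffB1 R t y| ≤ C
  B1_sub_le : ∀ y ∈ Icc (-Y) Y, |coeffB1 R t y - coeffB1 R t 0| ≤ C * |y|

theorem exists_geomBound (hY : 0 < Y) (hR : ∀ t ∈ Icc 0 T, InterfaceRegular d I F R t)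
    (hc : CoordinatesDefined R T Y) : ∃ C, ∀ t ∈ Icc 0 T, GeomBound R Y C t := by
  set K := Icc (0 : ℝ) T ×ˢ Icc (-Y) Y
  have hK : IsCompact K := isCompact_Icc.prod isCompact_Icc
  have bd : ∀ g : ℝ × ℝ → ℝ, ContinuousOn g K → ∃ C, 0 ≤ C ∧
      ∀ t ∈ Icc 0 T, ∀ y ∈ Icc (-Y) Y, |g (t, y)| ≤ C := fun g hg => by
    obtain ⟨C, hC⟩ := hK.exists_bound_of_continuousOn hg
    exact ⟨max C 0, le_max_right _ _, fun t ht y hy => (hC (t, y) ⟨ht, hy⟩).trans (le_max_left _ _)⟩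
  have fst : ∀ {g : ℝ → ℝ}, (∀ t ∈ Icc 0 T, ContinuousAt g t) →
      ContinuousOn (fun p : ℝ × ℝ => g p.1) K := fun hg =>
    ContinuousOn.comp (t := Icc 0 T) (fun t ht => (hg t ht).continuousWithinAt) continuousOn_fst
      fun p hp => hp.1
  have d0 : ∀ {f : ℝ → ℝ} {t : ℝ}, ContDiffAt ℝ 1 f t → ContinuousAt (deriv f) t := fun hf =>
    (hf.derivWithin (m := 0) le_rfl).continuousAt
  set k : ℝ → ℝ := fun t => mFactor R t ^ 3 * deriv (deriv R) t with hk
  have sk : ∀ t ∈ Icc 0 T, ContDiffAt ℝ 1 k t := fun t ht =>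
    ((hR t ht).smooth_mFactor.pow 3).mul (hR t ht).smooth_deriv2
  have cR := fst fun t ht => (hR t ht).smooth.continuousAt
  have cR1 := fst fun t ht => (hR t ht).smooth_deriv.continuousAt
  have cR2 := fst fun t ht => (hR t ht).smooth_deriv2.continuousAt
  have cm := fst fun t ht => (hR t ht).smooth_mFactor.continuousAt
  have cm' := fst fun t ht => d0 (hR t ht).smooth_mFactor
  have ck := fst fun t ht => (sk t ht).continuousAt
  have ck' := fst fun t ht => d0 (sk t ht)
  have hn : ∀ t y, nFactor R t y = 1 + y * k t := fun t y => by rw [nFactor, hk]; ring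
  have cy : ContinuousOn (fun p : ℝ × ℝ => p.2) K := continuousOn_snd
  have cn : ContinuousOn (fun p : ℝ × ℝ => nFactor R p.1 p.2) K := by
    simp only [hn]; exact continuousOn_const.add (cy.mul ck)
  have cρ : ContinuousOn (fun p : ℝ × ℝ => radius R p.1 p.2) K := cR.add (cy.mul cm)
  have n0 : ∀ p ∈ K, nFactor R p.1 p.2 ≠ 0 := fun p hp =>
    (hc p.1 hp.1 p.2 hp.2).1.ne'
  have ρ0 : ∀ p ∈ K, radius R p.1 p.2 ≠ 0 := fun p hp =>
    (hc p.1 hp.1 p.2 hp.2).2.ne'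
  have cB0 : ContinuousOn (fun p : ℝ × ℝ => coeffB0 R p.1 p.2)
      K := by
    have e : ∀ p ∈ K, coeffB0 R p.1 p.2 =
        mFactor R p.1 / nFactor R p.1 p.2 * ((deriv (mFactor R) p.1 * nFactor R p.1 p.2 -
          mFactor R p.1 * (p.2 * deriv k p.1)) / nFactor R p.1 p.2 ^ 2) +
        1 / radius R p.1 p.2 * (mFactor R p.1 ^ 2 / nFactor R p.1 p.2) * deriv R p.1 :=
      fun p hp => by
        have e1 := ((hR p.1 hp.1).smooth_mFactor.differentiableAt (by norm_num)).hasDerivAt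
        have e2 := ((sk p.1 hp.1).differentiableAt (by norm_num)).hasDerivAt
        have e3 : HasDerivAt (fun τ => nFactor R τ p.2) (p.2 * deriv k p.1) p.1 := by
          simp only [hn]; exact (e2.const_mul p.2).const_add 1
        have e4 : HasDerivAt (fun τ => mFactor R τ / nFactor R τ p.2) _ p.1 := e1.div e3 (n0 p hp)
        rw [coeffB0, e4.deriv]
    refine ContinuousOn.congr ?_ e
    exact ((cm.div cn n0).mul (((cm'.mul cn).sub (cm.mul (cy.mul ck'))).div (cn.pow 2)
      fun p hp => pow_ne_zero 2 (n0 p hp))).add (((continuousOn_const.div cρ ρ0).mul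
      ((cm.pow 2).div cn n0)).mul cR1)
  have cB1 : ContinuousOn (fun p : ℝ × ℝ => coeffB1 R p.1 p.2) K :=
    ((((cm.pow 3).div cn n0).mul cR2).neg).sub ((continuousOn_const.div cρ ρ0).mul cm)
  obtain ⟨C1, p1, b1⟩ := bd _ cm
  obtain ⟨C2, p2, b2⟩ := bd _ cm'
  obtain ⟨C3, p3, b3⟩ := bd _ cR2
  obtain ⟨C4, p4, b4⟩ := bd _ ck
  obtain ⟨C5, p5, b5⟩ := bd _ (cn.inv₀ n0)
  obtain ⟨C6, p6, b6⟩ := bd _ (cρ.inv₀ ρ0)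
  obtain ⟨C7, p7, b7⟩ := bd _ cB0
  obtain ⟨C8, p8, b8⟩ := bd _ cB1
  have hy0 : (0 : ℝ) ∈ Icc (-Y) Y := ⟨by linarith, hY.le⟩
  set C9 := C4 * C4 * C5 + C1 * C1 * C6 * C6
  have p9 : 0 ≤ C9 := by positivity
  refine ⟨1 + C1 + C2 + C3 + C4 + C5 + C6 + C7 + C8 + C9, fun t ht => ⟨by linarith,
    ((le_abs_self _).trans (b1 t ht 0 hy0)).trans (by linarith),
    (b2 t ht 0 hy0).trans (by linarith), (b3 t ht 0 hy0).trans (by linarith),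
    (b4 t ht 0 hy0).trans (by linarith), ?_,
    fun y hy => ((le_abs_self _).trans (b5 t ht y hy)).trans (by linarith),
    fun y hy => ((le_abs_self _).trans (b6 t ht y hy)).trans (by linarith),
    fun y hy => (b7 t ht y hy).trans (by linarith),
    fun y hy => (b8 t ht y hy).trans (by linarith), fun y hy => ?_⟩⟩
  · have := (le_abs_self _).trans (b6 t ht 0 hy0)
    simp only [Pi.inv_apply, radius, zero_mul, add_zero] at this
    linarith
  · obtain ⟨hn0, hρ0⟩ := hc t ht y hy
    obtain ⟨-, hρ00⟩ := hc t ht 0 hy0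
    have e : coeffB1 R t y - coeffB1 R t 0 = y * (k t * k t * (nFactor R t y)⁻¹ +
        mFactor R t * mFactor R t * (radius R t y)⁻¹ * (radius R t 0)⁻¹) := by
      have h1 : nFactor R t 0 = 1 := by simp [nFactor]
      have h2 : radius R t y - radius R t 0 = y * mFactor R t := by simp [radius]
      rw [coeffB1, coeffB1, h1]
      have h3 : k t = mFactor R t ^ 3 * deriv (deriv R) t := rfl
      have h4 := hn t y
      field_simp
      rw [h3] at h4 ⊢
      linear_combination (mFactor R t ^ 3 * deriv (deriv R) t) * radius R t y * radius R t 0 * h4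
        + nFactor R t y * mFactor R t * h2
    rw [e, abs_mul, mul_comm]
    refine mul_mono_right ((abs_add_le _ _).trans ?_) (abs_nonneg y)
    have e1 : |k t * k t * (nFactor R t y)⁻¹| ≤ C4 * C4 * C5 := by
      rw [abs_mul, abs_mul]
      gcongr
      exacts [b4 t ht y hy, b4 t ht y hy, b5 t ht y hy]
    have e2 : |mFactor R t * mFactor R t * (radius R t y)⁻¹ * (radius R t 0)⁻¹| ≤
        C1 * C1 * C6 * C6 := by
      rw [abs_mul, abs_mul, abs_mul]
      gcongr
      exacts [b1 t ht y hy, b1 t ht y hy, b6 t ht y hy, b6 t ht 0 hy0]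
    linarith

/-! ### Pairings with a rescaled test function -/

/-- `∫ ⟨Ψ(y), u((y - α) / ε)⟩ dy`. -/
def slicePair (κ ε : ℝ) (Ψ : ℝ → Plane) (u : Weighted) (α : ℝ) : ℝ :=
  ∫ y, ⟪Ψ y, unweight κ u ((y - α) / ε)⟫

/-- Local boundedness and continuity of a family of bounded continuous functions. -/
structure SliceCont {X : Type*} [TopologicalSpace X] (Ψ : X → ℝ → Plane) (x₀ : X) : Prop where
  continuous : ∀ᶠ x in 𝓝 x₀, Continuous (Ψ x)
  bounded : ∃ B, ∀ᶠ x in 𝓝 x₀, ∀ y, ‖Ψ x y‖ ≤ B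
  continuousAt : ∀ y, ContinuousAt (fun x => Ψ x y) x₀

theorem SliceCont.comp {X X' : Type*} [TopologicalSpace X] [TopologicalSpace X']
    {Ψ : X → ℝ → Plane} {g : X' → X} {x₀ : X'} (h : SliceCont Ψ (g x₀)) (hg : ContinuousAt g x₀) :
    SliceCont (fun x => Ψ (g x)) x₀ :=
  ⟨hg.eventually h.continuous, h.bounded.imp fun _ hB => hg.eventually hB,
    fun y => ContinuousAt.comp (f := g) (h.continuousAt y) hg⟩

theorem norm_unweight_le_norm (hκ : 0 ≤ κ) (w : Weighted) (x : ℝ) : ‖unweight κ w x‖ ≤ ‖w‖ :=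
  (norm_unweight_le κ w x).trans (mul_le_of_le_one_right (norm_nonneg _) (weight_le_one hκ x))

theorem continuousAt_unweight_comp {X : Type*} [TopologicalSpace X] (hκ : 0 ≤ κ)
    {w : X → Weighted} {ζ : X → ℝ} {x₀ : X} (hw : ContinuousAt w x₀) (hζ : ContinuousAt ζ x₀) :
    ContinuousAt (fun x => unweight κ (w x) (ζ x)) x₀ := by
  have h1 : ContinuousAt (fun x => unweight κ (w x₀) (ζ x)) x₀ :=
    ContinuousAt.comp (f := ζ) (continuous_unweight κ _).continuousAt hζ
  have h2 : Tendsto (fun x => unweight κ (w x - w x₀) (ζ x)) (𝓝 x₀) (𝓝 0) := by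
    have h3 : Tendsto (fun x => ‖w x - w x₀‖) (𝓝 x₀) (𝓝 0) := by
      have := (hw.sub (continuousAt_const (y := w x₀))).norm.tendsto
      simpa using this
    exact squeeze_zero_norm (fun x => norm_unweight_le_norm hκ _ _) h3
  have h3 := h1.tendsto.add h2
  rw [add_zero] at h3
  refine h3.congr fun x => ?_
  rw [unweight_sub]
  simp

theorem exp_shift_le {α α₀ : ℝ} (hκ : 0 < κ) (hε : 0 < ε) (hα : |α - α₀| ≤ 1) (y : ℝ) :
    e(κ,(y - α) / ε) ≤ exp (κ / ε) * e(κ / ε,y - α₀) := by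
  rw [← exp_add, exp_le_exp, abs_div, abs_of_pos hε]
  have h1 := abs_sub_abs_le_abs_sub (y - α₀) (y - α)
  rw [show y - α₀ - (y - α) = α - α₀ by ring] at h1
  have h2 : κ / ε * (|y - α₀| - |y - α|) ≤ κ / ε * 1 := by gcongr; linarith
  have h3 : κ * (|y - α| / ε) = κ / ε * |y - α| := by ring
  rw [h3]; linarith

theorem integrable_exp_shift {c : ℝ} (hc : 0 < c) (α₀ : ℝ) : Integrable fun y : ℝ => e(c,y - α₀) :=
  (integrable_exp_neg_abs hc).comp_sub_right α₀

theorem norm_inner_unweight_le {α α₀ B M : ℝ} (hκ : 0 < κ) (hε : 0 < ε) (hα : |α - α₀| ≤ 1)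
    {Ψ : Plane} {w : Weighted} (hB : ‖Ψ‖ ≤ B) (hM : ‖w‖ ≤ M) (y : ℝ) :
    ‖Ψ‖ * ‖unweight κ w ((y - α) / ε)‖ ≤ B * M * exp (κ / ε) * e(κ / ε,y - α₀) := by
  have hB0 := (norm_nonneg _).trans hB
  have hM0 := (norm_nonneg _).trans hM
  calc ‖Ψ‖ * ‖unweight κ w ((y - α) / ε)‖ ≤ B * (M * (exp (κ / ε) * e(κ / ε,y - α₀))) := by
        gcongr
        refine (norm_unweight_le _ _ _).trans ?_
        gcongr
        exact exp_shift_le hκ hε hα y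
    _ = _ := by ring

theorem integrable_slicePair {B : ℝ} (hκ : 0 < κ) (hε : 0 < ε) {Ψ : ℝ → Plane}
    (hc : Continuous Ψ) (hB : ∀ y, ‖Ψ y‖ ≤ B) (w : Weighted) (α : ℝ) :
    Integrable fun y => ⟪Ψ y, unweight κ w ((y - α) / ε)⟫ := by
  have hcw := continuous_unweight κ w
  refine ((integrable_exp_shift (c := κ / ε) (by positivity) α).const_mul
    (B * ‖w‖ * exp (κ / ε))).mono' (by fun_prop) (.of_forall fun y => ?_)
  exact (norm_inner_le_norm _ _).trans (norm_inner_unweight_le hκ hε (by simp) (hB y) le_rfl y)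

theorem continuousAt_slicePair {X : Type*} [TopologicalSpace X] [FirstCountableTopology X]
    (hκ : 0 < κ) (hε : 0 < ε) {Ψ : X → ℝ → Plane} {w : X → Weighted} {α : X → ℝ} {x₀ : X}
    (hΨ : SliceCont Ψ x₀) (hw : ContinuousAt w x₀) (hα : ContinuousAt α x₀) :
    ContinuousAt (fun x => slicePair κ ε (Ψ x) (w x) (α x)) x₀ := by
  obtain ⟨B, hB⟩ := hΨ.bounded
  refine tendsto_integral_filter_of_dominated_convergence (fun y => B * (‖w x₀‖ + 1) *
    exp (κ / ε) * e(κ / ε,y - α x₀)) ?_ ?_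
    ((integrable_exp_shift (by positivity) _).const_mul _) ?_
  · filter_upwards [hΨ.continuous] with x hx
    have hcw := continuous_unweight κ (w x)
    exact (by fun_prop : Continuous fun y => ⟪Ψ x y,
      unweight κ (w x) ((y - α x) / ε)⟫).aestronglyMeasurable
  · have h1 : ∀ᶠ x in 𝓝 x₀, ‖w x‖ < ‖w x₀‖ + 1 := hw.norm.eventually (gt_mem_nhds (lt_add_one _))
    have h2 : ∀ᶠ x in 𝓝 x₀, |α x - α x₀| < 1 := by
      have := hα.eventually (Metric.ball_mem_nhds _ one_pos)
      simpa only [Metric.mem_ball, dist_eq] using this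
    filter_upwards [hB, h1, h2] with x hx hx1 hx2
    exact .of_forall fun y => (norm_inner_le_norm _ _).trans
      (norm_inner_unweight_le hκ hε hx2.le (hx y) hx1.le y)
  · refine .of_forall fun y => ?_
    exact ((hΨ.continuousAt y).inner (𝕜 := ℝ) (continuousAt_unweight_comp hκ.le hw
      ((continuousAt_const.sub hα).div_const ε))).tendsto

/-- A family of test functions that is `C¹` in the parameter and in space. -/
structure TestFamily (κ : ℝ) (u u' ux : ℝ → Weighted) (r : ℝ) : Prop where
  deriv : ∀ᶠ s in 𝓝 r, HasDerivAt u (u' s) s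
  deriv_cont : ContinuousAt u' r
  space : ∀ᶠ s in 𝓝 r, ∀ x, HasDerivAt (unweight κ (u s)) (unweight κ (ux s) x) x
  space_cont : ContinuousAt ux r

theorem hasDerivAt_slicePair (hκ : 0 < κ) (hε : 0 < ε) {Ψ Ψ' : ℝ → ℝ → Plane}
    {u u' ux : ℝ → Weighted} {ρ ρ' α α' : ℝ → ℝ} {t₀ : ℝ} (hΨ : SliceCont Ψ t₀)
    (hΨ' : SliceCont Ψ' t₀)
    (hd : ∀ᶠ t in 𝓝 t₀, ∀ y, HasDerivAt (fun τ => Ψ τ y) (Ψ' t y) t)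
    (hu : TestFamily κ u u' ux (ρ t₀)) (hρ : ∀ᶠ t in 𝓝 t₀, HasDerivAt ρ (ρ' t) t)
    (hρ' : ContinuousAt ρ' t₀) (hα : ∀ᶠ t in 𝓝 t₀, HasDerivAt α (α' t) t)
    (hα' : ContinuousAt α' t₀) :
    HasDerivAt (fun t => slicePair κ ε (Ψ t) (u (ρ t)) (α t))
      (slicePair κ ε (Ψ' t₀) (u (ρ t₀)) (α t₀) + ρ' t₀ * slicePair κ ε (Ψ t₀) (u' (ρ t₀)) (α t₀)
        - α' t₀ / ε * slicePair κ ε (Ψ t₀) (ux (ρ t₀)) (α t₀)) t₀ := by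
  obtain ⟨B, hB⟩ := hΨ.bounded
  obtain ⟨B', hB'⟩ := hΨ'.bounded
  have hρc := hρ.self_of_nhds.continuousAt
  have hαc := hα.self_of_nhds.continuousAt
  have n1 : ∀ {w : ℝ → Weighted}, ContinuousAt w (ρ t₀) →
      ∀ᶠ t in 𝓝 t₀, ‖w (ρ t)‖ < ‖w (ρ t₀)‖ + 1 := fun hw =>
    (ContinuousAt.comp (f := ρ) hw hρc).norm.eventually (gt_mem_nhds (lt_add_one _))
  have n2 : ∀ {g : ℝ → ℝ}, ContinuousAt g t₀ → ∀ᶠ t in 𝓝 t₀, |g t| < |g t₀| + 1 := fun hg =>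
    hg.abs.eventually (gt_mem_nhds (lt_add_one _))
  have n3 : ∀ᶠ x in 𝓝 t₀, |α x - α t₀| < 1 := by
    have := hαc.eventually (Metric.ball_mem_nhds _ one_pos)
    simpa only [Metric.mem_ball, dist_eq] using this
  set D : ℝ → ℝ → ℝ := fun t y => ⟪Ψ t y, ρ' t • unweight κ (u' (ρ t)) ((y - α t) / ε)
      + (-(α' t) / ε) • unweight κ (ux (ρ t)) ((y - α t) / ε)⟫
      + ⟪Ψ' t y, unweight κ (u (ρ t)) ((y - α t) / ε)⟫ with hD
  set M : ℝ := B * (‖u' (ρ t₀)‖ + 1) * (|ρ' t₀| + 1) +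
    B * (‖ux (ρ t₀)‖ + 1) * ((|α' t₀| + 1) / ε) + B' * (‖u (ρ t₀)‖ + 1) with hM
  have huc : ContinuousAt u (ρ t₀) := hu.deriv.self_of_nhds.continuousAt
  have hgood : ∀ᶠ t in 𝓝 t₀, (∀ y, HasDerivAt (fun τ => ⟪Ψ τ y,
      unweight κ (u (ρ τ)) ((y - α τ) / ε)⟫) (D t y) t) ∧ ∀ y, ‖D t y‖ ≤
      M * exp (κ / ε) * e(κ / ε,y - α t₀) := by
    filter_upwards [hB, hB', hd, hρ, hα, hρc.eventually hu.deriv, hρc.eventually hu.space,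
      n1 huc, n1 hu.deriv_cont, n1 hu.space_cont, n2 hρ', n2 hα', n3] with
      t e1 e2 e3 e4 e5 e6 e7 e8 e9 e10 e11 e12 e13
    refine ⟨fun y => ?_, fun y => ?_⟩
    · have hζ : HasDerivAt (fun τ => (y - α τ) / ε) (-(α' t) / ε) t := (e5.const_sub y).div_const ε
      exact (e3 y).inner ℝ (hasDerivAt_unweight_comp hκ.le e4 hζ e6 (e7 _))
    · have i1 := norm_inner_unweight_le hκ hε e13.le (e1 y) e9.le y
      have i2 := norm_inner_unweight_le hκ hε e13.le (e1 y) e10.le y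
      have i3 := norm_inner_unweight_le hκ hε e13.le (e2 y) e8.le y
      have k1 := norm_inner_le_norm (𝕜 := ℝ) (Ψ t y) (unweight κ (u' (ρ t)) ((y - α t) / ε))
      have k2 := norm_inner_le_norm (𝕜 := ℝ) (Ψ t y) (unweight κ (ux (ρ t)) ((y - α t) / ε))
      have k3 := norm_inner_le_norm (𝕜 := ℝ) (Ψ' t y) (unweight κ (u (ρ t)) ((y - α t) / ε))
      simp only [hD, inner_add_right, inner_smul_right]
      refine (norm_add_le _ _).trans ((add_le_add_left (norm_add_le _ _) _).trans ?_)
      rw [norm_mul, norm_mul, norm_eq_abs (ρ' t), norm_eq_abs (-(α' t) / ε), abs_div,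
        abs_neg, abs_of_pos hε]
      have j1 := mul_mono e11.le (k1.trans i1)
      have j2 := mul_mono (div_le_div_of_nonneg_right e12.le hε.le) (k2.trans i2)
      rw [hM]
      linarith
  have key := hasDerivAt_integral_of_dominated_loc_of_deriv_le (μ := volume) (F' := D)
    (bound := fun y => M * exp (κ / ε) * e(κ / ε,y - α t₀)) hgood ?_ ?_ ?_
    (.of_forall fun y t ht => ht.2 y)
    ((integrable_exp_shift (by positivity) _).const_mul _)
    (.of_forall fun y t ht => ht.1 y)
  · refine key.2.congr_deriv ?_
    have c1 := integrable_slicePair hκ hε hΨ.continuous.self_of_nhds hB.self_of_nhds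
      (u' (ρ t₀)) (α t₀)
    have c2 := integrable_slicePair hκ hε hΨ.continuous.self_of_nhds hB.self_of_nhds
      (ux (ρ t₀)) (α t₀)
    have c3 := integrable_slicePair hκ hε hΨ'.continuous.self_of_nhds hB'.self_of_nhds
      (u (ρ t₀)) (α t₀)
    simp only [hD, inner_add_right, inner_smul_right]
    have c4 : Integrable fun y => ρ' t₀ * ⟪Ψ t₀ y, unweight κ (u' (ρ t₀)) ((y - α t₀) / ε)⟫
        + -(α' t₀) / ε * ⟪Ψ t₀ y, unweight κ (ux (ρ t₀)) ((y - α t₀) / ε)⟫ :=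
      (c1.const_mul _).add (c2.const_mul _)
    rw [integral_add c4 c3, integral_add (c1.const_mul _) (c2.const_mul _), integral_const_mul, integral_const_mul]
    simp only [slicePair]
    ring
  · filter_upwards [hΨ.continuous] with x hx
    have hcw := continuous_unweight κ (u (ρ x))
    exact (by fun_prop : Continuous fun y => ⟪Ψ x y,
      unweight κ (u (ρ x)) ((y - α x) / ε)⟫).aestronglyMeasurable
  · exact integrable_slicePair hκ hε hΨ.continuous.self_of_nhds hB.self_of_nhds _ _
  · have h1 := hΨ.continuous.self_of_nhds
    have h2 := hΨ'.continuous.self_of_nhds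
    have h3 := continuous_unweight κ (u (ρ t₀))
    have h4 := continuous_unweight κ (u' (ρ t₀))
    have h5 := continuous_unweight κ (ux (ρ t₀))
    exact (by fun_prop : Continuous (D t₀)).aestronglyMeasurable

theorem slicePair_eq (hε : 0 < ε) (Ψ : ℝ → Plane) (w : Weighted) (α : ℝ) :
    slicePair κ ε Ψ w α = ε * ∫ z, ⟪Ψ (ε * z + α), unweight κ w z⟫ := by
  have h1 := integral_sub_right_eq_self (μ := volume) (fun y => ⟪Ψ (y + α), unweight κ w (y / ε)⟫) α
  have h2 := Measure.integral_comp_mul_left (fun y => ⟪Ψ (y + α), unweight κ w (y / ε)⟫) ε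
  simp only [sub_add_cancel] at h1
  rw [slicePair, h1]
  simp only [mul_div_cancel_left₀ _ hε.ne'] at h2
  rw [h2, abs_of_pos (inv_pos.2 hε), smul_eq_mul, ← mul_assoc, mul_inv_cancel₀ hε.ne', one_mul]

/-- The derivative of an implicitly defined function. -/
theorem hasDerivAt_of_implicit {J Jt Jα : ℝ × ℝ → ℝ} {a : ℝ → ℝ} {t₀ : ℝ}
    (h1 : ∀ᶠ p in 𝓝 (t₀, a t₀), HasDerivAt (fun t => J (t, p.2)) (Jt p) p.1)
    (h2 : ∀ᶠ p in 𝓝 (t₀, a t₀), HasDerivAt (fun α => J (p.1, α)) (Jα p) p.2)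
    (c1 : ContinuousAt Jt (t₀, a t₀)) (c2 : ContinuousAt Jα (t₀, a t₀))
    (h0 : Jα (t₀, a t₀) ≠ 0) (ha : ContinuousAt a t₀) (hJ : ∀ᶠ t in 𝓝 t₀, J (t, a t) = 0) :
    HasDerivAt a (-(Jt (t₀, a t₀) / Jα (t₀, a t₀))) t₀ := by
  have hs := hasStrictFDerivAt_uncurry_coprod (𝕜 := ℝ) (u := (t₀, a t₀))
    (f := fun t α => J (t, α)) (f₁ := fun t α => ContinuousLinearMap.toSpanSingleton ℝ (Jt (t, α)))
    (f₂ := fun t α => ContinuousLinearMap.toSpanSingleton ℝ (Jα (t, α)))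
    (h1.mono fun p hp => hp.hasFDerivAt) (h2.mono fun p hp => hp.hasFDerivAt)
    ((ContinuousLinearMap.toSpanSingletonCLE (𝕜 := ℝ) (E := ℝ)).continuous.continuousAt.comp c1)
    ((ContinuousLinearMap.toSpanSingletonCLE (𝕜 := ℝ) (E := ℝ)).continuous.continuousAt.comp c2)
  have hp : Tendsto (fun t => (t, a t)) (𝓝 t₀) (𝓝 (t₀, a t₀)) := (continuousAt_id.prodMk ha).tendsto
  have hl := hs.hasFDerivAt.isLittleO.comp_tendsto hp
  set j := Jα (t₀, a t₀) with hj
  set c := Jt (t₀, a t₀) / j with hc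
  have hr : (fun t => a t - a t₀ + c * (t - t₀)) =o[𝓝 t₀]
      fun t => ((t - t₀, a t - a t₀) : ℝ × ℝ) := by
    refine ((hl.const_mul_left (-j⁻¹)).congr' ?_ (.of_forall fun t => rfl))
    filter_upwards [hJ] with t ht
    simp [Function.HasUncurry.uncurry, ht, hJ.self_of_nhds]
    rw [← hj, show Jt (t₀, a t₀) = c * j by rw [hc, div_mul_cancel₀ _ h0]]
    field_simp
    ring
  have hO : (fun t => ((t - t₀, a t - a t₀) : ℝ × ℝ)) =O[𝓝 t₀] fun t => t - t₀ := by
    refine Asymptotics.IsBigO.of_bound (2 * |c| + 2) ?_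
    filter_upwards [hr.bound (show (0 : ℝ) < 1 / 2 by norm_num)] with t ht
    rw [Prod.norm_def, norm_eq_abs, norm_eq_abs, norm_eq_abs] at *
    have h3 : |a t - a t₀| ≤ |a t - a t₀ + c * (t - t₀)| + |c| * |t - t₀| := by
      have := abs_sub (a t - a t₀ + c * (t - t₀)) (c * (t - t₀))
      rwa [add_sub_cancel_right, abs_mul] at this
    have h4 := abs_nonneg (t - t₀)
    have h5 := abs_nonneg (a t - a t₀)
    have h6 : max |t - t₀| |a t - a t₀| ≤ |t - t₀| + |a t - a t₀| := max_le (by linarith) (by linarith)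
    refine max_le ?_ ?_ <;> nlinarith [abs_nonneg c]
  rw [hasDerivAt_iff_isLittleO]
  refine (hr.trans_isBigO hO).congr_left fun t => ?_
  rw [smul_eq_mul]; ring

/-! ### Partial derivatives of a classical solution -/

theorem contDiffOn_deriv_fst {f : ℝ × ℝ → E} {s : Set (ℝ × ℝ)} (hs : IsOpen s) {n : ℕ} (hf : ContDiffOn ℝ (n + 1) f s) :
    ContDiffOn ℝ n (fun p => deriv (fun τ => f (τ, p.2)) p.1) s ∧
      ∀ p ∈ s, HasDerivAt (fun τ => f (τ, p.2)) (deriv (fun τ => f (τ, p.2)) p.1) p.1 := by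
  have hd : ∀ p ∈ s, HasDerivAt (fun τ => f (τ, p.2)) (fderiv ℝ f p (1, 0)) p.1 := fun p hp => by
    have h1 := ((hf.contDiffAt (hs.mem_nhds hp)).differentiableAt (by simp)).hasFDerivAt
    have h2 : HasDerivAt (fun τ : ℝ => (τ, p.2)) (1, 0) p.1 :=
      (hasDerivAt_id p.1).prodMk (hasDerivAt_const p.1 p.2)
    exact h1.comp_hasDerivAt p.1 h2
  refine ⟨?_, fun p hp => (hd p hp).differentiableAt.hasDerivAt⟩
  refine ContDiffOn.congr (f := fun p => fderiv ℝ f p (1, 0)) ?_ fun p hp => (hd p hp).deriv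
  exact (hf.fderiv_of_isOpen hs le_rfl).clm_apply contDiffOn_const

theorem contDiffOn_deriv_snd {f : ℝ × ℝ → E} {s : Set (ℝ × ℝ)} (hs : IsOpen s) {n : ℕ} (hf : ContDiffOn ℝ (n + 1) f s) :
    ContDiffOn ℝ n (fun p => deriv (fun y => f (p.1, y)) p.2) s ∧
      ∀ p ∈ s, HasDerivAt (fun y => f (p.1, y)) (deriv (fun y => f (p.1, y)) p.2) p.2 := by
  have hd : ∀ p ∈ s, HasDerivAt (fun y => f (p.1, y)) (fderiv ℝ f p (0, 1)) p.2 := fun p hp => by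
    have h1 := ((hf.contDiffAt (hs.mem_nhds hp)).differentiableAt (by simp)).hasFDerivAt
    have h2 : HasDerivAt (fun y : ℝ => (p.1, y)) (0, 1) p.2 :=
      (hasDerivAt_const p.2 p.1).prodMk (hasDerivAt_id p.2)
    exact h1.comp_hasDerivAt p.2 h2
  refine ⟨?_, fun p hp => (hd p hp).differentiableAt.hasDerivAt⟩
  refine ContDiffOn.congr (f := fun p => fderiv ℝ f p (0, 1)) ?_ fun p hp => (hd p hp).deriv
  exact (hf.fderiv_of_isOpen hs le_rfl).clm_apply contDiffOn_const

theorem sliceCont_of_continuousOn {G : ℝ → ℝ → Plane} {M : ℝ}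
    (hG : ContinuousOn (fun p : ℝ × ℝ => G p.1 p.2) (Ioo 0 b ×ˢ univ))
    (hM : ∀ t ∈ Ioo 0 b, ∀ y, Y < |y| → ‖G t y‖ ≤ M) (ht : t ∈ Ioo 0 b) :
    SliceCont G t := by
  have hopen : IsOpen (Ioo 0 b ×ˢ (univ : Set ℝ)) := isOpen_Ioo.prod isOpen_univ
  have hnb : Ioo 0 b ∈ 𝓝 t := Ioo_mem_nhds ht.1 ht.2
  have hca : ∀ s ∈ Ioo 0 b, ∀ y, ContinuousAt (fun p : ℝ × ℝ => G p.1 p.2) (s, y) :=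
    fun s hs y => hG.continuousAt (hopen.mem_nhds ⟨hs, mem_univ y⟩)
  refine ⟨?_, ?_, fun y => ?_⟩
  · filter_upwards [hnb] with s hs
    exact continuous_iff_continuousAt.2 fun y => ContinuousAt.comp (f := fun y => (s, y))
      (hca s hs y) (continuousAt_const.prodMk continuousAt_id)
  · obtain ⟨η, hη, hηs⟩ := Metric.nhds_basis_closedBall.mem_iff.1 hnb
    have hK : IsCompact (Metric.closedBall t η ×ˢ Icc (-Y) Y) :=
      (isCompact_closedBall _ _).prod isCompact_Icc
    obtain ⟨B, hB⟩ := hK.exists_bound_of_continuousOn (hG.mono (prod_mono hηs (subset_univ _)))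
    refine ⟨max B M, ?_⟩
    filter_upwards [Metric.closedBall_mem_nhds t hη] with s hs y
    rcases le_or_gt |y| Y with hy | hy
    · exact (hB (s, y) ⟨hs, abs_le.1 hy⟩).trans (le_max_left _ _)
    · exact (hM s (hηs hs) y hy).trans (le_max_right _ _)
  · exact ContinuousAt.comp (f := fun s => (s, y)) (hca t ht y)
      (continuousAt_id.prodMk continuousAt_const)

/-- `∂_t Φ`. -/
def timeDeriv (Φ : ℝ → ℝ → Plane) (t y : ℝ) : Plane := deriv (fun τ => Φ τ y) t

theorem neg_vacuum_eq : (!₂[-1, 0] : Plane) = flipφ vacuum := plane_ext (by simp [flipφ]) (by simp [flipφ])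

namespace IsSolution

variable {Φ : ℝ → ℝ → Plane} (hΦ : IsSolution V d R Y ε b Φ)
include hΦ

theorem eq_vacuum {y : ℝ} (ht : t ∈ Ioo 0 b) (hy : Y < y) : Φ t y = vacuum := hΦ.right t ht y hy

theorem eq_flip_vacuum {y : ℝ} (ht : t ∈ Ioo 0 b) (hy : y < -Y) : Φ t y = flipφ vacuum :=
  (hΦ.left t ht y hy).trans neg_vacuum_eq

theorem timeDeriv_eq_zero {y : ℝ} (ht : t ∈ Ioo 0 b) (hy : Y < |y|) :
    timeDeriv Φ t y = 0 ∧ timeDeriv (timeDeriv Φ) t y = 0 := by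
  have hev : ∃ c, ∀ s ∈ Ioo 0 b, Φ s y = c := by
    rcases lt_abs.1 hy with h | h
    · exact ⟨_, fun s hs => hΦ.eq_vacuum hs h⟩
    · exact ⟨_, fun s hs => hΦ.eq_flip_vacuum hs (by linarith)⟩
  obtain ⟨c, hc⟩ := hev
  have h1 : ∀ s ∈ Ioo 0 b, timeDeriv Φ s y = 0 := fun s hs => by
    have : (fun τ => Φ τ y) =ᶠ[𝓝 s] fun _ => c := (eventually_of_mem (Ioo_mem_nhds hs.1 hs.2) hc)
    rw [timeDeriv, this.deriv_eq, deriv_const]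
  refine ⟨h1 t ht, ?_⟩
  have : (fun τ => timeDeriv Φ τ y) =ᶠ[𝓝 t] fun _ => 0 :=
    (eventually_of_mem (Ioo_mem_nhds ht.1 ht.2) h1)
  rw [timeDeriv, this.deriv_eq, deriv_const]

theorem contDiffOn_timeDeriv :
    ContDiffOn ℝ 1 (fun p : ℝ × ℝ => timeDeriv Φ p.1 p.2) (Ioo 0 b ×ˢ univ) ∧
      ∀ t ∈ Ioo 0 b, ∀ y, HasDerivAt (fun τ => Φ τ y) (timeDeriv Φ t y) t := by
  have := contDiffOn_deriv_fst (n := 1) (isOpen_Ioo.prod isOpen_univ)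
    (by simpa [one_add_one_eq_two] using hΦ.smooth)
  exact ⟨by simpa [timeDeriv] using this.1, fun t ht y => this.2 (t, y) ⟨ht, mem_univ y⟩⟩

theorem continuousOn_timeDeriv2 :
    ContinuousOn (fun p : ℝ × ℝ => timeDeriv (timeDeriv Φ) p.1 p.2) (Ioo 0 b ×ˢ univ) ∧
      ∀ t ∈ Ioo 0 b, ∀ y, HasDerivAt (fun τ => timeDeriv Φ τ y) (timeDeriv (timeDeriv Φ) t y) t := by
  have := contDiffOn_deriv_fst (n := 0) (isOpen_Ioo.prod isOpen_univ)
    (by simpa using hΦ.contDiffOn_timeDeriv.1)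
  exact ⟨this.1.continuousOn, fun t ht y => this.2 (t, y) ⟨ht, mem_univ y⟩⟩

theorem hasDerivAt_space (ht : t ∈ Ioo 0 b) : Continuous (deriv (deriv (Φ t))) ∧
    (∀ y, HasDerivAt (Φ t) (deriv (Φ t) y) y) ∧
      ∀ y, HasDerivAt (deriv (Φ t)) (deriv (deriv (Φ t)) y) y := by
  have h1 := contDiffOn_deriv_snd (n := 1) (isOpen_Ioo.prod isOpen_univ)
    (by simpa [one_add_one_eq_two] using hΦ.smooth)
  have h2 := contDiffOn_deriv_snd (n := 0) (isOpen_Ioo.prod isOpen_univ) (by simpa using h1.1)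
  refine ⟨?_, fun y => h1.2 (t, y) ⟨ht, mem_univ y⟩, fun y => h2.2 (t, y) ⟨ht, mem_univ y⟩⟩
  exact h2.1.continuousOn.comp_continuous (Continuous.prodMk_right t) fun y => ⟨ht, mem_univ y⟩

theorem sliceCont (ht : t ∈ Ioo 0 b) : SliceCont Φ t ∧ SliceCont (timeDeriv Φ) t ∧
    SliceCont (timeDeriv (timeDeriv Φ)) t := by
  refine ⟨sliceCont_of_continuousOn (M := 1) (Y := Y) hΦ.smooth.continuousOn (fun s hs y hy => ?_) ht,
    sliceCont_of_continuousOn (M := 0) (Y := Y) hΦ.contDiffOn_timeDeriv.1.continuousOn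
      (fun s hs y hy => by rw [(hΦ.timeDeriv_eq_zero hs hy).1, norm_zero]) ht,
    sliceCont_of_continuousOn (M := 0) (Y := Y) hΦ.continuousOn_timeDeriv2.1
      (fun s hs y hy => by rw [(hΦ.timeDeriv_eq_zero hs hy).2, norm_zero]) ht⟩
  rcases lt_abs.1 hy with h | h
  · rw [hΦ.eq_vacuum hs h, norm_vacuum]
  · rw [hΦ.eq_flip_vacuum hs (by linarith), isFlip_flipφ.norm_map, norm_vacuum]

end IsSolution

/-! ### Test families -/

/-- `∂ₓ³ F` in the weighted space. -/
def profileForceX (V : Plane → ℝ) (d : ℝ) (F : ℝ → ℝ → Plane) (κ r : ℝ) : Weighted :=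
  weight κ fun x => hessW V d (F r x) r (deriv (F r) x)

namespace ProfileFamily

variable (h : ProfileFamily V d I F l) (hκ : 0 < κ) (hκl : κ < √l / 2)
include h hκ hκl

theorem unweight_profiles (hr : r ∈ I) : unweight κ (profileSlope F κ r) = deriv (F r) ∧
    unweight κ (profileForce V d F κ r) = (fun x => force V d (F r x) r) ∧
    unweight κ (profileForceX V d F κ r) = fun x => hessW V d (F r x) r (deriv (F r) x) :=
  ⟨unweight_weight ((h.decays_deriv hr).mono hκl.le),
    unweight_weight ((h.decays_force hr).mono hκl.le),
    unweight_weight (h.decays_hess_apply hr ((h.decays_deriv hr).mono hκl.le))⟩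

theorem continuousAt_profileForceX (hr : r ∈ I) : ContinuousAt (profileForceX V d F κ) r := by
  obtain ⟨hU, hS, -⟩ := h.regularity hκ hκl hr
  have h1 : ContinuousAt (fun s => mulOp (profileHess V d F r s) (profileSlope F κ s) +
      postOp (hessW V d vacuum r) (profileSlope F κ s)) r :=
    (((contDiffAt_mulOp (h.contDiffAt_profileHess_of hκ hκl hr hU)).continuousAt).clm_apply
      hS.continuousAt).add ((postOp (hessW V d vacuum r)).continuous.continuousAt.comp
      hS.continuousAt)
  refine h1.congr ?_
  filter_upwards [h.isOpen.mem_nhds hr] with s hs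
  apply unweight_injective κ
  obtain ⟨e1, -, e3⟩ := h.unweight_profiles hκ hκl hs
  funext x
  rw [e3, unweight_add, unweight_postOp]
  simp only [unweight_mulOp]
  rw [e1, profileHess, weight_zero_apply (h.decays_zero_hess_sub' hs r)]
  simp

theorem testFamilies (hr : r ∈ I) :
    TestFamily κ (profileSlope F κ) (deriv (profileSlope F κ)) (profileForce V d F κ) r ∧
    TestFamily κ (deriv (profileSlope F κ)) (deriv (deriv (profileSlope F κ)))
      (deriv (profileForce V d F κ)) r ∧
    TestFamily κ (profileForce V d F κ) (deriv (profileForce V d F κ))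
      (profileForceX V d F κ) r := by
  obtain ⟨-, hS, hSr, hT, -, -⟩ := h.regularity hκ hκl hr
  have d0 : ∀ {f : ℝ → Weighted}, ContDiffAt ℝ 1 f r → ContinuousAt (deriv f) r := fun hf =>
    (hf.derivWithin (m := 0) le_rfl).continuousAt
  have d1 : ∀ {f : ℝ → Weighted}, ContDiffAt ℝ 1 f r → ∀ᶠ s in 𝓝 r, HasDerivAt f (deriv f s) s :=
    fun hf => (hf.eventually (by simp)).mono fun s hs =>
      (hs.differentiableAt (by norm_num)).hasDerivAt
  have hI : ∀ᶠ s in 𝓝 r, s ∈ I := h.isOpen.mem_nhds hr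
  refine ⟨⟨d1 hS, d0 hS, ?_, hT.continuousAt⟩, ⟨d1 hSr, d0 hSr, ?_, d0 hT⟩,
    ⟨d1 hT, d0 hT, ?_, h.continuousAt_profileForceX hκ hκl hr⟩⟩
  · filter_upwards [hI] with s hs x
    obtain ⟨e1, e2, -⟩ := h.unweight_profiles hκ hκl hs
    rw [e1, e2]
    exact h.hasDerivAt_deriv hs x
  · filter_upwards [hI] with s hs x
    exact (h.regularity hκ hκl hs).2.2.2.2.2 x
  · filter_upwards [hI] with s hs x
    obtain ⟨-, e2, e3⟩ := h.unweight_profiles hκ hκl hs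
    rw [e2, e3]
    exact h.hasDerivAt_force_comp hs x

end ProfileFamily

/-! ### Distances to the translated profile -/

theorem integral_eq_mul_integral_affine (hε : 0 < ε) (g : ℝ → ℝ) (α : ℝ) :
    ∫ y, g y = ε * ∫ z, g (ε * z + α) := by
  have h1 := integral_add_right_eq_self (μ := volume) g α
  have h2 := Measure.integral_comp_mul_left (fun y => g (y + α)) ε
  rw [h2, abs_of_pos (inv_pos.2 hε), smul_eq_mul, ← mul_assoc, mul_inv_cancel₀ hε.ne', one_mul, h1]

theorem integral_exp_neg_abs {c : ℝ} (hc : 0 < c) : ∫ x : ℝ, e(c,x) = 2 / c := by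
  rw [integral_comp_abs (f := fun x => exp (-(c * x)))]
  have := integral_exp_mul_Ioi (a := -c) (by linarith) 0
  simp only [neg_mul, mul_zero, exp_zero] at this
  rw [this, neg_div_neg_eq]
  ring

/-- A pointwise exponential bound gives a bound of the square integral. -/
theorem integral_inner_self_le (hκ : 0 < κ) {u : ℝ → Plane}
    (hb : ∀ x, ‖u x‖ ≤ C * e(κ,x)) : ∫ x, ⟪u x, u x⟫ ≤ C ^ 2 / κ := by
  have e : ∫ x : ℝ, C ^ 2 * e(2 * κ,x) = C ^ 2 / κ := by
    rw [integral_const_mul, integral_exp_neg_abs (by positivity)]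
    field_simp
  rw [← e]
  refine integral_mono_of_nonneg (.of_forall fun x => real_inner_self_nonneg)
    ((integrable_exp_neg_abs (by positivity)).const_mul _) (.of_forall fun x => ?_)
  simp only [real_inner_self_eq_norm_sq]
  calc ‖u x‖ ^ 2 ≤ (C * e(κ,x)) ^ 2 := by gcongr; exact hb x
    _ = C ^ 2 * e(2 * κ,x) := by
      rw [mul_pow, ← exp_nat_mul]; congr 2; push_cast; ring

theorem integral_inner_self_add_le (hκ : 0 < κ) {u v : ℝ → Plane} (hu : Decays κ u)
    (hv : Decays κ v) : ∫ x, ⟪u x + v x, u x + v x⟫ ≤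
      2 * (∫ x, ⟪u x, u x⟫) + 2 * ∫ x, ⟪v x, v x⟫ := by
  have hp : 0 < κ + κ := by linarith
  rw [← integral_const_mul, ← integral_const_mul,
    ← integral_add ((hu.integrable_inner hu).const_mul 2) ((hv.integrable_inner hv).const_mul 2)]
  refine integral_mono ((hu.add hv).integrable_inner (hu.add hv))
    (((hu.integrable_inner hu).const_mul 2).add ((hv.integrable_inner hv).const_mul 2))
    fun x => ?_
  simp only [real_inner_self_eq_norm_sq]
  have := norm_add_le (u x) (v x)
  nlinarith [sq_nonneg (‖u x‖ - ‖v x‖), norm_nonneg (u x + v x)]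

theorem integral_inner_self_neg (u : ℝ → Plane) : ∫ x, ⟪-u x, -u x⟫ = ∫ x, ⟪u x, u x⟫ := by
  simp only [inner_neg_neg]

namespace ProfileFamily

variable (h : ProfileFamily V d I F l)
include h

theorem integral_inner_self_deriv (hr : r ∈ I) : ∫ x, ⟪F r x, deriv (F r) x⟫ = 0 := by
  have := integral_neg_eq_self (fun x => ⟪F r x, deriv (F r) x⟫) volume
  have e : ∀ x, ⟪F r (-x), deriv (F r) (-x)⟫ = -⟪F r x, deriv (F r) x⟫ := fun x => by
      rw [h.flip hr, h.deriv_flip hr, inner_neg_right, isFlip_flipφ.inner_left,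
        isFlip_flipφ.involutive]
  simp only [e] at this
  rw [integral_neg] at this
  linarith

theorem integral_inner_force (hr : r ∈ I) : ∫ x, ⟪F r x, force V d (F r x) r⟫ =
    -∫ x, ⟪deriv (F r) x, deriv (F r) x⟫ := by
  have hl := h.sqrt_pos
  refine integral_inner_deriv (κ := 0) (κ' := √l / 2) (by linarith)
    (.of_bounded (h.continuous hr) (h.norm_le hr)) ((h.decays_deriv hr).mono (by linarith))
    (h.decays_deriv hr) (h.decays_force hr) (h.hasDerivAt hr) (h.hasDerivAt_deriv hr)

theorem norm_translate_sub_le (hr : r ∈ I) (hb : ProfileBound V d F Z κ C r) (hκ : 0 < κ) (c x : ℝ) :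
    ‖F r (x - c) - F r x‖ ≤ |c| * C * exp (κ * |c|) * e(κ,x) := by
  have hC : 0 ≤ C := zero_le_one.trans hb.one_le
  have := (convex_uIcc x (x - c)).norm_image_sub_le_of_norm_hasDerivWithin_le
    (f := F r) (f' := deriv (F r)) (C := C * (exp (κ * |c|) * e(κ,x)))
    (fun y _ => (h.hasDerivAt hr y).hasDerivWithinAt) (fun y hy => (hb.slope y).trans ?_)
    left_mem_uIcc right_mem_uIcc
  · refine this.trans (le_of_eq ?_)
    rw [sub_sub_cancel_left, norm_neg, norm_eq_abs]; ring
  · rw [← exp_add]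
    gcongr
    have h1 : |y - x| ≤ |c| := by
      have := abs_sub_left_of_mem_uIcc hy
      rwa [sub_sub_cancel_left, abs_neg] at this
    have h2 := abs_sub_abs_le_abs_sub x y
    rw [abs_sub_comm x y] at h2
    nlinarith

theorem decays_translate_sub (hr : r ∈ I) (hb : ProfileBound V d F Z κ C r) (hκ : 0 < κ) (c : ℝ) :
    Decays κ fun x => F r (x - c) - F r x :=
  .of_bound (((h.continuous hr).comp (continuous_id.sub continuous_const)).sub (h.continuous hr))
    (h.norm_translate_sub_le hr hb hκ c)

/-- Separation of the translates of a profile. -/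
theorem le_integral_translate_sub (hr : r ∈ I) (hb : ProfileBound V d F Z κ C r) (hκ : 0 < κ)
    {c₀ μ c : ℝ} (hc₀ : 0 < c₀) (hμ0 : 0 ≤ μ) (hμ : ∀ x ∈ Icc (c₀ / 2) c₀, μ ≤ F r x 0)
    (hc : c₀ ≤ |c|) :
    μ ^ 2 * (c₀ / 2) ≤ ∫ x, ⟪F r (x - c) - F r x, F r (x - c) - F r x⟫ := by
  have main : ∀ c, c₀ ≤ c → μ ^ 2 * (c₀ / 2) ≤ ∫ x, ⟪F r (x - c) - F r x, F r (x - c) - F r x⟫ := by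
    intro c hc
    have hD := h.decays_translate_sub hr hb hκ c
    have hint := hD.integrable_inner hD
    have h1 : ∫ x in Icc (c₀ / 2) c₀, ⟪F r (x - c) - F r x, F r (x - c) - F r x⟫ ≤
        ∫ x, ⟪F r (x - c) - F r x, F r (x - c) - F r x⟫ :=
      setIntegral_le_integral hint (.of_forall fun x => real_inner_self_nonneg)
    have h2 : ∫ x in Icc (c₀ / 2) c₀, μ ^ 2 ≤
        ∫ x in Icc (c₀ / 2) c₀, ⟪F r (x - c) - F r x, F r (x - c) - F r x⟫ := by
      refine setIntegral_mono_on (by simp) hint.integrableOn measurableSet_Icc fun x hx => ?_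
      have e1 := hμ x hx
      have e2 : F r (x - c) 0 ≤ 0 := by
        have := h.nonneg_of_nonneg hr (x := -(x - c)) (by linarith [hx.2])
        rw [(h.profile r hr).odd] at this
        linarith
      have e3 := abs_coord_le_norm 0 (F r (x - c) - F r x)
      rw [real_inner_self_eq_norm_sq]
      have e4 : (F r (x - c) - F r x) 0 = F r (x - c) 0 - F r x 0 := rfl
      rw [e4, abs_of_nonpos (by linarith)] at e3
      gcongr
      linarith
    have h3 : ∫ x in Icc (c₀ / 2) c₀, μ ^ 2 = μ ^ 2 * (c₀ / 2) := by
      rw [setIntegral_const]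
      simp only [measureReal_def, Real.volume_Icc, smul_eq_mul]
      rw [ENNReal.toReal_ofReal (by linarith)]
      ring
    linarith
  rcases le_total 0 c with h0 | h0
  · exact main c (by rwa [abs_of_nonneg h0] at hc)
  · have h1 := main (-c) (by rwa [abs_of_nonpos h0] at hc)
    have h2 := integral_sub_right_eq_self (μ := volume)
      (fun x => ⟪F r (x - -c) - F r x, F r (x - -c) - F r x⟫) c
    have e : ∀ x, ⟪F r (x - c) - F r x, F r (x - c) - F r x⟫ =
        ⟪F r (x - c - -c) - F r (x - c), F r (x - c - -c) - F r (x - c)⟫ := fun x => by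
      rw [sub_neg_eq_add, sub_add_cancel, ← neg_sub (F r x), inner_neg_neg]
    simp only [e]
    rw [h2]
    exact h1

theorem integral_translate_sub_le (hr : r ∈ I) (hb : ProfileBound V d F Z κ C r) (hκ : 0 < κ)
    {c c₀ : ℝ} (hc : |c| ≤ c₀) (hc₀ : c₀ ≤ 1) :
    ∫ x, ⟪F r (x - c) - F r x, F r (x - c) - F r x⟫ ≤ (c₀ * C * exp κ) ^ 2 / κ := by
  have hC : 0 ≤ C := zero_le_one.trans hb.one_le
  refine integral_inner_self_le hκ fun x => (h.norm_translate_sub_le hr hb hκ c x).trans ?_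
  have : κ * |c| ≤ κ := mul_le_of_le_one_right hκ.le (hc.trans hc₀)
  have hc₀' := (abs_nonneg c).trans hc
  gcongr

end ProfileFamily

/-- The fixed data of the problem together with uniform bounds. -/
structure Setting (V : Plane → ℝ) (d : ℝ) (I : Set ℝ) (F : ℝ → ℝ → Plane) (l : ℝ)
    (Z : ℝ → ℝ → Plane) (R : ℝ → ℝ) (T Y κ C : ℝ) : Prop where
  family : ProfileFamily V d I F l
  corrector : ∀ r ∈ I, IsCorrector V d r 0 (F r) (Z r)
  κ_pos : 0 < κ
  κ_lt : κ < √l / 2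
  Y_pos : 0 < Y
  regular : ∀ t ∈ Icc 0 T, InterfaceRegular d I F R t
  profile : ∀ t ∈ Icc 0 T, ProfileBound V d F Z κ C (R t)
  geom : ∀ t ∈ Icc 0 T, GeomBound R Y C t
  coord : CoordinatesDefined R T Y

namespace Setting

variable (S : Setting V d I F l Z R T Y κ C)
include S

theorem C_pos (h : ∃ t, t ∈ Icc 0 T) : 1 ≤ C := let ⟨t, ht⟩ := h; (S.profile t ht).one_le

section Solution

variable {Φ : ℝ → ℝ → Plane} (hε : 0 < ε) (hb : b ≤ T) (hΦ : IsSolution V d R Y ε b Φ)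
include hε hb hΦ

theorem norm_vacuum_sub_le (ht : t ∈ Ioo 0 b) {α y : ℝ} (h1 : Y < |y|) (h2 : |α| ≤ |y|) :
    ‖Φ t y - F (R t) ((y - α) / ε)‖ ≤ C * e(κ,(y - α) / ε) := by
  have htT := mem_Icc_of_mem_Ioo hb ht
  have hv := (S.profile t htT).vacuum
  have hr := (S.regular t htT).mem
  rcases lt_abs.1 h1 with h | h
  · have hy0 : 0 < y := S.Y_pos.trans h
    rw [abs_of_pos hy0] at h2
    rw [hΦ.eq_vacuum ht h, norm_sub_rev]
    exact hv _ (div_nonneg (by linarith [le_abs_self α]) hε.le)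
  · have hy0 : y < 0 := by linarith [S.Y_pos]
    rw [abs_of_neg hy0] at h2
    have h3 := hv (-((y - α) / ε)) (by
      rw [← neg_div]; exact div_nonneg (by linarith [neg_abs_le α]) hε.le)
    rw [hΦ.eq_flip_vacuum ht (by linarith), norm_sub_rev]
    rwa [S.family.flip hr, abs_neg, ← isFlip_flipφ.norm_map, map_sub, isFlip_flipφ.involutive] at h3

theorem eventually_norm_sub_le (ht : t ∈ Ioo 0 b) (α : ℝ) :
    ∃ B, ∀ᶠ s in 𝓝 t, ∀ y, ‖Φ s y - F (R s) ((y - α) / ε)‖ ≤ B * e(κ,(y - α) / ε) := by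
  obtain ⟨B, hB⟩ := (hΦ.sliceCont ht).1.bounded
  set Y₀ := max Y |α|
  refine ⟨max C ((B + 2) * exp (κ * (2 * Y₀ / ε))), ?_⟩
  filter_upwards [hB, Ioo_mem_nhds ht.1 ht.2] with s hs hsI y
  have hsT : s ∈ Icc 0 T := ⟨hsI.1.le, hsI.2.le.trans hb⟩
  rcases lt_or_ge Y₀ |y| with hy | hy
  · refine (S.norm_vacuum_sub_le hε hb hΦ hsI ((le_max_left _ _).trans_lt hy)
      ((le_max_right _ _).trans hy.le)).trans ?_
    gcongr
    exact le_max_left _ _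
  · have hB0 := (norm_nonneg _).trans (hs 0)
    have h1 : ‖Φ s y - F (R s) ((y - α) / ε)‖ ≤ B + 2 := (norm_sub_le _ _).trans
      (add_le_add (hs y) (S.family.norm_le (S.regular s hsT).mem _))
    refine h1.trans ?_
    have h2 : |(y - α) / ε| ≤ 2 * Y₀ / ε := by
      rw [abs_div, abs_of_pos hε]
      gcongr
      have := abs_sub y α
      have := le_max_right Y |α|
      linarith
    have h3 : 1 ≤ exp (κ * (2 * Y₀ / ε)) * e(κ,(y - α) / ε) := by
      rw [← exp_add, Real.one_le_exp_iff]
      have := mul_mono_left h2 S.κ_pos.le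
      linarith
    calc B + 2 ≤ (B + 2) * (exp (κ * (2 * Y₀ / ε)) * e(κ,(y - α) / ε)) :=
          le_mul_of_one_le_right (by linarith) h3
      _ ≤ _ := by
        rw [← mul_assoc]
        gcongr
        exact le_max_right _ _

theorem decays_slice_sub (ht : t ∈ Ioo 0 b) (α : ℝ) :
    Decays κ fun z => Φ t (ε * z + α) - F (R t) z := by
  obtain ⟨B, hB⟩ := S.eventually_norm_sub_le hε hb hΦ ht α
  have hc := (hΦ.sliceCont ht).1.continuous.self_of_nhds
  have hcF := S.family.continuous (S.regular t (mem_Icc_of_mem_Ioo hb ht)).mem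
  refine .of_bound (C := B) (by fun_prop) fun z => ?_
  have := hB.self_of_nhds (ε * z + α)
  rwa [add_sub_cancel_right, mul_div_cancel_left₀ _ hε.ne'] at this

theorem shiftDist_eq (t α : ℝ) : shiftDist ε (F (R t)) (Φ t) α =
    ε * ∫ z, ⟪Φ t (ε * z + α) - F (R t) z, Φ t (ε * z + α) - F (R t) z⟫ := by
  rw [shiftDist, integral_eq_mul_integral_affine hε _ α]
  simp only [add_sub_cancel_right, mul_div_cancel_left₀ _ hε.ne', real_inner_self_eq_norm_sq]

theorem shiftGrad_eq_zero_iff (ht : t ∈ Ioo 0 b) (α : ℝ) : (shiftGrad ε (F (R t)) (Φ t) α = 0 ↔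
      ∫ z, ⟪Φ t (ε * z + α) - F (R t) z, deriv (F (R t)) z⟫ = 0) ∧
    (shiftGrad ε (F (R t)) (Φ t) α = 0 ↔ slicePair κ ε (Φ t) (profileSlope F κ (R t)) α = 0) := by
  have hr := (S.regular t (mem_Icc_of_mem_Ioo hb ht)).mem
  have hS := (S.family.decays_deriv hr).mono S.κ_lt.le
  have hκ := S.κ_pos
  have hF0 : Decays 0 (F (R t)) := .of_bounded (S.family.continuous hr) (S.family.norm_le hr)
  have hD := S.decays_slice_sub hε hb hΦ ht α
  rw [shiftGrad, integral_eq_mul_integral_affine hε _ α, slicePair_eq hε,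
    (S.family.unweight_profiles S.κ_pos S.κ_lt hr).1]
  simp only [add_sub_cancel_right, mul_div_cancel_left₀ _ hε.ne']
  have e : ∫ z, ⟪Φ t (ε * z + α), deriv (F (R t)) z⟫ =
      (∫ z, ⟪Φ t (ε * z + α) - F (R t) z, deriv (F (R t)) z⟫) +
        ∫ z, ⟪F (R t) z, deriv (F (R t)) z⟫ := by
    rw [← integral_add (hD.integrable_inner hS) (hF0.integrable_inner hS)]
    simp only [← inner_add_left, sub_add_cancel]
  rw [e, S.family.integral_inner_self_deriv hr, add_zero]
  simp [hε.ne']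

theorem slicePair_force_le {α : ℝ} (ht : t ∈ Ioo 0 b)
    (hd : shiftDist ε (F (R t)) (Φ t) α ≤ κ / (4 * C ^ 4) * ε) :
    slicePair κ ε (Φ t) (profileForce V d F κ (R t)) α ≤ -(ε / (2 * C)) := by
  have htT := mem_Icc_of_mem_Ioo hb ht
  have hr := (S.regular t htT).mem
  have hP := S.profile t htT
  have hC := hP.one_le
  have hκ := S.κ_pos
  have hT := (S.family.decays_force hr).mono S.κ_lt.le
  have hF0 : Decays 0 (F (R t)) := .of_bounded (S.family.continuous hr) (S.family.norm_le hr)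
  have hD := S.decays_slice_sub hε hb hΦ ht α
  rw [S.shiftDist_eq hε hb hΦ] at hd
  rw [slicePair_eq hε, (S.family.unweight_profiles S.κ_pos S.κ_lt hr).2.1]
  have e : ∫ z, ⟪Φ t (ε * z + α), force V d (F (R t) z) (R t)⟫ =
      (∫ z, ⟪Φ t (ε * z + α) - F (R t) z, force V d (F (R t) z) (R t)⟫) +
        ∫ z, ⟪F (R t) z, force V d (F (R t) z) (R t)⟫ := by
    rw [← integral_add (hD.integrable_inner hT) (hF0.integrable_inner hT)]
    simp only [← inner_add_left, sub_add_cancel]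
  rw [e, S.family.integral_inner_force hr]
  have hm := hP.mass
  have cs := integral_inner_sq_le (hD.integrable_inner hD)
    (hD.integrable_inner hT) (hT.integrable_inner hT)
  have hTT := integral_inner_self_le hκ hP.force
  set h2 := ∫ z, ⟪Φ t (ε * z + α) - F (R t) z, Φ t (ε * z + α) - F (R t) z⟫
  set p := ∫ z, ⟪Φ t (ε * z + α) - F (R t) z, force V d (F (R t) z) (R t)⟫
  set q := ∫ z, ⟪force V d (F (R t) z) (R t), force V d (F (R t) z) (R t)⟫
  have hh : h2 ≤ κ / (4 * C ^ 4) := by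
    rw [mul_comm ε] at hd
    exact le_of_mul_le_mul_right hd hε
  have hq0 : 0 ≤ q := integral_nonneg fun _ => real_inner_self_nonneg
  have hp : p ^ 2 ≤ (1 / (2 * C)) ^ 2 := by
    calc p ^ 2 ≤ h2 * q := cs
      _ ≤ κ / (4 * C ^ 4) * (C ^ 2 / κ) := by gcongr
      _ = _ := by field_simp; norm_num
  have hp' := (abs_le_of_sq_le_sq' hp (by positivity)).2
  have : C⁻¹ = 1 / (2 * C) + 1 / (2 * C) := by field_simp; norm_num
  calc ε * (p + -_) ≤ ε * (1 / (2 * C) + -C⁻¹) := by gcongr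
    _ = -(ε / (2 * C)) := by rw [this]; ring

end Solution

end Setting

/-! ### Regularity of the shift -/

theorem mul_abs_sub_le_of_le_deriv {g g' : ℝ → ℝ} {c x y : ℝ}
    (hg : ∀ z, HasDerivAt g (g' z) z) (hc : ∀ z ∈ uIcc x y, c ≤ g' z) :
    c * |x - y| ≤ |g x - g y| := by
  wlog hxy : x ≤ y generalizing x y
  · rw [abs_sub_comm x, abs_sub_comm (g x)]
    exact this (by rwa [uIcc_comm]) (le_of_not_ge hxy)
  rw [uIcc_of_le hxy] at hc
  have := (convex_Icc x y).mul_sub_le_image_sub_of_le_deriv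
    (fun z _ => (hg z).continuousAt.continuousWithinAt)
    (fun z _ => (hg z).differentiableAt.differentiableWithinAt)
    (fun z hz => by rw [(hg z).deriv]; exact hc z (interior_subset hz))
    x (left_mem_Icc.2 hxy) y (right_mem_Icc.2 hxy) hxy
  rw [abs_sub_comm x, abs_of_nonneg (sub_nonneg.2 hxy), abs_sub_comm (g x)]
  exact this.trans (le_abs_self _)

theorem contDiffOn_two_of_hasDerivAt {f f' f'' : ℝ → ℝ} {s : Set ℝ} (hs : IsOpen s)
    (h1 : ∀ t ∈ s, HasDerivAt f (f' t) t) (h2 : ∀ t ∈ s, HasDerivAt f' (f'' t) t)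
    (hc : ContinuousOn f'' s) : ContDiffOn ℝ 2 f s := by
  have e1 : ∀ t ∈ s, deriv f t = f' t := fun t ht => (h1 t ht).deriv
  have h2' : ∀ t ∈ s, HasDerivAt (deriv f) (f'' t) t := fun t ht =>
    (h2 t ht).congr_of_eventuallyEq (eventually_of_mem (hs.mem_nhds ht) e1)
  rw [show (2 : WithTop ℕ∞) = 1 + 1 from one_add_one_eq_two.symm,
    contDiffOn_succ_iff_deriv_of_isOpen hs]
  refine ⟨fun t ht => (h1 t ht).differentiableAt.differentiableWithinAt, by simp, ?_⟩
  rw [show (1 : WithTop ℕ∞) = 0 + 1 from (zero_add 1).symm, contDiffOn_succ_iff_deriv_of_isOpen hs]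
  refine ⟨fun t ht => (h2' t ht).differentiableAt.differentiableWithinAt, by simp, ?_⟩
  rw [contDiffOn_zero]
  exact hc.congr fun t ht => (h2' t ht).deriv

namespace Setting

variable (S : Setting V d I F l Z R T Y κ C)
include S

/-- The threshold below which the shift is unique. -/
structure IsThreshold (_ : Setting V d I F l Z R T Y κ C) (δ c₀ : ℝ) : Prop where
  pos : 0 < δ
  c₀_pos : 0 < c₀
  c₀_le : c₀ ≤ 1
  close : 2 * δ + 2 * ((c₀ * C * exp κ) ^ 2 / κ) ≤ κ / (4 * C ^ 4)
  separated : ∀ t ∈ Icc 0 T, ∀ c, c₀ ≤ |c| →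
    4 * δ < ∫ x, ⟪F (R t) (x - c) - F (R t) x, F (R t) (x - c) - F (R t) x⟫

theorem exists_threshold (hT : 0 < T) : ∃ δ c₀, S.IsThreshold δ c₀ := by
  have hC : 1 ≤ C := S.C_pos ⟨0, le_rfl, hT.le⟩
  have hκ := S.κ_pos
  obtain ⟨c₀, hc₀, hc₁, hc₂⟩ : ∃ c₀ : ℝ, 0 < c₀ ∧ c₀ ≤ 1 ∧
      2 * ((c₀ * C * exp κ) ^ 2 / κ) ≤ κ / (8 * C ^ 4) := by
    set q := 2 * (C * exp κ) ^ 2 / κ with hq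
    have hq0 : 0 < q := by positivity
    set p := κ / (8 * C ^ 4)
    have hp0 : 0 < p := by positivity
    refine ⟨min 1 (p / q), by positivity, min_le_left _ _, ?_⟩
    set c := min 1 (p / q)
    have h1 : c ≤ 1 := min_le_left _ _
    have h2 : c * q ≤ p := by rw [← le_div_iff₀ hq0]; exact min_le_right _ _
    have h3 : 2 * ((c * C * exp κ) ^ 2 / κ) = c * (c * q) := by rw [hq]; ring
    rw [h3]
    exact (mul_le_of_le_one_left (by positivity) h1).trans h2
  have hK : IsCompact (Icc 0 T ×ˢ Icc (c₀ / 2) c₀) := isCompact_Icc.prod isCompact_Icc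
  have hcont : ContinuousOn (fun p : ℝ × ℝ => F (R p.1) p.2 0) (Icc 0 T ×ˢ Icc (c₀ / 2) c₀) := by
    intro p hp
    have h1 := S.family.continuousAt (S.regular p.1 hp.1).mem p.2
    have h2 : ContinuousAt (fun p : ℝ × ℝ => (R p.1, p.2)) p :=
      (ContinuousAt.comp (f := Prod.fst) (S.regular p.1 hp.1).smooth.continuousAt
        continuousAt_fst).prodMk continuousAt_snd
    have h3 := ContinuousAt.comp (f := fun p : ℝ × ℝ => (R p.1, p.2)) h1 h2
    exact ((EuclideanSpace.proj 0 : Plane →L[ℝ] ℝ).continuous.continuousAt.comp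
      h3).continuousWithinAt
  obtain ⟨p, hp, hmin⟩ := hK.exists_isMinOn ⟨(0, c₀), ⟨le_rfl, hT.le⟩, by linarith, le_rfl⟩ hcont
  set μ := F (R p.1) p.2 0
  have hr := (S.regular p.1 hp.1).mem
  have hp2 : 0 < p.2 := by linarith [hp.2.1]
  have hμ0 : 0 < μ := lt_of_le_of_ne (S.family.nonneg_of_nonneg hr hp2.le)
    fun h0 => hp2.ne' (((S.family.profile _ hr).zero_iff p.2).1 h0.symm)
  refine ⟨min (κ / (16 * C ^ 4)) (μ ^ 2 * (c₀ / 2) / 8), c₀, by positivity, hc₀, hc₁, ?_,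
    fun t ht c hc => ?_⟩
  · have h1 := min_le_left (κ / (16 * C ^ 4)) (μ ^ 2 * (c₀ / 2) / 8)
    have h2 : κ / (4 * C ^ 4) = 2 * (κ / (16 * C ^ 4)) + κ / (8 * C ^ 4) := by
      field_simp; norm_num
    linarith
  · refine lt_of_lt_of_le ?_ (S.family.le_integral_translate_sub (S.regular t ht).mem (S.profile t ht)
      hκ hc₀ hμ0.le (fun x hx => hmin (a := (t, x)) ⟨ht, hx⟩) hc)
    have h1 := min_le_right (κ / (16 * C ^ 4)) (μ ^ 2 * (c₀ / 2) / 8)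
    have : 0 < μ ^ 2 * (c₀ / 2) := by positivity
    linarith

section Solution

variable {Φ : ℝ → ℝ → Plane} (hε : 0 < ε) (hb : b ≤ T) (hΦ : IsSolution V d R Y ε b Φ)
include hε hb hΦ

theorem translate_identity (t α α' z : ℝ) :
    Φ t (ε * (z - (α' - α) / ε) + α') - F (R t) (z - (α' - α) / ε) =
      (Φ t (ε * z + α) - F (R t) z) + -(F (R t) (z - (α' - α) / ε) - F (R t) z) := by
  have : ε * (z - (α' - α) / ε) + α' = ε * z + α := by field_simp; ring
  rw [this]; abel

theorem shiftDist_translate_le {α α' c₀ : ℝ} (ht : t ∈ Ioo 0 b) (hα : |α' - α| ≤ c₀ * ε)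
    (hc₀ : c₀ ≤ 1) : shiftDist ε (F (R t)) (Φ t) α' ≤
      2 * shiftDist ε (F (R t)) (Φ t) α + 2 * ((c₀ * C * exp κ) ^ 2 / κ) * ε := by
  have htT := mem_Icc_of_mem_Ioo hb ht
  have hr := (S.regular t htT).mem
  have hD := S.decays_slice_sub hε hb hΦ ht α
  set c := (α' - α) / ε with hc
  have hcle : |c| ≤ c₀ := by rw [hc, abs_div, abs_of_pos hε, div_le_iff₀ hε]; exact hα
  have h1 := integral_sub_right_eq_self (μ := volume) (fun z =>
    ⟪Φ t (ε * z + α') - F (R t) z, Φ t (ε * z + α') - F (R t) z⟫) c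
  simp only [hc, S.translate_identity hε hb hΦ] at h1
  rw [S.shiftDist_eq hε hb hΦ, S.shiftDist_eq hε hb hΦ, ← h1]
  have h2 := integral_inner_self_add_le S.κ_pos hD
    (S.family.decays_translate_sub hr (S.profile t htT) S.κ_pos c).neg
  rw [integral_inner_self_neg] at h2
  have h3 := S.family.integral_translate_sub_le hr (S.profile t htT) S.κ_pos hcle hc₀
  have h4 := mul_mono_left (h2.trans (add_le_add_right (mul_mono_left h3 zero_le_two) _)) hε.le
  linarith

theorem abs_sub_le_of_shiftDist_lt {δ c₀ α α' : ℝ} (hδ : S.IsThreshold δ c₀) (ht : t ∈ Ioo 0 b)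
    (h1 : shiftDist ε (F (R t)) (Φ t) α < δ * ε) (h2 : shiftDist ε (F (R t)) (Φ t) α' < δ * ε) :
    |α' - α| ≤ c₀ * ε := by
  have htT := mem_Icc_of_mem_Ioo hb ht
  have hr := (S.regular t htT).mem
  by_contra hcon
  rw [not_le] at hcon
  set c := (α' - α) / ε with hc
  have hcle : c₀ ≤ |c| := by rw [hc, abs_div, abs_of_pos hε, le_div_iff₀ hε]; exact hcon.le
  have hsep := hδ.separated t htT c hcle
  have hD := S.decays_slice_sub hε hb hΦ ht α
  have hD' : Decays κ fun z => Φ t (ε * (z - c) + α') - F (R t) (z - c) := by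
    have := hD.add (S.family.decays_translate_sub hr (S.profile t htT) S.κ_pos c).neg
    simp only [hc, S.translate_identity hε hb hΦ]
    exact this
  have h4 := integral_sub_right_eq_self (μ := volume) (fun z =>
    ⟪Φ t (ε * z + α') - F (R t) z, Φ t (ε * z + α') - F (R t) z⟫) c
  rw [S.shiftDist_eq hε hb hΦ, mul_comm] at h1 h2
  rw [← h4] at h2
  have h1' := lt_of_mul_lt_mul_right h1 hε.le
  have h2' := lt_of_mul_lt_mul_right h2 hε.le
  have h5 := integral_inner_self_add_le S.κ_pos hD hD'.neg
  rw [integral_inner_self_neg] at h5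
  have e : ∀ z, Φ t (ε * z + α) - F (R t) z + -(Φ t (ε * (z - c) + α') - F (R t) (z - c)) =
      F (R t) (z - c) - F (R t) z := fun z => by
    rw [hc, S.translate_identity hε hb hΦ]; abel
  simp only [e] at h5
  linarith

theorem slicePair_force_le_of_mem {δ c₀ α α' α₁ : ℝ} (hδ : S.IsThreshold δ c₀) (ht : t ∈ Ioo 0 b)
    (h1 : shiftDist ε (F (R t)) (Φ t) α < δ * ε) (h2 : shiftDist ε (F (R t)) (Φ t) α' < δ * ε)
    (hα₁ : α₁ ∈ uIcc α α') :
    slicePair κ ε (Φ t) (profileForce V d F κ (R t)) α₁ ≤ -(ε / (2 * C)) := by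
  refine S.slicePair_force_le hε hb hΦ ht ?_
  have h3 := S.abs_sub_le_of_shiftDist_lt hε hb hΦ hδ ht h1 h2
  have h4 := S.shiftDist_translate_le hε hb hΦ ht ((abs_sub_left_of_mem_uIcc hα₁).trans h3) hδ.c₀_le
  have h5 := mul_mono_right hδ.close hε.le
  linarith

theorem continuousAt_shiftDist (ht : t ∈ Ioo 0 b) (α : ℝ) :
    ContinuousAt (fun s => shiftDist ε (F (R s)) (Φ s) α) t := by
  have htT := mem_Icc_of_mem_Ioo hb ht
  obtain ⟨B, hB⟩ := S.eventually_norm_sub_le hε hb hΦ ht α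
  have hκ := S.κ_pos
  have hΦc := (hΦ.sliceCont ht).1
  have hRc := (S.regular t htT).smooth.continuousAt
  refine tendsto_integral_filter_of_dominated_convergence
    (fun y => B ^ 2 * e(2 * κ / ε,y - α)) ?_ ?_
    ((integrable_exp_shift (by positivity) α).const_mul _) (.of_forall fun y => ?_)
  · filter_upwards [hΦc.continuous, Ioo_mem_nhds ht.1 ht.2] with s hs hsI
    have := S.family.continuous (S.regular s ⟨hsI.1.le, hsI.2.le.trans hb⟩).mem
    exact (by fun_prop : Continuous fun y => ‖Φ s y - F (R s) ((y - α) / ε)‖ ^ 2).aestronglyMeasurable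
  · filter_upwards [hB] with s hs
    refine .of_forall fun y => ?_
    rw [norm_eq_abs, abs_of_nonneg (by positivity)]
    calc _ ≤ (B * e(κ,(y - α) / ε)) ^ 2 := by gcongr; exact hs y
      _ = _ := by
        rw [mul_pow, ← exp_nat_mul, abs_div, abs_of_pos hε]; congr 2; push_cast; ring
  · have h1 := S.family.continuousAt (S.regular t htT).mem ((y - α) / ε)
    have h2 : ContinuousAt (fun s => (R s, (y - α) / ε)) t := hRc.prodMk continuousAt_const
    have h3 := ContinuousAt.comp (f := fun s => (R s, (y - α) / ε)) h1 h2
    exact ((hΦc.continuousAt y).sub h3).norm.pow 2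

/-- Continuity of the pairings in time and shift. -/
theorem continuousAt_slice {X : Type*} [TopologicalSpace X] [FirstCountableTopology X]
    {Ψ : ℝ → ℝ → Plane} {u : ℝ → Weighted} {τ α : X → ℝ} {x : X} (ht : τ x ∈ Ioo 0 b)
    (hΨ : SliceCont Ψ (τ x)) (hu : ContinuousAt u (R (τ x))) (hτ : ContinuousAt τ x)
    (hα : ContinuousAt α x) :
    ContinuousAt (fun x => slicePair κ ε (Ψ (τ x)) (u (R (τ x))) (α x)) x := by
  have hRc := (S.regular (τ x) (mem_Icc_of_mem_Ioo hb ht)).smooth.continuousAt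
  exact continuousAt_slicePair S.κ_pos hε (hΨ.comp hτ)
    (ContinuousAt.comp (f := fun x => R (τ x)) hu (ContinuousAt.comp (f := τ) hRc hτ)) hα

/-- Differentiation of the pairings along a path. -/
theorem hasDerivAt_slice {Ψ Ψ' : ℝ → ℝ → Plane} {u u' ux : ℝ → Weighted} {α α' : ℝ → ℝ}
    (ht : t ∈ Ioo 0 b) (hΨ : SliceCont Ψ t) (hΨ' : SliceCont Ψ' t)
    (hd : ∀ s ∈ Ioo 0 b, ∀ y, HasDerivAt (fun τ => Ψ τ y) (Ψ' s y) s)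
    (hu : TestFamily κ u u' ux (R t)) (hα : ∀ s ∈ Ioo 0 b, HasDerivAt α (α' s) s)
    (hα' : ContinuousAt α' t) :
    HasDerivAt (fun t => slicePair κ ε (Ψ t) (u (R t)) (α t))
      (slicePair κ ε (Ψ' t) (u (R t)) (α t) + deriv R t * slicePair κ ε (Ψ t) (u' (R t)) (α t)
        - α' t / ε * slicePair κ ε (Ψ t) (ux (R t)) (α t)) t := by
  have hn : Ioo 0 b ∈ 𝓝 t := Ioo_mem_nhds ht.1 ht.2
  exact hasDerivAt_slicePair S.κ_pos hε hΨ hΨ' (eventually_of_mem hn hd) hu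
    (eventually_of_mem hn fun s hs => ((S.regular s ⟨hs.1.le,
      hs.2.le.trans hb⟩).smooth.differentiableAt (by norm_num)).hasDerivAt)
    (S.regular t (mem_Icc_of_mem_Ioo hb ht)).smooth_deriv.continuousAt
    (eventually_of_mem hn hα) hα'

theorem hasDerivAt_slice_shift (ht : t ∈ Ioo 0 b) (α : ℝ) :
    HasDerivAt (fun α => slicePair κ ε (Φ t) (profileSlope F κ (R t)) α)
      (-(1 / ε) * slicePair κ ε (Φ t) (profileForce V d F κ (R t)) α) α := by
  have htT := mem_Icc_of_mem_Ioo hb ht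
  have hr := (S.regular t htT).mem
  have hΦc := (hΦ.sliceCont ht).1
  have h1 : SliceCont (fun _ : ℝ => Φ t) α := hΦc.comp (g := fun _ : ℝ => t) continuousAt_const
  have h2 : SliceCont (fun (_ : ℝ) (_ : ℝ) => (0 : Plane)) α :=
    ⟨.of_forall fun _ => continuous_const, ⟨0, .of_forall fun _ _ => by simp⟩,
      fun _ => continuousAt_const⟩
  have := hasDerivAt_slicePair (ρ := fun _ => R t) (ρ' := fun _ => 0) (α := id) (α' := fun _ => 1)
    S.κ_pos hε h1 h2 (.of_forall fun _ _ => hasDerivAt_const _ _)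
    (S.family.testFamilies S.κ_pos S.κ_lt hr).1 (.of_forall fun _ => hasDerivAt_const _ _)
    continuousAt_const (.of_forall fun _ => hasDerivAt_id _) continuousAt_const
  refine this.congr_deriv ?_
  simp [slicePair]

variable {δ c₀ : ℝ} {a : ℝ → ℝ} (hδ : S.IsThreshold δ c₀) (ha : IsShift F R (δ * ε) ε b Φ a)
include hδ ha

theorem slicePair_force_shift_le (ht : t ∈ Ioo 0 b) :
    slicePair κ ε (Φ t) (profileForce V d F κ (R t)) (a t) ≤ -(ε / (2 * C)) :=
  S.slicePair_force_le_of_mem hε hb hΦ hδ ht (ha t ht).1 (ha t ht).1 left_mem_uIcc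

theorem slicePair_slope_shift (ht : t ∈ Ioo 0 b) :
    slicePair κ ε (Φ t) (profileSlope F κ (R t)) (a t) = 0 :=
  (S.shiftGrad_eq_zero_iff hε hb hΦ ht _).2.1 (ha t ht).2

theorem continuousAt_shift (ht : t ∈ Ioo 0 b) : ContinuousAt a t := by
  have htT := mem_Icc_of_mem_Ioo hb ht
  have hC : 1 ≤ C := (S.profile t htT).one_le
  have hr := (S.regular t htT).mem
  have hJ : ContinuousAt (fun s => slicePair κ ε (Φ s) (profileSlope F κ (R s)) (a t)) t :=
    S.continuousAt_slice hε hb hΦ (τ := id) ht (hΦ.sliceCont ht).1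
      (S.family.regularity S.κ_pos S.κ_lt hr).2.1.continuousAt continuousAt_id continuousAt_const
  have hJ' := hJ.tendsto.abs.const_mul (2 * C)
  rw [S.slicePair_slope_shift hε hb hΦ hδ ha ht, abs_zero, mul_zero] at hJ'
  rw [ContinuousAt, tendsto_iff_dist_tendsto_zero]
  refine squeeze_zero' (.of_forall fun s => dist_nonneg) ?_ hJ'
  filter_upwards [Ioo_mem_nhds ht.1 ht.2, (S.continuousAt_shiftDist hε hb hΦ ht (a t)).eventually
    (gt_mem_nhds (ha t ht).1)] with s hs hds
  have key := mul_abs_sub_le_of_le_deriv (c := 1 / (2 * C)) (x := a s) (y := a t)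
    (fun z => S.hasDerivAt_slice_shift hε hb hΦ hs z) fun z hz => by
      have h1 := S.slicePair_force_le_of_mem hε hb hΦ hδ hs (ha s hs).1 hds hz
      have h2 := mul_mono_left h1 (show 0 ≤ 1 / ε by positivity)
      have h3 : 1 / ε * -(ε / (2 * C)) = -(1 / (2 * C)) := by field_simp
      linarith
  rw [S.slicePair_slope_shift hε hb hΦ hδ ha hs, zero_sub, abs_neg] at key
  rw [dist_eq]
  rw [one_div, inv_mul_le_iff₀ (by positivity)] at key
  exact key

end Solution

end Setting

namespace Setting

variable (S : Setting V d I F l Z R T Y κ C)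

/-- The pairing at the shifted profile. -/
def shiftPair (_ : Setting V d I F l Z R T Y κ C) (ε : ℝ) (a : ℝ → ℝ) (Ψ : ℝ → ℝ → Plane)
    (u : ℝ → Weighted) (t : ℝ) : ℝ := slicePair κ ε (Ψ t) (u (R t)) (a t)

/-- The time derivative of `∫ ⟨∂_t Φ, S⟩ + R' ∫ ⟨Φ, S_r⟩` along the shift. -/
def numeratorDeriv (S : Setting V d I F l Z R T Y κ C) (ε : ℝ) (a a' : ℝ → ℝ) (Φ : ℝ → ℝ → Plane)
    (t : ℝ) : ℝ :=
  S.shiftPair ε a (timeDeriv (timeDeriv Φ)) (profileSlope F κ) t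
    + deriv R t * S.shiftPair ε a (timeDeriv Φ) (deriv (profileSlope F κ)) t
    - a' t / ε * S.shiftPair ε a (timeDeriv Φ) (profileForce V d F κ) t
    + (deriv (deriv R) t * S.shiftPair ε a Φ (deriv (profileSlope F κ)) t
    + deriv R t * (S.shiftPair ε a (timeDeriv Φ) (deriv (profileSlope F κ)) t
      + deriv R t * S.shiftPair ε a Φ (deriv (deriv (profileSlope F κ))) t
      - a' t / ε * S.shiftPair ε a Φ (deriv (profileForce V d F κ)) t))

/-- The time derivative of `∫ ⟨Φ, T⟩` along the shift. -/
def denominatorDeriv (S : Setting V d I F l Z R T Y κ C) (ε : ℝ) (a a' : ℝ → ℝ) (Φ : ℝ → ℝ → Plane)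
    (t : ℝ) : ℝ :=
  S.shiftPair ε a (timeDeriv Φ) (profileForce V d F κ) t
    + deriv R t * S.shiftPair ε a Φ (deriv (profileForce V d F κ)) t
    - a' t / ε * S.shiftPair ε a Φ (profileForceX V d F κ) t

/-- The first derivative of the shift. -/
def shiftDeriv (S : Setting V d I F l Z R T Y κ C) (ε : ℝ) (a : ℝ → ℝ) (Φ : ℝ → ℝ → Plane)
    (t : ℝ) : ℝ :=
  ε * (S.shiftPair ε a (timeDeriv Φ) (profileSlope F κ) t
    + deriv R t * S.shiftPair ε a Φ (deriv (profileSlope F κ)) t)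
    / S.shiftPair ε a Φ (profileForce V d F κ) t

variable {Φ : ℝ → ℝ → Plane} (hε : 0 < ε) (hb : b ≤ T) (hΦ : IsSolution V d R Y ε b Φ)
variable {δ c₀ : ℝ} {a : ℝ → ℝ} (hδ : S.IsThreshold δ c₀) (ha : IsShift F R (δ * ε) ε b Φ a)
include hε hb hΦ hδ ha

theorem shiftPair_force_ne_zero (ht : t ∈ Ioo 0 b) :
    S.shiftPair ε a Φ (profileForce V d F κ) t ≠ 0 := by
  have hC := S.C_pos ⟨t, ht.1.le, ht.2.le.trans hb⟩
  have h1 := S.slicePair_force_shift_le hε hb hΦ hδ ha ht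
  have h2 : 0 < ε / (2 * C) := by positivity
  exact (show S.shiftPair ε a Φ (profileForce V d F κ) t < 0 by unfold shiftPair; linarith).ne

theorem continuousAt_shiftPair {Ψ : ℝ → ℝ → Plane} {u : ℝ → Weighted} (ht : t ∈ Ioo 0 b)
    (hΨ : SliceCont Ψ t) (hu : ContinuousAt u (R t)) : ContinuousAt (S.shiftPair ε a Ψ u) t :=
  S.continuousAt_slice hε hb hΦ (τ := id) ht hΨ hu continuousAt_id
    (S.continuousAt_shift hε hb hΦ hδ ha ht)

theorem hasDerivAt_shift (ht : t ∈ Ioo 0 b) : HasDerivAt a (S.shiftDeriv ε a Φ t) t := by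
  have hn : ∀ᶠ p : ℝ × ℝ in 𝓝 (t, a t), p.1 ∈ Ioo 0 b :=
    continuousAt_fst.eventually (Ioo_mem_nhds ht.1 ht.2)
  have hr : ∀ {s}, s ∈ Ioo 0 b → R s ∈ I := fun hs => (S.regular _ ⟨hs.1.le, hs.2.le.trans hb⟩).mem
  have hreg := S.family.regularity S.κ_pos S.κ_lt (hr ht)
  have d0 : ContinuousAt (deriv (profileSlope F κ)) (R t) :=
    (hreg.2.1.derivWithin (m := 0) le_rfl).continuousAt
  have hRc := (S.regular t (mem_Icc_of_mem_Ioo hb ht)).smooth_deriv.continuousAt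
  have hsl := hΦ.sliceCont ht
  have key := hasDerivAt_of_implicit
    (J := fun p => slicePair κ ε (Φ p.1) (profileSlope F κ (R p.1)) p.2)
    (Jt := fun p => slicePair κ ε (timeDeriv Φ p.1) (profileSlope F κ (R p.1)) p.2
      + deriv R p.1 * slicePair κ ε (Φ p.1) (deriv (profileSlope F κ) (R p.1)) p.2)
    (Jα := fun p => -(1 / ε) * slicePair κ ε (Φ p.1) (profileForce V d F κ (R p.1)) p.2)
    (a := a) (t₀ := t) ?_ (hn.mono fun p hp => S.hasDerivAt_slice_shift hε hb hΦ hp p.2) ?_ ?_ ?_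
    (S.continuousAt_shift hε hb hΦ hδ ha ht) (eventually_of_mem (Ioo_mem_nhds ht.1 ht.2)
      fun s hs => S.slicePair_slope_shift hε hb hΦ hδ ha hs)
  · refine key.congr_deriv ?_
    have h0 := S.shiftPair_force_ne_zero hε hb hΦ hδ ha ht
    simp only [shiftDeriv, shiftPair] at h0 ⊢
    field_simp
  · refine hn.mono fun p hp => ?_
    have := S.hasDerivAt_slice hε hb hΦ hp (hΦ.sliceCont hp).1 (hΦ.sliceCont hp).2.1
      hΦ.contDiffOn_timeDeriv.2 (S.family.testFamilies S.κ_pos S.κ_lt (hr hp)).1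
      (α := fun _ => p.2) (α' := fun _ => 0) (fun _ _ => hasDerivAt_const _ _) continuousAt_const
    exact this.congr_deriv (by ring)
  · exact (S.continuousAt_slice hε hb hΦ (τ := Prod.fst) (x := (t, a t)) ht hsl.2.1
      hreg.2.1.continuousAt continuousAt_fst continuousAt_snd).add
      ((ContinuousAt.comp (f := Prod.fst) (x := (t, a t)) hRc continuousAt_fst).mul
      (S.continuousAt_slice hε hb hΦ (τ := Prod.fst) (x := (t, a t)) ht hsl.1 d0
      continuousAt_fst continuousAt_snd))
  · exact (S.continuousAt_slice hε hb hΦ (τ := Prod.fst) (x := (t, a t)) ht hsl.1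
      hreg.2.2.2.1.continuousAt continuousAt_fst continuousAt_snd).const_mul _
  · have h0 := S.shiftPair_force_ne_zero hε hb hΦ hδ ha ht
    exact mul_ne_zero (by simp [hε.ne']) h0

theorem continuousAt_shiftDeriv (ht : t ∈ Ioo 0 b) : ContinuousAt (S.shiftDeriv ε a Φ) t := by
  have hreg := S.family.regularity S.κ_pos S.κ_lt (S.regular t (mem_Icc_of_mem_Ioo hb ht)).mem
  have hsl := hΦ.sliceCont ht
  have hRc := (S.regular t (mem_Icc_of_mem_Ioo hb ht)).smooth_deriv.continuousAt
  have c : ∀ {Ψ u}, SliceCont Ψ t → ContinuousAt u (R t) → ContinuousAt (S.shiftPair ε a Ψ u) t :=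
    fun h1 h2 => S.continuousAt_shiftPair hε hb hΦ hδ ha ht h1 h2
  have d0 : ContinuousAt (deriv (profileSlope F κ)) (R t) :=
    (hreg.2.1.derivWithin (m := 0) le_rfl).continuousAt
  exact (continuousAt_const.mul ((c hsl.2.1 hreg.2.1.continuousAt).add
    (hRc.mul (c hsl.1 d0)))).div (c hsl.1 hreg.2.2.2.1.continuousAt)
    (S.shiftPair_force_ne_zero hε hb hΦ hδ ha ht)

theorem hasDerivAt_shiftDeriv (ht : t ∈ Ioo 0 b) : HasDerivAt (S.shiftDeriv ε a Φ)
      ((ε * S.numeratorDeriv ε a (S.shiftDeriv ε a Φ) Φ t -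
        S.shiftDeriv ε a Φ t * S.denominatorDeriv ε a (S.shiftDeriv ε a Φ) Φ t) /
        S.shiftPair ε a Φ (profileForce V d F κ) t) t := by
  have htT := mem_Icc_of_mem_Ioo hb ht
  obtain ⟨f1, f2, f3⟩ := S.family.testFamilies S.κ_pos S.κ_lt (S.regular t htT).mem
  obtain ⟨s1, s2, s3⟩ := hΦ.sliceCont ht
  have hR := ((S.regular t htT).smooth_deriv.differentiableAt (by norm_num)).hasDerivAt
  have D : ∀ {Ψ Ψ' : ℝ → ℝ → Plane} {u u' ux : ℝ → Weighted}, SliceCont Ψ t → SliceCont Ψ' t →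
      (∀ s ∈ Ioo 0 b, ∀ y, HasDerivAt (fun τ => Ψ τ y) (Ψ' s y) s) → TestFamily κ u u' ux (R t) →
      HasDerivAt (S.shiftPair ε a Ψ u) (S.shiftPair ε a Ψ' u t + deriv R t * S.shiftPair ε a Ψ u' t
        - S.shiftDeriv ε a Φ t / ε * S.shiftPair ε a Ψ ux t) t := fun h1 h2 h3 h4 =>
    S.hasDerivAt_slice hε hb hΦ ht h1 h2 h3 h4 (fun s hs => S.hasDerivAt_shift hε hb hΦ hδ ha hs)
      (S.continuousAt_shiftDeriv hε hb hΦ hδ ha ht)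
  have e1 := D s2 s3 hΦ.continuousOn_timeDeriv2.2 f1
  have e2 := D s1 s2 hΦ.contDiffOn_timeDeriv.2 f2
  have e3 := D s1 s2 hΦ.contDiffOn_timeDeriv.2 f3
  have h0 := S.shiftPair_force_ne_zero hε hb hΦ hδ ha ht
  refine (((e1.add (hR.mul e2)).const_mul ε).div e3 h0).congr_deriv ?_
  simp only [Pi.add_apply, Pi.mul_apply, numeratorDeriv, denominatorDeriv]
  have hs : S.shiftDeriv ε a Φ t = ε * (S.shiftPair ε a (timeDeriv Φ) (profileSlope F κ) t
    + deriv R t * S.shiftPair ε a Φ (deriv (profileSlope F κ)) t)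
    / S.shiftPair ε a Φ (profileForce V d F κ) t := rfl
  rw [sq, div_mul_eq_div_div, sub_div, mul_div_cancel_right₀ _ h0, mul_div_right_comm, ← hs]

theorem shift_regular : ContDiffOn ℝ 2 a (Ioo 0 b) ∧ ∀ t ∈ Ioo 0 b,
    deriv (deriv a) t / ε * S.shiftPair ε a Φ (profileForce V d F κ) t =
      S.numeratorDeriv ε a (deriv a) Φ t -
        deriv a t / ε * S.denominatorDeriv ε a (deriv a) Φ t := by
  have hd1 : ∀ t ∈ Ioo 0 b, HasDerivAt a (S.shiftDeriv ε a Φ t) t := fun t ht =>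
    S.hasDerivAt_shift hε hb hΦ hδ ha ht
  have hd2 := fun t (ht : t ∈ Ioo 0 b) => S.hasDerivAt_shiftDeriv hε hb hΦ hδ ha ht
  refine ⟨contDiffOn_two_of_hasDerivAt isOpen_Ioo hd1 hd2 fun t ht =>
    ContinuousAt.continuousWithinAt ?_, fun t ht => ?_⟩
  · have htT := mem_Icc_of_mem_Ioo hb ht
    have hreg := S.regular t htT
    obtain ⟨-, hS, hSr, hF, -, -⟩ := S.family.regularity S.κ_pos S.κ_lt hreg.mem
    have hX := S.family.continuousAt_profileForceX S.κ_pos S.κ_lt hreg.mem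
    obtain ⟨s1, s2, s3⟩ := hΦ.sliceCont ht
    have c : ∀ {Ψ u}, SliceCont Ψ t → ContinuousAt u (R t) → ContinuousAt (S.shiftPair ε a Ψ u) t :=
      fun h1 h2 => S.continuousAt_shiftPair hε hb hΦ hδ ha ht h1 h2
    have d0 : ∀ {f : ℝ → Weighted}, ContDiffAt ℝ 1 f (R t) → ContinuousAt (deriv f) (R t) :=
      fun hf => (hf.derivWithin (m := 0) le_rfl).continuousAt
    have r1 := hreg.smooth_deriv.continuousAt
    have r2 := hreg.smooth_deriv2.continuousAt
    have ca := S.continuousAt_shiftDeriv hε hb hΦ hδ ha ht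
    have k1 := c s3 hS.continuousAt
    have k2 := c s2 (d0 hS)
    have k3 := c s2 hF.continuousAt
    have k4 := c s1 (d0 hS)
    have k5 := c s1 (d0 hSr)
    have k6 := c s1 (d0 hF)
    have k7 := c s1 hX
    have k8 := c s1 hF.continuousAt
    have cp := ca.div_const ε
    refine ContinuousAt.div ((continuousAt_const.mul ?_).sub (ca.mul ?_)) k8
      (S.shiftPair_force_ne_zero hε hb hΦ hδ ha ht)
    · exact ((k1.add (r1.mul k2)).sub (cp.mul k3)).add ((r2.mul k4).add
        (r1.mul ((k2.add (r1.mul k5)).sub (cp.mul k6))))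
    · exact (k3.add (r1.mul k6)).sub (cp.mul k7)
  · have e : deriv a =ᶠ[𝓝 t] S.shiftDeriv ε a Φ :=
      eventually_of_mem (Ioo_mem_nhds ht.1 ht.2) fun s hs => (hd1 s hs).deriv
    have e2 := (hd2 t ht).deriv
    have h0 := S.shiftPair_force_ne_zero hε hb hΦ hδ ha ht
    rw [e.deriv_eq, e2, numeratorDeriv, numeratorDeriv, denominatorDeriv, denominatorDeriv,
      e.self_of_nhds]
    field_simp

end Setting

/-! ### Integral identities -/

theorem decays_of_compact {M : ℝ} (hκ : 0 ≤ κ) {f : ℝ → Plane} (hc : Continuous f)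
    (h0 : ∀ x, M < |x| → f x = 0) : Decays κ f := by
  obtain ⟨B, hB⟩ := (isCompact_Icc (a := -M) (b := M)).exists_bound_of_continuousOn hc.continuousOn
  refine .of_bound (C := max B 0 * exp (κ * M)) hc fun x => ?_
  rcases lt_or_ge M |x| with hx | hx
  · rw [h0 x hx, norm_zero]; positivity
  · rw [mul_assoc, ← exp_add]
    refine ((hB x (abs_le.1 hx)).trans (le_max_left _ _)).trans
      (le_mul_of_one_le_right (le_max_right _ _) (Real.one_le_exp_iff.2 ?_))
    have := mul_mono_left hx hκ
    linarith

theorem Decays.tendsto_zero (hκ : 0 < κ) {u : ℝ → E} (hu : Decays κ u) :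
    Tendsto u atBot (𝓝 0) ∧ Tendsto u atTop (𝓝 0) := by
  obtain ⟨C, hC0, hC⟩ := hu.exists_bound
  have h : ∀ {l : Filter ℝ}, Tendsto (fun x : ℝ => |x|) l atTop → Tendsto u l (𝓝 0) := fun hl => by
    refine squeeze_zero_norm hC ?_
    have := (Real.tendsto_exp_neg_atTop_nhds_zero.comp (hl.const_mul_atTop hκ)).const_mul C
    simpa using this
  exact ⟨h tendsto_abs_atBot_atTop, h tendsto_abs_atTop_atTop⟩

theorem integral_deriv_eq_zero (hκ : 0 < κ) {g g' : ℝ → ℝ} (hg : Decays κ g)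
    (hg' : Decays κ g') (hd : ∀ x, HasDerivAt g (g' x) x) : ∫ x, g' x = 0 := by
  have := integral_of_hasDerivAt_of_tendsto hd (hg'.integrable hκ) (hg.tendsto_zero hκ).1
    (hg.tendsto_zero hκ).2
  simpa using this

theorem norm_sq_le_of_decays (hκ : 0 < κ) {u u1 : ℝ → Plane} (hu : Decays κ u)
    (hu1 : Decays κ u1) (hd : ∀ x, HasDerivAt u (u1 x) x) (x : ℝ) :
    ‖u x‖ ^ 2 ≤ (∫ x, ⟪u x, u x⟫) + ∫ x, ⟪u1 x, u1 x⟫ := by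
  have hp : 0 < κ + κ := by linarith
  have h1 := fun x => (hd x).inner ℝ (hd x)
  have i1 := hu.integrable_inner hu1
  have i2 := hu1.integrable_inner hu
  have i3 := hu.integrable_inner hu
  have i4 := hu1.integrable_inner hu1
  have h2 := integral_Iic_of_hasDerivAt_of_tendsto' (a := x) (fun y _ => h1 y)
    (i1.add i2).integrableOn ((hu.inner hu).tendsto_zero hp).1
  rw [sub_zero] at h2
  rw [← real_inner_self_eq_norm_sq, ← h2, ← integral_add i3 i4]
  refine (setIntegral_mono (i1.add i2).integrableOn (i3.add i4).integrableOn fun y => ?_).trans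
    (setIntegral_le_integral (i3.add i4) (.of_forall fun y =>
      add_nonneg real_inner_self_nonneg real_inner_self_nonneg))
  simp only [Pi.add_apply, real_inner_self_eq_norm_sq]
  rw [real_inner_comm (u y)]
  have := real_inner_le_norm (u y) (u1 y)
  nlinarith [sq_nonneg (‖u y‖ - ‖u1 y‖)]

theorem Decays.quadratic {κ' : ℝ} (hκ : κ < κ') {u : ℝ → E} (hu : Decays κ' u) (c₀ c₁ c₂ : ℝ) :
    Decays κ fun x => (c₀ + c₁ * x + c₂ * x ^ 2) • u x := by
  obtain ⟨κ₁, h1, h2⟩ := exists_between hκ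
  have d1 := hu.id_smul h2
  have d2 := d1.id_smul h1
  have := ((hu.mono hκ.le).const_smul c₀).add (((d1.mono h1.le).const_smul c₁).add (d2.const_smul c₂))
  refine this.1.congr (fun x => ?_) |> fun h => ⟨h, ?_⟩
  · module
  · obtain ⟨C, hC⟩ := this.2
    refine ⟨C, fun x => ?_⟩
    refine (le_of_eq ?_).trans (hC x)
    congr 1
    module

theorem inv_sq_mul_exp_le {c : ℝ} (hc : 0 < c) (hε : 0 < ε) :
    (ε ^ 2)⁻¹ * exp (-(c / ε)) ≤ 2 / c ^ 2 := by
  have h1 := Real.quadratic_le_exp_of_nonneg (div_nonneg hc.le hε.le)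
  have h2 : 0 < c / ε := by positivity
  rw [Real.exp_neg, ← mul_inv, inv_le_comm₀ (by positivity) (by positivity), inv_div]
  calc c ^ 2 / 2 = ε ^ 2 * ((c / ε) ^ 2 / 2) := by field_simp
    _ ≤ ε ^ 2 * exp (c / ε) := by gcongr; linarith

namespace ProfileFamily

variable (h : ProfileFamily V d I F l) (hκ : 0 < κ) (hκl : κ < √l / 2) (hr : r ∈ I)
include h hκ hκl hr

/-- Green's identity against the translation mode, with a quadratic weight. -/
theorem integral_quadratic_green {u u1 u2 : ℝ → Plane} (hu : Decays κ u) (hu1 : Decays κ u1)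
    (hu2 : Decays κ u2) (hd : ∀ x, HasDerivAt u (u1 x) x) (hd1 : ∀ x, HasDerivAt u1 (u2 x) x)
    (c₀ c₁ c₂ : ℝ) :
    Integrable (fun x => (c₀ + c₁ * x + c₂ * x ^ 2) *
      ⟪u2 x - hessW V d (F r x) r (u x), deriv (F r) x⟫) ∧
    ∫ x, (c₀ + c₁ * x + c₂ * x ^ 2) * ⟪u2 x - hessW V d (F r x) r (u x), deriv (F r) x⟫ =
    ∫ x, (2 * (c₁ + 2 * c₂ * x) * ⟪u x, force V d (F r x) r⟫ + 2 * c₂ * ⟪u x, deriv (F r) x⟫) := by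
  have hS := (h.decays_deriv hr).mono hκl.le
  have hT := (h.decays_force hr).mono hκl.le
  have hk : κ < κ + κ := by linarith
  have k1 := (hu2.sub (h.decays_hess_apply hr hu)).inner hS
  have k2 := (hu1.inner hS).sub (hu.inner hT)
  have k3 := hu.inner hS
  have k4 := hu.inner hT
  have D1 := k1.quadratic hk c₀ c₁ c₂
  have D2 := (k4.quadratic hk (2 * c₁) (4 * c₂) 0).add (k3.quadratic hk (2 * c₂) 0 0)
  have D3 := (k2.quadratic hk c₀ c₁ c₂).sub (k3.quadratic hk c₁ (2 * c₂) 0)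
  have D4 := D1.sub D2
  simp only [smul_eq_mul] at D1 D2 D3 D4
  refine ⟨D1.integrable hκ, ?_⟩
  have key := integral_deriv_eq_zero hκ D3 D4 fun x => ?_
  · rw [integral_sub (D1.integrable hκ) (D2.integrable hκ), sub_eq_zero] at key
    rw [key]
    congr 1 with x
    ring
  · have e1 : HasDerivAt (fun x : ℝ => c₀ + c₁ * x + c₂ * x ^ 2) (c₁ + 2 * c₂ * x) x := by
      have := (((hasDerivAt_id x).const_mul c₁).const_add c₀).add ((hasDerivAt_pow 2 x).const_mul c₂)
      exact this.congr_deriv (by simp; ring)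
    have e2 : HasDerivAt (fun x : ℝ => c₁ + 2 * c₂ * x + 0 * x ^ 2) (2 * c₂) x := by
      have := (((hasDerivAt_id x).const_mul (2 * c₂)).const_add c₁)
      simpa using this
    have s1 := (hd1 x).inner ℝ (h.hasDerivAt_deriv hr x)
    have s2 := (hd x).inner ℝ (h.hasDerivAt_force_comp hr x)
    have s3 := (hd x).inner ℝ (h.hasDerivAt_deriv hr x)
    have s4 : HasDerivAt (fun x => ⟪u1 x, deriv (F r) x⟫ - ⟪u x, force V d (F r x) r⟫)
        _ x := s1.sub s2
    refine ((e1.mul s4).sub (e2.mul s3)).congr_deriv ?_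
    rw [inner_sub_left, hessW_symm h.potential]
    ring

theorem integral_id_mul_tail (q : ℝ) :
    Integrable (fun x => (x + q) * ⟪coordProj 1 (F r x), deriv (F r) x⟫) ∧
    ∫ x, (x + q) * ⟪coordProj 1 (F r x), deriv (F r) x⟫ = -(1 / 2) * ∫ x, (F r x 1) ^ 2 := by
  have hS := (h.decays_deriv hr).mono hκl.le
  have hP := (h.decays_coordProj hr).mono hκl.le
  have hk : κ < κ + κ := by linarith
  have D1 := ((hP.inner hS).quadratic hk q 1 0)
  have D2 := hP.inner hP
  have D3 := (D2.quadratic hk q 1 0)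
  have D4 := (D2.mono hk.le).add (D1.const_smul 2)
  simp only [smul_eq_mul] at D1 D3 D4
  have e : ∀ x, (q + 1 * x + 0 * x ^ 2) * ⟪coordProj 1 (F r x), deriv (F r) x⟫ =
      (x + q) * ⟪coordProj 1 (F r x), deriv (F r) x⟫ := fun x => by ring
  have i1 := D1.integrable hκ
  simp only [e] at i1
  refine ⟨i1, ?_⟩
  have key := integral_deriv_eq_zero hκ D3 D4 fun x => ?_
  · have i2 := (D2.mono hk.le).integrable hκ
    simp only [e] at key
    rw [integral_add i2 (i1.const_mul 2), integral_const_mul] at key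
    simp only [real_inner_self_eq_norm_sq, norm_coordProj_sq] at key
    linarith
  · have e2 : HasDerivAt (fun x : ℝ => q + 1 * x + 0 * x ^ 2) 1 x := by
      have := (hasDerivAt_id x).const_add q
      simpa using this
    have s1 : HasDerivAt (fun x => coordProj 1 (F r x)) (coordProj 1 (deriv (F r) x)) x :=
      (coordProj 1).hasFDerivAt.comp_hasDerivAt x (h.hasDerivAt hr x)
    refine (e2.mul (s1.inner ℝ s1)).congr_deriv ?_
    have e3 : ⟪coordProj 1 (deriv (F r) x), coordProj 1 (F r x)⟫ =
        ⟪coordProj 1 (F r x), deriv (F r) x⟫ := by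
      simp [inner_eq_coords, mul_comm]
    have e4 : ⟪coordProj 1 (F r x), coordProj 1 (deriv (F r) x)⟫ =
        ⟪coordProj 1 (F r x), deriv (F r) x⟫ := by
      simp [inner_eq_coords]
    rw [e3, e4]
    ring

end ProfileFamily

/-- Expansion of the force around a profile, in the field and in the radius. -/
theorem norm_force_remainder_le (hV : IsPotential V) {ρ₀ c K ρ : ℝ}
    (hc : TaylorBound V ρ₀ c) (hr : 0 < r) (hρ : 0 < ρ) (hrK : r⁻¹ ≤ K) (hρK : ρ⁻¹ ≤ K)
    {Ψ X : Plane} (hΨ : ‖Ψ‖ ≤ ρ₀) (hX : ‖X‖ ≤ ρ₀) :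
    ‖force V d X ρ - force V d Ψ r - hessW V d Ψ r (X - Ψ) - (ρ - r) • forceR V d Ψ r‖ ≤
      c * ‖X - Ψ‖ ^ 2 + 2 * d ^ 2 * K ^ 3 * |ρ - r| * ‖X - Ψ‖
        + 3 * d ^ 2 * K ^ 4 * |ρ - r| ^ 2 * ‖coordProj 1 Ψ‖ := by
  have hr1 : 0 < r⁻¹ := inv_pos.2 hr
  have hK : 0 ≤ K := hr1.le.trans hrK
  have e : force V d X ρ - force V d Ψ r - hessW V d Ψ r (X - Ψ) - (ρ - r) • forceR V d Ψ r =
      (gradient V X - gradient V Ψ - ∇²V Ψ (X - Ψ)) +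
      (d ^ 2 * (-(ρ - r) * (r⁻¹ * ρ⁻¹ ^ 2 + r⁻¹ ^ 2 * ρ⁻¹))) • coordProj 1 (X - Ψ) +
      (d ^ 2 * ((ρ - r) ^ 2 * (r⁻¹ ^ 2 * ρ⁻¹ ^ 2 + 2 * (r⁻¹ ^ 3 * ρ⁻¹)))) • coordProj 1 Ψ := by
    have a1 : d ^ 2 * (-(ρ - r) * (r⁻¹ * ρ⁻¹ ^ 2 + r⁻¹ ^ 2 * ρ⁻¹)) = d ^ 2 / ρ ^ 2 - d ^ 2 / r ^ 2 := by
      field_simp; ring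
    have a2 : d ^ 2 * ((ρ - r) ^ 2 * (r⁻¹ ^ 2 * ρ⁻¹ ^ 2 + 2 * (r⁻¹ ^ 3 * ρ⁻¹))) =
        d ^ 2 / ρ ^ 2 - d ^ 2 / r ^ 2 + (ρ - r) * (2 * d ^ 2 / r ^ 3) := by
      field_simp; ring
    rw [force_eq hV, force_eq hV, hessW_eq hV, forceR_eq hV _ hr.ne', a1, a2]
    simp only [FunLike.coe_add, Pi.add_apply, FunLike.coe_smul, Pi.smul_apply, map_sub]
    module
  rw [e]
  refine (norm_add₃_le).trans (add_le_add (add_le_add (hc.grad_taylor Ψ X hΨ hX) ?_) ?_)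
  · rw [norm_smul, norm_eq_abs, abs_mul, abs_mul, abs_neg, abs_of_nonneg (sq_nonneg d),
      abs_of_nonneg (by positivity : 0 ≤ r⁻¹ * ρ⁻¹ ^ 2 + r⁻¹ ^ 2 * ρ⁻¹)]
    have b1 : r⁻¹ * ρ⁻¹ ^ 2 + r⁻¹ ^ 2 * ρ⁻¹ ≤ 2 * K ^ 3 := by
      have : r⁻¹ * ρ⁻¹ ^ 2 ≤ K * K ^ 2 := by gcongr
      have : r⁻¹ ^ 2 * ρ⁻¹ ≤ K ^ 2 * K := by gcongr
      linarith
    have b2 : ‖coordProj 1 (X - Ψ)‖ ≤ ‖X - Ψ‖ := by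
      have := (coordProj 1).le_of_opNorm_le (norm_coordProj_le 1) (X - Ψ)
      linarith
    calc d ^ 2 * (|ρ - r| * (r⁻¹ * ρ⁻¹ ^ 2 + r⁻¹ ^ 2 * ρ⁻¹)) * ‖coordProj 1 (X - Ψ)‖
        ≤ d ^ 2 * (|ρ - r| * (2 * K ^ 3)) * ‖X - Ψ‖ := by gcongr
      _ = _ := by ring
  · rw [norm_smul, norm_eq_abs, abs_mul, abs_mul, abs_of_nonneg (sq_nonneg d), abs_pow,
      abs_of_nonneg (by positivity : 0 ≤ r⁻¹ ^ 2 * ρ⁻¹ ^ 2 + 2 * (r⁻¹ ^ 3 * ρ⁻¹))]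
    have b1 : r⁻¹ ^ 2 * ρ⁻¹ ^ 2 + 2 * (r⁻¹ ^ 3 * ρ⁻¹) ≤ 3 * K ^ 4 := by
      have : r⁻¹ ^ 2 * ρ⁻¹ ^ 2 ≤ K ^ 2 * K ^ 2 := by gcongr
      have : r⁻¹ ^ 3 * ρ⁻¹ ≤ K ^ 3 * K := by gcongr
      linarith
    calc d ^ 2 * (|ρ - r| ^ 2 * (r⁻¹ ^ 2 * ρ⁻¹ ^ 2 + 2 * (r⁻¹ ^ 3 * ρ⁻¹))) * ‖coordProj 1 Ψ‖
        ≤ d ^ 2 * (|ρ - r| ^ 2 * (3 * K ^ 4)) * ‖coordProj 1 Ψ‖ := by gcongr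
      _ = _ := by ring

namespace Setting

/-- The solution at a fixed time in the variable `z = (y - a) / ε`: the field is `F + ε U`, `P` is
the time derivative of the error, and `E` its energy. -/
structure Slice (S : Setting V d I F l Z R T Y κ C) (t ε a p E : ℝ)
    (U U1 U2 P Ψt Ψtt : ℝ → Plane) : Prop where
  mem : t ∈ Icc 0 T
  ε_pos : 0 < ε
  ε_le : ε ≤ 1
  a_le : |a| ≤ Y / 2
  decays : Decays κ U
  decays1 : Decays κ U1
  decays2 : Decays κ U2
  hasDerivAt : ∀ z, HasDerivAt U (U1 z) z
  hasDerivAt1 : ∀ z, HasDerivAt U1 (U2 z) z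
  orthogonal : ∫ z, ⟪U z, deriv (F (R t)) z⟫ = 0
  integrable : Integrable fun z => ⟪Ψtt z, deriv (F (R t)) z⟫
  continuous_P : Continuous P
  Ψt_sub : ∀ z, ‖Ψt z - P z‖ ≤ 3 * C ^ 2 * (1 + |p|) * e(κ,z)
  outside : ∀ z, Y < |ε * z + a| → Ψt z = 0 ∧ Ψtt z = 0 ∧
    ‖U z‖ ≤ ε⁻¹ * (C * e(κ,z)) ∧ ‖U1 z‖ ≤ ε⁻¹ * (C * e(κ,z)) ∧
    ‖U2 z‖ ≤ ε⁻¹ * (C * e(κ,z))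
  equation : ∀ z, |ε * z + a| < Y →
    (mFactor R t ^ 2 / nFactor R t (ε * z + a) ^ 2) • Ψtt z + coeffB0 R t (ε * z + a) • Ψt z
      + coeffB1 R t (ε * z + a) • (U1 z + ε⁻¹ • deriv (F (R t)) z)
      - ε⁻¹ • (U2 z + ε⁻¹ • force V d (F (R t) z) (R t))
      + (1 / ε ^ 2) • force V d (F (R t) z + ε • U z) (radius R t (ε * z + a)) = 0
  energy : E = ε * ∫ z in {z | ε * z + a ∈ Icc (-Y) Y},
    (1 / 2 * (mFactor R t ^ 2 / nFactor R t (ε * z + a) ^ 2) * ‖P z‖ ^ 2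
      + 1 / 2 * (⟪U1 z - mFactor R t • deriv (Z (R t)) z, U1 z - mFactor R t • deriv (Z (R t)) z⟫
      + ⟪U z - mFactor R t • Z (R t) z,
        hessW V d (F (R t) z) (R t) (U z - mFactor R t • Z (R t) z)⟫))

end Setting

namespace IsSolution

variable {Φ : ℝ → ℝ → Plane} (hΦ : IsSolution V d R Y ε b Φ)
include hΦ

theorem deriv_eq_zero {y : ℝ} (ht : t ∈ Ioo 0 b) (hy : Y < |y|) :
    deriv (Φ t) y = 0 ∧ deriv (deriv (Φ t)) y = 0 := by
  have h1 : ∀ y, Y < |y| → deriv (Φ t) y = 0 := fun y hy => by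
    have : ∃ c, Φ t =ᶠ[𝓝 y] fun _ => c := by
      rcases lt_abs.1 hy with h | h
      · exact ⟨_, eventually_of_mem (Ioi_mem_nhds h) fun z hz => hΦ.eq_vacuum ht hz⟩
      · exact ⟨_, eventually_of_mem (Iio_mem_nhds (show y < -Y by linarith))
          fun z hz => hΦ.eq_flip_vacuum ht hz⟩
    obtain ⟨c, hc⟩ := this
    rw [hc.deriv_eq, deriv_const]
  refine ⟨h1 y hy, ?_⟩
  have : deriv (Φ t) =ᶠ[𝓝 y] fun _ => 0 :=
    eventually_of_mem (continuous_abs.continuousAt.preimage_mem_nhds (Ioi_mem_nhds hy)) h1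
  rw [this.deriv_eq, deriv_const]

end IsSolution

namespace Setting

variable (S : Setting V d I F l Z R T Y κ C)
variable {Φ : ℝ → ℝ → Plane} (hε : 0 < ε) (hb : b ≤ T) (hΦ : IsSolution V d R Y ε b Φ)
variable {F₁ : ℝ → ℝ → ℝ → Plane} {a : ℝ → ℝ}
include S hε hb hΦ

theorem hasDerivAt_errorTerm (hF₁ : ∀ r ∈ I, ∀ v ∈ Ioo (-1 : ℝ) 1, IsCorrector V d r v (F r) (F₁ r v))
    {a' : ℝ} (ht : t ∈ Ioo 0 b) (ha : HasDerivAt a a' t) (y : ℝ) :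
    errorTerm F F₁ R a ε Φ t y = Φ t y - F (R t) ((y - a t) / ε) -
      ε • mFactor R t • Z (R t) ((y - a t) / ε) ∧
    HasDerivAt (fun τ => errorTerm F F₁ R a ε Φ τ y)
      (timeDeriv Φ t y - ((-a' / ε) • deriv (F (R t)) ((y - a t) / ε) +
        deriv R t • unweight κ (deriv (profileDiff F κ (R t)) (R t)) ((y - a t) / ε)) -
        ε • (mFactor R t • (deriv R t •
          unweight κ (deriv (fun r => weight κ (Z r)) (R t)) ((y - a t) / ε) +
          (-a' / ε) • deriv (Z (R t)) ((y - a t) / ε)) +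
          deriv (mFactor R) t • Z (R t) ((y - a t) / ε))) t := by
  have h := S.family
  have hn : Ioo 0 b ∈ 𝓝 t := Ioo_mem_nhds ht.1 ht.2
  have hreg := fun s (hs : s ∈ Ioo 0 b) => S.regular s ⟨hs.1.le, hs.2.le.trans hb⟩
  have hr := (hreg t ht).mem
  have hF : ∀ s ∈ Ioo 0 b, F₁ (R s) (deriv R s) = fun x => mFactor R s • Z (R s) x := fun s hs =>
    h.corrector_eq (hreg s hs).mem (S.corrector _ (hreg s hs).mem)
      (hF₁ _ (hreg s hs).mem _ (abs_lt.1 (hreg s hs).lt_one))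
  have hval : ∀ s ∈ Ioo 0 b, errorTerm F F₁ R a ε Φ s y = Φ s y - F (R s) ((y - a s) / ε) -
      ε • mFactor R s • Z (R s) ((y - a s) / ε) := fun s hs => by
    rw [errorTerm, tildeF0, tildeF1, hF s hs]
  refine ⟨hval t ht, ?_⟩
  have hζ : HasDerivAt (fun τ => (y - a τ) / ε) (-a' / ε) t := (ha.const_sub y).div_const ε
  have hR := ((hreg t ht).smooth.differentiableAt (by norm_num)).hasDerivAt
  have hm := ((hreg t ht).smooth_mFactor.differentiableAt (by norm_num)).hasDerivAt
  have e1 : HasDerivAt (fun τ => F (R τ) ((y - a τ) / ε)) ((-a' / ε) • deriv (F (R t)) ((y - a t) / ε)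
      + deriv R t • unweight κ (deriv (profileDiff F κ (R t)) (R t)) ((y - a t) / ε)) t := by
    have hU := ((h.regularity S.κ_pos S.κ_lt hr).1.differentiableAt (by norm_num)).hasDerivAt
    have h0 : profileDiff F κ (R t) (R t) = 0 := by
      apply unweight_injective κ
      rw [profileDiff, unweight_weight ((h.decays_sub hr hr).mono S.κ_lt.le), unweight_zero]
      simp
    have k1 := (h.hasDerivAt hr ((y - a t) / ε)).scomp t hζ
    have k2 := hasDerivAt_unweight_comp S.κ_pos.le hR hζ hU (ux := 0) (by
      rw [h0, unweight_zero]; exact hasDerivAt_const _ _)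
    refine ((k1.add k2).congr_of_eventuallyEq ?_).congr_deriv (by simp)
    filter_upwards [hn] with s hs
    simp only [Pi.add_apply, Function.comp]
    rw [profileDiff, unweight_weight ((h.decays_sub hr (hreg s hs).mem).mono S.κ_lt.le)]
    exact (add_sub_cancel _ _).symm
  have e2 : HasDerivAt (fun τ => Z (R τ) ((y - a τ) / ε)) (deriv R t •
      unweight κ (deriv (fun r => weight κ (Z r)) (R t)) ((y - a t) / ε) +
      (-a' / ε) • deriv (Z (R t)) ((y - a t) / ε)) t := by
    have hU := ((h.contDiffAt_corrector S.corrector S.κ_pos S.κ_lt hr).differentiableAt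
      (by norm_num)).hasDerivAt
    have hd := fun s (hs : s ∈ Ioo 0 b) =>
      (h.decays_corrector (hreg s hs).mem (S.corrector _ (hreg s hs).mem) S.κ_pos S.κ_lt).1
    have k2 := hasDerivAt_unweight_comp S.κ_pos.le hR hζ hU (by
      rw [unweight_weight (hd t ht)]
      exact h.hasDerivAt_corrector (S.corrector _ hr) _)
    refine k2.congr_of_eventuallyEq ?_
    filter_upwards [hn] with s hs
    rw [unweight_weight (hd s hs)]
  exact (((hΦ.contDiffOn_timeDeriv.2 t ht y).sub e1).sub
    ((hm.smul e2).const_smul ε)).congr_of_eventuallyEq (eventually_of_mem hn hval)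

/-- Every time slice of a solution with a shift satisfies the slice conditions. -/
theorem slice (hF₁ : ∀ r ∈ I, ∀ v ∈ Ioo (-1 : ℝ) 1, IsCorrector V d r v (F r) (F₁ r v))
    {δ : ℝ} (hshift : IsShift F R (δ * ε) ε b Φ a)
    (ht : t ∈ Ioo 0 b) (ha : HasDerivAt a (deriv a t) t) (hε1 : ε ≤ 1) (haY : |a t| ≤ Y / 2) :
    S.Slice t ε (a t) (deriv a t / ε) (errorEnergy V d F F₁ R a Y ε Φ t)
      (fun z => ε⁻¹ • (Φ t (ε * z + a t) - F (R t) z))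
      (fun z => deriv (Φ t) (ε * z + a t) - ε⁻¹ • deriv (F (R t)) z)
      (fun z => ε • deriv (deriv (Φ t)) (ε * z + a t) - ε⁻¹ • force V d (F (R t) z) (R t))
      (fun z => deriv (fun τ => errorTerm F F₁ R a ε Φ τ (ε * z + a t)) t)
      (fun z => timeDeriv Φ t (ε * z + a t)) (fun z => timeDeriv (timeDeriv Φ) t (ε * z + a t)) := by
  have h := S.family
  have htT := mem_Icc_of_mem_Ioo hb ht
  have hreg := S.regular t htT
  have hr := hreg.mem
  have hB := S.profile t htT
  have hG := S.geom t htT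
  have hκ := S.κ_pos
  have hC := hB.one_le
  have hS := (h.decays_deriv hr).mono S.κ_lt.le
  have hT := (h.decays_force hr).mono S.κ_lt.le
  obtain ⟨c2, d1, d2⟩ := hΦ.hasDerivAt_space ht
  have c1 : Continuous (deriv (Φ t)) := continuous_iff_continuousAt.2 fun y => (d2 y).continuousAt
  have out : ∀ z, (Y + |a t|) / ε < |z| → Y < |ε * z + a t| := fun z hz => by
    rw [div_lt_iff₀ hε] at hz
    have e1 := abs_sub (ε * z + a t) (a t)
    rw [add_sub_cancel_right, abs_mul, abs_of_pos hε] at e1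
    linarith
  have hlin : ∀ z, HasDerivAt (fun z => ε * z + a t) ε z := fun z => by
    simpa using ((hasDerivAt_id z).const_mul ε).add_const (a t)
  have hz : ∀ z, (ε * z + a t - a t) / ε = z := fun z => by field_simp; ring
  have D1 : Decays κ fun z => deriv (Φ t) (ε * z + a t) - ε⁻¹ • deriv (F (R t)) z :=
    (decays_of_compact hκ.le (by fun_prop) fun z hz =>
      (hΦ.deriv_eq_zero ht (out z hz)).1).sub (hS.const_smul _)
  have D2 : Decays κ fun z => ε • deriv (deriv (Φ t)) (ε * z + a t) -
      ε⁻¹ • force V d (F (R t) z) (R t) :=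
    ((decays_of_compact hκ.le (by fun_prop) fun z hz =>
      (hΦ.deriv_eq_zero ht (out z hz)).2).const_smul ε).sub (hT.const_smul _)
  have hU := S.decays_slice_sub hε hb hΦ ht (a t)
  have key := fun y => S.hasDerivAt_errorTerm hε hb hΦ hF₁ ht ha y
  have hcorr := h.hasDerivAt_corrector (S.corrector _ hr)
  have hZd := (h.decays_corrector hr (S.corrector _ hr) hκ S.κ_lt).2
  have hZc := (h.decays_corrector hr (S.corrector _ hr) hκ S.κ_lt).1.continuous
  have cS := hS.continuous
  have cZ := hZd.continuous
  have cw := fun w : Weighted => continuous_unweight κ w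
  have cΨ : Continuous fun z => timeDeriv Φ t (ε * z + a t) :=
    (hΦ.sliceCont ht).2.1.continuous.self_of_nhds.comp (by fun_prop)
  have hder : ∀ z, deriv (fun τ => errorTerm F F₁ R a ε Φ τ (ε * z + a t)) t = _ := fun z =>
    (key (ε * z + a t)).2.deriv
  simp only [hz] at hder
  refine ⟨htT, hε, hε1, haY, hU.const_smul _, D1, D2, fun z => ?_, fun z => ?_, ?_, ?_, ?_, fun z => ?_,
    fun z hzY => ⟨(hΦ.timeDeriv_eq_zero ht hzY).1, (hΦ.timeDeriv_eq_zero ht hzY).2, ?_, ?_, ?_⟩,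
    fun z hzY => ?_, ?_⟩
  · refine ((((d1 _).scomp z (hlin z)).sub (h.hasDerivAt hr z)).const_smul ε⁻¹).congr_deriv ?_
    rw [smul_sub, inv_smul_smul₀ hε.ne']
  · exact ((d2 _).scomp z (hlin z)).sub ((h.hasDerivAt_deriv hr z).const_smul ε⁻¹)
  · have e1 := (S.shiftGrad_eq_zero_iff hε hb hΦ ht _).1.1 (hshift t ht).2
    simp only [inner_smul_left, conj_trivial, integral_const_mul, e1, mul_zero]
  · have c3 := (hΦ.sliceCont ht).2.2.continuous.self_of_nhds
    exact (decays_of_compact hκ.le (f := fun z => timeDeriv (timeDeriv Φ) t (ε * z + a t))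
      (by fun_prop) fun z hz => (hΦ.timeDeriv_eq_zero ht (out z hz)).2).integrable_inner hS
  · simp only [hder]
    have := cw (deriv (profileDiff F κ (R t)) (R t))
    have := cw (deriv (fun r => weight κ (Z r)) (R t))
    fun_prop
  · have hm := hreg.mFactor_pos
    have hp : |-deriv a t / ε| = |deriv a t / ε| := by rw [neg_div, abs_neg]
    have hv := hreg.lt_one.le
    set e := e(κ,z)
    set p := |deriv a t / ε|
    have b1 : ‖(-deriv a t / ε) • deriv (F (R t)) z +
        deriv R t • unweight κ (deriv (profileDiff F κ (R t)) (R t)) z‖ ≤ p * (C * e) + 1 * (C * e) := by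
      refine (norm_add_le _ _).trans ?_
      rw [norm_smul, norm_smul, norm_eq_abs, norm_eq_abs, hp]
      gcongr
      exacts [hB.slope z, hB.rate z]
    have b2 : ‖mFactor R t • (deriv R t • unweight κ (deriv (fun r => weight κ (Z r)) (R t)) z +
        (-deriv a t / ε) • deriv (Z (R t)) z) + deriv (mFactor R) t • Z (R t) z‖ ≤
        C * (1 * (C * e) + p * (C * e)) + C * (C * e) := by
      refine (norm_add_le _ _).trans ?_
      rw [norm_smul, norm_smul, norm_eq_abs, norm_eq_abs, abs_of_nonneg (by linarith)]
      gcongr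
      · exact hG.m_le
      · refine (norm_add_le _ _).trans ?_
        rw [norm_smul, norm_smul, norm_eq_abs, norm_eq_abs, hp]
        gcongr
        exacts [hB.corrector_r z, hB.corrector_x z]
      exacts [hG.m_deriv, hB.corrector z]
    rw [hder, sub_sub, sub_sub_cancel]
    refine (norm_add_le _ _).trans ?_
    rw [norm_smul, norm_eq_abs, abs_of_pos hε]
    have b3 := mul_mono hε1 b2
    have b4 : 0 ≤ (C - 1) * (C * (e * (1 + p))) := by
      have := sub_nonneg.2 hC; positivity
    have b5 : 0 ≤ C ^ 2 * (p * e) := by positivity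
    linarith
  · have hle : |a t| ≤ |ε * z + a t| := by linarith [S.Y_pos]
    have := S.norm_vacuum_sub_le hε hb hΦ ht hzY hle
    rw [hz] at this
    rw [norm_smul, norm_inv, norm_eq_abs, abs_of_pos hε]
    gcongr
  · rw [(hΦ.deriv_eq_zero ht hzY).1, zero_sub, norm_neg, norm_smul, norm_inv, norm_eq_abs,
      abs_of_pos hε]
    gcongr
    exact hB.slope z
  · rw [(hΦ.deriv_eq_zero ht hzY).2, smul_zero, zero_sub, norm_neg, norm_smul, norm_inv,
      norm_eq_abs, abs_of_pos hε]
    gcongr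
    exact hB.force z
  · have := hΦ.equation t ht _ (abs_lt.1 hzY)
    simp only [sub_add_cancel, smul_inv_smul₀ hε.ne', inv_smul_smul₀ hε.ne', add_sub_cancel]
    exact this
  · have hJ : MeasurableSet {z | ε * z + a t ∈ Icc (-Y) Y} :=
      measurableSet_Icc.preimage (by fun_prop : Measurable fun z => ε * z + a t)
    rw [errorEnergy, ← integral_indicator measurableSet_Icc, integral_eq_mul_integral_affine hε _ (a t),
      ← integral_indicator hJ]
    congr 2 with z
    by_cases hmem : ε * z + a t ∈ Icc (-Y) Y
    · rw [indicator_of_mem hmem, indicator_of_mem (show z ∈ {z | ε * z + a t ∈ Icc (-Y) Y} from hmem)]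
      have hval : errorTerm F F₁ R a ε Φ t = fun y => Φ t y - F (R t) ((y - a t) / ε) -
          ε • mFactor R t • Z (R t) ((y - a t) / ε) := funext fun y => (key y).1
      have hdiv : HasDerivAt (fun y => (y - a t) / ε) ε⁻¹ (ε * z + a t) := by
        simpa using ((hasDerivAt_id (ε * z + a t)).sub_const (a t)).div_const ε
      have k1 := (d1 (ε * z + a t)).sub ((h.hasDerivAt hr _).scomp (ε * z + a t) hdiv)
      have k2 := k1.sub ((((hcorr _).scomp (ε * z + a t) hdiv).const_smul (mFactor R t)).const_smul ε)
      have k3 : deriv (errorTerm F F₁ R a ε Φ t) (ε * z + a t) = _ :=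
        (congrArg (fun f => deriv f (ε * z + a t)) hval).trans k2.deriv
      rw [hz] at k3
      have k4 : errorTerm F F₁ R a ε Φ t (ε * z + a t) =
          ε • (ε⁻¹ • (Φ t (ε * z + a t) - F (R t) z) - mFactor R t • Z (R t) z) := by
        rw [hval]
        simp only [hz]
        rw [smul_sub, smul_inv_smul₀ hε.ne']
      have k5 : ε • mFactor R t • ε⁻¹ • deriv (Z (R t)) z = mFactor R t • deriv (Z (R t)) z := by
        rw [smul_comm ε, smul_inv_smul₀ hε.ne']
      rw [energyDensity, k3, k4, k5, tildeF0, hz, map_smul, inner_smul_left, inner_smul_right,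
        real_inner_self_eq_norm_sq, conj_trivial]
      field_simp
      ring
    · rw [indicator_of_notMem hmem,
        indicator_of_notMem (show z ∉ {z | ε * z + a t ∈ Icc (-Y) Y} from hmem)]

end Setting

namespace Setting

variable {S : Setting V d I F l Z R T Y κ C} {a p E : ℝ} {U U1 U2 P Ψt Ψtt : ℝ → Plane}

/-- Away from the strip the weights beat any inverse power of `ε`. -/
theorem Slice.inv_sq_mul_exp_le (hs : S.Slice t ε a p E U U1 U2 P Ψt Ψtt) {z : ℝ}
    (hz : Y < |ε * z + a|) : (ε⁻¹) ^ 2 * e(κ,z) ≤ 8 / (κ * Y) ^ 2 := by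
  have hε := hs.ε_pos
  have h1 : Y / 2 ≤ ε * |z| := by
    have := abs_add_le (ε * z) a
    rw [abs_mul, abs_of_pos hε] at this
    linarith [hs.a_le]
  have hc : 0 < κ * Y / 2 := by have := S.κ_pos; have := S.Y_pos; positivity
  have h2 : κ * Y / 2 / ε ≤ κ * |z| := by
    rw [div_le_iff₀ hε]
    have := mul_mono_left h1 S.κ_pos.le
    linarith
  calc (ε⁻¹) ^ 2 * e(κ,z) ≤ (ε ^ 2)⁻¹ * exp (-(κ * Y / 2 / ε)) := by
        rw [inv_pow]; gcongr
    _ ≤ 2 / (κ * Y / 2) ^ 2 := InterfaceModel.inv_sq_mul_exp_le hc hε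
    _ = _ := by field_simp; norm_num

set_option maxHeartbeats 1000000 in
/-- Coercivity of the energy: the error is controlled by one function `θ` of norm `O(μ)`. -/
theorem exists_envelope (S : Setting V d I F l Z R T Y κ C) : ∃ K, 0 < K ∧
    ∀ {t ε a p E : ℝ} {U U1 U2 P Ψt Ψtt : ℝ → Plane}, S.Slice t ε a p E U U1 U2 P Ψt Ψtt →
    ∀ μ, 1 ≤ μ → E ≤ ε * μ ^ 2 → ∃ θ : ℝ → ℝ, (∀ z, 0 ≤ θ z) ∧
    (∀ z, ‖U z‖ ≤ θ z + C ^ 2 ∧ ‖U1 z‖ ≤ θ z + C ^ 2 ∧ ‖Ψt z‖ ≤ θ z + 3 * C ^ 2 * (1 + |p|) ∧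
      ‖U z‖ ≤ K * μ) ∧
    ∀ (A c : ℝ) (f : ℝ → ℝ), 0 ≤ A → 0 ≤ c →
      (∀ᵐ z, |f z| ≤ c * (A * e(κ / 4,z) * (1 + θ z) + θ z ^ 2)) →
      |∫ z, f z| ≤ c * (K * (A * μ + μ ^ 2)) := by
  have hκ := S.κ_pos
  set T0 := 4 * C ^ 4 * (1 + C) * (8 / (κ * Y) ^ 2) * (2 / κ)
  set K1 := (|C| + (1 + Y * C) ^ 2) * (2 + |T0|) with hK1
  refine ⟨K1 + 1 + C ^ 2 + 10 / κ, by positivity, ?_⟩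
  intro t ε a p E U U1 U2 P Ψt Ψtt hs μ hμ hE
  have h := S.family
  have hε := hs.ε_pos
  have hr := (S.regular t hs.mem).mem
  have hB := S.profile t hs.mem
  have hG := S.geom t hs.mem
  have hC := hB.one_le
  have hC0 : 0 ≤ C := by linarith
  have hm1 := (S.regular t hs.mem).mFactor_pos
  set m := mFactor R t
  have hcr := S.corrector _ hr
  obtain ⟨dZ, dZ1⟩ := h.decays_corrector hr hcr hκ S.κ_lt
  have hk2 : 0 < κ + κ := by linarith
  have hS := (h.decays_deriv hr).mono S.κ_lt.le
  set X : ℝ → Plane := fun z => U z - m • Z (R t) z with hX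
  set X1 : ℝ → Plane := fun z => U1 z - m • deriv (Z (R t)) z with hX1
  have DX : Decays κ X := hs.decays.sub (dZ.const_smul m)
  have DX1 : Decays κ X1 := hs.decays1.sub (dZ1.const_smul m)
  have DX2 := hs.decays2.sub (((h.decays_hess_apply hr dZ).sub (h.decays_source S.κ_lt hr)).const_smul m)
  have hd : ∀ z, HasDerivAt X (X1 z) z := fun z =>
    (hs.hasDerivAt z).sub ((h.hasDerivAt_corrector hcr z).const_smul m)
  have hd1 : ∀ z, HasDerivAt X1 _ z := fun z =>
    (hs.hasDerivAt1 z).sub ((h.hasDerivAt_deriv_corrector hcr z).const_smul m)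
  have hort : ∫ z, ⟪deriv (F (R t)) z, X z⟫ = 0 := by
    have e : ∀ z, ⟪deriv (F (R t)) z, X z⟫ = ⟪U z, deriv (F (R t)) z⟫ -
        m * ⟪Z (R t) z, deriv (F (R t)) z⟫ := fun z => by
      rw [real_inner_comm, hX, inner_sub_left, inner_smul_left, conj_trivial]
    simp only [e]
    rw [integral_sub (hs.decays.integrable_inner hS) ((dZ.integrable_inner hS).const_mul m),
      integral_const_mul, hs.orthogonal, hcr.orthogonal]
    ring
  have i1 := DX1.integrable_inner DX1
  have i2 := DX.integrable_inner (h.decays_hess_apply hr DX)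
  have i0 := DX.integrable_inner DX
  set q : ℝ → ℝ := fun z => ⟪X1 z, X1 z⟫ + ⟪X z, hessW V d (F (R t) z) (R t) (X z)⟫ with hq
  have iq : Integrable q := i1.add i2
  have hQ0 : 0 ≤ ∫ z, q z := h.second_variation_nonneg hr hκ DX DX1 hd
  have hco := hB.coercive X X1 _ DX DX1 DX2 hd hd1
  rw [hort, zero_pow two_ne_zero, add_zero, ← integral_add i1 i2] at hco
  change _ ≤ C * ∫ z, q z at hco
  set J : Set ℝ := {z | ε * z + a ∈ Icc (-Y) Y} with hJ
  have hJm : MeasurableSet J := measurableSet_Icc.preimage (by fun_prop : Measurable fun z => ε * z + a)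
  have hJI : J = Icc ((-Y - a) / ε) ((Y - a) / ε) := by
    ext z
    simp only [hJ, mem_ofPred_eq, mem_Icc, div_le_iff₀ hε, le_div_iff₀ hε]
    constructor <;> rintro ⟨h1, h2⟩ <;> constructor <;> linarith
  have hnot : ∀ z, z ∉ J → Y < |ε * z + a| := fun z hz => by
    by_contra hcon
    exact hz (abs_le.1 (not_lt.1 hcon))
  have hmZ : ∀ z, ‖m • Z (R t) z‖ ≤ C ^ 2 * e(κ,z) ∧
      ‖m • deriv (Z (R t)) z‖ ≤ C ^ 2 * e(κ,z) := fun z => by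
    rw [norm_smul, norm_smul, norm_eq_abs, abs_of_nonneg (by linarith), sq, mul_assoc]
    exact ⟨mul_le_mul hG.m_le (hB.corrector z) (norm_nonneg _) hC0,
      mul_le_mul hG.m_le (hB.corrector_x z) (norm_nonneg _) hC0⟩
  have tail : |∫ z in Jᶜ, q z| ≤ T0 := by
    have e : ∫ z : ℝ, 4 * C ^ 4 * (1 + C) * (8 / (κ * Y) ^ 2) * e(κ,z) = T0 := by
      rw [integral_const_mul, integral_exp_neg_abs hκ]
    rw [← e, ← integral_indicator hJm.compl]
    refine norm_integral_le_of_norm_le (G := ℝ) ((integrable_exp_neg_abs hκ).const_mul _)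
      (.of_forall fun z => ?_)
    by_cases hz : z ∈ J
    · rw [indicator_of_notMem (by simpa using hz), norm_zero]; positivity
    · rw [indicator_of_mem (by simpa using hz)]
      obtain ⟨-, -, o1, o2, -⟩ := hs.outside z (hnot z hz)
      have o3 := hs.inv_sq_mul_exp_le (hnot z hz)
      set e := e(κ,z)
      have hε1 : 1 ≤ ε⁻¹ := (one_le_inv₀ hε).2 hs.ε_le
      have n0 : C * e ≤ C ^ 2 * e := by
        have : C ≤ C ^ 2 := by nlinarith
        gcongr
      have n1 : ε⁻¹ * (C * e) + C ^ 2 * e ≤ 2 * C ^ 2 * (ε⁻¹ * e) := by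
        have : ε⁻¹ * (C * e) ≤ ε⁻¹ * (C ^ 2 * e) := by gcongr
        have : 1 * (C ^ 2 * e) ≤ ε⁻¹ * (C ^ 2 * e) := by gcongr
        linarith
      have b1 : ‖X z‖ ≤ 2 * C ^ 2 * (ε⁻¹ * e) :=
        ((norm_sub_le _ _).trans (add_le_add o1 (hmZ z).1)).trans n1
      have b2 : ‖X1 z‖ ≤ 2 * C ^ 2 * (ε⁻¹ * e) :=
        ((norm_sub_le _ _).trans (add_le_add o2 (hmZ z).2)).trans n1
      have b3 := (norm_inner_le_norm (𝕜 := ℝ) (X z) (hessW V d (F (R t) z) (R t) (X z))).trans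
        (mul_mono_left (ContinuousLinearMap.le_of_opNorm_le _ (hB.hess z) _) (norm_nonneg _))
      have b4 : ‖q z‖ ≤ ‖X1 z‖ ^ 2 + ‖X z‖ * (C * ‖X z‖) := by
        refine (norm_add_le _ _).trans (add_le_add (le_of_eq ?_) b3)
        rw [real_inner_self_eq_norm_sq, norm_pow, norm_norm]
      calc ‖q z‖ ≤ (2 * C ^ 2 * (ε⁻¹ * e)) ^ 2 + (2 * C ^ 2 * (ε⁻¹ * e)) * (C * (2 * C ^ 2 * (ε⁻¹ * e))) :=
            b4.trans (by gcongr)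
        _ = 4 * C ^ 4 * (1 + C) * (ε⁻¹ ^ 2 * e) * e := by ring
        _ ≤ _ := by gcongr
  have hsplit := integral_add_compl hJm iq
  have hnc : ContinuousOn (fun z => m ^ 2 / nFactor R t (ε * z + a) ^ 2) J := by
    refine ContinuousOn.div (by fun_prop) (by unfold nFactor; fun_prop) fun z hz => ?_
    exact pow_ne_zero _ (S.coord t hs.mem _ hz).1.ne'
  have hPc := hs.continuous_P
  have iP : IntegrableOn (fun z => m ^ 2 / nFactor R t (ε * z + a) ^ 2 * ‖P z‖ ^ 2) J := by
    rw [hJI] at hnc ⊢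
    exact (hnc.mul (by fun_prop)).integrableOn_Icc
  have iPP : IntegrableOn (fun z => ‖P z‖ ^ 2) J := by
    rw [hJI]
    exact (by fun_prop : Continuous fun z => ‖P z‖ ^ 2).continuousOn.integrableOn_Icc
  have hEs : 2 * E = ε * ((∫ z in J, m ^ 2 / nFactor R t (ε * z + a) ^ 2 * ‖P z‖ ^ 2) + ∫ z in J, q z) := by
    rw [← integral_add iP iq.integrableOn, hs.energy, mul_left_comm, ← integral_const_mul]
    congr 2 with z
    rw [hq]
    ring
  have hP0 : 0 ≤ ∫ z in J, m ^ 2 / nFactor R t (ε * z + a) ^ 2 * ‖P z‖ ^ 2 :=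
    integral_nonneg fun z => by positivity
  have hEt : (∫ z in J, m ^ 2 / nFactor R t (ε * z + a) ^ 2 * ‖P z‖ ^ 2) + ∫ z, q z ≤
      (2 + |T0|) * μ ^ 2 := by
    have h1 : ε * ((∫ z in J, m ^ 2 / nFactor R t (ε * z + a) ^ 2 * ‖P z‖ ^ 2) + ∫ z in J, q z) ≤
        ε * (2 * μ ^ 2) := by linarith
    have h2 := le_of_mul_le_mul_left h1 hε
    have h3 := (le_abs_self _).trans (tail.trans (le_abs_self _))
    have h4 : |T0| * 1 ≤ |T0| * μ ^ 2 := by gcongr; exact one_le_pow₀ hμ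
    linarith
  have hPle : ∫ z in J, ‖P z‖ ^ 2 ≤
      (1 + Y * C) ^ 2 * ∫ z in J, m ^ 2 / nFactor R t (ε * z + a) ^ 2 * ‖P z‖ ^ 2 := by
    rw [← integral_const_mul]
    refine setIntegral_mono_on iPP (iP.const_mul _) hJm fun z hz => ?_
    have n0 := (S.coord t hs.mem _ hz).1
    have n1 : nFactor R t (ε * z + a) ≤ 1 + Y * C := by
      have h1 := mul_le_mul (abs_le.2 hz) hG.slope (abs_nonneg _) S.Y_pos.le
      rw [← abs_mul] at h1
      rw [nFactor, mul_assoc]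
      linarith [le_abs_self ((ε * z + a) * (mFactor R t ^ 3 * deriv (deriv R) t))]
    rw [← mul_assoc]
    refine le_mul_of_one_le_left (by positivity) ?_
    rw [← mul_div_assoc, le_div_iff₀ (by positivity), one_mul]
    calc nFactor R t (ε * z + a) ^ 2 ≤ (1 + Y * C) ^ 2 * 1 := by rw [mul_one]; gcongr
      _ ≤ _ := by gcongr; exact one_le_pow₀ hm1
  set g : ℝ → ℝ := fun z => ⟪X z, X z⟫ + ⟪X1 z, X1 z⟫ + J.indicator (fun z => ‖P z‖ ^ 2) z
  have hind : ∀ z, 0 ≤ J.indicator (fun z => ‖P z‖ ^ 2) z := fun z => indicator_nonneg (fun _ _ => by positivity) z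
  have hg0 : ∀ z, 0 ≤ g z := fun z =>
    add_nonneg (add_nonneg real_inner_self_nonneg real_inner_self_nonneg) (hind z)
  have i01 : Integrable fun z => ⟪X z, X z⟫ + ⟪X1 z, X1 z⟫ := i0.add i1
  have ig : Integrable g := i01.add (iPP.integrable_indicator hJm)
  have hXX : (∫ z, ⟪X z, X z⟫) + ∫ z, ⟪X1 z, X1 z⟫ ≤ |C| * ((2 + |T0|) * μ ^ 2) := by
    rw [abs_of_nonneg hC0]
    refine hco.trans ?_
    gcongr
    linarith
  have hgi : ∫ z, g z ≤ K1 * μ ^ 2 := by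
    rw [integral_add i01 (iPP.integrable_indicator hJm), integral_add i0 i1, integral_indicator hJm]
    have : (1 + Y * C) ^ 2 * ∫ z in J, m ^ 2 / nFactor R t (ε * z + a) ^ 2 * ‖P z‖ ^ 2 ≤
        (1 + Y * C) ^ 2 * ((2 + |T0|) * μ ^ 2) := by gcongr; linarith
    rw [hK1]
    linarith
  have hle : ∀ (z : ℝ) (x : ℝ), x ^ 2 ≤ g z → x ≤ √(g z) := fun z x hx => Real.le_sqrt_of_sq_le hx
  refine ⟨fun z => √(g z), fun z => Real.sqrt_nonneg _, fun z => ?_, fun A c f hA hc hf => ?_⟩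
  · have e1 : e(κ,z) ≤ 1 := weight_le_one (by positivity) z
    have e2 : C ^ 2 * e(κ,z) ≤ C ^ 2 := mul_le_of_le_one_right (by positivity) e1
    have u1 : ‖U z‖ ≤ ‖X z‖ + C ^ 2 := by
      have := norm_add_le (X z) (m • Z (R t) z)
      rw [hX] at this
      simp only [sub_add_cancel] at this
      linarith [(hmZ z).1]
    have u2 : ‖U1 z‖ ≤ ‖X1 z‖ + C ^ 2 := by
      have := norm_add_le (X1 z) (m • deriv (Z (R t)) z)
      rw [hX1] at this
      simp only [sub_add_cancel] at this
      linarith [(hmZ z).2]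
    have g1 := real_inner_self_nonneg (F := Plane) (x := X z)
    have g2 := real_inner_self_nonneg (F := Plane) (x := X1 z)
    refine ⟨u1.trans (add_le_add_left (hle z _ ?_) _), u2.trans (add_le_add_left (hle z _ ?_) _), ?_, ?_⟩
    · rw [← real_inner_self_eq_norm_sq]; linarith [hind z]
    · rw [← real_inner_self_eq_norm_sq]; linarith [hind z]
    · by_cases hz : z ∈ J
      · have h1 : ‖P z‖ ≤ √(g z) := hle z _ (by
          have : J.indicator (fun z => ‖P z‖ ^ 2) z = ‖P z‖ ^ 2 := indicator_of_mem hz _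
          linarith)
        have h2 := norm_add_le (P z) (Ψt z - P z)
        rw [add_sub_cancel] at h2
        have h3 := hs.Ψt_sub z
        have h4 : 3 * C ^ 2 * (1 + |p|) * e(κ,z) ≤ 3 * C ^ 2 * (1 + |p|) :=
          mul_le_of_le_one_right (by positivity) e1
        linarith
      · rw [(hs.outside z (hnot z hz)).1, norm_zero]
        positivity
    · have h1 := norm_sq_le_of_decays hκ DX DX1 hd z
      have h2 : ‖X z‖ ^ 2 ≤ ((K1 + 1) * μ) ^ 2 := by
        have : 0 ≤ (1 + Y * C) ^ 2 * ((2 + |T0|) * μ ^ 2) := by positivity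
        have : |C| * ((2 + |T0|) * μ ^ 2) ≤ K1 * μ ^ 2 := by rw [hK1]; linarith
        have : 0 ≤ (K1 ^ 2 + K1 + 1) * μ ^ 2 := by positivity
        linarith
      have h3 := abs_le_of_sq_le_sq' h2 (by positivity)
      have h4 : C ^ 2 * 1 ≤ C ^ 2 * μ := by gcongr
      have h5 : 0 ≤ 10 / κ * μ := by positivity
      linarith [h3.2]
  · set w : ℝ → ℝ := fun z => e(κ / 4,z)
    set B : ℝ → ℝ := fun z => c * (A * (w z + (μ⁻¹ * g z + μ * e(κ / 2,z)) / 2) + g z)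
    have j1 : Integrable w := integrable_exp_neg_abs (by positivity)
    have j2 : Integrable fun z : ℝ => e(κ / 2,z) := integrable_exp_neg_abs (by positivity)
    have j3 : Integrable fun z => (μ⁻¹ * g z + μ * e(κ / 2,z)) / 2 :=
      ((ig.const_mul _).add (j2.const_mul _)).div_const 2
    have j4 : Integrable fun z => A * (w z + (μ⁻¹ * g z + μ * e(κ / 2,z)) / 2) :=
      (j1.add j3).const_mul A
    have jB : Integrable B := (j4.add ig).const_mul c
    refine (norm_integral_le_of_norm_le (f := f) jB (hf.mono fun z hz => hz.trans ?_)).trans ?_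
    · have s1 := sq_sqrt (hg0 z)
      have s2 : w z ^ 2 = e(κ / 2,z) := by
        rw [← exp_nat_mul]; congr 1; push_cast; ring
      have s3 : w z * √(g z) ≤ (μ⁻¹ * g z + μ * e(κ / 2,z)) / 2 := by
        rw [← s2]
        have := mul_nonneg (inv_nonneg.2 (zero_le_one.trans hμ)) (sq_nonneg (√(g z) - μ * w z))
        have e : μ⁻¹ * (√(g z) - μ * w z) ^ 2 =
            μ⁻¹ * √(g z) ^ 2 + μ * w z ^ 2 - 2 * (w z * √(g z)) := by
          field_simp; ring
        rw [s1] at e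
        linarith
      simp only [s1]
      refine mul_mono_left (add_le_add_left ?_ _) hc
      rw [mul_assoc]
      refine mul_mono_left ?_ hA
      change w z * _ ≤ _
      linarith
    · have e : ∫ z, B z = c * (A * (8 / κ + (μ⁻¹ * (∫ z, g z) + μ * (4 / κ)) / 2) + ∫ z, g z) := by
        rw [integral_const_mul, integral_add j4 ig, integral_const_mul, integral_add j1 j3,
          integral_div, integral_add (ig.const_mul _) (j2.const_mul _), integral_const_mul,
          integral_const_mul, integral_exp_neg_abs (by positivity), integral_exp_neg_abs (by positivity)]
        field_simp
        ring
      rw [e]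
      refine mul_mono_left ?_ hc
      have f1 : μ⁻¹ * (∫ z, g z) ≤ K1 * μ := by
        rw [inv_mul_le_iff₀ (by linarith)]
        exact hgi.trans_eq (by ring)
      have f2 : 8 / κ * 1 ≤ 8 / κ * μ := by gcongr
      have f3 : 8 / κ + (μ⁻¹ * (∫ z, g z) + μ * (4 / κ)) / 2 ≤ (K1 + 10 / κ) * μ := by
        have : 8 / κ * μ + μ * (4 / κ) / 2 = 10 / κ * μ := by ring
        have : 0 ≤ K1 * μ := by positivity
        linarith
      have f4 := mul_mono_left f3 hA
      have f5 : 0 ≤ (1 + C ^ 2) * (A * μ + μ ^ 2) + 10 / κ * μ ^ 2 := by positivity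
      linarith

end Setting

theorem InterfaceRegular.coeffB1_zero (h : InterfaceRegular d I F R t) : coeffB1 R t 0 = -meanCurvature R t := by
  have h1 := one_sub_sq_pos h.lt_one
  have h2 := sq_sqrt h1.le
  have h3 := (Real.sqrt_pos.2 h1).ne'
  rw [coeffB1, meanCurvature, nFactor, radius, mFactor]
  simp only [zero_mul, add_zero, div_one]
  have h4 : deriv (deriv R) t / (1 - deriv R t ^ 2) = deriv (deriv R) t / √(1 - deriv R t ^ 2) ^ 2 := by
    rw [h2]
  rw [h4]
  field_simp
  ring

/-- Polynomial weights are absorbed by the exponential. -/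
theorem weight_bounds {z q p τ A θ : ℝ} (hκ : 0 < κ) (hτ : |τ| ≤ |z| + |q|)
    (hA : (1 + |q| + |p|) ^ 3 ≤ A) (hθ : 0 ≤ θ) {e M c : ℝ} (he : e = e(κ,z))
    (hM : M = A * e(κ / 4,z) * (1 + θ) + θ ^ 2) (hc : c = 1 + 4 / κ) :
    ((1 + |p|) ^ 2 * e ≤ M ∧ (1 + |p|) * e * θ ≤ M ∧ e ≤ M ∧ e * θ ≤ M) ∧
      |τ| * e ≤ c * M ∧ |τ| * e * θ ≤ c * M ∧ τ ^ 2 * e ≤ c ^ 2 * M ∧ θ ^ 2 * e ≤ M := by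
  set ω := e(κ / 4,z) with hω
  have w0 : 0 < ω := exp_pos _
  have w1 : ω ≤ 1 := weight_le_one (by positivity) z
  have ew : e = ω ^ 4 := by rw [he, hω, ← exp_nat_mul]; congr 1; push_cast; ring
  have hz : |z| * ω ≤ 4 / κ := by
    have h1 := Real.add_one_le_exp (κ / 4 * |z|)
    have h2 : ω * exp (κ / 4 * |z|) = 1 := by rw [hω, ← exp_add]; simp
    rw [le_div_iff₀ hκ]
    nlinarith [mul_mono_left h1 w0.le]
  have hc1 : 1 ≤ c := by rw [hc]; have : 0 < 4 / κ := by positivity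
                         linarith
  have hq := abs_nonneg q
  have hp := abs_nonneg p
  have t1 : |τ| * ω ≤ c * (1 + |q| + |p|) := by
    have h1 := mul_mono_right hτ w0.le
    have h2 : |q| * ω ≤ |q| := mul_le_of_le_one_right hq w1
    have h3 : 0 ≤ 4 / κ * (|q| + |p|) := by positivity
    rw [hc]
    nlinarith
  set s := 1 + |q| + |p| with hs
  have s1 : 1 ≤ s := by rw [hs]; linarith
  have sA : s ^ 2 ≤ A := (pow_le_pow_right₀ s1 (by norm_num)).trans hA
  have sA1 : s ≤ A := by nlinarith
  have ps : 1 + |p| ≤ s := by rw [hs]; linarith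
  have hA0 : 0 < A := by linarith
  have we : ω ^ 2 ≤ ω := by nlinarith
  have e1 : e ≤ ω := by rw [ew]; nlinarith [sq_nonneg ω]
  have e0 : 0 ≤ e := by rw [ew]; positivity
  have M1 : A * ω ≤ M := by rw [hM]; nlinarith [mul_nonneg (mul_nonneg hA0.le w0.le) hθ]
  have M2 : A * ω * θ ≤ M := by rw [hM]; nlinarith [mul_pos hA0 w0]
  have te : |τ| * e ≤ c * s * ω := by
    calc |τ| * e = (|τ| * ω) * (ω ^ 2 * ω) := by rw [ew]; ring
      _ ≤ (c * s) * (1 * ω) := by gcongr; exact we.trans w1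
      _ = _ := by ring
  have p1 : (1 + |p|) ^ 2 ≤ A := (pow_le_pow_left₀ (by positivity) ps 2).trans sA
  refine ⟨⟨?_, ?_, ?_, ?_⟩, ?_, ?_, ?_, ?_⟩
  · exact (mul_le_mul p1 e1 e0 hA0.le).trans M1
  · exact (mul_mono_right (mul_le_mul (ps.trans sA1) e1 e0 hA0.le) hθ).trans M2
  · exact (e1.trans (le_mul_of_one_le_left w0.le (s1.trans sA1))).trans M1
  · exact (mul_mono_right (e1.trans (le_mul_of_one_le_left w0.le (s1.trans sA1))) hθ).trans M2
  · refine te.trans ?_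
    rw [mul_assoc]
    exact mul_mono_left ((mul_mono_right sA1 w0.le).trans M1) (by linarith)
  · refine (mul_mono_right te hθ).trans ?_
    rw [mul_assoc c, mul_assoc c]
    exact mul_mono_left ((mul_mono_right (mul_mono_right sA1 w0.le) hθ).trans M2) (by linarith)
  · calc τ ^ 2 * e = (|τ| * ω) ^ 2 * ω ^ 2 := by rw [ew, mul_pow, sq_abs]; ring
      _ ≤ (c * s) ^ 2 * ω := by gcongr
      _ = c ^ 2 * (s ^ 2 * ω) := by ring
      _ ≤ c ^ 2 * (A * ω) := by gcongr
      _ ≤ _ := by gcongr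
  · have : θ ^ 2 * e ≤ θ ^ 2 := mul_le_of_le_one_right (sq_nonneg _) (e1.trans w1)
    have : 0 ≤ A * ω * (1 + θ) := by positivity
    linarith

namespace Setting

variable {S : Setting V d I F l Z R T Y κ C} {a p E : ℝ} {U U1 U2 P Ψt Ψtt : ℝ → Plane}

/-- The leading part of `⟨∂ₜₜΦ, S⟩`. -/
def leading (_ : Setting V d I F l Z R T Y κ C) (t ε a : ℝ) (U U2 : ℝ → Plane) (z : ℝ) : ℝ :=
  ε⁻¹ * (nFactor R t (ε * z + a) ^ 2 / mFactor R t ^ 2 *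
    ⟪U2 z - hessW V d (F (R t) z) (R t) (U z), deriv (F (R t)) z⟫) -
  ε⁻¹ * (mFactor R t ^ 2)⁻¹ * (coeffB1 R t 0 * ⟪deriv (F (R t)) z, deriv (F (R t)) z⟫ +
    mFactor R t * (z + a / ε) * ⟪forceR V d (F (R t) z) (R t), deriv (F (R t)) z⟫)

/-- The interface equation cancels the singular part of the leading term. -/
theorem Slice.integral_leading (hs : S.Slice t ε a p E U U1 U2 P Ψt Ψtt) :
    Integrable (S.leading t ε a U U2) ∧ ∫ z, S.leading t ε a U U2 z =
      ∫ z, (4 * (mFactor R t ^ 3 * deriv (deriv R) t) * nFactor R t (ε * z + a) / mFactor R t ^ 2 *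
        ⟪U z, force V d (F (R t) z) (R t)⟫ +
        2 * (mFactor R t ^ 3 * deriv (deriv R) t) ^ 2 * ε / mFactor R t ^ 2 *
          ⟪U z, deriv (F (R t)) z⟫) := by
  have h := S.family
  have hε := hs.ε_pos
  have hκ := S.κ_pos
  have hreg := S.regular t hs.mem
  have hr := hreg.mem
  have hm1 := hreg.mFactor_pos
  have hS := (h.decays_deriv hr).mono S.κ_lt.le
  set m := mFactor R t with hm
  set k := m ^ 3 * deriv (deriv R) t with hk
  have hm0 : m ≠ 0 := by positivity
  have hn : ∀ z, nFactor R t (ε * z + a) = 1 + a * k + ε * k * z := fun z => by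
    rw [nFactor, hk]; ring
  obtain ⟨i1, e1⟩ := h.integral_quadratic_green hκ S.κ_lt hr hs.decays hs.decays1 hs.decays2
    hs.hasDerivAt hs.hasDerivAt1 ((1 + a * k) ^ 2 / m ^ 2) (2 * (1 + a * k) * (ε * k) / m ^ 2)
    ((ε * k) ^ 2 / m ^ 2)
  obtain ⟨i2, e2⟩ := h.integral_id_mul_tail hκ S.κ_lt hr (a / ε)
  have i3 := hS.integrable_inner hS
  set c := 2 * d ^ 2 / R t ^ 3 with hc
  have eL : S.leading t ε a U U2 = fun z => ε⁻¹ * (((1 + a * k) ^ 2 / m ^ 2 +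
      2 * (1 + a * k) * (ε * k) / m ^ 2 * z + (ε * k) ^ 2 / m ^ 2 * z ^ 2) *
      ⟪U2 z - hessW V d (F (R t) z) (R t) (U z), deriv (F (R t)) z⟫) -
      ε⁻¹ * (m ^ 2)⁻¹ * (coeffB1 R t 0 * ⟪deriv (F (R t)) z, deriv (F (R t)) z⟫ +
      -(m * c) * ((z + a / ε) * ⟪coordProj 1 (F (R t) z), deriv (F (R t)) z⟫)) := by
    funext z
    rw [leading, h.forceR_eq' hr, inner_smul_left, conj_trivial, ← hm, ← hc, hn]
    ring
  have j1 := i1.const_mul ε⁻¹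
  have j2 : Integrable fun z => coeffB1 R t 0 * ⟪deriv (F (R t)) z, deriv (F (R t)) z⟫ +
      -(m * c) * ((z + a / ε) * ⟪coordProj 1 (F (R t) z), deriv (F (R t)) z⟫) :=
    (i3.const_mul _).add (i2.const_mul _)
  rw [eL]
  refine ⟨j1.sub (j2.const_mul _), ?_⟩
  have hzero : coeffB1 R t 0 * (∫ z, ⟪deriv (F (R t)) z, deriv (F (R t)) z⟫) +
      -(m * c) * (-(1 / 2) * ∫ z, (F (R t) z 1) ^ 2) = 0 := by
    have := hreg.equation
    simp only [real_inner_self_eq_norm_sq]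
    rw [hreg.coeffB1_zero, hc]
    linear_combination -this
  rw [integral_sub j1 (j2.const_mul _), integral_const_mul, integral_const_mul, e1,
    integral_add (i3.const_mul _) (i2.const_mul _), integral_const_mul, integral_const_mul, e2, hzero,
    mul_zero, sub_zero, ← integral_const_mul]
  congr 1 with z
  rw [hn]
  field_simp
  ring

end Setting

namespace Setting

variable {S : Setting V d I F l Z R T Y κ C} {a p E : ℝ} {U U1 U2 P Ψt Ψtt : ℝ → Plane}

theorem Slice.abs_nFactor_le (hs : S.Slice t ε a p E U U1 U2 P Ψt Ψtt) (z : ℝ) :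
    |nFactor R t (ε * z + a) - 1| ≤ ε * |z + a / ε| * C := by
  have hε := hs.ε_pos
  have e : nFactor R t (ε * z + a) - 1 = ε * (z + a / ε) * (mFactor R t ^ 3 * deriv (deriv R) t) := by
    rw [nFactor]; field_simp; ring
  rw [e, abs_mul, abs_mul, abs_of_pos hε]
  exact mul_mono_left (S.geom t hs.mem).slope

theorem Slice.norm_forceR_le (hs : S.Slice t ε a p E U U1 U2 P Ψt Ψtt) (z : ℝ) :
    ‖forceR V d (F (R t) z) (R t)‖ ≤ 2 * d ^ 2 * C ^ 4 * e(κ,z) := by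
  have hr := (S.regular t hs.mem).mem
  have hr0 := S.family.pos _ hr
  have hC := (S.profile t hs.mem).one_le
  rw [S.family.forceR_eq' hr, norm_smul, norm_neg, norm_eq_abs, abs_of_nonneg (by positivity),
    div_eq_mul_inv, ← inv_pow]
  calc 2 * d ^ 2 * (R t)⁻¹ ^ 3 * ‖coordProj 1 (F (R t) z)‖ ≤ 2 * d ^ 2 * C ^ 3 * (C * e(κ,z)) := by
        gcongr
        exacts [(S.geom t hs.mem).radius_zero, (S.profile t hs.mem).tail z]
    _ = _ := by ring

theorem abs_sum_five_le (x₁ x₂ x₃ x₄ x₅ : ℝ) :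
    |-x₁ - x₂ - x₃ - x₄ - x₅| ≤ |x₁| + |x₂| + |x₃| + |x₄| + |x₅| := by
  refine (abs_sub _ _).trans (add_le_add ((abs_sub _ _).trans (add_le_add ((abs_sub _ _).trans
    (add_le_add ((abs_sub _ _).trans_eq (by rw [abs_neg])) le_rfl)) le_rfl)) le_rfl)

set_option maxHeartbeats 1000000 in
/-- The equation inside the strip, paired with the translation mode. -/
theorem Slice.abs_sub_leading_le_inside (hs : S.Slice t ε a p E U U1 U2 P Ψt Ψtt) {ρ₀ c₁ : ℝ}
    (hc₁ : TaylorBound V ρ₀ c₁) (hρ₀ : 2 ≤ ρ₀) {z θ A M : ℝ} (hθ : 0 ≤ θ)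
    (hX : ‖F (R t) z + ε • U z‖ ≤ ρ₀) (b0 : ‖U z‖ ≤ θ + C ^ 2) (b1 : ‖U1 z‖ ≤ θ + C ^ 2)
    (bt : ‖Ψt z‖ ≤ θ + 3 * C ^ 2 * (1 + |p|)) (hA : (1 + |a / ε| + |p|) ^ 3 ≤ A)
    (hM : M = A * e(κ / 4,z) * (1 + θ) + θ ^ 2) (hz : |ε * z + a| < Y) :
    |⟪Ψtt z, deriv (F (R t)) z⟫ - S.leading t ε a U U2 z| ≤
      ((1 + Y * C) ^ 2 * C ^ 2 * (1 + 3 * C ^ 2) + (1 + Y * C) ^ 2 * C ^ 2 * (1 + C ^ 2)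
      + (C ^ 2 * (2 + Y * C) + C) * C ^ 2 * (1 + 4 / κ)
      + 2 * d ^ 2 * C ^ 7 * (2 + Y * C) * (1 + 4 / κ) ^ 2
      + (1 + Y * C) ^ 2 * (c₁ * C * (2 + 2 * C ^ 4) + 2 * d ^ 2 * C ^ 5 * (1 + C ^ 2) * (1 + 4 / κ)
        + 3 * d ^ 2 * C ^ 8 * (1 + 4 / κ) ^ 2)) * M := by
  have h := S.family
  have hε := hs.ε_pos
  have hκ := S.κ_pos
  have hY := S.Y_pos
  have hreg := S.regular t hs.mem
  have hr := hreg.mem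
  have hr0 := h.pos _ hr
  have hB := S.profile t hs.mem
  have hG := S.geom t hs.mem
  have hm1 := hreg.mFactor_pos
  have hC := hB.one_le
  have hm2 := hG.m_le
  have hyJ : ε * z + a ∈ Icc (-Y) Y := abs_le.1 hz.le
  have hρ := (S.coord t hs.mem _ hyJ).2
  have hn0 := (S.coord t hs.mem _ hyJ).1
  have hn := hs.abs_nFactor_le z
  have eq := congrArg (fun v => ⟪v, deriv (F (R t)) z⟫) (hs.equation z hz)
  have hrem := norm_force_remainder_le (d := d) h.potential hc₁ hr0 hρ hG.radius_zero
    (hG.radius_inv _ hyJ) ((h.norm_le hr z).trans hρ₀) hX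
  have B0 := hG.B0_le _ hyJ
  have B1 := hG.B1_le _ hyJ
  have B1' := hG.B1_sub_le _ hyJ
  rw [leading]
  set y := ε * z + a with hy
  set τ := z + a / ε with hτ
  have hyτ : y = ε * τ := by rw [hy, hτ]; field_simp
  have hyabs : |y| = ε * |τ| := by rw [hyτ, abs_mul, abs_of_pos hε]
  set m := mFactor R t
  set n := nFactor R t y
  set e := e(κ,z) with he
  have e1 : e ≤ 1 := weight_le_one (by positivity) z
  obtain ⟨⟨w1, w2, w3, w4⟩, w5, w6, w7, w8⟩ := weight_bounds hκ (abs_add_le z (a / ε)) hA hθ he hM rfl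
  rw [← hτ] at w5 w6 w7
  set cw := 1 + 4 / κ
  have sS := hB.slope z
  have sT := hB.tail z
  rw [← he] at sS sT
  set w := forceR V d (F (R t) z) (R t) with hw
  have hwn : ‖w‖ ≤ 2 * d ^ 2 * C ^ 4 * e := hs.norm_forceR_le z
  have hrad : radius R t y - R t = y * m := by rw [radius]; ring
  rw [hrad, add_sub_cancel_left, map_smul] at hrem
  set Rem := force V d (F (R t) z + ε • U z) (radius R t y) - force V d (F (R t) z) (R t) -
    ε • hessW V d (F (R t) z) (R t) (U z) - (y * m) • w with hRem
  have hforce : force V d (F (R t) z + ε • U z) (radius R t y) = force V d (F (R t) z) (R t) +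
      ε • hessW V d (F (R t) z) (R t) (U z) + (y * m) • w + Rem := by rw [hRem]; abel
  rw [hforce] at eq
  simp only [inner_add_left, inner_sub_left, inner_smul_left, conj_trivial, inner_zero_left] at eq
  rw [inner_sub_left]
  set s := deriv (F (R t)) z
  have ip : ∀ v : Plane, |⟪v, s⟫| ≤ ‖v‖ * (C * e) := fun v =>
    (abs_real_inner_le_norm _ _).trans (by gcongr)
  have iT := ip (Ψt z)
  have i1 := ip (U1 z)
  have iS := ip (s)
  have iw := ip w
  have iR := ip Rem
  set N := n ^ 2 / m ^ 2 with hN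
  set N0 := (m ^ 2)⁻¹ with hN0
  have key : ⟪Ψtt z, s⟫ - (ε⁻¹ * (N * (⟪U2 z, s⟫ - ⟪hessW V d (F (R t) z) (R t) (U z), s⟫)) -
      ε⁻¹ * N0 * (coeffB1 R t 0 * ⟪s, s⟫ +
      m * τ * ⟪w, s⟫)) =
      -(N * coeffB0 R t y * ⟪Ψt z, s⟫) -
      N * coeffB1 R t y * ⟪U1 z, s⟫ -
      ε⁻¹ * ((N - N0) * coeffB1 R t y + N0 * (coeffB1 R t y - coeffB1 R t 0)) * ⟪s, s⟫ -
      ε⁻¹ * (N - N0) * (m * τ) * ⟪w, s⟫ -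
      N * (ε⁻¹ ^ 2 * ⟪Rem, s⟫) := by
    have e2 : N * (m ^ 2 / n ^ 2) = 1 := by rw [hN]; field_simp
    rw [hyτ] at eq ⊢
    have e3 : ε⁻¹ * ε = 1 := inv_mul_cancel₀ hε.ne'
    rw [one_div, ← inv_pow] at eq
    linear_combination N * eq - ⟪Ψtt z, s⟫ * e2 - N * ε⁻¹ *
      (⟪hessW V d (F (R t) z) (R t) (U z), s⟫ +
      m * τ * ⟪w, s⟫) * e3
  rw [key]
  have n1 : n ≤ 1 + Y * C := by
    have : ε * |τ| * C ≤ Y * C := by rw [← hyabs]; gcongr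
    linarith [le_abs_self (n - 1)]
  have hmm : 1 ≤ m ^ 2 := one_le_pow₀ hm1
  have N1 : N ≤ (1 + Y * C) ^ 2 := (div_le_self (sq_nonneg n) hmm).trans (by gcongr)
  have Np : 0 ≤ N := by positivity
  have N01 : N0 ≤ 1 := inv_le_one_of_one_le₀ hmm
  have N0p : 0 ≤ N0 := by positivity
  have NN : |N - N0| ≤ ε * |τ| * (C * (2 + Y * C)) := by
    have e2 : N - N0 = (n - 1) * (n + 1) / m ^ 2 := by rw [hN, hN0]; ring
    rw [e2, abs_div, abs_mul, abs_of_pos (by linarith : 0 < n + 1), abs_of_nonneg (sq_nonneg m)]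
    refine (div_le_self (by positivity) hmm).trans ?_
    calc |n - 1| * (n + 1) ≤ ε * |τ| * C * (2 + Y * C) :=
          mul_le_mul hn (by linarith) (by linarith) (by positivity)
      _ = _ := by ring
  have g1 : |N * coeffB0 R t y * ⟪Ψt z, s⟫| ≤
      (1 + Y * C) ^ 2 * C * ((θ + 3 * C ^ 2 * (1 + |p|)) * (C * e)) := by
    rw [abs_mul, abs_mul, abs_of_nonneg Np]
    gcongr
    exact iT.trans (by gcongr)
  have g2 : |N * coeffB1 R t y * ⟪U1 z, s⟫| ≤ (1 + Y * C) ^ 2 * C * ((θ + C ^ 2) * (C * e)) := by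
    rw [abs_mul, abs_mul, abs_of_nonneg Np]
    gcongr
    exact i1.trans (by gcongr)
  have g3 : |ε⁻¹ * ((N - N0) * coeffB1 R t y + N0 * (coeffB1 R t y - coeffB1 R t 0)) * ⟪s, s⟫| ≤
      |τ| * (C ^ 2 * (2 + Y * C) + C) * (C * (C * e)) := by
    rw [abs_mul, abs_mul, abs_of_pos (inv_pos.2 hε)]
    refine mul_mono ?_ (iS.trans ?_)
    · rw [inv_mul_le_iff₀ hε]
      refine (abs_add_le _ _).trans ?_
      rw [abs_mul, abs_mul, abs_of_nonneg N0p]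
      calc |N - N0| * |coeffB1 R t y| + N0 * |coeffB1 R t y - coeffB1 R t 0| ≤
          ε * |τ| * (C * (2 + Y * C)) * C + 1 * (C * (ε * |τ|)) := by gcongr; rwa [← hyabs]
        _ = _ := by ring
    · gcongr
      exact sS.trans (mul_le_of_le_one_right (by linarith) e1)
  have g4 : |ε⁻¹ * (N - N0) * (m * τ) * ⟪w, s⟫| ≤
      |τ| * (C * (2 + Y * C)) * (C * |τ|) * (2 * d ^ 2 * C ^ 4 * 1 * (C * e)) := by
    rw [abs_mul, abs_mul, abs_mul, abs_mul, abs_of_pos (inv_pos.2 hε), abs_of_pos (by linarith : 0 < m)]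
    refine mul_mono (mul_mono ?_ (by gcongr)) (iw.trans ?_)
    · rw [inv_mul_le_iff₀ hε]
      exact NN.trans_eq (by ring)
    · gcongr
      exact hwn.trans (by gcongr)
  have g5 : |N * (ε⁻¹ ^ 2 * ⟪Rem, s⟫)| ≤ (1 + Y * C) ^ 2 *
      ((c₁ * (2 * θ ^ 2 + 2 * C ^ 4) + 2 * d ^ 2 * C ^ 3 * (|τ| * C) * (θ + C ^ 2) +
        3 * d ^ 2 * C ^ 4 * (|τ| * C) ^ 2 * (C * 1)) * (C * e)) := by
    have hc0 := hc₁.nonneg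
    rw [abs_mul, abs_of_nonneg Np, abs_mul, abs_of_nonneg (sq_nonneg ε⁻¹)]
    refine mul_mono N1 ?_
    have r1 : ‖Rem‖ ≤ ε ^ 2 * (c₁ * ‖U z‖ ^ 2 + 2 * d ^ 2 * C ^ 3 * (|τ| * m) * ‖U z‖ +
        3 * d ^ 2 * C ^ 4 * (|τ| * m) ^ 2 * ‖coordProj 1 (F (R t) z)‖) := by
      refine hrem.trans_eq ?_
      rw [norm_smul, norm_eq_abs, abs_of_pos hε, abs_mul, hyabs, abs_of_pos (by linarith : 0 < m)]
      ring
    have r2 : ‖U z‖ ^ 2 ≤ 2 * θ ^ 2 + 2 * C ^ 4 := by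
      calc ‖U z‖ ^ 2 ≤ (θ + C ^ 2) ^ 2 := by gcongr
        _ ≤ _ := by linarith [sq_nonneg (θ - C ^ 2)]
    calc ε⁻¹ ^ 2 * |⟪Rem, s⟫| ≤ ε⁻¹ ^ 2 * (ε ^ 2 * (c₁ * ‖U z‖ ^ 2 +
          2 * d ^ 2 * C ^ 3 * (|τ| * m) * ‖U z‖ +
          3 * d ^ 2 * C ^ 4 * (|τ| * m) ^ 2 * ‖coordProj 1 (F (R t) z)‖) * (C * e)) := by
          gcongr; exact iR.trans (by gcongr)
      _ = (c₁ * ‖U z‖ ^ 2 + 2 * d ^ 2 * C ^ 3 * (|τ| * m) * ‖U z‖ +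
          3 * d ^ 2 * C ^ 4 * (|τ| * m) ^ 2 * ‖coordProj 1 (F (R t) z)‖) * (C * e) := by
          field_simp
      _ ≤ _ := by gcongr; exact sT.trans (by gcongr)
  refine (abs_sum_five_le _ _ _ _ _).trans ?_
  have w1' : (1 + |p|) * e ≤ M := by
    refine le_trans ?_ w1
    gcongr
    exact le_self_pow₀ (by linarith [abs_nonneg p]) two_ne_zero
  have hb : 0 ≤ (1 + Y * C) ^ 2 := sq_nonneg _
  have hc0 := hc₁.nonneg
  have f1 := mul_mono_left (add_le_add w4 (mul_mono_left w1'
    (a := 3 * C ^ 2))) (a := (1 + Y * C) ^ 2 * C ^ 2)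
  have f2 := mul_mono_left (add_le_add w4 (mul_mono_left w3
    (a := C ^ 2))) (a := (1 + Y * C) ^ 2 * C ^ 2)
  have f3 := mul_mono_left w5 (a := (C ^ 2 * (2 + Y * C) + C) * C ^ 2)
  have f4 := mul_mono_left w7 (a := 2 * d ^ 2 * C ^ 7 * (2 + Y * C))
  have f5 := mul_mono_left (add_le_add (add_le_add
    (mul_mono_left (add_le_add (mul_mono_left w8 zero_le_two)
      (mul_mono_left w3 (a := 2 * C ^ 4))) (a := c₁ * C))
    (mul_mono_left (add_le_add w6 (mul_mono_left w5 (a := C ^ 2))) (a := 2 * d ^ 2 * C ^ 5)))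
    (mul_mono_left w7 (a := 3 * d ^ 2 * C ^ 8))) hb
  rw [← sq_abs τ] at f4 f5
  linarith

theorem Slice.abs_leading_le_outside (hs : S.Slice t ε a p E U U1 U2 P Ψt Ψtt) {z θ A M : ℝ}
    (hθ : 0 ≤ θ) (hA : (1 + |a / ε| + |p|) ^ 3 ≤ A)
    (hM : M = A * e(κ / 4,z) * (1 + θ) + θ ^ 2) (hz : Y < |ε * z + a|) :
    |⟪Ψtt z, deriv (F (R t)) z⟫ - S.leading t ε a U U2 z| ≤
      8 / (κ * Y) ^ 2 * ((2 + 2 * C ^ 2 * (1 + 4 / κ) ^ 2) * (C ^ 2 + C ^ 3) + C ^ 3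
        + 2 * d ^ 2 * C ^ 6 * (1 + 4 / κ)) * M := by
  have hε := hs.ε_pos
  have hκ := S.κ_pos
  have hreg := S.regular t hs.mem
  have hB := S.profile t hs.mem
  have hG := S.geom t hs.mem
  have hm1 := hreg.mFactor_pos
  have hC := hB.one_le
  have hm2 := hG.m_le
  have hn := hs.abs_nFactor_le z
  have hexp := hs.inv_sq_mul_exp_le hz
  have B1 := hG.B1_le 0 ⟨by linarith [S.Y_pos], S.Y_pos.le⟩
  obtain ⟨-, o0, u0, -, u2⟩ := hs.outside z hz
  rw [o0, inner_zero_left, zero_sub, abs_neg, leading]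
  set τ := z + a / ε with hτ
  set m := mFactor R t
  set n := nFactor R t (ε * z + a)
  set e := e(κ,z) with he
  have e0 : 0 ≤ e := (exp_pos _).le
  obtain ⟨⟨-, -, w3, -⟩, w5, -, w7, -⟩ := weight_bounds hκ (abs_add_le z (a / ε)) hA hθ he hM rfl
  rw [← hτ] at w5 w7
  set cw := 1 + 4 / κ
  have sS := hB.slope z
  rw [← he] at sS
  set w := forceR V d (F (R t) z) (R t) with hw
  have hwn : ‖w‖ ≤ 2 * d ^ 2 * C ^ 4 * e := hs.norm_forceR_le z
  set s := deriv (F (R t)) z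
  have hε1 : 1 ≤ ε⁻¹ := (one_le_inv₀ hε).2 hs.ε_le
  have hmm : 1 ≤ m ^ 2 := one_le_pow₀ hm1
  have ip : ∀ v : Plane, |⟪v, s⟫| ≤ ‖v‖ * (C * e) := fun v =>
    (abs_real_inner_le_norm _ _).trans (by gcongr)
  have hN : n ^ 2 / m ^ 2 ≤ 2 + 2 * C ^ 2 * τ ^ 2 := by
    refine (div_le_self (sq_nonneg n) hmm).trans ?_
    have h1 : |n - 1| ≤ |1 * |τ| * C| := by
      rw [abs_of_nonneg (by positivity : 0 ≤ 1 * |τ| * C)]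
      exact hn.trans (by gcongr; exact hs.ε_le)
    have h2 := sq_le_sq.2 h1
    rw [one_mul, mul_pow, sq_abs] at h2
    linarith [sq_nonneg (n - 2)]
  have hUH : ‖U2 z - hessW V d (F (R t) z) (R t) (U z)‖ ≤ ε⁻¹ * ((C + C ^ 2) * e) := by
    refine (norm_sub_le _ _).trans ((add_le_add u2 ((ContinuousLinearMap.le_of_opNorm_le _ (hB.hess z) _).trans
      (mul_mono_left u0 (by linarith)))).trans_eq ?_)
    ring
  have g1 : |ε⁻¹ * (n ^ 2 / m ^ 2 * ⟪U2 z - hessW V d (F (R t) z) (R t) (U z),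
      s⟫)| ≤ ε⁻¹ * ((2 + 2 * C ^ 2 * τ ^ 2) * (ε⁻¹ * ((C + C ^ 2) * e) * (C * e))) := by
    rw [abs_mul, abs_mul, abs_of_pos (inv_pos.2 hε), abs_of_nonneg (by positivity : 0 ≤ n ^ 2 / m ^ 2)]
    gcongr
    exact (ip _).trans (by gcongr)
  have g2 : |ε⁻¹ * (m ^ 2)⁻¹ * (coeffB1 R t 0 * ⟪s, s⟫ +
      m * τ * ⟪w, s⟫)| ≤ ε⁻¹ * ε⁻¹ * (C * (C * e * (C * e)) +
        C * |τ| * (2 * d ^ 2 * C ^ 4 * e * (C * e))) := by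
    rw [abs_mul, abs_mul, abs_of_pos (inv_pos.2 hε), abs_of_pos (by positivity : 0 < (m ^ 2)⁻¹)]
    have : (m ^ 2)⁻¹ ≤ ε⁻¹ := (inv_le_one_of_one_le₀ hmm).trans hε1
    gcongr
    refine (abs_add_le _ _).trans ?_
    rw [abs_mul, abs_mul, abs_mul, abs_of_pos (by linarith : 0 < m)]
    gcongr
    exacts [(ip _).trans (by gcongr), (ip _).trans (by gcongr)]
  calc _ ≤ _ := (abs_sub _ _).trans (add_le_add g1 g2)
    _ = (ε⁻¹ ^ 2 * e) * ((C ^ 2 + C ^ 3) * (2 * e + 2 * C ^ 2 * (τ ^ 2 * e)) + C ^ 3 * e +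
        2 * d ^ 2 * C ^ 6 * (|τ| * e)) := by ring
    _ ≤ (8 / (κ * Y) ^ 2) * ((C ^ 2 + C ^ 3) * (2 * M + 2 * C ^ 2 * (cw ^ 2 * M)) + C ^ 3 * M +
        2 * d ^ 2 * C ^ 6 * (cw * M)) := by gcongr
    _ = _ := by ring

end Setting

theorem GeomBound.mono {C' : ℝ} (h : GeomBound R Y C t) (hC : C ≤ C') : GeomBound R Y C' t :=
  ⟨h.one_le.trans hC, h.m_le.trans hC, h.m_deriv.trans hC, h.deriv2.trans hC, h.slope.trans hC,
    h.radius_zero.trans hC, fun y hy => (h.n_inv y hy).trans hC, fun y hy => (h.radius_inv y hy).trans hC,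
    fun y hy => (h.B0_le y hy).trans hC, fun y hy => (h.B1_le y hy).trans hC,
    fun y hy => (h.B1_sub_le y hy).trans (by gcongr)⟩

namespace Setting

variable (S : Setting V d I F l Z R T Y κ C)
include S

/-- All pairings in the equation of the shift are bounded by `A μ + μ²`. -/
theorem exists_pairing_bound (hC : 1 ≤ C) : ∃ K, 0 < K ∧
    ∀ {t ε a p E : ℝ} {U U1 U2 P Ψt Ψtt : ℝ → Plane}, S.Slice t ε a p E U U1 U2 P Ψt Ψtt →
    ∀ μ A, 1 ≤ μ → E ≤ ε * μ ^ 2 → ε * μ ≤ 2 → (1 + |a / ε| + |p|) ^ 3 ≤ A →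
    |∫ z, ⟪Ψtt z, deriv (F (R t)) z⟫| ≤ K * (A * μ + μ ^ 2) ∧
    ∀ (w : ℝ → Plane) (c : ℝ), (∀ z, ‖w z‖ ≤ C ^ 2 * e(κ,z)) →
      (|c| ≤ 2 * (1 + |p|) → |c * ∫ z, ⟪Ψt z, w z⟫| ≤ K * (A * μ + μ ^ 2)) ∧
      (|c| ≤ 2 * C * (1 + |p|) ^ 2 →
        |c * ∫ z, ⟪F (R t) z + ε • U z, w z⟫| ≤ K * (A * μ + μ ^ 2)) := by
  have hκ := S.κ_pos
  have hY := S.Y_pos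
  obtain ⟨K₀, hK₀, hE₀⟩ := S.exists_envelope
  set ρ₀ := 2 + K₀ * 2 with hρ₀
  obtain ⟨c₁, hc₁⟩ := exists_taylorBound S.family.potential ρ₀
  have hc0 := hc₁.nonneg
  set k₁ := (1 + Y * C) ^ 2 * C ^ 2 * (1 + 3 * C ^ 2) + (1 + Y * C) ^ 2 * C ^ 2 * (1 + C ^ 2)
      + (C ^ 2 * (2 + Y * C) + C) * C ^ 2 * (1 + 4 / κ)
      + 2 * d ^ 2 * C ^ 7 * (2 + Y * C) * (1 + 4 / κ) ^ 2
      + (1 + Y * C) ^ 2 * (c₁ * C * (2 + 2 * C ^ 4) + 2 * d ^ 2 * C ^ 5 * (1 + C ^ 2) * (1 + 4 / κ)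
        + 3 * d ^ 2 * C ^ 8 * (1 + 4 / κ) ^ 2) with hk₁
  set k₂ := 8 / (κ * Y) ^ 2 * ((2 + 2 * C ^ 2 * (1 + 4 / κ) ^ 2) * (C ^ 2 + C ^ 3) + C ^ 3
        + 2 * d ^ 2 * C ^ 6 * (1 + 4 / κ))
  set k₃ := (4 * C ^ 2 * (1 + C * (1 + 4 / κ)) + 2 * C ^ 3) * (1 + C ^ 2) with hk₃
  set k₄ := 2 * C ^ 2 * (1 + 3 * C ^ 2) with hk₄
  set k₅ := 2 * C ^ 3 * ρ₀ with hk₅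
  have h₁ : 0 ≤ k₁ := by positivity
  have h₂ : 0 ≤ k₂ := by positivity
  have h₃ : 0 ≤ k₃ := by positivity
  have h₄ : 0 < k₄ := by positivity
  have h₅ : 0 ≤ k₅ := by positivity
  refine ⟨(k₁ + k₂ + k₃ + k₄ + k₅) * K₀, by positivity, ?_⟩
  intro t ε a p E U U1 U2 P Ψt Ψtt hs μ A hμ hE hεμ hA
  have h := S.family
  have hε := hs.ε_pos
  have hreg := S.regular t hs.mem
  have hr := hreg.mem
  have hB := S.profile t hs.mem
  have hG := S.geom t hs.mem
  have hm1 := hreg.mFactor_pos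
  obtain ⟨θ, hθ, hb, henv⟩ := hE₀ hs μ hμ hE
  have hA0 : 0 ≤ A := le_trans (by positivity) hA
  have hX : ∀ z, ‖F (R t) z + ε • U z‖ ≤ ρ₀ := fun z => by
    refine (norm_add_le _ _).trans (add_le_add (h.norm_le hr z) ?_)
    rw [norm_smul, norm_eq_abs, abs_of_pos hε]
    calc ε * ‖U z‖ ≤ ε * (K₀ * μ) := by gcongr; exact (hb z).2.2.2
      _ = K₀ * (ε * μ) := by ring
      _ ≤ _ := by gcongr
  have fin : ∀ {k x : ℝ}, 0 ≤ k → k ≤ k₁ + k₂ + k₃ + k₄ + k₅ → x ≤ k * (K₀ * (A * μ + μ ^ 2)) →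
      x ≤ (k₁ + k₂ + k₃ + k₄ + k₅) * K₀ * (A * μ + μ ^ 2) := fun _ hk hx => by
    rw [mul_assoc]
    exact hx.trans (by gcongr)
  have wb := fun z => weight_bounds hκ (abs_add_le z (a / ε)) hA (hθ z) rfl rfl rfl
  refine ⟨?_, fun w c hw => ⟨fun hc => ?_, fun hc => ?_⟩⟩
  · obtain ⟨iG, eG⟩ := hs.integral_leading
    have b1 : |∫ z, (⟪Ψtt z, deriv (F (R t)) z⟫ - S.leading t ε a U U2 z)| ≤
        (k₁ + k₂) * (K₀ * (A * μ + μ ^ 2)) := by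
      have hfin : ({(Y - a) / ε, (-Y - a) / ε} : Set ℝ).Countable := by simp
      refine henv A _ _ hA0 (by positivity) ((hfin.ae_notMem volume).mono fun z hz => ?_)
      have hM0 : 0 ≤ A * e(κ / 4,z) * (1 + θ z) + θ z ^ 2 := by
        have := hθ z; positivity
      rcases lt_trichotomy |ε * z + a| Y with hlt | heq | hgt
      · refine (hs.abs_sub_leading_le_inside hc₁ (by rw [hρ₀]; linarith) (hθ z) (hX z) (hb z).1
          (hb z).2.1 (hb z).2.2.1 hA rfl hlt).trans
          (mul_mono_right (le_add_of_nonneg_right h₂) hM0)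
      · refine absurd ?_ hz
        rcases (abs_eq hY.le).1 heq with h' | h'
        · exact Or.inl (by rw [eq_div_iff hε.ne']; linarith)
        · exact Or.inr (by rw [mem_singleton_iff, eq_div_iff hε.ne']; linarith)
      · refine (hs.abs_leading_le_outside (hθ z) hA rfl hgt).trans
          (mul_mono_right (le_add_of_nonneg_left h₁) hM0)
    have b2 : |∫ z, S.leading t ε a U U2 z| ≤ k₃ * (K₀ * (A * μ + μ ^ 2)) := by
      rw [eG]
      refine henv A _ _ hA0 h₃ (.of_forall fun z => ?_)
      obtain ⟨⟨-, -, w3, w4⟩, w5, w6, -, -⟩ := wb z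
      have hn := hs.abs_nFactor_le z
      set M := A * e(κ / 4,z) * (1 + θ z) + θ z ^ 2
      set e := e(κ,z)
      set τ := z + a / ε
      set m := mFactor R t
      set n := nFactor R t (ε * z + a)
      have hmm : 1 ≤ m ^ 2 := one_le_pow₀ hm1
      have n1 : |n| ≤ 1 + C * |τ| := by
        have h1 : ε * |τ| * C ≤ 1 * |τ| * C := by gcongr; exact hs.ε_le
        have h2 := abs_add_le (n - 1) 1
        rw [sub_add_cancel, abs_one] at h2
        linarith
      have iT := (abs_real_inner_le_norm (U z) (force V d (F (R t) z) (R t))).trans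
        (mul_le_mul (hb z).1 (hB.force z) (norm_nonneg _) (by have := hθ z; positivity))
      have iS := (abs_real_inner_le_norm (U z) (deriv (F (R t)) z)).trans
        (mul_le_mul (hb z).1 (hB.slope z) (norm_nonneg _) (by have := hθ z; positivity))
      have sl := hG.slope
      set k := m ^ 3 * deriv (deriv R) t
      have a1 : |4 * k * n / m ^ 2| ≤ 4 * C * (1 + C * |τ|) := by
        rw [abs_div, abs_mul, abs_mul, abs_of_pos (by norm_num : (0 : ℝ) < 4),
          abs_of_nonneg (by positivity : 0 ≤ m ^ 2)]
        exact (div_le_self (by positivity) hmm).trans (by gcongr)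
      have a2 : |2 * k ^ 2 * ε / m ^ 2| ≤ 2 * C ^ 2 * 1 := by
        rw [abs_of_nonneg (by positivity), ← sq_abs k]
        refine (div_le_self (by positivity) hmm).trans ?_
        gcongr
        exact hs.ε_le
      refine (abs_add_le _ _).trans ?_
      rw [abs_mul, abs_mul]
      have hθz := hθ z
      have f1 := mul_mono_left (add_le_add (add_le_add w4 (mul_mono_left w3
        (a := C ^ 2))) (mul_mono_left (add_le_add w6
        (mul_mono_left w5 (a := C ^ 2))) (a := C)))
        (a := 4 * C ^ 2)
      have f2 := mul_mono_left (add_le_add w4 (mul_mono_left w3 (a := C ^ 2))) (a := 2 * C ^ 3)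
      calc _ ≤ 4 * C * (1 + C * |τ|) * ((θ z + C ^ 2) * (C * e)) +
            2 * C ^ 2 * 1 * ((θ z + C ^ 2) * (C * e)) := by
            gcongr
        _ ≤ _ := by rw [hk₃]; linarith
    have e1 : ∫ z, ⟪Ψtt z, deriv (F (R t)) z⟫ =
        (∫ z, (⟪Ψtt z, deriv (F (R t)) z⟫ - S.leading t ε a U U2 z)) +
          ∫ z, S.leading t ε a U U2 z := by
      rw [integral_sub hs.integrable iG, sub_add_cancel]
    rw [e1]
    refine fin (k := k₁ + k₂ + k₃) (by positivity) (by linarith) ((abs_add_le _ _).trans ?_)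
    linarith
  · rw [← integral_const_mul]
    refine fin h₄.le (by linarith) (henv A _ _ hA0 h₄.le (.of_forall fun z => ?_))
    obtain ⟨⟨w1, w2, -, -⟩, -⟩ := wb z
    have hθz := hθ z
    rw [abs_mul]
    calc _ ≤ 2 * (1 + |p|) * ((θ z + 3 * C ^ 2 * (1 + |p|)) * (C ^ 2 * e(κ,z))) :=
          mul_mono hc ((abs_real_inner_le_norm _ _).trans (mul_mono (hb z).2.2.1 (hw z)))
      _ = 2 * C ^ 2 * ((1 + |p|) * e(κ,z) * θ z + 3 * C ^ 2 * ((1 + |p|) ^ 2 * e(κ,z))) := by ring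
      _ ≤ _ := mul_mono_left (add_le_add w2 (mul_mono_left w1))
      _ = _ := by rw [hk₄]; ring
  · rw [← integral_const_mul]
    refine fin h₅ (by linarith) (henv A _ _ hA0 h₅ (.of_forall fun z => ?_))
    rw [abs_mul]
    calc _ ≤ 2 * C * (1 + |p|) ^ 2 * (ρ₀ * (C ^ 2 * e(κ,z))) :=
          mul_mono hc ((abs_real_inner_le_norm _ _).trans (mul_mono (hX z) (hw z)))
      _ = k₅ * ((1 + |p|) ^ 2 * e(κ,z)) := by rw [hk₅]; ring
      _ ≤ _ := by gcongr; exact (wb z).1.1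

/-- The bound on the acceleration of the shift. -/
theorem exists_acceleration_bound (hC : 1 ≤ C) {δ c₀ : ℝ} (hδ : S.IsThreshold δ c₀)
    {F₁ : ℝ → ℝ → ℝ → Plane}
    (hF₁ : ∀ r ∈ I, ∀ v ∈ Ioo (-1 : ℝ) 1, IsCorrector V d r v (F r) (F₁ r v)) : ∃ K, 0 < K ∧
    ∀ {ε b : ℝ} {Φ : ℝ → ℝ → Plane} {a : ℝ → ℝ}, 0 < ε → ε ≤ 1 → b ≤ T →
    IsSolution V d R Y ε b Φ → IsShift F R (δ * ε) ε b Φ a → ∀ t ∈ Ioo 0 b, |a t| ≤ Y / 2 →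
    ∀ μ, 1 ≤ μ → errorEnergy V d F F₁ R a Y ε Φ t ≤ ε * μ ^ 2 → ε * μ ≤ 2 →
    |deriv (deriv a) t| / ε ≤ K * (shiftSize a ε t * μ + μ ^ 2) := by
  obtain ⟨K, hK, hb⟩ := S.exists_pairing_bound hC
  refine ⟨14 * C * K, by positivity, ?_⟩
  intro ε b Φ a hε hε1 hbT hΦ ha t ht haY μ hμ hE hεμ
  have h := S.family
  have htT := mem_Icc_of_mem_Ioo hbT ht
  have hreg := S.regular t htT
  have hr := hreg.mem
  have hB := S.profile t htT
  have hG := S.geom t htT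
  have hd := S.hasDerivAt_shift hε hbT hΦ hδ ha ht
  have hs := S.slice hε hbT hΦ hF₁ ha ht hd.differentiableAt.hasDerivAt hε1 haY
  have hA : (1 + |a t / ε| + |deriv a t / ε|) ^ 3 ≤ shiftSize a ε t := by
    rw [shiftSize, abs_div, abs_div, abs_of_pos hε]
  obtain ⟨b1, b2⟩ := hb hs μ _ hμ hE hεμ hA
  simp only [smul_inv_smul₀ hε.ne', add_sub_cancel] at b2
  have key := (S.shift_regular hε hbT hΦ hδ ha).2 t ht
  have hT := S.slicePair_force_shift_le hε hbT hΦ hδ ha ht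
  obtain ⟨eS, eT, eX⟩ := h.unweight_profiles S.κ_pos S.κ_lt hr
  set A := shiftSize a ε t
  set p := deriv a t / ε
  have hCC : C ≤ C ^ 2 := by nlinarith
  have up : ∀ {x z : ℝ}, x ≤ C * e(κ,z) → x ≤ C ^ 2 * e(κ,z) := fun hx => hx.trans (by gcongr)
  have hv := hreg.lt_one.le
  have hp := abs_nonneg p
  have s0 : (1 + |p|) ^ 2 ≤ C * (1 + |p|) ^ 2 := le_mul_of_one_le_left (by positivity) hC
  have s1 : C ≤ C * (1 + |p|) ^ 2 := le_mul_of_one_le_right (by positivity)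
    (one_le_pow₀ (by linarith))
  have q1 := (b2 _ (2 * deriv R t) fun z => up (hB.slope_r z)).1 (by
    rw [abs_mul, abs_two]; nlinarith)
  have q2 := (b2 _ (-2 * p) fun z => up (hB.force z)).1 (by
    rw [abs_mul, abs_neg, abs_two]; linarith)
  have q3 := (b2 _ (deriv (deriv R) t) fun z => up (hB.slope_r z)).2 (by
    linarith [hG.deriv2])
  have q4 := (b2 _ (deriv R t ^ 2) fun z => up (hB.slope_rr z)).2 (by
    rw [abs_pow]; linarith [pow_le_one₀ (n := 2) (abs_nonneg (deriv R t)) hv])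
  have q5 := (b2 _ (-2 * p * deriv R t) fun z => up (hB.force_r z)).2 (by
    rw [abs_mul, abs_mul, abs_neg, abs_two]
    linarith [mul_le_of_le_one_right (by positivity : 0 ≤ 2 * |p|) hv, sq_nonneg |p|])
  have q6 := (b2 (fun z => hessW V d (F (R t) z) (R t) (deriv (F (R t)) z)) (p ^ 2) fun z => by
    refine (ContinuousLinearMap.le_of_opNorm_le _ (hB.hess z) _).trans ?_
    rw [sq, mul_assoc]
    gcongr
    exact hB.slope z).2 (by
    rw [abs_pow]; linarith)
  simp only [numeratorDeriv, denominatorDeriv, shiftPair, slicePair_eq hε, eS, eT, eX] at key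
  rw [slicePair_eq hε, eT] at hT
  set B := K * (A * μ + μ ^ 2)
  set X := ∫ z, ⟪Φ t (ε * z + a t), force V d (F (R t) z) (R t)⟫
  have hX : 1 / (2 * C) ≤ |X| := by
    have : ε * X ≤ ε * (-(1 / (2 * C))) := hT.trans_eq (by ring)
    linarith [neg_le_abs X, le_of_mul_le_mul_left this hε]
  have tot : |deriv (deriv a) t / ε * X| ≤ 7 * B := by
    have sc : ∀ {x : ℝ}, |x| ≤ B → -(ε * B) ≤ ε * x ∧ ε * x ≤ ε * B := fun hx => by
      have h1 := mul_mono_left (abs_le.1 hx).1 hε.le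
      exact ⟨by linarith, mul_mono_left (abs_le.1 hx).2 hε.le⟩
    obtain ⟨⟨l0, u0⟩, ⟨l1, u1⟩, ⟨l2, u2⟩, ⟨l3, u3⟩⟩ := And.intro (sc b1) (And.intro (sc q1)
      (And.intro (sc q2) (sc q3)))
    obtain ⟨⟨l4, u4⟩, ⟨l5, u5⟩, ⟨l6, u6⟩⟩ := And.intro (sc q4) (And.intro (sc q5) (sc q6))
    rw [abs_le]
    constructor <;> refine le_of_mul_le_mul_left ?_ hε <;> linarith
  rw [abs_mul, abs_div, abs_of_pos hε] at tot
  have h1 := (mul_mono_left hX (a := |deriv (deriv a) t| / ε)).trans tot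
  rw [mul_one_div, div_le_iff₀ (by positivity)] at h1
  calc _ ≤ _ := h1
    _ = _ := by ring

end Setting

end

end InterfaceModel

theorem mainTheorem5
    (V : Plane → ℝ) (hV : IsPotential V) (d : ℝ)
    -- `I` is the interval `(r₀, r₁)` with `0 ≤ r₀ < r₁ ≤ ∞`
    (I : Set ℝ) (hIopen : IsOpen I) (hIconn : I.OrdConnected) (hIpos : I ⊆ Ioi 0)
    (F₀ : ℝ → ℝ → Plane) (hF₀ : ∀ r ∈ I, IsProfile V d r (F₀ r))
    (hnondeg : ∀ r ∈ I, Nondegenerate V d r (F₀ r))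
    (hcont : ContinuousOn (fun p : ℝ × ℝ => F₀ p.1 p.2) (I ×ˢ univ))
    (F₁ : ℝ → ℝ → ℝ → Plane)
    (hF₁ : ∀ r ∈ I, ∀ v ∈ Ioo (-1 : ℝ) 1, IsCorrector V d r v (F₀ r) (F₁ r v))
    (R : ℝ → ℝ) (T Y : ℝ) (hT : 0 < T) (hY : 0 < Y)
    (hR : IsInterface d I F₀ R T) (hcoord : CoordinatesDefined R T Y) :
    ∃ δ : ℝ, 0 < δ ∧ ∃ α : ℝ, 0 < α ∧ ∃ C : ℝ, 0 < C ∧ ∃ ε₀ : ℝ, 0 < ε₀ ∧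
      ∀ ε : ℝ, 0 < ε → ε < ε₀ → ∀ b : ℝ, 0 < b → b ≤ T →
      ∀ Φ : ℝ → ℝ → Plane, IsSolution V d R Y ε b Φ →
      ∀ a : ℝ → ℝ, IsShift F₀ R (δ * ε) ε b Φ a →
        ContDiffOn ℝ 2 a (Ioo 0 b) ∧
        ∀ t ∈ Ioo 0 b, ∀ A E D : ℝ, A = shiftSize a ε t →
          E = errorEnergy V d F₀ F₁ R a Y ε Φ t → D = Real.exp (-α * ((Y - a t) / ε)) →
          (1 - ε * A - √ε * A * √E - D) * (|deriv (deriv a) t| / ε) ≤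
            C * (1 / √ε ^ 5 * (ε * A + √(ε * √E + D) * √(√E)) * (√ε ^ 3 + ε * √E + D)) := by
  obtain ⟨l, hl, hw⟩ := hV.hess_wells
  have h : ProfileFamily V d I F₀ l := ⟨hV, hIopen, fun r hr => hIpos hr, hF₀, hnondeg, hcont, hl,
    fun ψ => hw _ (Or.inl rfl) ψ⟩
  have hsl := h.sqrt_pos
  have hκ : 0 < √l / 4 := by positivity
  have hκl : √l / 4 < √l / 2 := by linarith
  set Z : ℝ → ℝ → Plane := fun r => F₁ r 0
  have hZ : ∀ r ∈ I, IsCorrector V d r 0 (F₀ r) (Z r) := fun r hr => hF₁ r hr 0 (by simp)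
  have hreg : ∀ t ∈ Icc 0 T, InterfaceRegular d I F₀ R t := fun t ht => h.interfaceRegular hR ht
  obtain ⟨C₁, hC₁⟩ := h.exists_profileBound hZ hκ hκl
    ((isCompact_Icc (a := 0) (b := T)).image_of_continuousOn (f := R)
      fun t ht => (hreg t ht).smooth.continuousAt.continuousWithinAt)
    (image_subset_iff.2 fun t ht => (hreg t ht).mem)
  obtain ⟨C₂, hC₂⟩ := exists_geomBound hY hreg hcoord
  have S : Setting V d I F₀ l Z R T Y (√l / 4) (max C₁ C₂) := ⟨h, hZ, hκ, hκl, hY, hreg,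
    fun t ht => (hC₁ _ (mem_image_of_mem R ht)).mono h (hreg t ht).mem hκ (le_max_left _ _),
    fun t ht => (hC₂ t ht).mono (le_max_right _ _), hcoord⟩
  have hC := S.C_pos ⟨0, le_rfl, hT.le⟩
  obtain ⟨δ, c₀, hδ⟩ := S.exists_threshold hT
  obtain ⟨K, hK, hb⟩ := S.exists_acceleration_bound hC hδ hF₁
  refine ⟨δ, hδ.pos, 1, one_pos, 2 * K, by positivity, min 1 ((Y / 2) ^ 3), by positivity, ?_⟩
  intro ε hε hε₀ b _ hbT Φ hΦ a ha
  refine ⟨(S.shift_regular hε hbT hΦ hδ ha).1, fun t ht A E D hA hE hD => ?_⟩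
  have hε1 : ε ≤ 1 := hε₀.le.trans (min_le_left _ _)
  have hD0 : 0 ≤ D := hD ▸ (Real.exp_pos _).le
  have hA1 : (|a t| / ε) ^ 3 ≤ A ∧ 1 ≤ A := by
    have e1 : 0 ≤ |a t| / ε := by positivity
    have e2 : 0 ≤ |deriv a t| / ε := by positivity
    rw [hA, shiftSize]
    exact ⟨by gcongr; linarith, one_le_pow₀ (by linarith)⟩
  set s := √ε
  have hs0 : 0 < s := Real.sqrt_pos.2 hε
  have hsε : s ^ 2 = ε := Real.sq_sqrt hε.le
  set g := √E
  have hg0 : 0 ≤ g := Real.sqrt_nonneg _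
  have hr : s ^ 5 * ((A + g / s) * (1 + g / s)) ≤
      (ε * A + √(ε * g + D) * √g) * (s ^ 3 + ε * g + D) := by
    have e1 : s * g ≤ √(ε * g + D) * √g := by
      rw [← Real.sqrt_mul (by positivity : 0 ≤ ε * g + D)]
      refine Real.le_sqrt_of_sq_le ?_
      rw [mul_pow, hsε]
      nlinarith [mul_nonneg hD0 hg0]
    calc s ^ 5 * ((A + g / s) * (1 + g / s)) = (ε * A + s * g) * (s ^ 3 + ε * g + 0) := by
          rw [← hsε]; field_simp; ring
      _ ≤ _ := mul_le_mul (by linarith) (by linarith) (by positivity)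
          (add_nonneg (mul_nonneg hε.le (by linarith [hA1.2])) (by positivity))
  have hη : 0 ≤ g / s := by positivity
  have hR' : 2 * K * ((A + g / s) * (1 + g / s)) ≤
      2 * K * (1 / s ^ 5 * (ε * A + √(ε * g + D) * √g) * (s ^ 3 + ε * g + D)) := by
    refine mul_mono_left ?_
    rw [mul_assoc, one_div, le_inv_mul_iff₀ (by positivity)]
    exact hr
  have hp : 0 ≤ |deriv (deriv a) t| / ε := by positivity
  have hsA : 0 ≤ s * A * g := by have := hA1.2; positivity
  have hεA : 0 ≤ ε * A := by have := hA1.2; positivity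
  refine le_trans ?_ hR'
  rcases le_or_gt (1 - ε * A - s * A * g - D) 0 with hneg | hpos
  · refine (mul_nonpos_of_nonpos_of_nonneg hneg hp).trans ?_
    have := hA1.2
    positivity
  · have haY : |a t| ≤ Y / 2 := by
      by_contra! hcon
      have e1 : ε * (|a t| / ε) ^ 3 < 1 := (mul_mono_left hA1.1 hε.le).trans_lt (by linarith)
      have e2 : ε * (|a t| / ε) ^ 3 = |a t| ^ 3 / ε ^ 2 := by field_simp
      rw [e2, div_lt_one (by positivity)] at e1
      have e3 : (Y / 2) ^ 3 < |a t| ^ 3 := by gcongr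
      have e4 := hε₀.trans_le (min_le_right _ _)
      nlinarith
    have hgs : s * g ≤ s * A * g := by
      have := mul_mono_left hA1.2 (mul_nonneg hs0.le hg0); linarith
    have hεμ : ε * (1 + g / s) ≤ 2 := by
      have : ε * (g / s) = s * g := by rw [← hsε]; field_simp
      linarith
    have hEμ : errorEnergy V d F₀ F₁ R a Y ε Φ t ≤ ε * (1 + g / s) ^ 2 := by
      rw [← hE]
      have e1 : E ≤ g ^ 2 := by
        rcases le_total 0 E with h0 | h0
        · exact (Real.sq_sqrt h0).ge
        · exact h0.trans (sq_nonneg _)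
      have e2 : ε * (1 + g / s) ^ 2 = ε + 2 * (s * g) + g ^ 2 := by rw [← hsε]; field_simp; ring
      have : 0 ≤ s * g := by positivity
      linarith
    have key := hb hε hε1 hbT hΦ ha t ht haY (1 + g / s) (by linarith) hEμ hεμ
    rw [← hA] at key
    refine (mul_le_of_le_one_left hp (by linarith)).trans (key.trans ?_)
    rw [mul_comm 2 K, mul_assoc]
    refine mul_mono_left ?_ hK.le
    nlinarith [hA1.2, mul_nonneg (sub_nonneg.2 hA1.2) (by linarith : 0 ≤ 1 + g / s)]
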